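/- Let $N\ge 1$ and $m\ge 1$ be integers, let $\mathbb{H}=\{z:\Im z>0\}$, and put $\mu_\gamma(z_1,z_2)=cz_1z_2+dz_2+az_1+b$ for an integer matrix $\gamma=\begin{pmatrix}a&b\\c&d\end{pmatrix}$. Let $M(m,N)$ be the set of integer matrices $\gamma$ with $ad-bc=m$, $(a,N)=1$ and $c\equiv 0\pmod N$. For $z_1,z_2\in\mathbb{H}$ with $z_2\ne\gamma z_1$ for all $\gamma\in M(m,N)$, the series $$\Omega_{m,N}(z_1,\bar z_2,s)=\frac12\sum_{\gamma\in M(m,N)}\frac{\mu_\gamma(\bar z_1,-z_2)^2}{|\mu_\gamma(z_1,-z_2)|^{2s-2}\,|\mu_\gamma(z_1,-\bar z_2)|^{2s+2}}$$ converges absolutely for $\Re s>1$ and has a limit as $s\to1$ in the half-plane $\Re s>1$; this limit is denoted $\omega_{m,N}(z_1,\bar z_2)$ (it is the regularized value of the series $\frac12\sum_{\gamma\in M(m,N)}\mu_\gamma(z_1,-\bar z_2)^{-2}$, which does not converge absolutely). Let $\Phi_N\subset\mathbb{H}$ be a measurable fundamental domain for the action of $\Gamma_0(N)$. Then for every holomorphic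 cusp form $f$ of weight $2$ on $\Gamma_0(N)$ and every $z_1\in\mathbb{H}$ the function $z_2\mapsto f(z_2)\,\omega_{m,N}(z_1,\bar z_2)$, which is defined for almost all $z_2$, is integrable over $\Phi_N$, and $$\int_{\Phi_N} f(z_2)\,\omega_{m,N}(z_1,\bar z_2)\,dz_2\,\overline{dz_2}=f*\overline{\omega_{m,N}(z_1,\bar z_2)}=2\pi i\,m^{-1}\,(T_2(m)f)(z_1).$$ Here $dz\,\overline{dz}=dz\wedge d\bar z=-2i\,dx\,dy$, $f*g=\int_{\Phi_N}f(z)\overline{g(z)}\,dz\,\overline{dz}$, and $T_2(m)$ is the Hecke operator of level $N$ and weight $2$, $$(T_2(m)f)(z)=m\sum_{\substack{ad=m,\ a>0\\(a,N)=1}}\ \sum_{b=0}^{d-1}d^{-2}f\!\left(\frac{az+b}{d}\right).$$ (If $\Gamma_0(N)$ has genus $0$, then $f=0$ and both sides of the formula vanish; the formula has content only when the genus is positive.) -/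

import Mathlib

open Complex MeasureTheory Filter Topology
open scoped ComplexConjugate MatrixGroups UpperHalfPlane

noncomputable section

namespace ZagierKernel

/-- `μ_γ(z₁, z₂) = c z₁ z₂ + d z₂ + a z₁ + b` for an integer matrix `γ = (a b; c d)`. -/
def mu (γ : Matrix (Fin 2) (Fin 2) ℤ) (z₁ z₂ : ℂ) : ℂ :=
  (γ 1 0 : ℂ) * z₁ * z₂ + (γ 1 1 : ℂ) * z₂ + (γ 0 0 : ℂ) * z₁ + (γ 0 1 : ℂ)

/-- The set `M(m, N)` of integer matrices `(a b; c d)` with `ad - bc = m`, `(a, N) = 1` and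
`c ≡ 0 (mod N)`. -/
def matSet (m N : ℕ) : Set (Matrix (Fin 2) (Fin 2) ℤ) :=
  {γ | γ.det = (m : ℤ) ∧ IsCoprime (γ 0 0) (N : ℤ) ∧ (N : ℤ) ∣ γ 1 0}

/-- The general term of Hecke's regularization of `∑ μ_γ(z₁, -z̄₂)⁻²`. For `s = 1` (and
`μ_γ(z₁, -z̄₂) ≠ 0`) it equals `μ_γ(z₁, -z̄₂)⁻²`. -/
def regTerm (z₁ z₂ : ℍ) (s : ℂ) (γ : Matrix (Fin 2) (Fin 2) ℤ) : ℂ :=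
  mu γ (conj (z₁ : ℂ)) (-(z₂ : ℂ)) ^ 2 /
    ((‖mu γ z₁ (-(z₂ : ℂ))‖ : ℂ) ^ (2 * s - 2) *
      (‖mu γ z₁ (-conj (z₂ : ℂ))‖ : ℂ) ^ (2 * s + 2))

/-- The regularizing series `Ω_{m,N}(z₁, z̄₂, s)`, for `Re s > 1`, normalized with the factor `1/2`
(the matrices `γ` and `-γ` give the same term). -/
def Omega (m N : ℕ) (z₁ z₂ : ℍ) (s : ℂ) : ℂ :=
  1 / 2 * ∑' γ : matSet m N, regTerm z₁ z₂ s γ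

/-- The kernel `ω_{m,N}(z₁, z̄₂)`: the limit of `Ω_{m,N}(z₁, z̄₂, s)` as `s → 1`, `Re s > 1`. -/
def omega (m N : ℕ) (z₁ z₂ : ℍ) : ℂ :=
  limUnder (𝓝[{s : ℂ | 1 < s.re}] 1) (Omega m N z₁ z₂)

/-- The Lebesgue measure `dx dy` on the upper half-plane. -/
def area : Measure ℍ := volume.comap UpperHalfPlane.coe

/-- `∫_Φ h(z) dz dz̄`, where `dz dz̄ = dz ∧ dz̄ = -2i dx dy`. -/
def formIntegral (Φ : Set ℍ) (h : ℍ → ℂ) : ℂ :=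
  -2 * Complex.I * ∫ z in Φ, h z ∂area

/-- The weight `2` Petersson product `f ∗ g = ∫_Φ f(z) conj(g(z)) dz dz̄`
(the factor `(Im z)^(k-2)` is `1`). -/
def peterssonProd (Φ : Set ℍ) (f g : ℍ → ℂ) : ℂ :=
  formIntegral Φ fun z => f z * conj (g z)

/-- The group of transformations of `ℍ` induced by `Γ₀(N)`, that is `Γ₀(N) / {±1}`. -/
def transformationGroup (N : ℕ) : Subgroup (Equiv.Perm ℍ) :=
  (CongruenceSubgroup.Gamma0 N).map (MulAction.toPermHom SL(2, ℤ) ℍ)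

/-- `Φ` is a (measurable) fundamental domain of `Γ₀(N)` in `ℍ`: up to null sets, the images of
`Φ` under the transformations of `Γ₀(N)` cover `ℍ`, and distinct ones are disjoint. -/
def IsFundamentalDomainGamma0 (N : ℕ) (Φ : Set ℍ) : Prop :=
  IsFundamentalDomain (transformationGroup N) Φ (volume : Measure ℍ)

/-- The Hecke operator `T₂(m)` of level `N` and weight `2`:
`(T₂(m) f)(z) = m ∑_{ad = m, a > 0, (a, N) = 1} ∑_{0 ≤ b < d} d⁻² f((a z + b) / d)`. -/
def heckeT2 (m N : ℕ) (f : ℍ → ℂ) (z : ℍ) : ℂ :=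
  (m : ℂ) * ∑ p ∈ m.divisorsAntidiagonal with p.1.Coprime N, ∑ b ∈ Finset.range p.2,
    ((p.2 : ℂ) ^ 2)⁻¹ * f (UpperHalfPlane.ofComplex (((p.1 : ℂ) * z + b) / p.2))

end ZagierKernel

end

/-! Two things are needed: the limit defining the kernel exists, with bounds uniform enough to
integrate, and the integral has the stated value.

Existence. Put `ε = 2s - 2`, `μ₋ = μ_γ(z₁, -z̄₂)`, `μ₊ = μ_γ(z₁, -z₂)`. A term of the series equals
`μ₋⁻² |μ₋|^(-2ε) (|μ₋| / |μ₊|)^ε`. Since `|μ₋|² - |μ₊|² = 4 m y₁ y₂`, replacing the last factor by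
`1` costs `|ε|` times an absolutely convergent sum (`norm_regSum_sub_kernelSum_le`). In the
remaining series the matrices with `c = 0` are harmless. For `c ≠ 0` one has `μ₋ = c (A B - m / c²)`
with `A = z₁ + d/c`, `B = -z̄₂ + a/c`, and dropping `m / c²` gains a factor `c⁻²`, which again
leaves an absolutely convergent error (`norm_largeCorrection_le`). What is left for each `c` is a
sum over the integer points of `a d ≡ m (mod c)` of a product of two smooth functions, one of `a/c`
and one of `d/c`.

Finite Fourier analysis and Kloosterman's fourth moment bound for exponential sums over the
hyperbola show that this sum is an explicit leading term up to `O(τ(c) |c|^(-5/4))`, with `τ` the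
divisor function and uniformly in `ε` (`norm_mainTerm_sub_leadTerm_le`); the errors are summable
over `c`. The leading terms carry two factors `∫ (t + iy)⁻² |t + iy|^(-2ε) dt`. Each is `O(ε)`,
because `∫ (t + iy)⁻² dt = 0`, whereas the Dirichlet series of the numbers of points on the
hyperbolas has at most a simple pole and is `O(1/ε)`. Hence the leading terms contribute `O(ε)` in
total (`exists_norm_classLeadSum_le`) and the limit exists by dominated convergence.

Value. For real `ε > 0` the function `y^(2+ε) Ω` transforms under `Γ₀(N)` so that its product with
`f` is invariant. The set `M(m, N)` is the disjoint union of the cosets of `Γ₀(N)` through the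
matrices `(a b; 0 d)` with `0 ≤ b < d`, so unfolding turns the integral over `Φ` into a finite sum
of integrals over `ℍ` of `f` against a reproducing kernel with base point `w = (a z₁ + b) / d`. In
the disc model centred at `w` the integrand is a holomorphic function times a radial weight, and the
mean value property gives `-f(w)` times the integral of the weight, which tends to the area `π` of
the disc (`setIntegral_mul_kernelSeries`, `tendsto_radialIntegral`). Multiplication by `-2i` gives
the formula.

Interchange of limit and integral. The bounds above hold uniformly in `z₂` for `Im z₂` bounded
below, up to singularities of type `|μ₊|^(-1/2)`, which are integrable. With the exponential decay
of `f` at every cusp they provide an integrable majorant independent of `ε` (`exists_dominating`).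
-/

noncomputable section

namespace ZagierKernel

/-! ### Kloosterman's bound for exponential sums over the hyperbola `a d ≡ m`. -/

section ExponentialSums

set_option linter.unusedSectionVars false

variable {Q : ℕ} [NeZero Q]

/-- Subtracting one solution injects the solutions into the elements killed by `M`, of which a
cyclic group has at most `M`. -/
lemma card_filter_natCast_mul_eq_le {M : ℕ} (hM : 0 < M) (b : ZMod Q) :
    (Finset.univ.filter fun x : ZMod Q => (M : ZMod Q) * x = b).card ≤ M := by
  rcases Finset.eq_empty_or_nonempty
    (Finset.univ.filter fun x : ZMod Q => (M : ZMod Q) * x = b) with h | ⟨x₀, hx₀⟩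
  · simp [h]
  · simp only [Finset.mem_filter, Finset.mem_univ, true_and] at hx₀
    refine le_trans ?_ (IsAddCyclic.card_nsmul_eq_zero_le (α := ZMod Q) hM)
    refine Finset.card_le_card_of_injOn (fun x => x - x₀) ?_ (fun x _ y _ h => by simpa using h)
    intro x hx
    simp only [Finset.coe_filter, Finset.mem_univ, true_and, Set.mem_ofPred_eq] at hx
    simp only [Finset.coe_filter, Finset.mem_univ, true_and, Set.mem_ofPred_eq, nsmul_eq_mul,
      mul_sub, hx, hx₀, sub_self]

/-- By Bézout `gcd(A, Q)` is a multiple of `A` modulo `Q`, so all solutions share the same product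
with this gcd, and the previous bound applies. -/
lemma card_filter_mul_eq_le (A b : ZMod Q) :
    (Finset.univ.filter fun x : ZMod Q => A * x = b).card ≤ Nat.gcd A.val Q := by
  have hg : 0 < Nat.gcd A.val Q := Nat.gcd_pos_of_pos_right _ (NeZero.pos Q)
  rcases Finset.eq_empty_or_nonempty
    (Finset.univ.filter fun x : ZMod Q => A * x = b) with h | ⟨x₀, hx₀⟩
  · simp [h]
  · simp only [Finset.mem_filter, Finset.mem_univ, true_and] at hx₀
    refine le_trans (Finset.card_le_card ?_)
      (card_filter_natCast_mul_eq_le hg ((Nat.gcd A.val Q : ZMod Q) * x₀))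
    intro x hx
    simp only [Finset.mem_filter, Finset.mem_univ, true_and] at hx ⊢
    have h1 : ((Nat.gcd A.val Q : ℤ) : ZMod Q) = A * ((A.val.gcdA Q : ℤ) : ZMod Q) := by
      rw [Nat.gcd_eq_gcd_ab]
      push_cast
      simp
    have h2 : ((Nat.gcd A.val Q : ℕ) : ZMod Q) = A * ((A.val.gcdA Q : ℤ) : ZMod Q) := by
      rw [← h1]; simp
    rw [h2]
    linear_combination ((A.val.gcdA Q : ℤ) : ZMod Q) * (hx - hx₀)

/-- Each gcd is bounded by the sum of the divisors `d` of `Q` dividing `u`. For each `d` at most `Q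
/ d` residues are divisible by `d`, so every divisor contributes at most `Q`. -/
lemma sum_gcd_val_le :
    ∑ u : ZMod Q, Nat.gcd u.val Q ≤ Q * Q.divisors.card := by
  calc ∑ u : ZMod Q, Nat.gcd u.val Q
      ≤ ∑ u : ZMod Q, ∑ d ∈ Q.divisors, if d ∣ u.val then d else 0 := by
        refine Finset.sum_le_sum fun u _ => ?_
        have hmem : Nat.gcd u.val Q ∈ Q.divisors :=
          Nat.mem_divisors.2 ⟨Nat.gcd_dvd_right _ _, NeZero.ne Q⟩
        refine le_trans ?_ (Finset.single_le_sum (f := fun d => if d ∣ u.val then d else 0)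
          (fun _ _ => Nat.zero_le _) hmem)
        simp [Nat.gcd_dvd_left]
    _ = ∑ d ∈ Q.divisors, d * (Finset.univ.filter fun u : ZMod Q => d ∣ u.val).card := by
        rw [Finset.sum_comm]
        refine Finset.sum_congr rfl fun d _ => ?_
        rw [← Finset.sum_filter, Finset.sum_const, smul_eq_mul, mul_comm]
    _ ≤ ∑ d ∈ Q.divisors, Q := by
        refine Finset.sum_le_sum fun d hd => ?_
        obtain ⟨e, he⟩ := Nat.dvd_of_mem_divisors hd
        have hQ := NeZero.pos Q
        have he0 : 0 < e := Nat.pos_of_ne_zero fun h => by simp [h] at he; omega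
        calc d * _ ≤ d * e := by
              refine Nat.mul_le_mul_left _ (le_trans (Finset.card_le_card ?_)
                (card_filter_natCast_mul_eq_le (Q := Q) he0 0))
              intro u hu
              simp only [Finset.mem_filter, Finset.mem_univ, true_and] at hu ⊢
              obtain ⟨k, hk⟩ := hu
              have : u = ((u.val : ℕ) : ZMod Q) := by simp
              rw [this, hk, ← Nat.cast_mul, ZMod.natCast_eq_zero_iff]
              exact ⟨k, by rw [he]; ring⟩
          _ = Q := he.symm
    _ = Q * Q.divisors.card := by simp [mul_comm]

/-- The exponential sum `∑ e((h d + k a) / Q)` over the points `(a, d)` of `X`. -/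
def expSum (X : Finset (ZMod Q × ZMod Q)) (h k : ZMod Q) : ℂ :=
  ∑ x ∈ X, ZMod.stdAddChar (h * x.2 + k * x.1)

lemma conj_stdAddChar (x : ZMod Q) : conj (ZMod.stdAddChar x : ℂ) = ZMod.stdAddChar (-x) := by
  rw [AddChar.map_neg_eq_conj]

lemma sum_stdAddChar_mul (t : ZMod Q) :
    ∑ h : ZMod Q, (ZMod.stdAddChar (h * t) : ℂ) = if t = 0 then (Q : ℂ) else 0 := by
  classical
  rw [AddChar.sum_mulShift t (ZMod.isPrimitive_stdAddChar Q)]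
  split_ifs <;> simp

lemma sum_sum_stdAddChar (s t : ZMod Q) :
    ∑ h : ZMod Q, ∑ k : ZMod Q, (ZMod.stdAddChar (h * s + k * t) : ℂ) =
      if s = 0 ∧ t = 0 then (Q : ℂ) ^ 2 else 0 := by
  simp only [AddChar.map_add_eq_mul, ← Finset.mul_sum, ← Finset.sum_mul, sum_stdAddChar_mul]
  by_cases h1 : s = 0 <;> by_cases h2 : t = 0 <;> simp [h1, h2, sq]

/-- The additive quadruples `x₁ + x₂ = x₃ + x₄` in `X`. -/
def quadruples (X : Finset (ZMod Q × ZMod Q)) :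
    Finset ((ZMod Q × ZMod Q) × (ZMod Q × ZMod Q) × (ZMod Q × ZMod Q) × (ZMod Q × ZMod Q)) :=
  (X ×ˢ X ×ˢ X ×ˢ X).filter fun x => x.1 + x.2.1 = x.2.2.1 + x.2.2.2

/-- Expanding `|S|⁴ = S S S̄ S̄` and summing over both frequencies, orthogonality of characters
retains exactly the additive quadruples. -/
lemma sum_norm_expSum_pow_four (X : Finset (ZMod Q × ZMod Q)) :
    ∑ h : ZMod Q, ∑ k : ZMod Q, ‖expSum X h k‖ ^ 4 = (Q : ℝ) ^ 2 * (quadruples X).card := by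
  have key : ∀ h k : ZMod Q, ((‖expSum X h k‖ ^ 4 : ℝ) : ℂ) =
      ∑ x ∈ X ×ˢ X ×ˢ X ×ˢ X, (ZMod.stdAddChar
        (h * (x.1.2 + x.2.1.2 - x.2.2.1.2 - x.2.2.2.2) +
          k * (x.1.1 + x.2.1.1 - x.2.2.1.1 - x.2.2.2.1)) : ℂ) := by
    intro h k
    have e1 : ((‖expSum X h k‖ ^ 4 : ℝ) : ℂ) =
        expSum X h k * (expSum X h k * (conj (expSum X h k) * conj (expSum X h k))) := by
      have := Complex.mul_conj' (expSum X h k)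
      push_cast
      calc (‖expSum X h k‖ : ℂ) ^ 4 = ((‖expSum X h k‖ : ℂ) ^ 2) ^ 2 := by ring
        _ = _ := by rw [← this]; ring
    rw [e1]
    have e2 : ∀ A B : ZMod Q × ZMod Q → ℂ,
        (∑ x ∈ X, A x) * ((∑ x ∈ X, A x) * ((∑ x ∈ X, B x) * ∑ x ∈ X, B x)) =
          ∑ x ∈ X ×ˢ X ×ˢ X ×ˢ X, A x.1 * (A x.2.1 * (B x.2.2.1 * B x.2.2.2)) := by
      intro A B
      simp only [Finset.sum_product, ← Finset.mul_sum, ← Finset.sum_mul]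
    simp only [expSum, map_sum, conj_stdAddChar]
    rw [e2]
    refine Finset.sum_congr rfl fun x _ => ?_
    simp only [← AddChar.map_add_eq_mul]
    congr 1
    ring
  have : ((∑ h : ZMod Q, ∑ k : ZMod Q, ‖expSum X h k‖ ^ 4 : ℝ) : ℂ) =
      ((Q : ℝ) ^ 2 * (quadruples X).card : ℝ) := by
    push_cast
    simp only [← Complex.ofReal_pow, key]
    calc _ = ∑ x ∈ X ×ˢ X ×ˢ X ×ˢ X, ∑ h : ZMod Q, ∑ k : ZMod Q, (ZMod.stdAddChar
        (h * (x.1.2 + x.2.1.2 - x.2.2.1.2 - x.2.2.2.2) +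
          k * (x.1.1 + x.2.1.1 - x.2.2.1.1 - x.2.2.2.1)) : ℂ) := by
          rw [Finset.sum_comm]
          simp_rw [Finset.sum_comm (s := X ×ˢ X ×ˢ X ×ˢ X)]
          rw [Finset.sum_comm]
      _ = _ := by
          simp only [sum_sum_stdAddChar, quadruples]
          rw [← Finset.sum_filter, Finset.sum_const, nsmul_eq_mul, mul_comm]
          congr 3
          refine Finset.filter_congr fun x _ => ?_
          rw [Prod.ext_iff]
          simp only [Prod.fst_add, Prod.snd_add]
          constructor
          · rintro ⟨h1, h2⟩
            exact ⟨by linear_combination h2, by linear_combination h1⟩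
          · rintro ⟨h1, h2⟩
            exact ⟨by linear_combination h2, by linear_combination h1⟩
  exact_mod_cast this

/-- Fourier inversion for the indicator function of `X`. -/
lemma sum_expSum_mul (X : Finset (ZMod Q × ZMod Q)) (a d : ZMod Q) :
    ∑ h : ZMod Q, ∑ k : ZMod Q, expSum X (-h) (-k) * ZMod.stdAddChar (h * d + k * a) =
      if (a, d) ∈ X then (Q : ℂ) ^ 2 else 0 := by
  classical
  calc _ = ∑ x ∈ X, ∑ h : ZMod Q, ∑ k : ZMod Q,
        (ZMod.stdAddChar (h * (d - x.2) + k * (a - x.1)) : ℂ) := by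
        rw [Finset.sum_comm]
        simp_rw [Finset.sum_comm (s := X)]
        rw [Finset.sum_comm]
        refine Finset.sum_congr rfl fun h _ => Finset.sum_congr rfl fun k _ => ?_
        rw [expSum, Finset.sum_mul]
        refine Finset.sum_congr rfl fun x _ => ?_
        rw [← AddChar.map_add_eq_mul]
        congr 1
        ring
    _ = ∑ x ∈ X, if (a, d) = x then (Q : ℂ) ^ 2 else 0 := by
        refine Finset.sum_congr rfl fun x _ => ?_
        rw [sum_sum_stdAddChar]
        congr 1
        rw [Prod.ext_iff, sub_eq_zero, sub_eq_zero, and_comm]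
    _ = _ := by simp

variable {N : ℕ} [NeZero N] (hN : N ∣ Q)

/-- The points `(a, d)` modulo `Q` of the hyperbola `a d ≡ m (mod Q / N)` with `a ≡ r (mod N)`. -/
def hyperbola (m : ℕ) (r : ZMod N) : Finset (ZMod Q × ZMod Q) :=
  Finset.univ.filter fun x => (N : ZMod Q) * (x.1 * x.2 - m) = 0 ∧
    ZMod.castHom hN (ZMod N) x.1 = r

/-- The substitution `(a, d) ↦ (u⁻¹ a, u d)` preserves `a d`, and it preserves the class of `a`
because `u ≡ 1 (mod N)`. The same value is thus taken along a large orbit of frequencies, which is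
what makes a fourth moment yield a bound for an individual sum. -/
lemma expSum_hyperbola_unit_mul (m : ℕ) (r : ZMod N) (h k : ZMod Q) (u : (ZMod Q)ˣ)
    (hu : u ∈ (ZMod.unitsMap hN).ker) :
    expSum (hyperbola hN m r) (h * u) (k * (u⁻¹ : (ZMod Q)ˣ)) =
      expSum (hyperbola hN m r) h k := by
  have hu' : ZMod.castHom hN (ZMod N) (u : ZMod Q) = 1 := by
    have := congrArg Units.val (MonoidHom.mem_ker.1 hu)
    simpa [ZMod.unitsMap] using this
  have hui : ZMod.castHom hN (ZMod N) ((u⁻¹ : (ZMod Q)ˣ) : ZMod Q) = 1 := by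
    have := congrArg Units.val (MonoidHom.mem_ker.1 (inv_mem hu))
    simpa [ZMod.unitsMap] using this
  refine Finset.sum_bij' (fun x _ => ((u⁻¹ : (ZMod Q)ˣ) * x.1, u * x.2))
    (fun x _ => (u * x.1, (u⁻¹ : (ZMod Q)ˣ) * x.2)) ?_ ?_ ?_ ?_ ?_
  · intro x hx
    simp only [hyperbola, Finset.mem_filter, Finset.mem_univ, true_and, map_mul] at hx ⊢
    refine ⟨?_, by rw [hui, one_mul, hx.2]⟩
    rw [mul_mul_mul_comm, Units.inv_mul, one_mul, hx.1]
  · intro x hx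
    simp only [hyperbola, Finset.mem_filter, Finset.mem_univ, true_and, map_mul] at hx ⊢
    refine ⟨?_, by rw [hu', one_mul, hx.2]⟩
    rw [mul_mul_mul_comm, Units.mul_inv, one_mul, hx.1]
  · intro x _; simp
  · intro x _; simp
  · intro x _
    congr 1
    ring

/-- The size of the smallest representative of a residue class, or `1` for the class of `0`. -/
def height (h : ZMod Q) : ℕ := max 1 h.valMinAbs.natAbs

lemma one_le_height (h : ZMod Q) : 1 ≤ height h := le_max_left _ _

lemma card_filter_mul_eq_le_height {h : ZMod Q} (hh : h ≠ 0) (b : ZMod Q) :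
    (Finset.univ.filter fun x : ZMod Q => h * x = b).card ≤ height h := by
  have h0 : 0 < h.valMinAbs.natAbs := by
    rw [Int.natAbs_pos]
    simpa using hh
  refine le_trans ?_ (le_max_right 1 _)
  have hcast : ((h.valMinAbs : ℤ) : ZMod Q) = h := ZMod.coe_valMinAbs h
  rcases Int.natAbs_eq h.valMinAbs with e | e
  · refine le_trans (Finset.card_le_card fun x hx => ?_) (card_filter_natCast_mul_eq_le h0 b)
    simp only [Finset.mem_filter, Finset.mem_univ, true_and] at hx ⊢
    rw [← hx, ← Int.cast_natCast, ← e, hcast]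
  · refine le_trans (Finset.card_le_card fun x hx => ?_) (card_filter_natCast_mul_eq_le h0 (-b))
    simp only [Finset.mem_filter, Finset.mem_univ, true_and] at hx ⊢
    rw [← hx, ← Int.cast_natCast, show ((h.valMinAbs.natAbs : ℕ) : ℤ) = -h.valMinAbs by omega,
      Int.cast_neg, hcast, neg_mul]

/-- The orbit of `(h, k)` under the units congruent to `1` modulo `N` has few repetitions. -/
lemma card_fiber_le {h k : ZMod Q} (hhk : h ≠ 0 ∨ k ≠ 0) (y : ZMod Q × ZMod Q) :
    (Finset.univ.filter fun u : (ZMod Q)ˣ =>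
      (h * (u : ZMod Q), k * ((u⁻¹ : (ZMod Q)ˣ) : ZMod Q)) = y).card ≤ height h * height k := by
  rcases hhk with h0 | k0
  · refine le_trans (le_trans (Finset.card_le_card_of_injOn (fun u : (ZMod Q)ˣ => (u : ZMod Q))
      ?_ (fun u _ v _ e => Units.ext e)) (card_filter_mul_eq_le_height h0 y.1))
      (Nat.le_mul_of_pos_right _ (one_le_height k))
    intro u hu
    simp only [Finset.coe_filter, Finset.mem_univ, true_and, Set.mem_ofPred_eq] at hu ⊢
    rw [← hu]
  · refine le_trans (le_trans (Finset.card_le_card_of_injOn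
      (fun u : (ZMod Q)ˣ => ((u⁻¹ : (ZMod Q)ˣ) : ZMod Q))
      ?_ (fun u _ v _ e => inv_injective (Units.ext e))) (card_filter_mul_eq_le_height k0 y.2))
      (Nat.le_mul_of_pos_left _ (one_le_height h))
    intro u hu
    simp only [Finset.coe_filter, Finset.mem_univ, true_and, Set.mem_ofPred_eq] at hu ⊢
    rw [← hu]

/-- In `n = ∑ φ(d)` over `d ∣ n`, every `φ(d)` divides `φ(n)`. -/
lemma le_totient_mul_card_divisors (n : ℕ) (hn : 0 < n) : n ≤ n.totient * n.divisors.card := by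
  calc n = ∑ d ∈ n.divisors, d.totient := (Nat.sum_totient n).symm
    _ ≤ ∑ d ∈ n.divisors, n.totient := Finset.sum_le_sum fun d hd =>
        Nat.le_of_dvd (Nat.totient_pos.2 hn) (Nat.totient_dvd_of_dvd (Nat.dvd_of_mem_divisors hd))
    _ = _ := by simp [mul_comm]

/-- The image in `(ℤ/N)ˣ` has at most `N` elements, so the kernel has size at least `φ(Q) / N`. -/
lemma le_card_ker_unitsMap :
    Q ≤ N * Q.divisors.card * Nat.card (ZMod.unitsMap hN).ker := by
  have h1 := Subgroup.card_mul_index (ZMod.unitsMap hN).ker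
  rw [Subgroup.index_ker] at h1
  have h2 : Nat.card (ZMod.unitsMap hN).range ≤ N := by
    calc _ ≤ Nat.card (ZMod N)ˣ := Subgroup.card_le_card_group _
      _ = N.totient := by rw [Nat.card_eq_fintype_card, ZMod.card_units_eq_totient]
      _ ≤ N := Nat.totient_le N
  have h3 : Nat.card (ZMod Q)ˣ = Q.totient := by
    rw [Nat.card_eq_fintype_card, ZMod.card_units_eq_totient]
  calc Q ≤ Q.totient * Q.divisors.card := le_totient_mul_card_divisors Q (NeZero.pos Q)
    _ = Nat.card (ZMod.unitsMap hN).ker * Nat.card (ZMod.unitsMap hN).range *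
          Q.divisors.card := by rw [h1, h3]
    _ ≤ Nat.card (ZMod.unitsMap hN).ker * N * Q.divisors.card := by gcongr
    _ = _ := by ring

lemma gcd_val_mul_le (M : ℕ) (hM : 0 < M) (u v : ZMod Q) :
    Nat.gcd ((M : ZMod Q) * u * v).val Q ≤ M * Nat.gcd u.val Q * Nat.gcd v.val Q := by
  have e : ((M : ZMod Q) * u * v) = ((M * u.val * v.val : ℕ) : ZMod Q) := by simp
  have hQ := NeZero.pos Q
  rw [e, ZMod.val_natCast, ← Nat.gcd_rec]
  refine Nat.le_of_dvd (by positivity) ?_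
  refine (Nat.gcd_mul_right_dvd_mul_gcd Q (M * u.val) v.val).trans ?_
  rw [Nat.gcd_comm Q v.val]
  refine mul_dvd_mul_right ((Nat.gcd_mul_right_dvd_mul_gcd Q M u.val).trans ?_) _
  rw [Nat.gcd_comm Q u.val]
  exact mul_dvd_mul_right (Nat.gcd_dvd_right _ _) _

/-- The number of solutions of `M (a₁ + a₂) (a₃ - a₁) (a₃ - a₂) = 0` in `ZMod Q`. -/
lemma card_triples_le (M : ℕ) (hM : 0 < M) :
    (Finset.univ.filter fun a : ZMod Q × ZMod Q × ZMod Q =>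
      (M : ZMod Q) * (a.1 + a.2.1) * (a.2.2 - a.1) * (a.2.2 - a.2.1) = 0).card ≤
      2 * M * (Q * Q.divisors.card) ^ 2 := by
  classical
  -- New variables `u = a₃ - a₁`, `v = a₃ - a₂`, `x = a₃`. Since `a₁ + a₂ = 2x - u - v`, for fixed
  -- `u, v` the condition is a linear congruence for `x` with coefficient `2 M u v`.
  calc _ ≤ (Finset.univ.sigma fun p : ZMod Q × ZMod Q => Finset.univ.filter fun x : ZMod Q =>
        (((2 * M : ℕ) : ZMod Q) * p.1 * p.2) * x = M * p.1 * p.2 * (p.1 + p.2)).card := by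
        refine Finset.card_le_card_of_injOn
          (fun a => ⟨(a.2.2 - a.1, a.2.2 - a.2.1), a.2.2⟩) ?_ ?_
        · intro a ha
          simp only [Finset.coe_filter, Finset.mem_univ, true_and, Set.mem_ofPred_eq] at ha
          simp only [Finset.coe_sigma, Finset.coe_univ, Set.mem_sigma_iff, Set.mem_univ, true_and,
            Finset.coe_filter, Finset.mem_univ, Set.mem_ofPred_eq]
          push_cast
          linear_combination ha
        · intro a _ b _ e
          simp only [Sigma.mk.injEq, Prod.mk.injEq, heq_eq_eq] at e
          obtain ⟨⟨e1, e2⟩, e3⟩ := e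
          refine Prod.ext ?_ (Prod.ext ?_ e3)
          · linear_combination e3 - e1
          · linear_combination e3 - e2
    _ = ∑ p : ZMod Q × ZMod Q, (Finset.univ.filter fun x : ZMod Q =>
        (((2 * M : ℕ) : ZMod Q) * p.1 * p.2) * x = M * p.1 * p.2 * (p.1 + p.2)).card :=
        Finset.card_sigma _ _
    _ ≤ ∑ p : ZMod Q × ZMod Q, 2 * M * Nat.gcd p.1.val Q * Nat.gcd p.2.val Q :=
        Finset.sum_le_sum fun p _ => (card_filter_mul_eq_le _ _).trans
          (gcd_val_mul_le (2 * M) (by positivity) _ _)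
    _ = 2 * M * (∑ u : ZMod Q, Nat.gcd u.val Q) ^ 2 := by
        rw [Fintype.sum_prod_type]
        simp only [← Finset.mul_sum, ← Finset.sum_mul]
        ring
    _ ≤ _ := by gcongr; exact sum_gcd_val_le

/-- The `a`-coordinates of a quadruple satisfy a cubic congruence, whose solutions are counted by
`card_triples_le`. Once they are fixed, each `d`-coordinate has at most `N m` possible values. -/
lemma card_quadruples_hyperbola_le (hN0 : 0 < N) {m : ℕ} (hm : 0 < m) (r : ZMod N) :
    (quadruples (hyperbola hN m r)).card ≤
      (N * m) ^ 4 * (2 * (N * m) * (Q * Q.divisors.card) ^ 2) := by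
  classical
  set T := Finset.univ.filter fun a : ZMod Q × ZMod Q × ZMod Q =>
      ((N * m : ℕ) : ZMod Q) * (a.1 + a.2.1) * (a.2.2 - a.1) * (a.2.2 - a.2.1) = 0 with hT
  have hNm : 0 < N * m := by positivity
  have hd : ∀ a : ZMod Q, (Finset.univ.filter fun d : ZMod Q =>
      (N : ZMod Q) * (a * d - m) = 0).card ≤ N * m := by
    intro a
    rcases Finset.eq_empty_or_nonempty (Finset.univ.filter fun d : ZMod Q =>
      (N : ZMod Q) * (a * d - m) = 0) with h | ⟨d₀, hd₀⟩
    · simp [h]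
    · simp only [Finset.mem_filter, Finset.mem_univ, true_and] at hd₀
      refine le_trans (Finset.card_le_card ?_)
        (card_filter_natCast_mul_eq_le hNm (((N * m : ℕ) : ZMod Q) * d₀))
      intro d hd
      simp only [Finset.mem_filter, Finset.mem_univ, true_and] at hd ⊢
      push_cast
      -- Both `N m d` and `N m d₀` equal `N a d d₀`.
      linear_combination d * hd - (d : ZMod Q) * hd + d₀ * hd - d * hd₀
  refine le_trans (Finset.card_le_card_of_injOn (t := T.sigma fun a =>
      (Finset.univ.filter fun d : ZMod Q => (N : ZMod Q) * (a.1 * d - m) = 0) ×ˢ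
      (Finset.univ.filter fun d : ZMod Q => (N : ZMod Q) * (a.2.1 * d - m) = 0) ×ˢ
      (Finset.univ.filter fun d : ZMod Q => (N : ZMod Q) * (a.2.2 * d - m) = 0) ×ˢ
      (Finset.univ.filter fun d : ZMod Q =>
        (N : ZMod Q) * ((a.1 + a.2.1 - a.2.2) * d - m) = 0))
      (fun x => ⟨(x.1.1, x.2.1.1, x.2.2.1.1), (x.1.2, x.2.1.2, x.2.2.1.2, x.2.2.2.2)⟩) ?_ ?_) ?_
  · rintro ⟨⟨a₁, d₁⟩, ⟨a₂, d₂⟩, ⟨a₃, d₃⟩, ⟨a₄, d₄⟩⟩ hx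
    simp only [quadruples, hyperbola, Finset.coe_filter, Finset.mem_product, Finset.mem_filter,
      Finset.mem_univ, true_and, Set.mem_ofPred_eq, Prod.mk_add_mk, Prod.mk.injEq] at hx
    obtain ⟨⟨⟨h1, -⟩, ⟨h2, -⟩, ⟨h3, -⟩, ⟨h4, -⟩⟩, ha, hdd⟩ := hx
    simp only [Finset.coe_sigma, Set.mem_sigma_iff, Finset.mem_coe, Finset.mem_product,
      Finset.mem_filter, Finset.mem_univ, true_and, hT]
    have ha4 : a₄ = a₁ + a₂ - a₃ := by linear_combination -ha
    subst ha4
    refine ⟨?_, h1, h2, h3, h4⟩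
    have hd4 : d₄ = d₁ + d₂ - d₃ := by linear_combination -hdd
    subst hd4
    push_cast
    -- Multiply `d₁ + d₂ = d₃ + d₄` by `N a₁ a₂ a₃ a₄` and replace each `N aᵢ dᵢ` by `N m`: this
    -- gives `N m (a₁ + a₂)(a₃ a₄ - a₁ a₂) = 0`. With `a₄ = a₁ + a₂ - a₃` the last factor is `-(a₃ -
    -- a₁)(a₃ - a₂)`.
    linear_combination (a₂ * a₃ * (a₁ + a₂ - a₃)) * h1 + (a₁ * a₃ * (a₁ + a₂ - a₃)) * h2 -
      (a₁ * a₂ * (a₁ + a₂ - a₃)) * h3 - (a₁ * a₂ * a₃) * h4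
  · rintro ⟨⟨a₁, d₁⟩, ⟨a₂, d₂⟩, ⟨a₃, d₃⟩, ⟨a₄, d₄⟩⟩ hx ⟨⟨b₁, e₁⟩, ⟨b₂, e₂⟩, ⟨b₃, e₃⟩, ⟨b₄, e₄⟩⟩ hy h
    simp only [quadruples, Finset.coe_filter, Finset.mem_product, Set.mem_ofPred_eq,
      Prod.mk_add_mk, Prod.mk.injEq] at hx hy
    simp only [Sigma.mk.injEq, Prod.mk.injEq, heq_eq_eq] at h
    obtain ⟨⟨rfl, rfl, rfl⟩, rfl, rfl, rfl, rfl⟩ := h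
    have : a₄ = b₄ := by linear_combination hy.2.1 - hx.2.1
    rw [this]
  · rw [Finset.card_sigma]
    calc _ ≤ ∑ a ∈ T, (N * m) ^ 4 := by
          refine Finset.sum_le_sum fun a _ => ?_
          simp only [Finset.card_product]
          calc _ ≤ (N * m) * ((N * m) * ((N * m) * (N * m))) := by
                gcongr <;> exact hd _
            _ = _ := by ring
      _ = (N * m) ^ 4 * T.card := by simp [mul_comm]
      _ ≤ _ := by gcongr; exact card_triples_le (N * m) hNm

/-- Kloosterman's bound, by the fourth moment. -/
lemma norm_expSum_hyperbola_pow_four_le {m : ℕ} (hm : 0 < m) (r : ZMod N) {h k : ZMod Q}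
    (hhk : h ≠ 0 ∨ k ≠ 0) :
    ‖expSum (hyperbola hN m r) h k‖ ^ 4 ≤
      2 * (N : ℝ) * (N * m) ^ 5 * (height h * height k) * (Q * Q.divisors.card : ℝ) ^ 3 := by
  classical
  set T := expSum (hyperbola hN m r) with hT
  set τ : ℝ := (Q.divisors.card : ℝ) with hτ
  set K : Finset (ZMod Q)ˣ := Finset.univ.filter fun u => u ∈ (ZMod.unitsMap hN).ker with hK
  have hcard : (K.card : ℝ) = Nat.card (ZMod.unitsMap hN).ker := by
    rw [hK, Nat.card_eq_fintype_card, Fintype.card_subtype]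
  have hQ : (0 : ℝ) < Q := by exact_mod_cast NeZero.pos Q
  have hlow : (Q : ℝ) ≤ N * τ * K.card := by
    rw [hcard, hτ]; exact_mod_cast le_card_ker_unitsMap hN
  -- Average over the orbit of `(h, k)`: all its points carry the same value, and each frequency is
  -- hit at most `height h * height k` times, so the orbit sum is controlled by the full fourth
  -- moment. The lower bound `hlow` for the size of the kernel then gives the saving.
  have h1 : (K.card : ℝ) * ‖T h k‖ ^ 4 ≤
      (height h * height k : ℝ) * ∑ y : ZMod Q × ZMod Q, ‖T y.1 y.2‖ ^ 4 := by
    calc (K.card : ℝ) * ‖T h k‖ ^ 4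
        = ∑ u ∈ K, ‖T (h * (u : ZMod Q)) (k * ((u⁻¹ : (ZMod Q)ˣ) : ZMod Q))‖ ^ 4 := by
          rw [← nsmul_eq_mul, ← Finset.sum_const]
          refine Finset.sum_congr rfl fun u hu => ?_
          rw [hT, expSum_hyperbola_unit_mul hN m r h k u (Finset.mem_filter.1 hu).2]
      _ ≤ ∑ u : (ZMod Q)ˣ, ‖T (h * (u : ZMod Q)) (k * ((u⁻¹ : (ZMod Q)ˣ) : ZMod Q))‖ ^ 4 :=
          Finset.sum_le_univ_sum_of_nonneg fun _ => by positivity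
      _ = ∑ y : ZMod Q × ZMod Q, ∑ _u ∈ Finset.univ.filter (fun u : (ZMod Q)ˣ =>
            (h * (u : ZMod Q), k * ((u⁻¹ : (ZMod Q)ˣ) : ZMod Q)) = y), ‖T y.1 y.2‖ ^ 4 := by
          rw [← Finset.sum_fiberwise (s := Finset.univ) (g := fun u : (ZMod Q)ˣ =>
            (h * (u : ZMod Q), k * ((u⁻¹ : (ZMod Q)ˣ) : ZMod Q)))]
          refine Finset.sum_congr rfl fun y _ => Finset.sum_congr rfl fun u hu => ?_
          rw [← (Finset.mem_filter.1 hu).2]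
      _ ≤ ∑ y : ZMod Q × ZMod Q, (height h * height k : ℝ) * ‖T y.1 y.2‖ ^ 4 := by
          refine Finset.sum_le_sum fun y _ => ?_
          rw [Finset.sum_const, nsmul_eq_mul]
          gcongr
          exact_mod_cast card_fiber_le hhk y
      _ = _ := by rw [Finset.mul_sum]
  have h2 : ∑ y : ZMod Q × ZMod Q, ‖T y.1 y.2‖ ^ 4 ≤
      (Q : ℝ) ^ 2 * ((N * m) ^ 4 * (2 * (N * m) * (Q * τ) ^ 2)) := by
    rw [Fintype.sum_prod_type, hT, sum_norm_expSum_pow_four]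
    refine mul_le_mul_of_nonneg_left ?_ (by positivity)
    rw [hτ]
    exact_mod_cast card_quadruples_hyperbola_le hN (NeZero.pos N) hm r
  have h3 : (Q : ℝ) * ‖T h k‖ ^ 4 ≤ Q *
      (2 * (N : ℝ) * (N * m) ^ 5 * (height h * height k) * (Q * τ) ^ 3) := by
    calc (Q : ℝ) * ‖T h k‖ ^ 4 ≤ (N * τ * K.card) * ‖T h k‖ ^ 4 := by gcongr
      _ = N * τ * (K.card * ‖T h k‖ ^ 4) := by ring
      _ ≤ N * τ * ((height h * height k : ℝ) *
            ((Q : ℝ) ^ 2 * ((N * m) ^ 4 * (2 * (N * m) * (Q * τ) ^ 2)))) := by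
          refine mul_le_mul_of_nonneg_left ?_ (by positivity)
          exact h1.trans (mul_le_mul_of_nonneg_left h2 (by positivity))
      _ = _ := by ring
  exact le_of_mul_le_mul_left h3 hQ

end ExponentialSums

/-! ### Equidistribution on the hyperbola, by finite Fourier analysis. -/

section FourierExpansion

variable {Q : ℕ} [NeZero Q]

/-- The Fourier transform of a summable sequence at the frequency `h / Q`. -/
def seqFourier (p : ℤ → ℂ) (h : ZMod Q) : ℂ := ∑' n : ℤ, p n * ZMod.stdAddChar (h * (n : ZMod Q))

lemma summable_mul_stdAddChar {p : ℤ → ℂ} (hp : Summable fun n => ‖p n‖) (h : ZMod Q) :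
    Summable fun n : ℤ => p n * (ZMod.stdAddChar (h * (n : ZMod Q)) : ℂ) :=
  Summable.of_norm (by simpa [norm_mul] using hp)

lemma norm_seqFourier_le {p : ℤ → ℂ} (hp : Summable fun n => ‖p n‖) (h : ZMod Q) :
    ‖seqFourier p h‖ ≤ ∑' n, ‖p n‖ := by
  refine (norm_tsum_le_tsum_norm ?_).trans_eq ?_
  · simpa using hp
  · simp

/-- The second difference of a sequence. -/
def secondDiff (p : ℤ → ℂ) (n : ℤ) : ℂ := p (n + 1) - 2 * p n + p (n - 1)

lemma summable_norm_secondDiff {p : ℤ → ℂ} (hp : Summable fun n => ‖p n‖) :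
    Summable fun n => ‖secondDiff p n‖ := by
  have h1 : Summable fun n : ℤ => ‖p (n + 1)‖ :=
    Summable.comp_injective (f := fun n => ‖p n‖) (i := fun n : ℤ => n + 1) hp
      (add_left_injective (1 : ℤ))
  have h2 : Summable fun n : ℤ => ‖p (n - 1)‖ :=
    Summable.comp_injective (f := fun n => ‖p n‖) (i := fun n : ℤ => n - 1) hp
      (sub_left_injective (b := (1 : ℤ)))
  refine Summable.of_nonneg_of_le (fun _ => norm_nonneg _) (fun n => ?_)
    ((h1.add (hp.mul_left 2)).add h2)
  have e1 := norm_add_le (p (n + 1) - 2 * p n) (p (n - 1))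
  have e2 := norm_sub_le (p (n + 1)) (2 * p n)
  rw [norm_mul, Complex.norm_ofNat] at e2
  rw [secondDiff]
  linarith

/-- A shift of the sequence multiplies its transform by a character value; this is summation by
parts. -/
lemma seqFourier_secondDiff {p : ℤ → ℂ} (hp : Summable fun n => ‖p n‖) (h : ZMod Q) :
    seqFourier (secondDiff p) h =
      (ZMod.stdAddChar (-h) - 2 + ZMod.stdAddChar h) * seqFourier p h := by
  have e0 := (summable_mul_stdAddChar hp h).hasSum
  have e1 : HasSum (fun n : ℤ => p (n + 1) * (ZMod.stdAddChar (h * (n : ZMod Q)) : ℂ))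
      (ZMod.stdAddChar (-h) * seqFourier p h) := by
    have := ((Equiv.addRight (1 : ℤ)).hasSum_iff.2 e0).mul_left (ZMod.stdAddChar (-h) : ℂ)
    have e : (fun n : ℤ => p (n + 1) * (ZMod.stdAddChar (h * (n : ZMod Q)) : ℂ)) =
        fun n => (ZMod.stdAddChar (-h) : ℂ) *
          ((fun n : ℤ => p n * (ZMod.stdAddChar (h * (n : ZMod Q)) : ℂ)) ∘ Equiv.addRight (1 : ℤ)) n := by
      funext n
      simp only [Function.comp, Equiv.coe_addRight]
      rw [mul_left_comm, ← AddChar.map_add_eq_mul]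
      congr 2
      push_cast; ring
    rw [e]
    exact this
  have e2 : HasSum (fun n : ℤ => p (n - 1) * (ZMod.stdAddChar (h * (n : ZMod Q)) : ℂ))
      (ZMod.stdAddChar h * seqFourier p h) := by
    have := ((Equiv.subRight (1 : ℤ)).hasSum_iff.2 e0).mul_left (ZMod.stdAddChar h : ℂ)
    have e : (fun n : ℤ => p (n - 1) * (ZMod.stdAddChar (h * (n : ZMod Q)) : ℂ)) =
        fun n => (ZMod.stdAddChar h : ℂ) *
          ((fun n : ℤ => p n * (ZMod.stdAddChar (h * (n : ZMod Q)) : ℂ)) ∘ Equiv.subRight (1 : ℤ)) n := by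
      funext n
      simp only [Function.comp, Equiv.subRight_apply]
      rw [mul_left_comm, ← AddChar.map_add_eq_mul]
      congr 2
      push_cast; ring
    rw [e]
    exact this
  have := ((e1.sub (e0.mul_left 2)).add e2).tsum_eq
  calc seqFourier (secondDiff p) h = _ := tsum_congr fun n => by
        rw [secondDiff]
        ring
    _ = _ := this
    _ = _ := by
        change _ - 2 * seqFourier p h + _ = _
        ring

/-- The multiplier of the second difference is `-4 sin²(π j / Q)`, where `j` is the representative
with `|j| ≤ Q / 2`. Jordan's inequality `sin θ ≥ 2θ / π` applies on `[0, π/2]`. -/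
lemma height_sq_le (h : ZMod Q) (h0 : h ≠ 0) :
    16 * (height h : ℝ) ^ 2 / Q ^ 2 ≤
      ‖(ZMod.stdAddChar (-h) - 2 + ZMod.stdAddChar h : ℂ)‖ := by
  have hQ : (0 : ℝ) < Q := by exact_mod_cast NeZero.pos Q
  set j : ℤ := h.valMinAbs with hj
  have hjh : ((j : ℤ) : ZMod Q) = h := ZMod.coe_valMinAbs h
  have hj0 : j ≠ 0 := fun e => h0 (by rw [← hjh, e]; simp)
  have hjn : 0 < j.natAbs := Int.natAbs_pos.2 hj0
  have hh : (height h : ℝ) = |(j : ℝ)| := by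
    rw [height, ← hj, max_eq_right hjn, Nat.cast_natAbs, Int.cast_abs]
  have hle : 2 * |(j : ℝ)| ≤ Q := by
    have h1 := ZMod.natAbs_valMinAbs_le h
    have h2 : 2 * j.natAbs ≤ Q := by omega
    have h3 : ((2 * j.natAbs : ℕ) : ℝ) ≤ Q := by exact_mod_cast h2
    simpa [Nat.cast_natAbs, Int.cast_abs] using h3
  set θ : ℝ := Real.pi * |(j : ℝ)| / Q with hθ
  have e1 : (ZMod.stdAddChar h : ℂ) + ZMod.stdAddChar (-h) =
      2 * Complex.cos (2 * θ) := by
    have hc : Complex.cos (2 * (θ : ℂ)) = Complex.cos (2 * Real.pi * j / Q) := by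
      rcases abs_cases (j : ℝ) with ⟨e, -⟩ | ⟨e, -⟩
      · rw [hθ, e]; congr 1; push_cast; ring
      · rw [hθ, e, ← Complex.cos_neg]; congr 1; push_cast; ring
    rw [hc, Complex.two_cos, ← hjh, ← Int.cast_neg, ZMod.stdAddChar_coe, ZMod.stdAddChar_coe]
    congr 2 <;> push_cast <;> ring
  have e2 : (ZMod.stdAddChar (-h) - 2 + ZMod.stdAddChar h : ℂ) =
      ((-(4 * Real.sin θ ^ 2) : ℝ) : ℂ) := by
    have : (ZMod.stdAddChar (-h) - 2 + ZMod.stdAddChar h : ℂ) =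
      ((ZMod.stdAddChar h : ℂ) + ZMod.stdAddChar (-h)) - 2 := by ring
    rw [this, e1, Complex.cos_two_mul, Complex.cos_sq']
    push_cast
    ring
  rw [e2, Complex.norm_real, Real.norm_eq_abs, abs_neg, abs_of_nonneg (by positivity), hh]
  have hsin : 2 / Real.pi * θ ≤ Real.sin θ := by
    refine Real.mul_le_sin (by positivity) ?_
    rw [hθ, div_le_div_iff₀ hQ two_pos]
    nlinarith [Real.pi_pos]
  have h5 : 2 / Real.pi * θ = 2 * |(j : ℝ)| / Q := by
    rw [hθ]; field_simp
  rw [h5] at hsin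
  have h6 : 0 ≤ 2 * |(j : ℝ)| / Q := by positivity
  calc 16 * |(j : ℝ)| ^ 2 / Q ^ 2 = 4 * (2 * |(j : ℝ)| / Q) ^ 2 := by ring
    _ ≤ 4 * Real.sin θ ^ 2 := by gcongr

/-- For `h ≠ 0`, two summations by parts give decay `height⁻²`. For `h = 0` the trivial bound
suffices, the height being `1` by convention. -/
lemma norm_seqFourier_le_height {p : ℤ → ℂ} (hp : Summable fun n => ‖p n‖) {B : ℝ}
    (h1 : ∑' n, ‖p n‖ ≤ B * Q) (h2 : ∑' n, ‖secondDiff p n‖ ≤ B / Q) (h : ZMod Q) :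
    ‖seqFourier p h‖ ≤ B * Q / (height h : ℝ) ^ 2 := by
  have hQ : (0 : ℝ) < Q := by exact_mod_cast NeZero.pos Q
  rcases eq_or_ne h 0 with rfl | h0
  · simpa [height] using (norm_seqFourier_le hp (0 : ZMod Q)).trans h1
  · have hj : (0 : ℝ) < height h := by exact_mod_cast one_le_height h
    have hB : 0 ≤ B := by
      have : 0 ≤ B * Q := (tsum_nonneg fun _ => norm_nonneg _).trans h1
      exact nonneg_of_mul_nonneg_left this hQ
    have e := congrArg norm (seqFourier_secondDiff hp h)
    rw [norm_mul] at e
    have e3 : 16 * (height h : ℝ) ^ 2 / Q ^ 2 * ‖seqFourier p h‖ ≤ B / Q := by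
      refine le_trans ?_ ((norm_seqFourier_le (summable_norm_secondDiff hp) h).trans h2)
      rw [e]
      gcongr
      exact height_sq_le h h0
    rw [div_mul_eq_mul_div, div_le_div_iff₀ (by positivity) hQ] at e3
    rw [le_div_iff₀ (by positivity)]
    have e4 : 0 ≤ ‖seqFourier p h‖ * (height h : ℝ) ^ 2 := by positivity
    have e5 : Q * (16 * (‖seqFourier p h‖ * (height h : ℝ) ^ 2)) ≤ Q * (B * Q) := by
      linarith
    have e6 := le_of_mul_le_mul_left e5 hQ
    linarith

/-- A bound for `∑ height(h)^(-7/4)`, independent of the modulus. -/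
def heightConst : ℝ := ∑' j : ℤ, (max 1 (j.natAbs : ℝ)) ^ (-(7 / 4) : ℝ)

lemma summable_height : Summable fun j : ℤ => (max 1 (j.natAbs : ℝ)) ^ (-(7 / 4) : ℝ) := by
  have hs : Summable fun n : ℕ => (n : ℝ) ^ (-(7 / 4) : ℝ) :=
    Real.summable_nat_rpow.2 (by norm_num)
  have hn : Summable fun n : ℕ => (max 1 (n : ℝ)) ^ (-(7 / 4) : ℝ) := by
    rw [← summable_nat_add_iff 1] at hs ⊢
    refine hs.congr fun n => ?_
    rw [max_eq_right]
    push_cast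
    linarith [(Nat.cast_nonneg n : (0 : ℝ) ≤ n)]
  exact Summable.of_nat_of_neg (by simpa using hn) (by simpa using hn)

lemma sum_height_le : ∑ h : ZMod Q, (height h : ℝ) ^ (-(7 / 4) : ℝ) ≤ heightConst := by
  have hinj : Function.Injective (ZMod.valMinAbs : ZMod Q → ℤ) := ZMod.injective_valMinAbs
  calc _ = ∑ j ∈ Finset.univ.map ⟨_, hinj⟩, (max 1 (j.natAbs : ℝ)) ^ (-(7 / 4) : ℝ) := by
        rw [Finset.sum_map]
        simp [height]
    _ ≤ _ := summable_height.sum_le_tsum _ fun _ _ => by positivity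

variable {N : ℕ} [NeZero N] (hN : N ∣ Q)

lemma hasSum_mul_of_summable_norm {ι κ : Type*} {f : ι → ℂ} {g : κ → ℂ}
    (hf : Summable fun n => ‖f n‖) (hg : Summable fun n => ‖g n‖) :
    HasSum (fun x : ι × κ => f x.1 * g x.2) ((∑' n, f n) * ∑' n, g n) := by
  rw [tsum_mul_tsum_of_summable_norm hf hg]
  exact (summable_mul_of_summable_norm hf hg).hasSum

/-- Insert the Fourier expansion of the indicator of `X` and interchange the finite sums over
frequencies with the absolutely convergent sum over `ℤ × ℤ`. -/
lemma tsum_hyperbola_eq (X : Finset (ZMod Q × ZMod Q)) {p r : ℤ → ℂ}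
    (hp : Summable fun n => ‖p n‖) (hr : Summable fun n => ‖r n‖) :
    ∑' x : ℤ × ℤ, (if ((x.1 : ZMod Q), (x.2 : ZMod Q)) ∈ X then r x.1 * p x.2 else 0) =
      ((Q : ℂ) ^ 2)⁻¹ * ∑ h : ZMod Q, ∑ k : ZMod Q,
        expSum X (-h) (-k) * (seqFourier p h * seqFourier r k) := by
  have hQ : (Q : ℂ) ≠ 0 := NeZero.ne _
  have key : ∀ h k : ZMod Q, HasSum (fun x : ℤ × ℤ =>
      (r x.1 * ZMod.stdAddChar (k * (x.1 : ZMod Q))) *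
        (p x.2 * ZMod.stdAddChar (h * (x.2 : ZMod Q))))
      (seqFourier r k * seqFourier p h) := by
    intro h k
    exact hasSum_mul_of_summable_norm (f := fun n : ℤ => r n *
      (ZMod.stdAddChar (k * (n : ZMod Q)) : ℂ)) (g := fun n : ℤ => p n *
      (ZMod.stdAddChar (h * (n : ZMod Q)) : ℂ)) (by simpa using hr) (by simpa using hp)
  have h2 : HasSum (fun x : ℤ × ℤ => ((Q : ℂ) ^ 2)⁻¹ * ∑ h : ZMod Q, ∑ k : ZMod Q,
      expSum X (-h) (-k) * ((r x.1 * ZMod.stdAddChar (k * (x.1 : ZMod Q))) *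
        (p x.2 * ZMod.stdAddChar (h * (x.2 : ZMod Q)))))
      (((Q : ℂ) ^ 2)⁻¹ * ∑ h : ZMod Q, ∑ k : ZMod Q,
        expSum X (-h) (-k) * (seqFourier r k * seqFourier p h)) :=
    (hasSum_sum fun h _ => hasSum_sum fun k _ => (key h k).mul_left _).mul_left _
  refine HasSum.tsum_eq ?_
  convert h2 using 1
  · funext x
    have := sum_expSum_mul X (x.1 : ZMod Q) (x.2 : ZMod Q)
    calc (if ((x.1 : ZMod Q), (x.2 : ZMod Q)) ∈ X then r x.1 * p x.2 else 0)
        = ((Q : ℂ) ^ 2)⁻¹ * ((if ((x.1 : ZMod Q), (x.2 : ZMod Q)) ∈ X then (Q : ℂ) ^ 2 else 0) *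
            (r x.1 * p x.2)) := by
          split_ifs
          · field_simp
          · simp
      _ = _ := by
          rw [← this, Finset.sum_mul]
          congr 1
          refine Finset.sum_congr rfl fun h _ => ?_
          rw [Finset.sum_mul]
          refine Finset.sum_congr rfl fun k _ => ?_
          rw [AddChar.map_add_eq_mul]
          ring
  · simp only [mul_comm (seqFourier p _)]

/-- Equidistribution of the points of a hyperbola, tested against two sequences. -/
lemma norm_tsum_hyperbola_sub_le {m : ℕ} (hm : 0 < m) (s : ZMod N) {p r : ℤ → ℂ} {B : ℝ}
    (hp : Summable fun n => ‖p n‖) (hr : Summable fun n => ‖r n‖)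
    (hp1 : ∑' n, ‖p n‖ ≤ B * Q) (hp2 : ∑' n, ‖secondDiff p n‖ ≤ B / Q)
    (hr1 : ∑' n, ‖r n‖ ≤ B * Q) (hr2 : ∑' n, ‖secondDiff r n‖ ≤ B / Q) :
    ‖∑' x : ℤ × ℤ, (if ((x.1 : ZMod Q), (x.2 : ZMod Q)) ∈ hyperbola hN m s
        then r x.1 * p x.2 else 0) -
      ((Q : ℂ) ^ 2)⁻¹ * ((hyperbola hN m s).card * ((∑' n, p n) * ∑' n, r n))‖ ≤
      (2 * (N : ℝ) * (N * m) ^ 5) ^ (1 / 4 : ℝ) * heightConst ^ 2 * B ^ 2 *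
        (Q * Q.divisors.card : ℝ) ^ (3 / 4 : ℝ) := by
  classical
  have hQ : (0 : ℝ) < Q := by exact_mod_cast NeZero.pos Q
  set X := hyperbola hN m s with hX
  set K : ℝ := 2 * (N : ℝ) * (N * m) ^ 5 with hK
  set τ : ℝ := (Q * Q.divisors.card : ℝ) with hτ
  have hK0 : 0 ≤ K := by positivity
  have hτ0 : 0 ≤ τ := by positivity
  have hfin : ∀ h k : ZMod Q, h ≠ 0 ∨ k ≠ 0 → ‖expSum X h k‖ ^ 4 ≤
      K * (height h * height k) * τ ^ 3 := fun h k hhk =>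
    norm_expSum_hyperbola_pow_four_le hN hm s hhk
  clear_value K τ X
  have hT : ∀ h k : ZMod Q, (h, k) ≠ 0 → ‖expSum X (-h) (-k)‖ ≤
      K ^ (1 / 4 : ℝ) * τ ^ (3 / 4 : ℝ) *
        ((height h : ℝ) ^ (1 / 4 : ℝ) * (height k : ℝ) ^ (1 / 4 : ℝ)) := by
    intro h k hhk
    have hne : -h ≠ 0 ∨ -k ≠ 0 := by
      by_contra! hc
      exact hhk (Prod.ext (neg_eq_zero.1 hc.1) (neg_eq_zero.1 hc.2))
    have h4 := hfin _ _ hne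
    have hh : ∀ h : ZMod Q, height (-h) = height h := by
      intro h
      simp [height, ZMod.natAbs_valMinAbs_neg]
    rw [hh, hh] at h4
    have h5 : ‖expSum X (-h) (-k)‖ = (‖expSum X (-h) (-k)‖ ^ 4) ^ (1 / 4 : ℝ) := by
      rw [← Real.rpow_natCast, ← Real.rpow_mul (norm_nonneg _)]
      norm_num
    rw [h5]
    refine (Real.rpow_le_rpow (by positivity) h4 (by norm_num)).trans_eq ?_
    have a1 : (0 : ℝ) ≤ height h := Nat.cast_nonneg _
    have a2 : (0 : ℝ) ≤ height k := Nat.cast_nonneg _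
    rw [Real.mul_rpow (mul_nonneg hK0 (mul_nonneg a1 a2)) (pow_nonneg hτ0 3),
      Real.mul_rpow hK0 (mul_nonneg a1 a2), Real.mul_rpow a1 a2, ← Real.rpow_natCast τ 3,
      ← Real.rpow_mul hτ0, show ((3 : ℕ) : ℝ) * (1 / 4) = 3 / 4 by norm_num]
    ring
  have h00 : seqFourier p (0 : ZMod Q) = ∑' n, p n := by simp [seqFourier]
  have h00' : seqFourier r (0 : ZMod Q) = ∑' n, r n := by simp [seqFourier]
  have hT0 : expSum X (-0) (-0) = X.card := by simp [expSum]
  -- The frequency `(0, 0)` is split off: it produces exactly the product main term, and all other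
  -- frequencies obey Kloosterman's bound.
  rw [tsum_hyperbola_eq X hp hr, ← mul_sub, ← Finset.sum_product',
    ← Finset.sum_erase_add _ _ (Finset.mem_product.2 ⟨Finset.mem_univ (0 : ZMod Q × ZMod Q).1,
      Finset.mem_univ (0 : ZMod Q × ZMod Q).2⟩)]
  simp only [Prod.fst_zero, Prod.snd_zero, hT0, h00, h00', add_sub_cancel_right]
  have hterm : ∀ x ∈ ((Finset.univ : Finset (ZMod Q)) ×ˢ (Finset.univ : Finset (ZMod Q))).erase 0,
      ‖expSum X (-x.1) (-x.2) * (seqFourier p x.1 * seqFourier r x.2)‖ ≤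
        K ^ (1 / 4 : ℝ) * τ ^ (3 / 4 : ℝ) * (B * Q) ^ 2 *
          ((height x.1 : ℝ) ^ (-(7 / 4) : ℝ) * (height x.2 : ℝ) ^ (-(7 / 4) : ℝ)) := by
    intro x hx
    rw [norm_mul, norm_mul]
    -- The exponent is `1/4 - 2`: growth `1/4` from Kloosterman's bound against decay `2` of the
    -- transforms. It lies below `-1`, so the sum over frequencies is bounded independently of `Q`.
    have e : ∀ h : ZMod Q, (height h : ℝ) ^ (-(7 / 4) : ℝ) =
        (height h : ℝ) ^ (1 / 4 : ℝ) / (height h : ℝ) ^ 2 := by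
      intro h
      have : (0 : ℝ) < height h := by exact_mod_cast one_le_height h
      rw [← Real.rpow_natCast, ← Real.rpow_sub this]
      norm_num
    calc _ ≤ (K ^ (1 / 4 : ℝ) * τ ^ (3 / 4 : ℝ) *
          ((height x.1 : ℝ) ^ (1 / 4 : ℝ) * (height x.2 : ℝ) ^ (1 / 4 : ℝ))) *
          (B * Q / (height x.1 : ℝ) ^ 2 * (B * Q / (height x.2 : ℝ) ^ 2)) := by
          have b1 := norm_seqFourier_le_height hp hp1 hp2 x.1
          have b2 := norm_seqFourier_le_height hr hr1 hr2 x.2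
          have b3 := hT x.1 x.2 (Finset.ne_of_mem_erase hx)
          have b4 := (norm_nonneg _).trans b1
          exact mul_le_mul b3 (mul_le_mul b1 b2 (norm_nonneg _) b4) (by positivity) (by positivity)
      _ = _ := by rw [e, e]; ring
  rw [norm_mul, norm_inv, norm_pow, Complex.norm_natCast]
  calc _ ≤ ((Q : ℝ) ^ 2)⁻¹ * ∑ x ∈ (Finset.univ : Finset (ZMod Q)) ×ˢ (Finset.univ : Finset (ZMod Q)),
        K ^ (1 / 4 : ℝ) * τ ^ (3 / 4 : ℝ) * (B * Q) ^ 2 *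
          ((height x.1 : ℝ) ^ (-(7 / 4) : ℝ) * (height x.2 : ℝ) ^ (-(7 / 4) : ℝ)) := by
        gcongr
        refine (norm_sum_le_of_le _ hterm).trans
          (Finset.sum_le_sum_of_subset_of_nonneg (Finset.erase_subset _ _) fun _ _ _ => ?_)
        positivity
    _ = K ^ (1 / 4 : ℝ) * τ ^ (3 / 4 : ℝ) * B ^ 2 *
          (∑ h : ZMod Q, (height h : ℝ) ^ (-(7 / 4) : ℝ)) ^ 2 := by
        rw [← Finset.mul_sum, Finset.sum_product]
        simp only [← Finset.mul_sum, ← Finset.sum_mul]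
        field_simp
    _ ≤ K ^ (1 / 4 : ℝ) * τ ^ (3 / 4 : ℝ) * B ^ 2 * heightConst ^ 2 := by
        gcongr
        exact sum_height_le
    _ = _ := by ring

end FourierExpansion

/-! ### Derivative bounds for `w⁻² |w|^(-2ε)`. -/

section RegularizedInverseSquare

/-- Hecke's regularization `w⁻² |w|^(-2ε)` of `w⁻²`. -/
def regInv (ε w : ℂ) : ℂ := (w ^ 2)⁻¹ * cexp (-2 * ε * (Real.log ‖w‖ : ℝ))

lemma regInv_mul {ε a b : ℂ} (ha : a ≠ 0) (hb : b ≠ 0) :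
    regInv ε (a * b) = regInv ε a * regInv ε b := by
  have h : Real.log ‖a * b‖ = Real.log ‖a‖ + Real.log ‖b‖ := by
    rw [norm_mul, Real.log_mul (norm_ne_zero_iff.2 ha) (norm_ne_zero_iff.2 hb)]
  rw [regInv, regInv, regInv, h, mul_pow, mul_inv, Complex.ofReal_add, mul_add, Complex.exp_add]
  ring

lemma norm_regInv (ε w : ℂ) :
    ‖regInv ε w‖ = (‖w‖ ^ 2)⁻¹ * Real.exp (-2 * ε.re * Real.log ‖w‖) := by
  rw [regInv, norm_mul, norm_inv, norm_pow, Complex.norm_exp]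
  congr 2
  simp

lemma norm_regInv_eq_rpow (ε : ℂ) {w : ℂ} (hw : w ≠ 0) :
    ‖regInv ε w‖ = ‖w‖ ^ (-2 - 2 * ε.re) := by
  have h := norm_pos_iff.2 hw
  rw [norm_regInv, Real.rpow_sub h, Real.rpow_neg h.le, div_eq_mul_inv,
    ← Real.rpow_neg h.le (2 * ε.re), Real.rpow_def_of_pos h (-(2 * ε.re))]
  congr 2
  · norm_cast
  · ring

/-- Since `y₀ ≤ 1` and `2 Re ε ≤ 1/2`, the factor `|w|^(-2 Re ε)` is at most `y₀^(-2 Re ε) ≤ y₀⁻¹`.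
All later estimates are uniform in `ε` through this bound. -/
lemma norm_regInv_le {ε w : ℂ} {y₀ : ℝ} (hε : 0 ≤ ε.re) (hε' : ‖ε‖ ≤ 1 / 4) (hy₀ : 0 < y₀)
    (hy₁ : y₀ ≤ 1) (hw : y₀ ≤ ‖w‖) : ‖regInv ε w‖ ≤ y₀⁻¹ * (‖w‖ ^ 2)⁻¹ := by
  rw [norm_regInv, mul_comm]
  gcongr
  have hre : ε.re ≤ 1 / 4 := (Complex.re_le_norm ε).trans hε'
  have h1 : Real.log y₀ ≤ Real.log ‖w‖ := Real.log_le_log hy₀ hw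
  have h2 : Real.log y₀ ≤ 0 := Real.log_nonpos hy₀.le hy₁
  rw [← Real.exp_log (inv_pos.2 hy₀), Real.log_inv, Real.exp_le_exp]
  nlinarith

lemma continuous_regInv_left (w : ℂ) : Continuous fun ε => regInv ε w := by
  unfold regInv
  fun_prop

/-- The logarithmic derivative of `regInv ε` in the direction `v`, where `u = v / w`. -/
def regInvLogDeriv (ε u : ℂ) : ℂ := -2 * u - 2 * ε * (u.re : ℝ)

lemma norm_regInvLogDeriv_le {ε : ℂ} (hε' : ‖ε‖ ≤ 1 / 4) (u : ℂ) :
    ‖regInvLogDeriv ε u‖ ≤ 5 / 2 * ‖u‖ := by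
  rw [regInvLogDeriv]
  refine (norm_sub_le _ _).trans ?_
  rw [norm_mul, norm_mul, norm_mul, norm_neg, Complex.norm_ofNat, Complex.norm_real]
  have h1 : ‖u.re‖ ≤ ‖u‖ := Complex.abs_re_le_norm u
  have h2 : ‖ε‖ * ‖u.re‖ ≤ 1 / 4 * ‖u‖ := mul_le_mul hε' h1 (norm_nonneg _) (by norm_num)
  linarith

lemma hasDerivAt_log_norm {w v : ℂ} {t : ℝ} (h : w + t * v ≠ 0) :
    HasDerivAt (fun t : ℝ => Real.log ‖w + t * v‖) (v / (w + t * v)).re t := by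
  have e : (fun t : ℝ => Real.log ‖w + t * v‖) =
      fun t : ℝ => 1 / 2 * Real.log ((w.re + t * v.re) ^ 2 + (w.im + t * v.im) ^ 2) := by
    funext t
    have : ‖w + t * v‖ ^ 2 = (w.re + t * v.re) ^ 2 + (w.im + t * v.im) ^ 2 := by
      rw [Complex.sq_norm, Complex.normSq_apply]
      simp
      ring
    rw [← this, Real.log_pow]
    push_cast
    ring
  have hn : (w.re + t * v.re) ^ 2 + (w.im + t * v.im) ^ 2 ≠ 0 := by
    intro h0
    apply h
    have h1 : w.re + t * v.re = 0 := by nlinarith [sq_nonneg (w.re + t * v.re), sq_nonneg (w.im + t * v.im)]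
    have h2 : w.im + t * v.im = 0 := by nlinarith [sq_nonneg (w.re + t * v.re), sq_nonneg (w.im + t * v.im)]
    apply Complex.ext <;> simp [h1, h2]
  have hd : ∀ a b : ℝ, HasDerivAt (fun t : ℝ => (a + t * b) ^ 2) (2 * (a + t * b) * b) t := by
    intro a b
    exact ((((hasDerivAt_id t).mul_const b).const_add a).fun_pow 2).congr_deriv (by simp)
  rw [e]
  refine ((((hd w.re v.re).fun_add (hd w.im v.im)).log hn).const_mul (1 / 2)).congr_deriv ?_
  rw [Complex.div_re, Complex.normSq_apply]
  simp only [Complex.add_re, Complex.add_im, Complex.mul_re, Complex.mul_im, Complex.ofReal_re,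
    Complex.ofReal_im, zero_mul, sub_zero, add_zero]
  have hn' : (w.re + t * v.re) * (w.re + t * v.re) + (w.im + t * v.im) * (w.im + t * v.im) ≠ 0 := by
    convert hn using 1; ring
  field_simp

lemma hasDerivAt_div_line {w v : ℂ} {t : ℝ} (h : w + t * v ≠ 0) :
    HasDerivAt (fun t : ℝ => v / (w + t * v)) (-(v / (w + t * v)) ^ 2) t := by
  have h1 : HasDerivAt (fun t : ℝ => w + (t : ℂ) * v) v t := by
    simpa using ((Complex.ofRealCLM.hasDerivAt (x := t)).mul_const v).const_add w
  refine ((hasDerivAt_const t v).fun_div h1 h).congr_deriv ?_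
  field_simp
  ring

lemma hasDerivAt_regInv (ε : ℂ) {w v : ℂ} {t : ℝ} (h : w + t * v ≠ 0) :
    HasDerivAt (fun t : ℝ => regInv ε (w + t * v))
      (regInv ε (w + t * v) * regInvLogDeriv ε (v / (w + t * v))) t := by
  have h1 : HasDerivAt (fun t : ℝ => w + (t : ℂ) * v) v t := by
    simpa using ((Complex.ofRealCLM.hasDerivAt (x := t)).mul_const v).const_add w
  have h2 := (h1.fun_pow 2).fun_inv (pow_ne_zero 2 h)
  have h3 := ((hasDerivAt_log_norm h).ofReal_comp.const_mul (-2 * ε)).cexp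
  refine (h2.fun_mul h3).congr_deriv ?_
  simp only [regInv, regInvLogDeriv]
  field_simp
  push_cast
  ring

lemma hasDerivAt_regInv_deriv (ε : ℂ) {w v : ℂ} {t : ℝ} (h : w + t * v ≠ 0) :
    HasDerivAt (fun t : ℝ => regInv ε (w + t * v) * regInvLogDeriv ε (v / (w + t * v)))
      (regInv ε (w + t * v) * (regInvLogDeriv ε (v / (w + t * v)) ^ 2 +
        regInvLogDeriv ε (-(v / (w + t * v)) ^ 2))) t := by
  have h1 := hasDerivAt_regInv ε h
  have h2 := hasDerivAt_div_line h
  have h3 : HasDerivAt (fun t : ℝ => (v / (w + t * v)).re) (-(v / (w + t * v)) ^ 2).re t := by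
    exact (Complex.reCLM.hasFDerivAt.comp_hasDerivAt t h2)
  have h4 : HasDerivAt (fun t : ℝ => regInvLogDeriv ε (v / (w + t * v)))
      (regInvLogDeriv ε (-(v / (w + t * v)) ^ 2)) t := by
    unfold regInvLogDeriv
    exact (h2.const_mul (-2)).fun_sub (h3.ofReal_comp.const_mul (2 * ε))
  refine (h1.fun_mul h4).congr_deriv ?_
  ring

lemma norm_regInv_deriv_le {ε : ℂ} {y₀ : ℝ} (hε : 0 ≤ ε.re) (hε' : ‖ε‖ ≤ 1 / 4)
    (hy₀ : 0 < y₀) (hy₁ : y₀ ≤ 1) {w : ℂ} (hw : y₀ ≤ ‖w‖) (v : ℂ) :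
    ‖regInv ε w * regInvLogDeriv ε (v / w)‖ ≤ 5 / 2 * y₀⁻¹ * ‖v‖ * (‖w‖ ^ 3)⁻¹ := by
  have h0 : 0 < ‖w‖ := hy₀.trans_le hw
  rw [norm_mul]
  calc _ ≤ (y₀⁻¹ * (‖w‖ ^ 2)⁻¹) * (5 / 2 * ‖v / w‖) :=
        mul_le_mul (norm_regInv_le hε hε' hy₀ hy₁ hw) (norm_regInvLogDeriv_le hε' _)
          (norm_nonneg _) (by positivity)
    _ = _ := by rw [norm_div]; field_simp

lemma norm_regInv_deriv_two_le {ε : ℂ} {y₀ : ℝ} (hε : 0 ≤ ε.re) (hε' : ‖ε‖ ≤ 1 / 4)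
    (hy₀ : 0 < y₀) (hy₁ : y₀ ≤ 1) {w : ℂ} (hw : y₀ ≤ ‖w‖) (v : ℂ) :
    ‖regInv ε w * (regInvLogDeriv ε (v / w) ^ 2 + regInvLogDeriv ε (-(v / w) ^ 2))‖ ≤
      9 * y₀⁻¹ * ‖v‖ ^ 2 * (‖w‖ ^ 4)⁻¹ := by
  have h0 : 0 < ‖w‖ := hy₀.trans_le hw
  rw [norm_mul]
  -- The constant: `(5/2)² + 5/2 ≤ 9`.
  have h1 : ‖regInvLogDeriv ε (v / w) ^ 2 + regInvLogDeriv ε (-(v / w) ^ 2)‖ ≤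
      9 * ‖v / w‖ ^ 2 := by
    refine (norm_add_le _ _).trans ?_
    rw [norm_pow]
    have h2 := norm_regInvLogDeriv_le hε' (v / w)
    have h3 := norm_regInvLogDeriv_le hε' (-(v / w) ^ 2)
    rw [norm_neg, norm_pow] at h3
    have h4 := pow_le_pow_left₀ (norm_nonneg _) h2 2
    nlinarith [sq_nonneg ‖v / w‖]
  calc _ ≤ (y₀⁻¹ * (‖w‖ ^ 2)⁻¹) * (9 * ‖v / w‖ ^ 2) :=
        mul_le_mul (norm_regInv_le hε hε' hy₀ hy₁ hw) h1 (norm_nonneg _) (by positivity)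
    _ = _ := by rw [norm_div]; field_simp

lemma norm_sub_le_of_hasDerivAt {f f' : ℝ → ℂ} {a : ℝ} (hf : ∀ t, HasDerivAt f (f' t) t) {C : ℝ}
    (hC : ∀ t ∈ Set.Icc a (a + 1), ‖f' t‖ ≤ C) {s : ℝ} (hs : s ∈ Set.Icc a (a + 1)) :
    ‖f s - f a‖ ≤ C := by
  have hC0 : 0 ≤ C := (norm_nonneg _).trans (hC a ⟨le_rfl, by linarith⟩)
  refine (norm_image_sub_le_of_norm_deriv_le_segment' (f := f) (f' := f') (C := C)
    (fun x _ => (hf x).hasDerivWithinAt) (fun x hx => hC x ⟨hx.1, hx.2.le⟩) s hs).trans ?_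
  nlinarith [hs.1, hs.2]

/-- The mean value inequality is used twice, first for `t ↦ f t - f (t - 1)` and then for `f'` on
`[t - 1, t]`. -/
lemma norm_second_difference_le {f f' f'' : ℝ → ℂ} {a : ℝ} (hf : ∀ t, HasDerivAt f (f' t) t)
    (hf' : ∀ t, HasDerivAt f' (f'' t) t) {C : ℝ}
    (hC : ∀ t ∈ Set.Icc (a - 1) (a + 1), ‖f'' t‖ ≤ C) :
    ‖f (a + 1) - 2 * f a + f (a - 1)‖ ≤ C := by
  have h1 : ∀ t, HasDerivAt (fun t => f t - f (t - 1)) (f' t - f' (t - 1)) t := by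
    intro t
    have := (hf (t - 1)).scomp t ((hasDerivAt_id t).sub_const 1)
    simp only [id, one_smul] at this
    exact (hf t).fun_sub this
  have h2 := norm_sub_le_of_hasDerivAt (a := a) (s := a + 1) h1 (C := C) ?_ ⟨by linarith, le_rfl⟩
  · convert h2 using 2
    rw [add_sub_cancel_right]
    ring
  · intro t ht
    have := norm_sub_le_of_hasDerivAt (a := t - 1) (s := t) hf' (C := C) ?_
      ⟨by linarith, by linarith⟩
    · exact this
    · intro x hx
      exact hC x ⟨by linarith [hx.1, ht.1], by linarith [hx.2, ht.2]⟩

end RegularizedInverseSquare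

/-! ### Uniform bounds for `∑ |w + n/c|⁻²`. -/

section LatticeSums

lemma summable_inv_one_add_sq_int : Summable fun n : ℤ => (1 + (n : ℝ) ^ 2)⁻¹ := by
  have h1 : Summable fun n : ℤ => 1 / (n : ℝ) ^ 2 := Real.summable_one_div_int_pow.2 one_lt_two
  have h2 : Summable fun n : ℤ => if n = 0 then (1 : ℝ) else 0 := (hasSum_ite_eq 0 1).summable
  refine Summable.of_nonneg_of_le (fun _ => by positivity) (fun n => ?_) (h1.add h2)
  rcases eq_or_ne n 0 with rfl | hn
  · simp
  · have : (0 : ℝ) < (n : ℝ) ^ 2 := by positivity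
    simp only [hn, if_false, add_zero, one_div]
    gcongr
    linarith

/-- A bound for `∑ |w + n|⁻²` on `Im w ≥ y₀`. -/
def latticeConst (y₀ : ℝ) : ℝ := 3 / y₀ ^ 2 * ∑' n : ℤ, (1 + (n : ℝ) ^ 2)⁻¹

lemma latticeConst_nonneg (y₀ : ℝ) : 0 ≤ latticeConst y₀ :=
  mul_nonneg (by positivity) (tsum_nonneg fun _ => by positivity)

lemma inv_norm_add_int_sq_le {y₀ : ℝ} (hy₀ : 0 < y₀) (hy₁ : y₀ ≤ 1) {w : ℂ} (hw : y₀ ≤ w.im)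
    (hx : |w.re| ≤ 1) (t : ℝ) : (‖w + t‖ ^ 2)⁻¹ ≤ 3 / y₀ ^ 2 * (1 + t ^ 2)⁻¹ := by
  have e : ‖w + t‖ ^ 2 = (w.re + t) ^ 2 + w.im ^ 2 := by
    rw [Complex.sq_norm, Complex.normSq_apply]
    simp
    ring
  have hx2 : w.re ^ 2 ≤ 1 := by
    rw [← sq_abs]
    nlinarith [abs_nonneg w.re]
  have him : y₀ ^ 2 ≤ w.im ^ 2 := by gcongr
  -- With `x = Re w`, the difference of the two sides is `(2x + t)² + 2 - 2x²`, and `x² ≤ 1`.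
  have h1 : 1 + t ^ 2 ≤ 3 + 2 * (w.re + t) ^ 2 := by nlinarith [sq_nonneg (2 * w.re + t)]
  have h2 : y₀ ^ 2 * (1 + t ^ 2) ≤ 3 * ‖w + t‖ ^ 2 := by
    have hy2 : y₀ ^ 2 ≤ 1 := by nlinarith
    rw [e]
    calc y₀ ^ 2 * (1 + t ^ 2) ≤ y₀ ^ 2 * (3 + 2 * (w.re + t) ^ 2) := by gcongr
      _ ≤ 3 * y₀ ^ 2 + 3 * (w.re + t) ^ 2 := by nlinarith [sq_nonneg (w.re + t)]
      _ ≤ _ := by linarith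
  have h3 : 0 < ‖w + t‖ ^ 2 := by rw [e]; nlinarith [sq_nonneg (w.re + t), pow_pos hy₀ 2]
  have h4 : 3 / y₀ ^ 2 * (1 + t ^ 2)⁻¹ = 3 / (y₀ ^ 2 * (1 + t ^ 2)) := by field_simp
  rw [h4, ← one_div, div_le_div_iff₀ h3 (by positivity)]
  linarith

/-- Translating `n` by the integer part of `Re w` reduces to `0 ≤ Re w < 1`, so the bound depends
only on `y₀`. -/
lemma latticeSum_one {y₀ : ℝ} (hy₀ : 0 < y₀) (hy₁ : y₀ ≤ 1) {w : ℂ} (hw : y₀ ≤ w.im) :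
    Summable (fun n : ℤ => (‖w + n‖ ^ 2)⁻¹) ∧ ∑' n : ℤ, (‖w + n‖ ^ 2)⁻¹ ≤ latticeConst y₀ := by
  set k : ℤ := ⌊w.re⌋ with hk
  set w' : ℂ := w - k with hw'
  have him : y₀ ≤ w'.im := by simpa [hw'] using hw
  have hre : |w'.re| ≤ 1 := by
    have : w'.re = Int.fract w.re := by simp [hw', hk]
    rw [this, abs_of_nonneg (Int.fract_nonneg _)]
    exact (Int.fract_lt_one _).le
  have hb : ∀ n : ℤ, (‖w' + n‖ ^ 2)⁻¹ ≤ 3 / y₀ ^ 2 * (1 + (n : ℝ) ^ 2)⁻¹ := fun n => by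
    simpa using inv_norm_add_int_sq_le hy₀ hy₁ him hre n
  have hs : Summable fun n : ℤ => (‖w' + n‖ ^ 2)⁻¹ :=
    Summable.of_nonneg_of_le (fun _ => by positivity) hb (summable_inv_one_add_sq_int.mul_left _)
  have e : (fun n : ℤ => (‖w + n‖ ^ 2)⁻¹) =
      (fun n : ℤ => (‖w' + n‖ ^ 2)⁻¹) ∘ Equiv.addRight k := by
    funext n
    simp [hw']
  constructor
  · rw [e]
    exact (Equiv.addRight k).summable_iff.2 hs
  · rw [e]
    calc _ = ∑' n : ℤ, (‖w' + n‖ ^ 2)⁻¹ := (Equiv.addRight k).tsum_eq _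
      _ ≤ ∑' n : ℤ, 3 / y₀ ^ 2 * (1 + (n : ℝ) ^ 2)⁻¹ :=
        hs.tsum_le_tsum hb (summable_inv_one_add_sq_int.mul_left _)
      _ = _ := tsum_mul_left

/-- Division with remainder `n = l q + j` splits `(1/q)ℤ` into `q` translates of `ℤ`, each
contributing at most the previous constant. -/
lemma latticeSum_natCast {y₀ : ℝ} (hy₀ : 0 < y₀) (hy₁ : y₀ ≤ 1) {w : ℂ} (hw : y₀ ≤ w.im) (q : ℕ)
    [NeZero q] :
    Summable (fun n : ℤ => (‖w + n / q‖ ^ 2)⁻¹) ∧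
      ∑' n : ℤ, (‖w + n / q‖ ^ 2)⁻¹ ≤ latticeConst y₀ * q := by
  set F : Fin q × ℤ → ℝ := fun x => (‖(w + (x.1 : ℕ) / q) + x.2‖ ^ 2)⁻¹ with hF
  have hq : (q : ℂ) ≠ 0 := NeZero.ne _
  have him : ∀ j : Fin q, y₀ ≤ (w + (j : ℕ) / q : ℂ).im := by
    intro j
    have : (w + (j : ℕ) / q : ℂ).im = w.im := by
      have : ((j : ℕ) / q : ℂ) = (((j : ℕ) / q : ℝ) : ℂ) := by push_cast; rfl
      rw [this, Complex.add_im, Complex.ofReal_im, add_zero]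
    rwa [this]
  have hs : Summable F := by
    rw [summable_prod_of_nonneg fun _ => by positivity]
    exact ⟨fun j => (latticeSum_one hy₀ hy₁ (him j)).1, Summable.of_finite⟩
  set E : Fin q × ℤ ≃ ℤ := (Equiv.prodComm _ _).trans (Int.divModEquiv q).symm with hE
  have e : (fun n : ℤ => (‖w + n / q‖ ^ 2)⁻¹) ∘ E = F := by
    funext ⟨j, l⟩
    have : E (j, l) = l * q + (j : ℕ) := rfl
    simp only [hF, Function.comp, this]
    congr 3
    push_cast
    field_simp
    ring
  constructor
  · rwa [← E.summable_iff, e]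
  · calc _ = ∑' x, F x := by rw [← e]; exact (E.tsum_eq _).symm
      _ = ∑' j : Fin q, ∑' n : ℤ, F (j, n) := hs.tsum_prod
      _ = ∑ j : Fin q, ∑' n : ℤ, F (j, n) := tsum_fintype _
      _ ≤ ∑ j : Fin q, latticeConst y₀ :=
          Finset.sum_le_sum fun j _ => (latticeSum_one hy₀ hy₁ (him j)).2
      _ = _ := by simp [mul_comm]

lemma latticeSum {y₀ : ℝ} (hy₀ : 0 < y₀) (hy₁ : y₀ ≤ 1) {w : ℂ} (hw : y₀ ≤ w.im) {c : ℤ}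
    (hc : c ≠ 0) :
    Summable (fun n : ℤ => (‖w + n / c‖ ^ 2)⁻¹) ∧
      ∑' n : ℤ, (‖w + n / c‖ ^ 2)⁻¹ ≤ latticeConst y₀ * |(c : ℝ)| := by
  have : NeZero c.natAbs := ⟨Int.natAbs_ne_zero.2 hc⟩
  obtain ⟨h1, h2⟩ := latticeSum_natCast hy₀ hy₁ hw c.natAbs
  have hcast : (c.natAbs : ℝ) = |(c : ℝ)| := by rw [Nat.cast_natAbs, Int.cast_abs]
  rw [hcast] at h2
  rcases lt_or_gt_of_ne hc with h | h
  · have e : (fun n : ℤ => (‖w + n / c‖ ^ 2)⁻¹) =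
        (fun n : ℤ => (‖w + n / (c.natAbs : ℂ)‖ ^ 2)⁻¹) ∘ Equiv.neg ℤ := by
      funext n
      have h3 : (c : ℂ) = -(c.natAbs : ℂ) := by
        have : c = -(c.natAbs : ℤ) := by omega
        conv_lhs => rw [this]
        rw [Int.cast_neg, Int.cast_natCast]
      simp only [Function.comp, Equiv.neg_apply]
      rw [h3]
      push_cast
      rw [div_neg, neg_div]
    rw [e]
    exact ⟨(Equiv.neg ℤ).summable_iff.2 h1, ((Equiv.neg ℤ).tsum_eq _).trans_le h2⟩
  · have h3 : (c : ℂ) = (c.natAbs : ℂ) := by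
      have : c = (c.natAbs : ℤ) := by omega
      conv_lhs => rw [this]
      rw [Int.cast_natCast]
    rw [h3]
    exact ⟨h1, h2⟩

end LatticeSums

/-! ### The sequences `n ↦ regInv ε (w + n/c)` and the mean value on a horizontal line. -/

section RegularizedSequences

/-- The range of the regularization parameter in which estimates are uniform. -/
structure IsSmall (ε : ℂ) : Prop where
  re_nonneg : 0 ≤ ε.re
  norm_le : ‖ε‖ ≤ 1 / 4

lemma measurable_regInv (ε : ℂ) : Measurable (regInv ε) := by
  unfold regInv
  fun_prop

lemma measurable_regInvLogDeriv (ε : ℂ) : Measurable (regInvLogDeriv ε) := by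
  unfold regInvLogDeriv
  fun_prop

/-- The mean value `∫ regInv ε (t + i y) dt` over a horizontal line. -/
def lineIntegral (ε : ℂ) (y : ℝ) : ℂ := ∫ t : ℝ, regInv ε (t + y * I)

lemma im_le_norm_add_real (w : ℂ) (t : ℝ) : w.im ≤ ‖w + t‖ := by
  have : (w + t).im = w.im := by simp
  rw [← this]
  exact Complex.im_le_norm _

lemma integrable_inv_norm_sq {y₀ y : ℝ} (hy₀ : 0 < y₀) (hy₁ : y₀ ≤ 1) (hy : y₀ ≤ y) :
    Integrable fun t : ℝ => (‖(y * I : ℂ) + t‖ ^ 2)⁻¹ := by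
  refine (integrable_inv_one_add_sq.const_mul (3 / y₀ ^ 2)).mono' (by fun_prop)
    (ae_of_all _ fun t => ?_)
  rw [Real.norm_of_nonneg (by positivity)]
  exact inv_norm_add_int_sq_le hy₀ hy₁ (by simpa using hy) (by simp) t

lemma integral_inv_norm_sq_le {y₀ y : ℝ} (hy₀ : 0 < y₀) (hy₁ : y₀ ≤ 1) (hy : y₀ ≤ y) :
    ∫ t : ℝ, (‖(y * I : ℂ) + t‖ ^ 2)⁻¹ ≤ 3 / y₀ ^ 2 * Real.pi := by
  rw [← integral_univ_inv_one_add_sq, ← integral_const_mul]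
  exact integral_mono (integrable_inv_norm_sq hy₀ hy₁ hy)
    (integrable_inv_one_add_sq.const_mul _) fun t =>
      inv_norm_add_int_sq_le hy₀ hy₁ (by simpa using hy) (by simp) t

variable {ε : ℂ} {y₀ : ℝ}

lemma integrable_regInv_line (hε : IsSmall ε) (hy₀ : 0 < y₀) (hy₁ : y₀ ≤ 1) {y : ℝ}
    (hy : y₀ ≤ y) : Integrable fun t : ℝ => regInv ε ((y * I : ℂ) + t) := by
  refine ((integrable_inv_norm_sq hy₀ hy₁ hy).const_mul y₀⁻¹).mono' ?_ (ae_of_all _ fun t => ?_)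
  · exact ((measurable_regInv ε).comp (by fun_prop)).aestronglyMeasurable
  · exact norm_regInv_le hε.1 hε.2 hy₀ hy₁ (le_trans (by simpa using hy)
      (im_le_norm_add_real (y * I) t))

/-- At `ε = 0` the integral of `(t + iy)⁻²` vanishes, its primitive being `-(t + iy)⁻¹`. In general
the derivative of `regInv ε w * w` along the line is `-regInv ε w` plus a term of size `|ε| |w|⁻²`,
and the integral of the derivative is zero. This factor `ε` is what defeats the pole of the
Dirichlet series over `c`. -/
lemma norm_lineIntegral_le (hε : IsSmall ε) (hy₀ : 0 < y₀) (hy₁ : y₀ ≤ 1) {y : ℝ}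
    (hy : y₀ ≤ y) : ‖lineIntegral ε y‖ ≤ 6 * Real.pi / y₀ ^ 3 * ‖ε‖ := by
  set w : ℂ := y * I with hw
  have hn : ∀ t : ℝ, y₀ ≤ ‖w + t‖ := fun t =>
    le_trans (by simpa [hw] using hy) (im_le_norm_add_real w t)
  have h0 : ∀ t : ℝ, w + t ≠ 0 := fun t => norm_pos_iff.1 (hy₀.trans_le (hn t))
  set φ' : ℝ → ℂ := fun t => regInv ε (w + t) * regInvLogDeriv ε (1 / (w + t)) * (w + t) +
    regInv ε (w + t) with hφ'
  have hreg : Integrable fun t : ℝ => regInv ε (w + t) := integrable_regInv_line hε hy₀ hy₁ hy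
  have hd : ∀ t : ℝ, HasDerivAt (fun t : ℝ => regInv ε (w + t) * (w + t)) (φ' t) t := by
    intro t
    have h1 := hasDerivAt_regInv ε (w := w) (v := 1) (t := t) (by simpa using h0 t)
    simp only [mul_one] at h1
    have h2 : HasDerivAt (fun t : ℝ => w + (t : ℂ)) 1 t :=
      (Complex.ofRealCLM.hasDerivAt (x := t)).const_add w
    refine (h1.fun_mul h2).congr_deriv ?_
    simp [hφ']
  have e : ∀ t : ℝ, φ' t + regInv ε (w + t) =
      regInv ε (w + t) * (-2 * ε * ((w + t) * ((1 / (w + t)).re : ℝ))) := by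
    intro t
    have := h0 t
    simp only [hφ', regInvLogDeriv]
    field_simp
    ring
  have hb : ∀ t : ℝ, ‖φ' t + regInv ε (w + t)‖ ≤
      2 * ‖ε‖ * (y₀⁻¹ * (‖w + t‖ ^ 2)⁻¹) := by
    intro t
    have h1 : ‖(w + t) * ((1 / (w + t)).re : ℂ)‖ ≤ 1 := by
      rw [norm_mul, Complex.norm_real]
      calc _ ≤ ‖w + t‖ * ‖1 / (w + t)‖ := by
            gcongr
            exact Complex.abs_re_le_norm _
        _ = 1 := by rw [norm_div, norm_one]; field_simp [norm_ne_zero_iff.2 (h0 t)]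
    rw [e, norm_mul, norm_mul, norm_mul, norm_neg, Complex.norm_ofNat]
    calc _ ≤ (y₀⁻¹ * (‖w + t‖ ^ 2)⁻¹) * (2 * ‖ε‖ * 1) := by
          gcongr
          exact norm_regInv_le hε.1 hε.2 hy₀ hy₁ (hn t)
      _ = _ := by ring
  have hint : Integrable fun t : ℝ => 2 * ‖ε‖ * (y₀⁻¹ * (‖w + t‖ ^ 2)⁻¹) :=
    ((integrable_inv_norm_sq hy₀ hy₁ hy).const_mul _).const_mul _
  have hsum : Integrable fun t : ℝ => φ' t + regInv ε (w + t) := by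
    refine hint.mono' ?_ (ae_of_all _ hb)
    have m1 : Measurable fun t : ℝ => w + (t : ℂ) := by fun_prop
    have m2 := (measurable_regInv ε).comp m1
    have m3 := (measurable_regInvLogDeriv ε).comp (measurable_const.div m1 : Measurable fun t : ℝ =>
      (1 : ℂ) / (w + t))
    exact (((m2.mul m3).mul m1).add m2 |>.add m2).aestronglyMeasurable
  have hφint : Integrable φ' := by
    have := hsum.sub hreg
    refine this.congr (ae_of_all _ fun t => ?_)
    simp
  -- The boundary terms vanish at both ends, because `regInv ε w * w` is `O(|w|⁻¹)`.
  have hlim : ∀ l : Filter ℝ, Tendsto (fun t : ℝ => |t|) l atTop →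
      Tendsto (fun t : ℝ => regInv ε (w + t) * (w + t)) l (𝓝 0) := by
    intro l hl
    refine squeeze_zero_norm' (a := fun t => y₀⁻¹ * |t|⁻¹)
      ((hl.eventually (eventually_gt_atTop 0)).mono fun t h2 => ?_) ?_
    · rw [norm_mul]
      have h1 : |t| ≤ ‖w + t‖ := by
        have : (w + t).re = t := by simp [hw]
        conv_lhs => rw [← this]
        exact Complex.abs_re_le_norm _
      have h3 : 0 < ‖w + t‖ := h2.trans_le h1
      calc _ ≤ (y₀⁻¹ * (‖w + t‖ ^ 2)⁻¹) * ‖w + t‖ := by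
            gcongr
            exact norm_regInv_le hε.1 hε.2 hy₀ hy₁ (hn t)
        _ = y₀⁻¹ * ‖w + t‖⁻¹ := by field_simp
        _ ≤ _ := by gcongr
    · simpa using (tendsto_inv_atTop_zero.comp hl).const_mul y₀⁻¹
  have hzero : ∫ t, φ' t = 0 := by
    have := integral_of_hasDerivAt_of_tendsto hd hφint (hlim _ tendsto_abs_atBot_atTop)
      (hlim _ tendsto_abs_atTop_atTop)
    simpa using this
  have hα : lineIntegral ε y = ∫ t : ℝ, (φ' t + regInv ε (w + t)) := by
    rw [integral_add hφint hreg, hzero, zero_add, lineIntegral]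
    simp only [add_comm]
    rfl
  rw [hα]
  refine (norm_integral_le_of_norm_le hint (ae_of_all _ hb)).trans ?_
  rw [integral_const_mul, integral_const_mul]
  calc _ ≤ 2 * ‖ε‖ * (y₀⁻¹ * (3 / y₀ ^ 2 * Real.pi)) := by
        gcongr
        exact integral_inv_norm_sq_le hy₀ hy₁ hy
    _ = _ := by field_simp; ring

/-- As `|c| ≥ 1`, moving `t` by at most `1` moves the point by at most `1 ≤ y₀⁻¹ ‖w + t/c‖`. Bounds
for derivatives on an interval can thus be expressed by the value at an integer and summed. -/
lemma norm_le_of_abs_sub_le_one (hy₀ : 0 < y₀) {w : ℂ} (hw : y₀ ≤ w.im) {c : ℤ} (hc : c ≠ 0)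
    {s t : ℝ} (hst : |s - t| ≤ 1) :
    ‖w + s / c‖ ≤ (1 + y₀⁻¹) * ‖w + t / c‖ := by
  have hc1 : (1 : ℝ) ≤ |(c : ℝ)| := by exact_mod_cast Int.one_le_abs hc
  have h1 : y₀ ≤ ‖w + t / c‖ := by
    have := im_le_norm_add_real w (t / c)
    push_cast at this
    exact hw.trans this
  have h2 : ‖((s - t : ℝ) : ℂ) / c‖ ≤ 1 := by
    rw [norm_div, Complex.norm_real, Complex.norm_intCast, Real.norm_eq_abs]
    exact div_le_one_of_le₀ (hst.trans hc1) (abs_nonneg _)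
  have h3 : 1 ≤ y₀⁻¹ * ‖w + t / c‖ := by
    rw [← inv_mul_cancel₀ hy₀.ne']
    gcongr
  calc ‖w + s / c‖ = ‖(w + t / c) + ((s - t : ℝ) : ℂ) / c‖ := by
        congr 1
        push_cast
        ring
    _ ≤ ‖w + t / c‖ + 1 := (norm_add_le _ _).trans (by gcongr)
    _ ≤ _ := by linarith

/-- The sequence `n ↦ regInv ε (w + n / c)`. -/
def regSeq (ε w : ℂ) (c n : ℤ) : ℂ := regInv ε (w + n / c)

lemma le_norm_add_div (w : ℂ) (hw : y₀ ≤ w.im) (t : ℝ) (c : ℤ) : y₀ ≤ ‖w + t / c‖ := by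
  have := im_le_norm_add_real w (t / c)
  push_cast at this
  exact hw.trans this

lemma norm_regSeq_le (hε : IsSmall ε) (hy₀ : 0 < y₀) (hy₁ : y₀ ≤ 1) {w : ℂ} (hw : y₀ ≤ w.im)
    (c n : ℤ) : ‖regSeq ε w c n‖ ≤ y₀⁻¹ * (‖w + n / c‖ ^ 2)⁻¹ :=
  norm_regInv_le hε.1 hε.2 hy₀ hy₁ (by simpa using le_norm_add_div w hw n c)

lemma hasDerivAt_regInv_div (ε : ℂ) (hy₀ : 0 < y₀) {w : ℂ} (hw : y₀ ≤ w.im) (c : ℤ) (t : ℝ) :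
    HasDerivAt (fun t : ℝ => regInv ε (w + t / c))
      (regInv ε (w + t / c) * regInvLogDeriv ε ((c : ℂ)⁻¹ / (w + t / c))) t := by
  have h := norm_pos_iff.1 (hy₀.trans_le (le_norm_add_div w hw t c))
  rw [div_eq_mul_inv] at h
  simpa only [div_eq_mul_inv] using hasDerivAt_regInv ε h

lemma hasDerivAt_regInv_div_deriv (ε : ℂ) (hy₀ : 0 < y₀) {w : ℂ} (hw : y₀ ≤ w.im) (c : ℤ)
    (t : ℝ) : HasDerivAt
      (fun t : ℝ => regInv ε (w + t / c) * regInvLogDeriv ε ((c : ℂ)⁻¹ / (w + t / c)))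
      (regInv ε (w + t / c) * (regInvLogDeriv ε ((c : ℂ)⁻¹ / (w + t / c)) ^ 2 +
        regInvLogDeriv ε (-((c : ℂ)⁻¹ / (w + t / c)) ^ 2))) t := by
  have h := norm_pos_iff.1 (hy₀.trans_le (le_norm_add_div w hw t c))
  rw [div_eq_mul_inv] at h
  have := hasDerivAt_regInv_deriv ε h
  simp only [← div_eq_mul_inv (_ : ℂ) (c : ℂ)] at this
  exact this

lemma inv_norm_sq_le_of_abs_sub_le_one (hy₀ : 0 < y₀) {w : ℂ} (hw : y₀ ≤ w.im) {c : ℤ}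
    (hc : c ≠ 0) {s t : ℝ} (hst : |s - t| ≤ 1) :
    (‖w + t / c‖ ^ 2)⁻¹ ≤ (1 + y₀⁻¹) ^ 2 * (‖w + s / c‖ ^ 2)⁻¹ := by
  have h0 := hy₀.trans_le (le_norm_add_div w hw t c)
  have h1 := hy₀.trans_le (le_norm_add_div w hw s c)
  have h2 := pow_le_pow_left₀ h1.le (norm_le_of_abs_sub_le_one hy₀ hw hc hst) 2
  rw [mul_pow] at h2
  rw [← div_eq_mul_inv, le_div_iff₀ (by positivity), inv_mul_le_iff₀ (by positivity)]
  linarith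

/-- Two derivatives in the index bring `|c|⁻²`. Of the four inverse powers of `‖w + t/c‖`, two are
spent on `y₀` and two are kept for summation over `n`. -/
lemma norm_secondDiff_regSeq_le (hε : IsSmall ε) (hy₀ : 0 < y₀) (hy₁ : y₀ ≤ 1) {w : ℂ}
    (hw : y₀ ≤ w.im) {c : ℤ} (hc : c ≠ 0) (n : ℤ) :
    ‖secondDiff (regSeq ε w c) n‖ ≤
      9 * y₀⁻¹ ^ 3 * (1 + y₀⁻¹) ^ 2 / |(c : ℝ)| ^ 2 * (‖w + n / c‖ ^ 2)⁻¹ := by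
  have hc0 : (0 : ℝ) < |(c : ℝ)| := abs_pos.2 (by exact_mod_cast hc)
  have := norm_second_difference_le (a := (n : ℝ)) (hasDerivAt_regInv_div ε hy₀ hw c)
    (hasDerivAt_regInv_div_deriv ε hy₀ hw c)
    (C := 9 * y₀⁻¹ ^ 3 * (1 + y₀⁻¹) ^ 2 / |(c : ℝ)| ^ 2 * (‖w + n / c‖ ^ 2)⁻¹) ?_
  · simpa [secondDiff, regSeq] using this
  · intro t ht
    have h0 := le_norm_add_div w hw t c
    have h1 := hy₀.trans_le h0
    refine (norm_regInv_deriv_two_le hε.1 hε.2 hy₀ hy₁ h0 _).trans ?_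
    have h2 := inv_norm_sq_le_of_abs_sub_le_one hy₀ hw hc (s := n) (t := t)
      (abs_le.2 ⟨by linarith [ht.2], by linarith [ht.1]⟩)
    have h3 : (‖w + t / c‖ ^ 2)⁻¹ ≤ y₀⁻¹ ^ 2 := by rw [← inv_pow]; gcongr
    rw [norm_inv, Complex.norm_intCast]
    push_cast at h2
    calc 9 * y₀⁻¹ * |(c : ℝ)|⁻¹ ^ 2 * (‖w + t / c‖ ^ 4)⁻¹
        = 9 * y₀⁻¹ * |(c : ℝ)|⁻¹ ^ 2 * ((‖w + t / c‖ ^ 2)⁻¹ * (‖w + t / c‖ ^ 2)⁻¹) := by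
          rw [← mul_inv, ← pow_add]
      _ ≤ 9 * y₀⁻¹ * |(c : ℝ)|⁻¹ ^ 2 *
            (y₀⁻¹ ^ 2 * ((1 + y₀⁻¹) ^ 2 * (‖w + n / c‖ ^ 2)⁻¹)) := by gcongr
      _ = _ := by field_simp

lemma norm_regSeq_sub_integral_le (hε : IsSmall ε) (hy₀ : 0 < y₀) (hy₁ : y₀ ≤ 1) {w : ℂ}
    (hw : y₀ ≤ w.im) {c : ℤ} (hc : c ≠ 0) (n : ℤ) :
    ‖regSeq ε w c n - ∫ t in (n : ℝ)..n + 1, regInv ε (w + t / c)‖ ≤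
      5 / 2 * y₀⁻¹ ^ 2 * (1 + y₀⁻¹) ^ 2 / |(c : ℝ)| * (‖w + n / c‖ ^ 2)⁻¹ := by
  have hc0 : (0 : ℝ) < |(c : ℝ)| := abs_pos.2 (by exact_mod_cast hc)
  set C := 5 / 2 * y₀⁻¹ ^ 2 * (1 + y₀⁻¹) ^ 2 / |(c : ℝ)| * (‖w + n / c‖ ^ 2)⁻¹ with hC
  have hcont : Continuous fun t : ℝ => regInv ε (w + t / c) :=
    continuous_iff_continuousAt.2 fun t => (hasDerivAt_regInv_div ε hy₀ hw c t).continuousAt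
  have hbd : ∀ t ∈ Set.Icc (n : ℝ) (n + 1), ‖regInv ε (w + t / c) - regSeq ε w c n‖ ≤ C := by
    intro t ht
    have := norm_sub_le_of_hasDerivAt (a := (n : ℝ)) (hasDerivAt_regInv_div ε hy₀ hw c)
      (C := C) ?_ ht
    · simpa [regSeq] using this
    · intro t ht
      have h0 := le_norm_add_div w hw t c
      have h1 := hy₀.trans_le h0
      refine (norm_regInv_deriv_le hε.1 hε.2 hy₀ hy₁ h0 _).trans ?_
      have h2 := inv_norm_sq_le_of_abs_sub_le_one hy₀ hw hc (s := n) (t := t)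
        (abs_le.2 ⟨by linarith [ht.2], by linarith [ht.1]⟩)
      have h3 : ‖w + t / c‖⁻¹ ≤ y₀⁻¹ := by gcongr
      rw [norm_inv, Complex.norm_intCast]
      push_cast at h2
      calc 5 / 2 * y₀⁻¹ * |(c : ℝ)|⁻¹ * (‖w + t / c‖ ^ 3)⁻¹
          = 5 / 2 * y₀⁻¹ * |(c : ℝ)|⁻¹ * (‖w + t / c‖⁻¹ * (‖w + t / c‖ ^ 2)⁻¹) := by
            rw [← mul_inv, ← pow_succ']
        _ ≤ 5 / 2 * y₀⁻¹ * |(c : ℝ)|⁻¹ * (y₀⁻¹ * ((1 + y₀⁻¹) ^ 2 * (‖w + n / c‖ ^ 2)⁻¹)) := by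
            gcongr
        _ = C := by rw [hC]; field_simp
  have e : regSeq ε w c n - ∫ t in (n : ℝ)..n + 1, regInv ε (w + t / c) =
      -∫ t in (n : ℝ)..n + 1, (regInv ε (w + t / c) - regSeq ε w c n) := by
    rw [intervalIntegral.integral_sub (hcont.intervalIntegrable _ _) (by simp)]
    simp
  rw [e, norm_neg]
  refine (intervalIntegral.norm_integral_le_of_norm_le_const (C := C) fun t ht => hbd t ?_).trans ?_
  · rw [Set.uIoc_of_le (by linarith)] at ht
    exact ⟨ht.1.le, ht.2⟩
  · simp

lemma summable_norm_regSeq (hε : IsSmall ε) (hy₀ : 0 < y₀) (hy₁ : y₀ ≤ 1) {w : ℂ}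
    (hw : y₀ ≤ w.im) {c : ℤ} (hc : c ≠ 0) : Summable fun n => ‖regSeq ε w c n‖ :=
  Summable.of_nonneg_of_le (fun _ => norm_nonneg _) (norm_regSeq_le hε hy₀ hy₁ hw c)
    ((latticeSum hy₀ hy₁ hw hc).1.mul_left _)

/-- A common bound for the sequences `regSeq`. -/
def seqConst (y₀ : ℝ) : ℝ :=
  9 * y₀⁻¹ ^ 3 * (1 + y₀⁻¹) ^ 2 * latticeConst y₀ + 6 * Real.pi / y₀ ^ 3

lemma tsum_norm_regSeq_le (hε : IsSmall ε) (hy₀ : 0 < y₀) (hy₁ : y₀ ≤ 1) {w : ℂ}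
    (hw : y₀ ≤ w.im) {c : ℤ} (hc : c ≠ 0) :
    ∑' n, ‖regSeq ε w c n‖ ≤ seqConst y₀ * |(c : ℝ)| := by
  obtain ⟨h1, h2⟩ := latticeSum hy₀ hy₁ hw hc
  have hY : 1 ≤ y₀⁻¹ := (one_le_inv₀ hy₀).2 hy₁
  have hL := latticeConst_nonneg y₀
  calc _ ≤ ∑' n : ℤ, y₀⁻¹ * (‖w + n / c‖ ^ 2)⁻¹ :=
        (summable_norm_regSeq hε hy₀ hy₁ hw hc).tsum_le_tsum (norm_regSeq_le hε hy₀ hy₁ hw c)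
          (h1.mul_left _)
    _ = y₀⁻¹ * ∑' n : ℤ, (‖w + n / c‖ ^ 2)⁻¹ := tsum_mul_left
    _ ≤ y₀⁻¹ * (latticeConst y₀ * |(c : ℝ)|) := by gcongr
    _ ≤ _ := by
        rw [← mul_assoc]
        gcongr
        rw [seqConst]
        have h3 : y₀⁻¹ ≤ 9 * y₀⁻¹ ^ 3 * (1 + y₀⁻¹) ^ 2 := by
          have : y₀⁻¹ ≤ y₀⁻¹ ^ 3 := le_self_pow₀ hY (by norm_num)
          nlinarith [pow_pos (lt_of_lt_of_le one_pos hY) 3, one_le_pow₀ (n := 2)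
            (show 1 ≤ 1 + y₀⁻¹ by linarith)]
        have h4 : 0 ≤ 6 * Real.pi / y₀ ^ 3 := by positivity
        nlinarith

lemma tsum_norm_secondDiff_regSeq_le (hε : IsSmall ε) (hy₀ : 0 < y₀) (hy₁ : y₀ ≤ 1) {w : ℂ}
    (hw : y₀ ≤ w.im) {c : ℤ} (hc : c ≠ 0) :
    ∑' n, ‖secondDiff (regSeq ε w c) n‖ ≤ seqConst y₀ / |(c : ℝ)| := by
  obtain ⟨h1, h2⟩ := latticeSum hy₀ hy₁ hw hc
  have hc0 : (0 : ℝ) < |(c : ℝ)| := abs_pos.2 (by exact_mod_cast hc)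
  calc _ ≤ ∑' n : ℤ, 9 * y₀⁻¹ ^ 3 * (1 + y₀⁻¹) ^ 2 / |(c : ℝ)| ^ 2 * (‖w + n / c‖ ^ 2)⁻¹ :=
        (summable_norm_secondDiff (summable_norm_regSeq hε hy₀ hy₁ hw hc)).tsum_le_tsum
          (norm_secondDiff_regSeq_le hε hy₀ hy₁ hw hc) (h1.mul_left _)
    _ = 9 * y₀⁻¹ ^ 3 * (1 + y₀⁻¹) ^ 2 / |(c : ℝ)| ^ 2 * ∑' n : ℤ, (‖w + n / c‖ ^ 2)⁻¹ :=
        tsum_mul_left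
    _ ≤ 9 * y₀⁻¹ ^ 3 * (1 + y₀⁻¹) ^ 2 / |(c : ℝ)| ^ 2 * (latticeConst y₀ * |(c : ℝ)|) := by
        gcongr
    _ = (9 * y₀⁻¹ ^ 3 * (1 + y₀⁻¹) ^ 2 * latticeConst y₀) / |(c : ℝ)| := by field_simp
    _ ≤ _ := by
        gcongr
        rw [seqConst]
        have : 0 ≤ 6 * Real.pi / y₀ ^ 3 := by positivity
        linarith

/-- Comparison of a Riemann sum with its integral. Each unit interval contributes an error `O(|c|⁻¹
‖w + n/c‖⁻²)`, and the lattice sum is `O(|c|)`, so the total error is bounded. Rescaling yields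
`|c|`, and translation invariance removes `Re w`. -/
lemma norm_tsum_regSeq_sub_le (hε : IsSmall ε) (hy₀ : 0 < y₀) (hy₁ : y₀ ≤ 1) {w : ℂ}
    (hw : y₀ ≤ w.im) {c : ℤ} (hc : c ≠ 0) :
    ‖∑' n, regSeq ε w c n - |(c : ℝ)| * lineIntegral ε w.im‖ ≤ seqConst y₀ := by
  obtain ⟨h1, h2⟩ := latticeSum hy₀ hy₁ hw hc
  have hcR : (c : ℝ) ≠ 0 := by exact_mod_cast hc
  have hc0 : (0 : ℝ) < |(c : ℝ)| := abs_pos.2 hcR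
  set g : ℝ → ℂ := fun t => regInv ε ((w.im * I : ℂ) + t) with hg
  have hgi : Integrable g := integrable_regInv_line hε hy₀ hy₁ hw
  have e1 : (fun t : ℝ => regInv ε (w + t / c)) = fun t : ℝ => g (t / c + w.re) := by
    funext t
    simp only [hg]
    congr 1
    conv_lhs => rw [← Complex.re_add_im w]
    push_cast
    ring
  have hfi : Integrable fun t : ℝ => regInv ε (w + t / c) := by
    rw [e1]
    exact (hgi.comp_add_right w.re).comp_div hcR
  have e2 : ∫ t : ℝ, regInv ε (w + t / c) = |(c : ℝ)| * lineIntegral ε w.im := by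
    rw [e1, Measure.integral_comp_div (fun t => g (t + w.re)) (c : ℝ),
      integral_add_right_eq_self g w.re, lineIntegral]
    simp only [hg, add_comm, Complex.real_smul]
  have hs1 := (summable_norm_regSeq hε hy₀ hy₁ hw hc).of_norm.hasSum
  have hs2 := hfi.hasSum_intervalIntegral 0
  simp only [zero_add] at hs2
  rw [e2] at hs2
  have hs3 := (hs1.sub hs2).tsum_eq
  rw [← hs3]
  have hb := norm_regSeq_sub_integral_le hε hy₀ hy₁ hw hc
  refine (tsum_of_norm_bounded ((h1.mul_left _).hasSum) hb).trans ?_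
  rw [tsum_mul_left]
  calc _ ≤ 5 / 2 * y₀⁻¹ ^ 2 * (1 + y₀⁻¹) ^ 2 / |(c : ℝ)| * (latticeConst y₀ * |(c : ℝ)|) := by
        gcongr
    _ = 5 / 2 * y₀⁻¹ ^ 2 * (1 + y₀⁻¹) ^ 2 * latticeConst y₀ := by field_simp
    _ ≤ 9 * y₀⁻¹ ^ 3 * (1 + y₀⁻¹) ^ 2 * latticeConst y₀ := by
        have hL := latticeConst_nonneg y₀
        have hY : 1 ≤ y₀⁻¹ := (one_le_inv₀ hy₀).2 hy₁
        gcongr ?_ * _ * _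
        have : y₀⁻¹ ^ 2 ≤ y₀⁻¹ ^ 3 := pow_le_pow_right₀ hY (by norm_num)
        nlinarith [pow_pos (lt_of_lt_of_le one_pos hY) 2]
    _ ≤ _ := by
        rw [seqConst]
        have : 0 ≤ 6 * Real.pi / y₀ ^ 3 := by positivity
        linarith

lemma norm_lineIntegral_le_seqConst (hε : IsSmall ε) (hy₀ : 0 < y₀) (hy₁ : y₀ ≤ 1) {y : ℝ}
    (hy : y₀ ≤ y) : ‖lineIntegral ε y‖ ≤ seqConst y₀ * ‖ε‖ := by
  refine (norm_lineIntegral_le hε hy₀ hy₁ hy).trans ?_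
  gcongr
  rw [seqConst]
  have := latticeConst_nonneg y₀
  have : 0 ≤ 9 * y₀⁻¹ ^ 3 * (1 + y₀⁻¹) ^ 2 * latticeConst y₀ := by positivity
  linarith

end RegularizedSequences

/-! ### The number of points of the hyperbola as a divisor sum. -/

section CountingHyperbola

set_option linter.unusedSectionVars false

lemma card_filter_mul_eq_zero {Q : ℕ} [NeZero Q] (A : ZMod Q) :
    (Finset.univ.filter fun x : ZMod Q => A * x = 0).card = Q.gcd A.val := by
  have h := IsAddCyclic.card_nsmulAddMonoidHom_ker (G := ZMod Q) A.val
  rw [Nat.card_zmod] at h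
  rw [← h, ← Fintype.card_subtype, ← Nat.card_eq_fintype_card]
  refine Nat.card_congr (Equiv.subtypeEquivRight fun x => ?_)
  rw [AddMonoidHom.mem_ker]
  simp

variable {q N : ℕ} [NeZero q] [NeZero N]

/-- The identity on the divisors of `m`, and `0` elsewhere. -/
def divisorId (m n : ℕ) : ℕ := if n ∣ m then n else 0

/-- For fixed `a` the condition is `a d ≡ m (mod q)`. By Bézout it is solvable exactly when `gcd(a,
q) ∣ m`, and the solutions modulo `q N` then form a coset of the kernel of multiplication by `N a`,
of order `N gcd(a, q)`. -/
lemma card_filter_hyperbola_fiber (m : ℕ) (a : ZMod (q * N)) :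
    (Finset.univ.filter fun d : ZMod (q * N) => (N : ZMod (q * N)) * (a * d - m) = 0).card =
      N * divisorId m (a.val.gcd q) := by
  set A : ZMod (q * N) := N * a with hA
  have hN := NeZero.pos N
  have hq := NeZero.pos q
  have hav : ((a.val : ℕ) : ZMod (q * N)) = a := ZMod.natCast_zmod_val a
  have hgcd : (q * N).gcd A.val = N * a.val.gcd q := by
    have : A = ((N * a.val : ℕ) : ZMod (q * N)) := by rw [Nat.cast_mul, hav]
    rw [this, ZMod.val_natCast, Nat.gcd_comm, ← Nat.gcd_rec]
    generalize a.val = v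
    rw [mul_comm q N, Nat.gcd_mul_left, Nat.gcd_comm]
  rcases Finset.eq_empty_or_nonempty
    (Finset.univ.filter fun d : ZMod (q * N) => (N : ZMod (q * N)) * (a * d - m) = 0)
    with h | ⟨d₀, hd₀⟩
  · rw [h, Finset.card_empty, divisorId, if_neg, mul_zero]
    rintro ⟨k, hk⟩
    have hb : ((a.val.gcd q : ℕ) : ℤ) = a.val * a.val.gcdA q + q * a.val.gcdB q :=
      Nat.gcd_eq_gcd_ab _ _
    have hmem : ((a.val.gcdA q * k : ℤ) : ZMod (q * N)) ∈ (Finset.univ.filter fun d : ZMod (q * N) =>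
        (N : ZMod (q * N)) * (a * d - m) = 0) := by
      simp only [Finset.mem_filter, Finset.mem_univ, true_and]
      have e : (N : ZMod (q * N)) * (a * ((a.val.gcdA q * k : ℤ) : ZMod (q * N)) - m) =
          ((N * (a.val * (a.val.gcdA q * k) - m) : ℤ) : ZMod (q * N)) := by
        push_cast
        rw [hav]
      rw [e, ZMod.intCast_zmod_eq_zero_iff_dvd]
      refine ⟨-(a.val.gcdB q * k), ?_⟩
      have hk' : (m : ℤ) = (a.val.gcd q : ℕ) * k := by exact_mod_cast hk
      rw [hk', hb]
      push_cast
      ring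
    rw [h] at hmem
    exact absurd hmem (Finset.notMem_empty _)
  · simp only [Finset.mem_filter, Finset.mem_univ, true_and] at hd₀
    have hdvd : a.val.gcd q ∣ m := by
      have e : (N : ZMod (q * N)) * (a * d₀ - m) =
          ((N * (a.val * d₀.val - m) : ℤ) : ZMod (q * N)) := by
        push_cast
        rw [hav, ZMod.natCast_zmod_val]
      rw [e, ZMod.intCast_zmod_eq_zero_iff_dvd] at hd₀
      push_cast at hd₀
      rw [mul_comm (q : ℤ)] at hd₀
      have h1 : (q : ℤ) ∣ a.val * d₀.val - m :=
        Int.dvd_of_mul_dvd_mul_left (by exact_mod_cast hN.ne') hd₀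
      have h2 : ((a.val.gcd q : ℕ) : ℤ) ∣ a.val * d₀.val - m :=
        (Int.natCast_dvd_natCast.2 (Nat.gcd_dvd_right _ _)).trans h1
      have h3 : ((a.val.gcd q : ℕ) : ℤ) ∣ a.val * d₀.val :=
        (Int.natCast_dvd_natCast.2 (Nat.gcd_dvd_left _ _)).mul_right _
      have h4 := (Int.dvd_iff_dvd_of_dvd_sub h2).1 h3
      exact Int.natCast_dvd_natCast.1 h4
    rw [divisorId, if_pos hdvd, ← hgcd, ← card_filter_mul_eq_zero]
    refine Finset.card_bij' (fun d _ => d - d₀) (fun d _ => d + d₀) ?_ ?_ ?_ ?_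
    · intro d hd
      simp only [Finset.mem_filter, Finset.mem_univ, true_and] at hd ⊢
      rw [hA]
      linear_combination hd - hd₀
    · intro d hd
      simp only [Finset.mem_filter, Finset.mem_univ, true_and] at hd ⊢
      rw [hA] at hd
      linear_combination hd + hd₀
    · intro d _; simp
    · intro d _; simp

/-- The Möbius inverse of `divisorId m`. -/
def divisorKernel (m l : ℕ) : ℝ :=
  ∑ x ∈ l.divisorsAntidiagonal, (ArithmeticFunction.moebius x.1 : ℝ) * divisorId m x.2

lemma sum_divisorKernel (m n : ℕ) (hn : 0 < n) :
    ∑ l ∈ n.divisors, divisorKernel m l = divisorId m n :=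
  (ArithmeticFunction.sum_eq_iff_sum_mul_moebius_eq (R := ℝ) (f := divisorKernel m)
    (g := fun n => (divisorId m n : ℝ))).2 (fun _ _ => rfl) n hn

/-- Only divisors of `m` contribute and `|μ| ≤ 1`, so the bound does not depend on `l`. -/
lemma abs_divisorKernel_le {m : ℕ} (hm : 0 < m) (l : ℕ) :
    |divisorKernel m l| ≤ ∑ y ∈ m.divisors, (y : ℝ) := by
  calc |divisorKernel m l| ≤ ∑ x ∈ l.divisorsAntidiagonal, (divisorId m x.2 : ℝ) := by
        refine (Finset.abs_sum_le_sum_abs _ _).trans (Finset.sum_le_sum fun x _ => ?_)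
        rw [abs_mul, Nat.abs_cast]
        have h1 : |(ArithmeticFunction.moebius x.1 : ℝ)| ≤ 1 := by
          exact_mod_cast ArithmeticFunction.abs_moebius_le_one
        nlinarith [(Nat.cast_nonneg (divisorId m x.2) : (0 : ℝ) ≤ _)]
    _ = ∑ y ∈ l.divisors, (divisorId m y : ℝ) := by
        exact Nat.sum_divisorsAntidiagonal' fun _ y => (divisorId m y : ℝ)
    _ = ∑ y ∈ l.divisors with y ∣ m, (y : ℝ) := by
        rw [Finset.sum_filter]
        refine Finset.sum_congr rfl fun y _ => ?_
        simp only [divisorId]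
        split_ifs <;> simp
    _ ≤ _ := by
        refine Finset.sum_le_sum_of_subset_of_nonneg (fun y hy => ?_) fun _ _ _ => by positivity
        exact Nat.mem_divisors.2 ⟨(Finset.mem_filter.1 hy).2, hm.ne'⟩

/-- The number of `k < l N` divisible by `l` in a given class modulo `N`. -/
def periodCount (r : ZMod N) (l : ℕ) : ℕ :=
  Nat.count (fun k : ℕ => (k : ZMod N) = r ∧ l ∣ k) (l * N)

lemma periodCount_le (r : ZMod N) (l : ℕ) : periodCount r l ≤ N := by
  rw [periodCount, Nat.count_eq_card_filter_range]
  refine (Finset.card_le_card_of_injOn (fun k => k / l) (t := Finset.range N) ?_ ?_).trans_eq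
    (Finset.card_range N)
  · intro k hk
    simp only [Finset.coe_filter, Finset.mem_range, Set.mem_ofPred_eq, Finset.coe_range,
      Set.mem_Iio] at hk ⊢
    exact Nat.div_lt_of_lt_mul hk.1
  · intro k hk j hj h
    simp only [Finset.coe_filter, Finset.mem_range, Set.mem_ofPred_eq] at hk hj h
    rw [← Nat.div_mul_cancel hk.2.2, ← Nat.div_mul_cancel hj.2.2, h]

lemma count_mul_period (r : ZMod N) (l j : ℕ) :
    Nat.count (fun k : ℕ => (k : ZMod N) = r ∧ l ∣ k) (j * (l * N)) = j * periodCount r l := by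
  induction j with
  | zero => simp
  | succ j ih =>
    rw [add_mul, one_mul, Nat.count_add, ih, add_mul, one_mul, periodCount]
    congr 1
    have : (fun k : ℕ => ((j * (l * N) + k : ℕ) : ZMod N) = r ∧ l ∣ j * (l * N) + k) =
        fun k : ℕ => (k : ZMod N) = r ∧ l ∣ k := by
      funext k
      have h2 : l ∣ j * (l * N) := ⟨j * N, by ring⟩
      simp [Nat.dvd_add_right h2]
    simp only [this]

/-- The condition is periodic modulo `l N`, and the residues modulo `q N` fill `q / l` periods. -/
lemma card_filter_dvd_val (r : ZMod N) {l : ℕ} (hl : l ∣ q) :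
    (Finset.univ.filter fun a : ZMod (q * N) =>
      ZMod.castHom (Dvd.intro_left q rfl) (ZMod N) a = r ∧ l ∣ a.val).card =
      q / l * periodCount r l := by
  have hq := NeZero.pos q
  rw [← count_mul_period, ← mul_assoc, Nat.div_mul_cancel hl, Nat.count_eq_card_filter_range]
  refine Finset.card_bij' (fun a _ => a.val) (fun k _ => (k : ZMod (q * N))) ?_ ?_ ?_ ?_
  · intro a ha
    simp only [Finset.mem_filter, Finset.mem_univ, true_and, Finset.mem_range] at ha ⊢
    refine ⟨ZMod.val_lt a, ?_, ha.2⟩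
    rw [← ha.1]
    conv_rhs => rw [← ZMod.natCast_zmod_val a]
    rw [map_natCast]
  · intro k hk
    simp only [Finset.mem_filter, Finset.mem_univ, true_and, Finset.mem_range] at hk ⊢
    rw [ZMod.val_natCast, Nat.mod_eq_of_lt hk.1, map_natCast]
    exact hk.2
  · intro a _; simp
  · intro k hk
    simp only [Finset.mem_filter, Finset.mem_range] at hk
    rw [ZMod.val_natCast, Nat.mod_eq_of_lt hk.1]

/-- The multiplicative weights in the divisor-sum expression for the number of points of a
hyperbola. -/
def hyperbolaWeight (m : ℕ) (r : ZMod N) (l : ℕ) : ℝ :=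
  divisorKernel m l * periodCount r l / l

lemma abs_hyperbolaWeight_le {m : ℕ} (hm : 0 < m) (r : ZMod N) (l : ℕ) :
    |hyperbolaWeight m r l| ≤ ((∑ y ∈ m.divisors, (y : ℝ)) * N) / l := by
  rcases Nat.eq_zero_or_pos l with rfl | hl
  · simp [hyperbolaWeight]
  · rw [hyperbolaWeight, abs_div, abs_mul, Nat.abs_cast, Nat.abs_cast]
    gcongr
    · exact abs_divisorKernel_le hm l
    · exact periodCount_le r l

/-- Sum the fibre counts over `a ≡ r (mod N)`. Möbius inversion writes the dependence on `gcd(a, q)`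
as a sum over its divisors `l`, and the condition `l ∣ a` is then counted. -/
lemma card_hyperbola_eq (m : ℕ) (r : ZMod N) :
    ((hyperbola (Dvd.intro_left q rfl : N ∣ q * N) m r).card : ℝ) =
      N * q * ∑ l ∈ q.divisors, hyperbolaWeight m r l := by
  classical
  have hq := NeZero.pos q
  set S := Finset.univ.filter fun a : ZMod (q * N) =>
      ZMod.castHom (Dvd.intro_left q rfl) (ZMod N) a = r with hS
  have e1 : (hyperbola (Dvd.intro_left q rfl : N ∣ q * N) m r).card =
      ∑ a ∈ S, N * divisorId m (a.val.gcd q) := by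
    simp_rw [← card_filter_hyperbola_fiber]
    rw [← Finset.card_sigma]
    refine Finset.card_bij' (fun x _ => ⟨x.1, x.2⟩) (fun x _ => (x.1, x.2)) ?_ ?_ ?_ ?_
    · intro x hx
      simp only [hyperbola, Finset.mem_filter, Finset.mem_univ, true_and] at hx
      exact Finset.mem_sigma.2 ⟨Finset.mem_filter.2 ⟨Finset.mem_univ _, hx.2⟩,
        Finset.mem_filter.2 ⟨Finset.mem_univ _, hx.1⟩⟩
    · intro x hx
      simp only [hS, Finset.mem_sigma, Finset.mem_filter, Finset.mem_univ, true_and] at hx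
      exact Finset.mem_filter.2 ⟨Finset.mem_univ _, hx.2, hx.1⟩
    · intro x _; rfl
    · intro x _; rfl
  rw [e1]
  push_cast
  rw [← Finset.mul_sum, mul_assoc]
  congr 1
  calc ∑ a ∈ S, (divisorId m (a.val.gcd q) : ℝ)
      = ∑ a ∈ S, ∑ l ∈ q.divisors, if l ∣ a.val then divisorKernel m l else 0 := by
        refine Finset.sum_congr rfl fun a _ => ?_
        rw [← sum_divisorKernel m _ (Nat.gcd_pos_of_pos_right _ hq), ← Finset.sum_filter]
        refine Finset.sum_congr ?_ fun _ _ => rfl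
        ext l
        simp only [Nat.mem_divisors, Nat.dvd_gcd_iff, Finset.mem_filter]
        have := (Nat.gcd_pos_of_pos_right a.val hq).ne'
        have := hq.ne'
        tauto
    _ = ∑ l ∈ q.divisors, divisorKernel m l * (q / l * periodCount r l : ℕ) := by
        rw [Finset.sum_comm]
        refine Finset.sum_congr rfl fun l hl => ?_
        rw [← card_filter_dvd_val r (Nat.dvd_of_mem_divisors hl), ← Finset.sum_filter,
          Finset.sum_const, nsmul_eq_mul, mul_comm, hS, Finset.filter_filter]
    _ = _ := by
        rw [Finset.mul_sum]
        refine Finset.sum_congr rfl fun l hl => ?_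
        have hl' := Nat.dvd_of_mem_divisors hl
        have : (l : ℝ) ≠ 0 := by
          exact_mod_cast (Nat.pos_of_mem_divisors hl).ne'
        rw [hyperbolaWeight, Nat.cast_mul, Nat.cast_div hl' this]
        ring

end CountingHyperbola

/-! ### The Dirichlet series of the hyperbola counts has at most a simple pole. -/

section ResidueClassSums

variable {N : ℕ} [NeZero N]

/-- `(s - 1) L(Φ, s)` becomes continuous once its value at `1` is set to the residue, hence is
bounded on the closed disc. -/
lemma exists_norm_LFunction_le (Φ : ZMod N → ℂ) :
    ∃ C : ℝ, 0 ≤ C ∧ ∀ s : ℂ, s ≠ 1 → ‖s - 1‖ ≤ 1 → ‖ZMod.LFunction Φ s‖ ≤ C / ‖s - 1‖ := by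
  set G : ℂ → ℂ := Function.update (fun s => (s - 1) * ZMod.LFunction Φ s) 1 (∑ j, Φ j / N) with hG
  have hcont : Continuous G := by
    rw [continuous_iff_continuousAt]
    intro s
    rcases eq_or_ne s 1 with rfl | hs
    · rw [hG, continuousAt_update_same]
      exact ZMod.LFunction_residue_one Φ
    · have h1 : ContinuousAt (fun s => (s - 1) * ZMod.LFunction Φ s) s :=
        (by fun_prop : ContinuousAt (fun s : ℂ => s - 1) s).mul
          (ZMod.differentiableAt_LFunction Φ s (Or.inl hs)).continuousAt
      exact (continuousAt_update_of_ne hs).2 h1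
  obtain ⟨C, hC⟩ := (isCompact_closedBall (1 : ℂ) 1).exists_bound_of_continuousOn
    hcont.continuousOn
  refine ⟨C, (norm_nonneg _).trans (hC 1 (by simp)), fun s hs hs1 => ?_⟩
  have h := hC s (by simpa [dist_eq_norm] using hs1)
  rw [hG, Function.update_of_ne hs, norm_mul] at h
  rw [le_div_iff₀ (norm_pos_iff.2 (sub_ne_zero.2 hs))]
  linarith

/-- Sums over residue classes: `∑ k^(-1-2ε)` over `k` with `l k = ρ` in `ZMod N` is `O(1/|ε|)`. -/
lemma exists_norm_classSum_le (N : ℕ) [NeZero N] (ρ : ZMod N) :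
    ∃ C : ℝ, 0 ≤ C ∧ ∀ l : ZMod N, ∀ ε : ℂ, IsSmall ε → 0 < ε.re →
      ‖∑' k : ℕ+, (if l * (k : ℕ) = ρ then ((k : ℕ) : ℂ) ^ (-1 - 2 * ε) else 0)‖ ≤ C / ‖ε‖ := by
  classical
  choose C hC0 hC using fun l : ZMod N =>
    exists_norm_LFunction_le (fun j : ZMod N => if l * j = ρ then (1 : ℂ) else 0)
  refine ⟨∑ l, C l, Finset.sum_nonneg fun l _ => hC0 l, fun l ε hε hpos => ?_⟩
  have hre : 1 < (1 + 2 * ε).re := by simp; linarith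
  have hε0 : ε ≠ 0 := fun h => by simp [h] at hpos
  have e : ∑' k : ℕ+, (if l * (k : ℕ) = ρ then ((k : ℕ) : ℂ) ^ (-1 - 2 * ε) else 0) =
      ZMod.LFunction (fun j : ZMod N => if l * j = ρ then (1 : ℂ) else 0) (1 + 2 * ε) := by
    rw [ZMod.LFunction_eq_LSeries _ hre, LSeries, ← tsum_pnat_eq_tsum_of_eq_zero (LSeries.term_zero _ _)]
    refine tsum_congr fun k => ?_
    rw [LSeries.term_of_ne_zero k.ne_zero, show (-1 - 2 * ε) = -(1 + 2 * ε) by ring,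
      Complex.cpow_neg]
    split_ifs <;> simp
  rw [e]
  have h1 := hC l (1 + 2 * ε) (by simpa using hε0) (by
    have := hε.2
    simp only [add_sub_cancel_left, norm_mul, Complex.norm_ofNat]
    linarith)
  refine h1.trans ?_
  rw [add_sub_cancel_left, norm_mul, Complex.norm_ofNat]
  have h2 : C l ≤ ∑ l, C l := Finset.single_le_sum (fun l _ => hC0 l) (Finset.mem_univ l)
  have h3 := norm_pos_iff.2 hε0
  rw [div_le_div_iff₀ (by positivity) h3]
  nlinarith [hC0 l]

/-- The number of points of the hyperbola `a d ≡ m (mod q)`, `a ≡ r (mod N)` modulo `q N`. -/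
def hyperbolaCount (m : ℕ) (r : ZMod N) (q : ℕ) : ℝ :=
  N * q * ∑ l ∈ q.divisors, hyperbolaWeight m r l

/-- The summand of the double series behind the Dirichlet series of `hyperbolaCount`. -/
def weightTerm (m : ℕ) (r ρ : ZMod N) (ε : ℂ) (x : ℕ+ × ℕ+) : ℂ :=
  hyperbolaWeight m r x.1 * ((x.1 : ℕ) : ℂ) ^ (-1 - 2 * ε) *
    (if ((x.1 : ℕ) : ZMod N) * (x.2 : ℕ) = ρ then ((x.2 : ℕ) : ℂ) ^ (-1 - 2 * ε) else 0)

lemma norm_natCast_cpow_neg_le {ε : ℂ} (hpos : 0 < ε.re) (k : ℕ+) :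
    ‖((k : ℕ) : ℂ) ^ (-1 - 2 * ε)‖ ≤ ((k : ℕ) : ℝ)⁻¹ := by
  rw [Complex.norm_natCast_cpow_of_pos k.pos, ← Real.rpow_neg_one]
  refine Real.rpow_le_rpow_of_exponent_le (by exact_mod_cast k.pos) ?_
  simp
  linarith

lemma norm_hyperbolaWeight_mul_le {m : ℕ} (hm : 0 < m) (r : ZMod N) {ε : ℂ} (hpos : 0 < ε.re)
    (l : ℕ+) : ‖(hyperbolaWeight m r l : ℂ) * ((l : ℕ) : ℂ) ^ (-1 - 2 * ε)‖ ≤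
      ((∑ y ∈ m.divisors, (y : ℝ)) * N) * (((l : ℕ) : ℝ) ^ 2)⁻¹ := by
  rw [norm_mul, Complex.norm_real, Real.norm_eq_abs]
  have hl : (0 : ℝ) < (l : ℕ) := by exact_mod_cast l.pos
  calc _ ≤ (((∑ y ∈ m.divisors, (y : ℝ)) * N) / (l : ℕ)) * ((l : ℕ) : ℝ)⁻¹ :=
        mul_le_mul (abs_hyperbolaWeight_le hm r l) (norm_natCast_cpow_neg_le hpos l)
          (norm_nonneg _) (by positivity)
    _ = _ := by field_simp

lemma summable_pnat_inv_sq : Summable fun l : ℕ+ => (((l : ℕ) : ℝ) ^ 2)⁻¹ :=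
  (Real.summable_nat_pow_inv.2 one_lt_two).comp_injective PNat.coe_injective

lemma summable_weightTerm {m : ℕ} (hm : 0 < m) (r ρ : ZMod N) {ε : ℂ} (hpos : 0 < ε.re) :
    Summable fun x => ‖weightTerm m r ρ ε x‖ := by
  have h1 : Summable fun l : ℕ+ => ((∑ y ∈ m.divisors, (y : ℝ)) * N) * (((l : ℕ) : ℝ) ^ 2)⁻¹ :=
    summable_pnat_inv_sq.mul_left _
  have h2 : Summable fun k : ℕ+ => ‖((k : ℕ) : ℂ) ^ (-1 - 2 * ε)‖ := by
    have : Summable fun k : ℕ => (k : ℝ) ^ (-1 - 2 * ε.re) :=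
      Real.summable_nat_rpow.2 (by linarith)
    refine (this.comp_injective PNat.coe_injective).congr fun k => ?_
    rw [Complex.norm_natCast_cpow_of_pos k.pos]
    simp
  refine Summable.of_nonneg_of_le (fun _ => norm_nonneg _) (fun x => ?_)
    (h1.mul_of_nonneg h2 (fun _ => by positivity) fun _ => norm_nonneg _)
  rw [weightTerm, norm_mul]
  refine mul_le_mul (norm_hyperbolaWeight_mul_le hm r hpos x.1) ?_ (norm_nonneg _) (by positivity)
  split_ifs
  · exact le_rfl
  · simp

/-- The count is `N q` times a sum over `l ∣ q`, so writing `q = l k` makes the Dirichlet series a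
double series over `l` and `k`. The factor `q` turns the exponent `-2 - 2ε` into `-1 - 2ε`. -/
lemma hasSum_hyperbolaCount {m : ℕ} (hm : 0 < m) (r ρ : ZMod N) {ε : ℂ} (hpos : 0 < ε.re) :
    HasSum (fun q : ℕ+ => if ((q : ℕ) : ZMod N) = ρ then
      (hyperbolaCount m r q : ℂ) * ((q : ℕ) : ℂ) ^ (-2 - 2 * ε) else 0)
      (N * ∑' x, weightTerm m r ρ ε x) := by
  have h1 := (summable_weightTerm hm r ρ hpos).of_norm.hasSum
  have h2 := sigmaAntidiagonalEquivProd.hasSum_iff.2 h1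
  have h3 := (h2.sigma fun q => (hasSum_fintype _)).mul_left (N : ℂ)
  have e : ∀ q : ℕ+, (if ((q : ℕ) : ZMod N) = ρ then
      (hyperbolaCount m r q : ℂ) * ((q : ℕ) : ℂ) ^ (-2 - 2 * ε) else 0) =
      N * ∑ b, (weightTerm m r ρ ε ∘ sigmaAntidiagonalEquivProd) ⟨q, b⟩ := by
    intro q
    have hb : ∀ b : (q : ℕ).divisorsAntidiagonal,
        (weightTerm m r ρ ε ∘ sigmaAntidiagonalEquivProd) ⟨q, b⟩ =
        (hyperbolaWeight m r b.1.1 : ℂ) *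
          (if ((q : ℕ) : ZMod N) = ρ then ((q : ℕ) : ℂ) ^ (-1 - 2 * ε) else 0) := by
      rintro ⟨⟨k, l⟩, h⟩
      have h' := (Nat.mem_divisorsAntidiagonal.1 h).1
      dsimp only at h'
      change (hyperbolaWeight m r k : ℂ) * (k : ℂ) ^ (-1 - 2 * ε) *
        (if (k : ZMod N) * (l : ZMod N) = ρ then (l : ℂ) ^ (-1 - 2 * ε) else 0) = _
      simp only [← h', Nat.cast_mul]
      rw [Complex.natCast_mul_natCast_cpow]
      by_cases hkl : (k : ZMod N) * l = ρ
      · rw [if_pos hkl, if_pos hkl]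
        ring
      · rw [if_neg hkl, if_neg hkl]
        ring
    have hq : (q : ℂ) ≠ 0 := by exact_mod_cast q.ne_zero
    rw [Finset.sum_congr rfl fun b _ => hb b, ← Finset.sum_mul,
      Finset.sum_coe_sort (q : ℕ).divisorsAntidiagonal
        (fun b : ℕ × ℕ => (hyperbolaWeight m r b.1 : ℂ)),
      Nat.sum_divisorsAntidiagonal (fun a _ => (hyperbolaWeight m r a : ℂ)), hyperbolaCount,
      show (-1 - 2 * ε) = (-2 - 2 * ε) + 1 by ring, Complex.cpow_add _ _ hq, Complex.cpow_one]
    push_cast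
    split_ifs <;> ring
  rw [funext e]
  exact h3

/-- The sum over `k` is `O(1/|ε|)` uniformly in `l`. Because the weights are `O(1/l)`, the outer sum
over `l` converges like `∑ l⁻²`. -/
lemma exists_norm_hyperbolaSum_le {m : ℕ} (hm : 0 < m) (r ρ : ZMod N) :
    ∃ C : ℝ, 0 ≤ C ∧ ∀ ε : ℂ, IsSmall ε → 0 < ε.re →
      ‖∑' q : ℕ+, (if ((q : ℕ) : ZMod N) = ρ then
      (hyperbolaCount m r q : ℂ) * ((q : ℕ) : ℂ) ^ (-2 - 2 * ε) else 0)‖ ≤ C / ‖ε‖ := by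
  obtain ⟨C, hC0, hC⟩ := exists_norm_classSum_le N ρ
  set K : ℝ := (∑ y ∈ m.divisors, (y : ℝ)) * N with hK
  have hK0 : 0 ≤ K := by positivity
  refine ⟨N * (K * (∑' l : ℕ+, (((l : ℕ) : ℝ) ^ 2)⁻¹) * C), by positivity, fun ε hε hpos => ?_⟩
  rw [(hasSum_hyperbolaCount hm r ρ hpos).tsum_eq, norm_mul, Complex.norm_natCast, mul_div_assoc]
  gcongr
  rw [(summable_weightTerm hm r ρ hpos).of_norm.tsum_prod]
  have hb : ∀ l : ℕ+, ‖∑' k : ℕ+, weightTerm m r ρ ε (l, k)‖ ≤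
      K * (((l : ℕ) : ℝ) ^ 2)⁻¹ * (C / ‖ε‖) := by
    intro l
    simp only [weightTerm]
    rw [tsum_mul_left, norm_mul]
    exact mul_le_mul (norm_hyperbolaWeight_mul_le hm r hpos l) (hC _ ε hε hpos) (norm_nonneg _)
      (by positivity)
  refine (tsum_of_norm_bounded
    (((summable_pnat_inv_sq.mul_left K).mul_right (C / ‖ε‖)).hasSum) hb).trans_eq ?_
  rw [tsum_mul_right, tsum_mul_left]
  ring

end ResidueClassSums

/-! ### Series over `ℤ` from the positive and the negative integers. -/

section SumsOverIntegers

variable {E : Type*} [NormedAddCommGroup E]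

lemma summable_int_of_pnat {f : ℤ → E} (h1 : Summable fun q : ℕ+ => f (q : ℕ))
    (h2 : Summable fun q : ℕ+ => f (-(q : ℕ))) : Summable f := by
  refine Summable.of_add_one_of_neg_add_one ?_ ?_
  · have := (Equiv.pnatEquivNat.symm.summable_iff (f := fun q : ℕ+ => f (q : ℕ))).2 h1
    exact this.congr fun n => by simp
  · have := (Equiv.pnatEquivNat.symm.summable_iff (f := fun q : ℕ+ => f (-(q : ℕ)))).2 h2
    refine this.congr fun n => ?_
    simp [add_comm]

lemma tsum_int_eq_tsum_pnat {f : ℤ → E} (h0 : f 0 = 0) (h1 : Summable fun q : ℕ+ => f (q : ℕ))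
    (h2 : Summable fun q : ℕ+ => f (-(q : ℕ))) :
    ∑' c, f c = (∑' q : ℕ+, f (q : ℕ)) + ∑' q : ℕ+, f (-(q : ℕ)) := by
  have e1 := (Equiv.pnatEquivNat.symm.summable_iff (f := fun q : ℕ+ => f (q : ℕ))).2 h1
  have e2 := (Equiv.pnatEquivNat.symm.summable_iff (f := fun q : ℕ+ => f (-(q : ℕ)))).2 h2
  rw [tsum_of_add_one_of_neg_add_one, h0, add_zero]
  · congr 1
    · rw [← Equiv.pnatEquivNat.symm.tsum_eq]
      exact tsum_congr fun n => by simp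
    · rw [← Equiv.pnatEquivNat.symm.tsum_eq]
      exact tsum_congr fun n => by simp [add_comm]
  · exact e1.congr fun n => by simp
  · exact e2.congr fun n => by simp [add_comm]

end SumsOverIntegers

/-! ### Estimates for the divisor function. -/

section DivisorSums

/-- The series is the square of `∑ k^s`, rearranged by the value of the product. -/
lemma summable_card_divisors_mul {s : ℝ} (hs : s < -1) :
    Summable fun q : ℕ+ => ((q : ℕ).divisors.card : ℝ) * ((q : ℕ) : ℝ) ^ s := by
  have h : Summable fun k : ℕ+ => ((k : ℕ) : ℝ) ^ s :=
    (Real.summable_nat_rpow.2 hs).comp_injective PNat.coe_injective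
  have h1 := h.mul_of_nonneg h (fun _ => by positivity) fun _ => by positivity
  have h2 := (sigmaAntidiagonalEquivProd.summable_iff.2 h1).sigma
  refine h2.congr fun q => ?_
  have hb : ∀ b : (q : ℕ).divisorsAntidiagonal,
      ((fun x : ℕ+ × ℕ+ => ((x.1 : ℕ) : ℝ) ^ s * ((x.2 : ℕ) : ℝ) ^ s) ∘
        sigmaAntidiagonalEquivProd) ⟨q, b⟩ = ((q : ℕ) : ℝ) ^ s := by
    rintro ⟨⟨k, l⟩, h⟩
    change (k : ℝ) ^ s * (l : ℝ) ^ s = _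
    rw [← (Nat.mem_divisorsAntidiagonal.1 h).1, Nat.cast_mul,
      Real.mul_rpow (Nat.cast_nonneg _) (Nat.cast_nonneg _)]
  rw [tsum_congr hb, tsum_fintype, Finset.sum_const, Finset.card_univ, Fintype.card_coe,
    ← Nat.map_div_right_divisors, Finset.card_map, nsmul_eq_mul]

lemma card_divisors_mul_le (a b : ℕ) :
    (a * b).divisors.card ≤ a.divisors.card * b.divisors.card := by
  rw [Nat.divisors_mul]
  exact Finset.card_mul_le

/-- Submultiplicativity separates the fixed level `N`. The power `3/4` is retained only for `q`; for
quantities that are at least `1` it is bounded by the first power. -/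
lemma card_divisors_rpow_le {q N : ℕ} (hq : 0 < q) (hN : 0 < N) :
    (((q * N : ℕ) : ℝ) * (q * N).divisors.card : ℝ) ^ (3 / 4 : ℝ) ≤
      ((N : ℝ) * N.divisors.card) * (q.divisors.card * (q : ℝ) ^ (3 / 4 : ℝ)) := by
  have h1 : ((q * N).divisors.card : ℝ) ≤ q.divisors.card * N.divisors.card := by
    exact_mod_cast card_divisors_mul_le q N
  have hqd : (1 : ℝ) ≤ q.divisors.card := by
    exact_mod_cast Finset.card_pos.2 ⟨1, Nat.one_mem_divisors.2 hq.ne'⟩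
  have hNd : (1 : ℝ) ≤ N.divisors.card := by
    exact_mod_cast Finset.card_pos.2 ⟨1, Nat.one_mem_divisors.2 hN.ne'⟩
  have hN1 : (1 : ℝ) ≤ N := by exact_mod_cast hN
  have key : ∀ x : ℝ, 1 ≤ x → x ^ (3 / 4 : ℝ) ≤ x := fun x hx => by
    simpa using Real.rpow_le_rpow_of_exponent_le hx (by norm_num : (3 / 4 : ℝ) ≤ 1)
  calc _ ≤ ((q : ℝ) * ((N * N.divisors.card) * q.divisors.card)) ^ (3 / 4 : ℝ) := by
        refine Real.rpow_le_rpow (by positivity) ?_ (by norm_num)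
        push_cast
        calc (q : ℝ) * N * (q * N).divisors.card ≤ q * N * (q.divisors.card * N.divisors.card) := by
              gcongr
          _ = _ := by ring
    _ = (q : ℝ) ^ (3 / 4 : ℝ) * ((N * N.divisors.card) * q.divisors.card) ^ (3 / 4 : ℝ) :=
        Real.mul_rpow (by positivity) (by positivity)
    _ ≤ (q : ℝ) ^ (3 / 4 : ℝ) * ((N * N.divisors.card) * q.divisors.card) := by
        gcongr
        exact key _ (one_le_mul_of_one_le_of_one_le (one_le_mul_of_one_le_of_one_le hN1 hNd) hqd)
    _ = _ := by ring

variable {N : ℕ} [NeZero N]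

lemma hyperbolaCount_nonneg_le {m : ℕ} (hm : 0 < m) (r : ZMod N) (q : ℕ) :
    |hyperbolaCount m r q| ≤
      ((N : ℝ) * ((∑ y ∈ m.divisors, (y : ℝ)) * N)) * (q * q.divisors.card) := by
  rw [hyperbolaCount, abs_mul, abs_mul, Nat.abs_cast, Nat.abs_cast]
  have : |∑ l ∈ q.divisors, hyperbolaWeight m r l| ≤
      q.divisors.card * ((∑ y ∈ m.divisors, (y : ℝ)) * N) := by
    refine (Finset.abs_sum_le_sum_abs _ _).trans ?_
    rw [← nsmul_eq_mul]
    refine Finset.sum_le_card_nsmul _ _ _ fun l hl => ?_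
    refine (abs_hyperbolaWeight_le hm r l).trans (div_le_self (by positivity) ?_)
    exact_mod_cast Nat.pos_of_mem_divisors hl
  calc _ ≤ N * q * (q.divisors.card * ((∑ y ∈ m.divisors, (y : ℝ)) * N)) := by gcongr
    _ = _ := by ring

end DivisorSums

/-! ### The contribution of a single `c` to the product approximation. -/

section MainTerm

variable {N : ℕ} [NeZero N] {ε : ℂ} {y₀ : ℝ}

/-- The part with given `c` of the product approximation to the kernel. -/
def mainTerm (m : ℕ) (r : ZMod N) (w z : ℂ) (c : ℤ) (ε : ℂ) : ℂ :=
  regInv ε c * ∑' x : ℤ × ℤ, if c ∣ x.1 * x.2 - m ∧ (x.1 : ZMod N) = r then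
    regSeq ε z c x.1 * regSeq ε w c x.2 else 0

/-- The leading term of `mainTerm`. -/
def leadTerm (m : ℕ) (r : ZMod N) (w z : ℂ) (c : ℤ) (ε : ℂ) : ℂ :=
  lineIntegral ε w.im * lineIntegral ε z.im * ((N : ℂ) ^ 2)⁻¹ *
    (hyperbolaCount m r c.natAbs * regInv ε c)

lemma mem_hyperbola_natAbs_iff (m : ℕ) (r : ZMod N) {c : ℤ} [NeZero c.natAbs] (a d : ℤ) :
    ((a : ZMod (c.natAbs * N)), (d : ZMod (c.natAbs * N))) ∈
      hyperbola (Dvd.intro_left c.natAbs rfl : N ∣ c.natAbs * N) m r ↔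
      c ∣ a * d - m ∧ (a : ZMod N) = r := by
  have hN : (N : ℤ) ≠ 0 := by exact_mod_cast NeZero.ne N
  have e : (N : ZMod (c.natAbs * N)) * ((a : ZMod (c.natAbs * N)) * d - m) =
      ((N * (a * d - m) : ℤ) : ZMod (c.natAbs * N)) := by
    push_cast
    ring
  rw [hyperbola, Finset.mem_filter]
  simp only [Finset.mem_univ, true_and, map_intCast]
  rw [e, ZMod.intCast_zmod_eq_zero_iff_dvd, Nat.cast_mul, mul_comm (c.natAbs : ℤ),
    mul_dvd_mul_iff_left hN, Int.natAbs_dvd]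

/-- The constant in the approximation of `mainTerm` by `leadTerm`. -/
def mainConst (N m : ℕ) (y₀ : ℝ) : ℝ :=
  (2 * (N : ℝ) * (N * m) ^ 5) ^ (1 / 4 : ℝ) * heightConst ^ 2 * (seqConst y₀ * N) ^ 2 *
    (N * N.divisors.card) + 2 * seqConst y₀ ^ 2 *
      ((N : ℝ) * ((∑ y ∈ m.divisors, (y : ℝ)) * N))

lemma seqConst_nonneg (hy₀ : 0 < y₀) : 0 ≤ seqConst y₀ := by
  have := latticeConst_nonneg y₀
  rw [seqConst]
  positivity

lemma norm_regInv_intCast_le (hε : 0 ≤ ε.re) {c : ℤ} (hc : c ≠ 0) :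
    ‖regInv ε c‖ ≤ (|(c : ℝ)| ^ 2)⁻¹ := by
  have h1 : (1 : ℝ) ≤ |(c : ℝ)| := by exact_mod_cast Int.one_le_abs hc
  rw [norm_regInv_eq_rpow ε (by exact_mod_cast hc), Complex.norm_intCast, ← Real.rpow_natCast,
    ← Real.rpow_neg (abs_nonneg _)]
  exact Real.rpow_le_rpow_of_exponent_le h1 (by push_cast; linarith)

/-- There are two errors. Equidistribution modulo `Q = |c| N` costs `O((Q τ(Q))^(3/4))`. Replacing
each sequence sum by `|c|` times its line integral costs `O(|c|)` in the product, hence `O(τ(c))`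
after multiplication by the density `O(τ(c) / |c|)` of the hyperbola. The prefactor of size at most
`|c|⁻²` leaves `τ(c) |c|^(3/4 - 2)`, summable because Kloosterman's exponent is below `1`. -/
lemma norm_mainTerm_sub_leadTerm_le {m : ℕ} (hm : 0 < m) (r : ZMod N) (hε : IsSmall ε)
    (hy₀ : 0 < y₀) (hy₁ : y₀ ≤ 1) {w z : ℂ} (hw : y₀ ≤ w.im) (hz : y₀ ≤ z.im) {c : ℤ}
    (hc : c ≠ 0) :
    ‖mainTerm m r w z c ε - leadTerm m r w z c ε‖ ≤
      mainConst N m y₀ * (c.natAbs.divisors.card * (c.natAbs : ℝ) ^ (-(5 / 4) : ℝ)) := by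
  classical
  have : NeZero c.natAbs := ⟨Int.natAbs_ne_zero.2 hc⟩
  set q := c.natAbs with hq
  have hq0 : 0 < q := NeZero.pos q
  have hqR : (0 : ℝ) < q := by exact_mod_cast hq0
  have hqc : |(c : ℝ)| = q := by rw [hq, Nat.cast_natAbs, Int.cast_abs]
  have hN1 : (1 : ℝ) ≤ N := by exact_mod_cast NeZero.pos N
  have hNR : (0 : ℝ) < N := by linarith
  set K := seqConst y₀ with hK
  have hK0 : 0 ≤ K := seqConst_nonneg hy₀
  set X := hyperbola (Dvd.intro_left q rfl : N ∣ q * N) m r with hX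
  have hcard : (X.card : ℝ) = hyperbolaCount m r q := card_hyperbola_eq m r
  set p := regSeq ε w c with hp
  set t := regSeq ε z c with ht
  -- The sequences vary on the scale `q = |c|`, while the modulus is `q N`; enlarging the constant
  -- from `K` to `K N` accommodates both the sum and the second differences.
  have b1 : ∀ v : ℂ, y₀ ≤ v.im → ∑' n, ‖regSeq ε v c n‖ ≤ K * N * (q * N : ℕ) := fun v hv => by
    refine (tsum_norm_regSeq_le hε hy₀ hy₁ hv hc).trans ?_
    rw [hqc]
    push_cast
    have : K * q * 1 ≤ K * q * (N * N) := by
      gcongr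
      nlinarith
    linarith
  have b2 : ∀ v : ℂ, y₀ ≤ v.im →
      ∑' n, ‖secondDiff (regSeq ε v c) n‖ ≤ K * N / (q * N : ℕ) := fun v hv => by
    refine (tsum_norm_secondDiff_regSeq_le hε hy₀ hy₁ hv hc).trans_eq ?_
    rw [hqc, ← hK]
    push_cast
    field_simp
  have main := norm_tsum_hyperbola_sub_le (Dvd.intro_left q rfl : N ∣ q * N) hm r (B := K * N)
    (summable_norm_regSeq hε hy₀ hy₁ hw hc) (summable_norm_regSeq hε hy₀ hy₁ hz hc)
    (b1 w hw) (b2 w hw) (b1 z hz) (b2 z hz)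
  have e1 : (∑' x : ℤ × ℤ, if ((x.1 : ZMod (q * N)), (x.2 : ZMod (q * N))) ∈ X
        then t x.1 * p x.2 else 0) =
      ∑' x : ℤ × ℤ, if c ∣ x.1 * x.2 - m ∧ (x.1 : ZMod N) = r then t x.1 * p x.2 else 0 := by
    refine tsum_congr fun x => ?_
    exact if_congr (mem_hyperbola_natAbs_iff m r x.1 x.2) rfl rfl
  rw [← hX, ← hp, ← ht, e1] at main
  set S := ∑' x : ℤ × ℤ, if c ∣ x.1 * x.2 - m ∧ (x.1 : ZMod N) = r then t x.1 * p x.2 else 0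
    with hS
  set α := lineIntegral ε w.im
  set β := lineIntegral ε z.im
  have hα : ‖α‖ ≤ K := by
    refine (norm_lineIntegral_le_seqConst hε hy₀ hy₁ hw).trans ?_
    nlinarith [hε.2]
  have hP := norm_tsum_regSeq_sub_le hε hy₀ hy₁ hw hc
  have hR := norm_tsum_regSeq_sub_le hε hy₀ hy₁ hz hc
  rw [hqc] at hP hR
  have hR1 : ‖∑' n, t n‖ ≤ K * q := by
    refine (norm_tsum_le_tsum_norm (summable_norm_regSeq hε hy₀ hy₁ hz hc)).trans ?_
    rw [← hqc]
    exact tsum_norm_regSeq_le hε hy₀ hy₁ hz hc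
  have hprod : ‖(∑' n, p n) * (∑' n, t n) - (q : ℂ) ^ 2 * (α * β)‖ ≤ 2 * K ^ 2 * q := by
    have e : (∑' n, p n) * (∑' n, t n) - (q : ℂ) ^ 2 * (α * β) =
        (∑' n, p n - q * α) * (∑' n, t n) + q * α * (∑' n, t n - q * β) := by ring
    rw [e]
    refine (norm_add_le _ _).trans ?_
    rw [norm_mul, norm_mul, norm_mul, Complex.norm_natCast]
    have h1 : ‖∑' n, p n - q * α‖ * ‖∑' n, t n‖ ≤ K * (K * q) :=
      mul_le_mul (by simpa using hP) hR1 (norm_nonneg _) hK0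
    have h2 : q * ‖α‖ * ‖∑' n, t n - q * β‖ ≤ q * K * K :=
      mul_le_mul (by gcongr) (by simpa using hR) (norm_nonneg _) (by positivity)
    linarith
  have hqC : (q : ℂ) ≠ 0 := by exact_mod_cast hq0.ne'
  have hNC : (N : ℂ) ≠ 0 := by exact_mod_cast NeZero.ne N
  -- The first summand is the equidistribution error, the second the error in replacing the product
  -- of the two sums by `q² α β`.
  have split : S - α * β * ((N : ℂ) ^ 2)⁻¹ * X.card =
      (S - (((q * N : ℕ) : ℂ) ^ 2)⁻¹ * (X.card * ((∑' n, p n) * ∑' n, t n))) +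
      (((q * N : ℕ) : ℂ) ^ 2)⁻¹ * X.card *
        ((∑' n, p n) * (∑' n, t n) - (q : ℂ) ^ 2 * (α * β)) := by
    push_cast
    field_simp
    ring
  have hXb : (X.card : ℝ) ≤ ((N : ℝ) * ((∑ y ∈ m.divisors, (y : ℝ)) * N)) *
      (q * q.divisors.card) := by
    rw [hcard]
    exact (le_abs_self _).trans (hyperbolaCount_nonneg_le hm r q)
  set M : ℝ := (N : ℝ) * ((∑ y ∈ m.divisors, (y : ℝ)) * N) with hM
  have hM0 : 0 ≤ M := by positivity
  set D : ℝ := (q.divisors.card : ℝ) with hD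
  have hq34 : (1 : ℝ) ≤ (q : ℝ) ^ (3 / 4 : ℝ) :=
    Real.one_le_rpow (by exact_mod_cast hq0) (by norm_num)
  have hsecond : ‖(((q * N : ℕ) : ℂ) ^ 2)⁻¹ * X.card *
        ((∑' n, p n) * (∑' n, t n) - (q : ℂ) ^ 2 * (α * β))‖ ≤ 2 * K ^ 2 * M * D := by
    rw [norm_mul, norm_mul, norm_inv, norm_pow, Complex.norm_natCast, Complex.norm_natCast]
    calc _ ≤ (((q * N : ℕ) : ℝ) ^ 2)⁻¹ * (M * (q * D)) * (2 * K ^ 2 * q) := by gcongr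
      _ = 2 * K ^ 2 * M * D * (((N : ℝ) ^ 2)⁻¹) := by
          push_cast
          field_simp
      _ ≤ 2 * K ^ 2 * M * D * 1 := by
          gcongr
          exact inv_le_one_of_one_le₀ (one_le_pow₀ hN1)
      _ = _ := mul_one _
  have total : ‖S - α * β * ((N : ℂ) ^ 2)⁻¹ * X.card‖ ≤
      mainConst N m y₀ * (D * (q : ℝ) ^ (3 / 4 : ℝ)) := by
    rw [split]
    refine (norm_add_le _ _).trans ?_
    have h1 := main.trans (mul_le_mul_of_nonneg_left (card_divisors_rpow_le hq0 (NeZero.pos N))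
      (by positivity))
    have h2 : 2 * K ^ 2 * M * D * 1 ≤ 2 * K ^ 2 * M * D * (q : ℝ) ^ (3 / 4 : ℝ) := by gcongr
    rw [mainConst]
    linarith
  have e2 : mainTerm m r w z c ε - leadTerm m r w z c ε =
      regInv ε c * (S - α * β * ((N : ℂ) ^ 2)⁻¹ * X.card) := by
    have : (X.card : ℂ) = (hyperbolaCount m r q : ℂ) := by exact_mod_cast congrArg ((↑) : ℝ → ℂ) hcard
    rw [mainTerm, leadTerm, this]
    ring
  rw [e2, norm_mul]
  have h3 := norm_regInv_intCast_le hε.1 hc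
  rw [hqc] at h3
  calc _ ≤ ((q : ℝ) ^ 2)⁻¹ * (mainConst N m y₀ * (D * (q : ℝ) ^ (3 / 4 : ℝ))) :=
        mul_le_mul h3 total (norm_nonneg _) (by positivity)
    _ = mainConst N m y₀ * (D * (((q : ℝ) ^ (2 : ℕ))⁻¹ * (q : ℝ) ^ (3 / 4 : ℝ))) := by ring
    _ = _ := by
        rw [← Real.rpow_natCast, ← Real.rpow_neg hqR.le, ← Real.rpow_add hqR]
        norm_num

end MainTerm

/-! ### The limit `ε → 0` in the right half-plane. -/

section RegularizationFilter

/-- The filter of complex `ε` with positive real part tending to `0`. -/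
def regFilter : Filter ℂ := 𝓝[{ε : ℂ | 0 < ε.re}] 0

lemma eventually_isSmall : ∀ᶠ ε in regFilter, IsSmall ε ∧ 0 < ε.re := by
  have h1 : ∀ᶠ ε in regFilter, 0 < ε.re := eventually_mem_nhdsWithin
  have h2 : ∀ᶠ ε in regFilter, ‖ε‖ ≤ 1 / 4 := by
    refine Filter.Eventually.filter_mono nhdsWithin_le_nhds ?_
    filter_upwards [Metric.closedBall_mem_nhds (0 : ℂ) (by norm_num : (0 : ℝ) < 1 / 4)] with ε h
    simpa using h
  filter_upwards [h1, h2] with ε h1 h2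
  exact ⟨⟨h1.le, h2⟩, h1⟩

lemma tendsto_regFilter_id : Tendsto (fun ε : ℂ => ε) regFilter (𝓝 0) :=
  tendsto_id.mono_left nhdsWithin_le_nhds

lemma tendsto_regInv_left (w : ℂ) : Tendsto (fun ε => regInv ε w) regFilter (𝓝 (regInv 0 w)) :=
  ((continuous_regInv_left w).tendsto 0).mono_left nhdsWithin_le_nhds

end RegularizationFilter

/-! ### Summation over `c` and the limit of the product approximation. -/

section MainSum

set_option linter.unusedSectionVars false

variable {N : ℕ} [NeZero N] {ε : ℂ} {y₀ : ℝ}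

lemma summable_mainTerm_bound (hy₀ : 0 < y₀) (hy₁ : y₀ ≤ 1) {w z : ℂ} (hw : y₀ ≤ w.im)
    (hz : y₀ ≤ z.im) {c : ℤ} (hc : c ≠ 0) :
    Summable fun x : ℤ × ℤ => (‖z + x.1 / c‖ ^ 2)⁻¹ * (‖w + x.2 / c‖ ^ 2)⁻¹ :=
  (latticeSum hy₀ hy₁ hz hc).1.mul_of_nonneg (latticeSum hy₀ hy₁ hw hc).1
    (fun _ => by positivity) fun _ => by positivity

lemma norm_regSeq_mul_le (hε : IsSmall ε) (hy₀ : 0 < y₀) (hy₁ : y₀ ≤ 1) {w z : ℂ}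
    (hw : y₀ ≤ w.im) (hz : y₀ ≤ z.im) (c : ℤ) (x : ℤ × ℤ) :
    ‖regSeq ε z c x.1 * regSeq ε w c x.2‖ ≤
      y₀⁻¹ ^ 2 * ((‖z + x.1 / c‖ ^ 2)⁻¹ * (‖w + x.2 / c‖ ^ 2)⁻¹) := by
  rw [norm_mul]
  refine (mul_le_mul (norm_regSeq_le hε hy₀ hy₁ hz c x.1) (norm_regSeq_le hε hy₀ hy₁ hw c x.2)
    (norm_nonneg _) (by positivity)).trans_eq (by ring)

/-- For a fixed `c` the double series converges absolutely even at `ε = 0`; only the sum over `c`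
needs the regularization. -/
lemma tendsto_mainTerm (m : ℕ) (r : ZMod N) (hy₀ : 0 < y₀) (hy₁ : y₀ ≤ 1) {w z : ℂ}
    (hw : y₀ ≤ w.im) (hz : y₀ ≤ z.im) {c : ℤ} (hc : c ≠ 0) :
    Tendsto (mainTerm m r w z c) regFilter (𝓝 (mainTerm m r w z c 0)) := by
  refine (tendsto_regInv_left c).mul (tendsto_tsum_of_dominated_convergence
    ((summable_mainTerm_bound hy₀ hy₁ hw hz hc).mul_left (y₀⁻¹ ^ 2)) (fun x => ?_) ?_)
  · split_ifs
    · exact (tendsto_regInv_left _).mul (tendsto_regInv_left _)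
    · exact tendsto_const_nhds
  · filter_upwards [eventually_isSmall] with ε hε x
    split_ifs
    · exact norm_regSeq_mul_le hε.1 hy₀ hy₁ hw hz c x
    · rw [norm_zero]
      positivity

lemma tendsto_lineIntegral (hy₀ : 0 < y₀) (hy₁ : y₀ ≤ 1) {y : ℝ} (hy : y₀ ≤ y) :
    Tendsto (fun ε => lineIntegral ε y) regFilter (𝓝 0) := by
  have h : Tendsto (fun ε : ℂ => seqConst y₀ * ‖ε‖) regFilter (𝓝 0) := by
    simpa using tendsto_regFilter_id.norm.const_mul (seqConst y₀)
  refine squeeze_zero_norm' ?_ h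
  filter_upwards [eventually_isSmall] with ε hε
  exact norm_lineIntegral_le_seqConst hε.1 hy₀ hy₁ hy

lemma tendsto_leadTerm (m : ℕ) (r : ZMod N) (hy₀ : 0 < y₀) (hy₁ : y₀ ≤ 1) {w z : ℂ}
    (hw : y₀ ≤ w.im) (hz : y₀ ≤ z.im) (c : ℤ) :
    Tendsto (leadTerm m r w z c) regFilter (𝓝 0) := by
  have := (((tendsto_lineIntegral hy₀ hy₁ hw).mul (tendsto_lineIntegral hy₀ hy₁ hz)).mul_const
    ((N : ℂ) ^ 2)⁻¹).mul ((tendsto_regInv_left c).const_mul (hyperbolaCount m r c.natAbs : ℂ))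
  simp only [zero_mul] at this
  exact this

/-- The sum of `leadTerm` over all admissible `c`, without the line integrals. -/
def countTerm (m : ℕ) (r ρ : ZMod N) (ε : ℂ) (c : ℤ) : ℂ :=
  if c ≠ 0 ∧ (c : ZMod N) = ρ then hyperbolaCount m r c.natAbs * regInv ε c else 0

lemma regInv_natCast (ε : ℂ) {q : ℕ} (hq : 0 < q) : regInv ε q = (q : ℂ) ^ (-2 - 2 * ε) := by
  have h : (q : ℂ) ≠ 0 := by exact_mod_cast hq.ne'
  rw [regInv, Complex.cpow_sub _ _ h, Complex.cpow_neg, div_eq_mul_inv, ← Complex.cpow_neg _ (2 * ε),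
    Complex.cpow_def_of_ne_zero h (-(2 * ε)), Complex.norm_natCast, Complex.natCast_log]
  congr 2
  · norm_cast
  · ring

lemma regInv_neg (ε w : ℂ) : regInv ε (-w) = regInv ε w := by simp [regInv]

lemma countTerm_natCast (m : ℕ) (r ρ : ZMod N) (ε : ℂ) (q : ℕ+) :
    countTerm m r ρ ε ((q : ℕ) : ℤ) = if ((q : ℕ) : ZMod N) = ρ then
      (hyperbolaCount m r q : ℂ) * ((q : ℕ) : ℂ) ^ (-2 - 2 * ε) else 0 := by
  rw [countTerm, ← regInv_natCast ε q.pos]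
  simp

lemma countTerm_neg (m : ℕ) (r ρ : ZMod N) (ε : ℂ) (q : ℕ+) :
    countTerm m r ρ ε (-((q : ℕ) : ℤ)) = if ((q : ℕ) : ZMod N) = -ρ then
      (hyperbolaCount m r q : ℂ) * ((q : ℕ) : ℂ) ^ (-2 - 2 * ε) else 0 := by
  rw [countTerm, ← regInv_natCast ε q.pos]
  have : (-((q : ℕ) : ZMod N) = ρ) ↔ ((q : ℕ) : ZMod N) = -ρ := neg_eq_iff_eq_neg
  simp [regInv_neg, this]

lemma summable_countTerm {m : ℕ} (hm : 0 < m) (r ρ : ZMod N) (hpos : 0 < ε.re) :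
    Summable (countTerm m r ρ ε) := by
  refine summable_int_of_pnat ?_ ?_
  · simp only [countTerm_natCast]
    exact (hasSum_hyperbolaCount hm r ρ hpos).summable
  · simp only [countTerm_neg]
    exact (hasSum_hyperbolaCount hm r (-ρ) hpos).summable

lemma exists_norm_countSum_le {m : ℕ} (hm : 0 < m) (r ρ : ZMod N) :
    ∃ C : ℝ, 0 ≤ C ∧ ∀ ε : ℂ, IsSmall ε → 0 < ε.re →
      ‖∑' c, countTerm m r ρ ε c‖ ≤ C / ‖ε‖ := by
  obtain ⟨C₁, h₁, H₁⟩ := exists_norm_hyperbolaSum_le hm r ρ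
  obtain ⟨C₂, h₂, H₂⟩ := exists_norm_hyperbolaSum_le hm r (-ρ)
  refine ⟨C₁ + C₂, by positivity, fun ε hε hpos => ?_⟩
  rw [tsum_int_eq_tsum_pnat (by simp [countTerm])
    (by simpa only [countTerm_natCast] using (hasSum_hyperbolaCount hm r ρ hpos).summable)
    (by simpa only [countTerm_neg] using (hasSum_hyperbolaCount hm r (-ρ) hpos).summable), add_div]
  simp only [countTerm_natCast, countTerm_neg]
  exact (norm_add_le _ _).trans (add_le_add (H₁ ε hε hpos) (H₂ ε hε hpos))

/-- The product approximation to the kernel: the terms `mainTerm` in a class modulo `N`. -/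
def classTerm (m : ℕ) (r ρ : ZMod N) (w z : ℂ) (ε : ℂ) (c : ℤ) : ℂ :=
  if c ≠ 0 ∧ (c : ZMod N) = ρ then mainTerm m r w z c ε else 0

/-- The terms `leadTerm` in a class modulo `N`. -/
def classLead (m : ℕ) (r ρ : ZMod N) (w z : ℂ) (ε : ℂ) (c : ℤ) : ℂ :=
  if c ≠ 0 ∧ (c : ZMod N) = ρ then leadTerm m r w z c ε else 0

/-- The summable majorant of `classTerm - classLead`. -/
def classBound (N m : ℕ) (y₀ : ℝ) (c : ℤ) : ℝ :=
  mainConst N m y₀ * (c.natAbs.divisors.card * (c.natAbs : ℝ) ^ (-(5 / 4) : ℝ))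

lemma mainConst_nonneg (N m : ℕ) (y₀ : ℝ) : 0 ≤ mainConst N m y₀ := by
  rw [mainConst]
  positivity

lemma summable_classBound (N m : ℕ) (y₀ : ℝ) : Summable (classBound N m y₀) := by
  have h := (summable_card_divisors_mul (s := -(5 / 4)) (by norm_num)).mul_left (mainConst N m y₀)
  refine summable_int_of_pnat ?_ ?_
  · simpa [classBound] using h
  · simpa [classBound] using h

lemma norm_classTerm_sub_le {m : ℕ} (hm : 0 < m) (r ρ : ZMod N) (hε : IsSmall ε)
    (hy₀ : 0 < y₀) (hy₁ : y₀ ≤ 1) {w z : ℂ} (hw : y₀ ≤ w.im) (hz : y₀ ≤ z.im) (c : ℤ) :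
    ‖classTerm m r ρ w z ε c - classLead m r ρ w z ε c‖ ≤ classBound N m y₀ c := by
  rw [classTerm, classLead]
  split_ifs with h
  · exact norm_mainTerm_sub_leadTerm_le hm r hε hy₀ hy₁ hw hz h.1
  · have := mainConst_nonneg N m y₀
    rw [sub_zero, norm_zero, classBound]
    positivity

lemma classLead_eq (m : ℕ) (r ρ : ZMod N) (w z : ℂ) (ε : ℂ) (c : ℤ) :
    classLead m r ρ w z ε c = lineIntegral ε w.im * lineIntegral ε z.im * ((N : ℂ) ^ 2)⁻¹ *
      countTerm m r ρ ε c := by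
  rw [classLead, countTerm]
  split_ifs
  · rfl
  · simp

lemma summable_classLead {m : ℕ} (hm : 0 < m) (r ρ : ZMod N) (hpos : 0 < ε.re) (w z : ℂ) :
    Summable (classLead m r ρ w z ε) := by
  rw [funext (classLead_eq m r ρ w z ε)]
  exact (summable_countTerm hm r ρ hpos).mul_left _

/-- Two line integrals of size `O(|ε|)` meet a Dirichlet series of size `O(1/|ε|)`. -/
lemma exists_norm_classLeadSum_le {m : ℕ} (hm : 0 < m) (r ρ : ZMod N) (hy₀ : 0 < y₀)
    (hy₁ : y₀ ≤ 1) :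
    ∃ C : ℝ, 0 ≤ C ∧ ∀ ε : ℂ, IsSmall ε → 0 < ε.re → ∀ w z : ℂ, y₀ ≤ w.im → y₀ ≤ z.im →
      ‖∑' c, classLead m r ρ w z ε c‖ ≤ C * ‖ε‖ := by
  obtain ⟨C, hC, H⟩ := exists_norm_countSum_le hm r ρ
  have hK := seqConst_nonneg hy₀
  refine ⟨seqConst y₀ ^ 2 * ((N : ℝ) ^ 2)⁻¹ * C, by positivity, fun ε hε hpos w z hw hz => ?_⟩
  simp only [classLead_eq]
  rw [tsum_mul_left, norm_mul, norm_mul, norm_mul, norm_inv, norm_pow, Complex.norm_natCast]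
  have hε0 : ‖ε‖ ≠ 0 := norm_ne_zero_iff.2 fun h => by simp [h] at hpos
  calc _ ≤ (seqConst y₀ * ‖ε‖) * (seqConst y₀ * ‖ε‖) * ((N : ℝ) ^ 2)⁻¹ * (C / ‖ε‖) := by
        gcongr
        · exact norm_lineIntegral_le_seqConst hε hy₀ hy₁ hw
        · exact norm_lineIntegral_le_seqConst hε hy₀ hy₁ hz
        · exact H ε hε hpos
    _ = _ := by field_simp

lemma tsum_classTerm_eq {m : ℕ} (hm : 0 < m) (r ρ : ZMod N) (hε : IsSmall ε) (hpos : 0 < ε.re)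
    (hy₀ : 0 < y₀) (hy₁ : y₀ ≤ 1) {w z : ℂ} (hw : y₀ ≤ w.im) (hz : y₀ ≤ z.im) :
    ∑' c, classTerm m r ρ w z ε c =
      ∑' c, (classTerm m r ρ w z ε c - classLead m r ρ w z ε c) +
        ∑' c, classLead m r ρ w z ε c := by
  rw [← Summable.tsum_add (.of_norm_bounded (summable_classBound N m y₀)
    (norm_classTerm_sub_le hm r ρ hε hy₀ hy₁ hw hz)) (summable_classLead hm r ρ hpos w z)]
  simp

lemma exists_norm_classSum_main_le {m : ℕ} (hm : 0 < m) (r ρ : ZMod N) (hy₀ : 0 < y₀)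
    (hy₁ : y₀ ≤ 1) :
    ∃ C : ℝ, ∀ ε : ℂ, IsSmall ε → 0 < ε.re → ∀ w z : ℂ, y₀ ≤ w.im → y₀ ≤ z.im →
      ‖∑' c, classTerm m r ρ w z ε c‖ ≤ C := by
  obtain ⟨C, hC, H⟩ := exists_norm_classLeadSum_le hm r ρ hy₀ hy₁
  refine ⟨∑' c, classBound N m y₀ c + C, fun ε hε hpos w z hw hz => ?_⟩
  rw [tsum_classTerm_eq hm r ρ hε hpos hy₀ hy₁ hw hz]
  refine (norm_add_le _ _).trans (add_le_add ?_ ?_)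
  · exact tsum_of_norm_bounded (summable_classBound N m y₀).hasSum
      (norm_classTerm_sub_le hm r ρ hε hy₀ hy₁ hw hz)
  · exact (H ε hε hpos w z hw hz).trans (mul_le_of_le_one_right hC (hε.2.trans (by norm_num)))

/-- The differences `classTerm - classLead` have a summable majorant independent of `ε`, so the
limit may be taken termwise; the sum of the leading terms tends to zero. The limit is the sum over
`c` of the unregularized terms. -/
lemma exists_tendsto_classSum {m : ℕ} (hm : 0 < m) (r ρ : ZMod N) (hy₀ : 0 < y₀)
    (hy₁ : y₀ ≤ 1) {w z : ℂ} (hw : y₀ ≤ w.im) (hz : y₀ ≤ z.im) :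
    ∃ L : ℂ, Tendsto (fun ε => ∑' c, classTerm m r ρ w z ε c) regFilter (𝓝 L) := by
  refine ⟨∑' c, classTerm m r ρ w z 0 c, ?_⟩
  have h1 : Tendsto (fun ε => ∑' c, (classTerm m r ρ w z ε c - classLead m r ρ w z ε c))
      regFilter (𝓝 (∑' c, classTerm m r ρ w z 0 c)) := by
    refine tendsto_tsum_of_dominated_convergence (summable_classBound N m y₀) (fun c => ?_) ?_
    · simp only [classTerm, classLead]
      split_ifs with h
      · simpa using (tendsto_mainTerm m r hy₀ hy₁ hw hz h.1).sub
          (tendsto_leadTerm m r hy₀ hy₁ hw hz c)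
      · simpa using tendsto_const_nhds
    · filter_upwards [eventually_isSmall] with ε hε
      exact norm_classTerm_sub_le hm r ρ hε.1 hy₀ hy₁ hw hz
  obtain ⟨C, hC, H⟩ := exists_norm_classLeadSum_le hm r ρ hy₀ hy₁
  have h2 : Tendsto (fun ε => ∑' c, classLead m r ρ w z ε c) regFilter (𝓝 0) := by
    have h : Tendsto (fun ε : ℂ => C * ‖ε‖) regFilter (𝓝 0) := by
      simpa using tendsto_regFilter_id.norm.const_mul C
    refine squeeze_zero_norm' ?_ h
    filter_upwards [eventually_isSmall] with ε hε
    exact H ε hε.1 hε.2 w z hw hz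
  have h3 := h1.add h2
  rw [add_zero] at h3
  refine h3.congr' ?_
  filter_upwards [eventually_isSmall] with ε hε
  exact (tsum_classTerm_eq hm r ρ hε.1 hε.2 hy₀ hy₁ hw hz).symm

end MainSum

/-! ### Majorants for sums over triples `(c, a, d)`. -/

section TripleSums

variable {y₀ : ℝ}

/-- If `d` and `d₀` both solve `c ∣ a d - m`, then computing `a d d₀` in two ways gives `c ∣ m (d -
d₀)`. Hence `d/c` runs through a subset of `d₀/c + (1/m)ℤ`, and the bound depends on `m` but not on
`c`. -/
lemma tsum_dvd_le (hy₀ : 0 < y₀) (hy₁ : y₀ ≤ 1) {w : ℂ} (hw : y₀ ≤ w.im) {m : ℕ} (hm : 0 < m)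
    {c : ℤ} (hc : c ≠ 0) (a : ℤ) :
    ∑' d : ℤ, (if c ∣ a * d - m then (‖w + d / c‖ ^ 2)⁻¹ else 0) ≤ latticeConst y₀ * m := by
  classical
  have : NeZero m := ⟨hm.ne'⟩
  have hcC : (c : ℂ) ≠ 0 := by exact_mod_cast hc
  have hmC : (m : ℂ) ≠ 0 := by exact_mod_cast hm.ne'
  by_cases h : ∃ d₀ : ℤ, c ∣ a * d₀ - m
  · obtain ⟨d₀, hd₀⟩ := h
    set S : Set ℤ := {d | c ∣ a * d - m} with hS
    have e1 : ∑' d : ℤ, (if c ∣ a * d - m then (‖w + d / c‖ ^ 2)⁻¹ else 0) =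
        ∑' d : S, (‖w + (d : ℤ) / c‖ ^ 2)⁻¹ := by
      rw [tsum_subtype S fun d : ℤ => (‖w + d / c‖ ^ 2)⁻¹]
      refine tsum_congr fun d => ?_
      rw [Set.indicator_apply]
      exact if_congr Iff.rfl rfl rfl
    have hdvd : ∀ d : S, c ∣ m * ((d : ℤ) - d₀) := by
      rintro ⟨d, hd⟩
      obtain ⟨k, hk⟩ := hd
      obtain ⟨l, hl⟩ := hd₀
      refine ⟨-l * (d - d₀) + (k - l) * d₀, ?_⟩
      dsimp only
      linear_combination (-(d - d₀)) * hl + d₀ * (hk - hl)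
    have hdiv : ∀ d : S, ((m : ℂ) * ((d : ℤ) - d₀)) / c = ((m * ((d : ℤ) - d₀) / c : ℤ) : ℂ) := by
      intro d
      rw [Int.cast_div (hdvd d) hcC]
      push_cast
      ring
    set i : S → ℤ := fun d => m * ((d : ℤ) - d₀) / c with hi
    have hinj : Function.Injective i := by
      intro d e h
      have h1 := hdiv d
      have h2 := hdiv e
      simp only [hi] at h
      rw [h, ← h2] at h1
      field_simp at h1
      have h3 : ((d : ℤ) : ℂ) = ((e : ℤ) : ℂ) := by linear_combination h1
      exact Subtype.ext (by exact_mod_cast h3)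
    have him : y₀ ≤ (w + d₀ / c).im := by
      have : (w + d₀ / c).im = w.im := by
        have e : (w + d₀ / c) = w + ((d₀ / c : ℝ) : ℂ) := by push_cast; ring
        rw [e]
        simp
      rwa [this]
    obtain ⟨h1, h2⟩ := latticeSum_natCast hy₀ hy₁ him m
    rw [e1]
    refine le_trans (le_of_eq ?_) ((tsum_comp_le_tsum_of_inj h1 (fun _ => by positivity)
      hinj).trans h2)
    refine tsum_congr fun d => ?_
    simp only [Function.comp, hi]
    rw [← hdiv d]
    congr 3
    field_simp
    ring
  · push Not at h
    simp only [h, if_false, tsum_zero]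
    exact mul_nonneg (latticeConst_nonneg _) (Nat.cast_nonneg _)

/-- A product of two lattice majorants. -/
def pairBound (w z : ℂ) (c : ℤ) (x : ℤ × ℤ) : ℝ :=
  (‖z + x.1 / c‖ ^ 2)⁻¹ * (‖w + x.2 / c‖ ^ 2)⁻¹

lemma pairBound_nonneg (w z : ℂ) (c : ℤ) (x : ℤ × ℤ) : 0 ≤ pairBound w z c x := by
  rw [pairBound]
  positivity

lemma summable_pairBound (hy₀ : 0 < y₀) (hy₁ : y₀ ≤ 1) {w z : ℂ} (hw : y₀ ≤ w.im)
    (hz : y₀ ≤ z.im) {c : ℤ} (hc : c ≠ 0) : Summable (pairBound w z c) :=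
  summable_mainTerm_bound hy₀ hy₁ hw hz hc

/-- The part of `pairBound` on `c ∣ a d - m`. -/
def dvdBound (m : ℕ) (w z : ℂ) (c : ℤ) (x : ℤ × ℤ) : ℝ :=
  if c ∣ x.1 * x.2 - m then pairBound w z c x else 0

lemma dvdBound_nonneg (m : ℕ) (w z : ℂ) (c : ℤ) (x : ℤ × ℤ) : 0 ≤ dvdBound m w z c x := by
  rw [dvdBound]
  split_ifs
  · exact pairBound_nonneg w z c x
  · exact le_rfl

lemma dvdBound_le (m : ℕ) (w z : ℂ) (c : ℤ) (x : ℤ × ℤ) :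
    dvdBound m w z c x ≤ pairBound w z c x := by
  rw [dvdBound]
  split_ifs
  · exact le_rfl
  · exact pairBound_nonneg w z c x

lemma summable_dvdBound (hy₀ : 0 < y₀) (hy₁ : y₀ ≤ 1) {w z : ℂ} (hw : y₀ ≤ w.im)
    (hz : y₀ ≤ z.im) (m : ℕ) {c : ℤ} (hc : c ≠ 0) : Summable (dvdBound m w z c) :=
  (summable_pairBound hy₀ hy₁ hw hz hc).of_nonneg_of_le (dvdBound_nonneg m w z c)
    (dvdBound_le m w z c)

/-- The divisibility condition leaves a bounded sum over `d` for each `a`, so the total is `O(|c|)`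
instead of `O(c²)`. -/
lemma tsum_dvdBound_le (hy₀ : 0 < y₀) (hy₁ : y₀ ≤ 1) {w z : ℂ} (hw : y₀ ≤ w.im)
    (hz : y₀ ≤ z.im) {m : ℕ} (hm : 0 < m) {c : ℤ} (hc : c ≠ 0) :
    ∑' x, dvdBound m w z c x ≤ latticeConst y₀ ^ 2 * m * |(c : ℝ)| := by
  obtain ⟨h3, h4⟩ := latticeSum hy₀ hy₁ hz hc
  have hL := latticeConst_nonneg y₀
  have hs := summable_dvdBound hy₀ hy₁ hw hz m hc
  rw [hs.tsum_prod]
  have hb : ∀ a : ℤ, ∑' d : ℤ, dvdBound m w z c (a, d) ≤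
      (‖z + a / c‖ ^ 2)⁻¹ * (latticeConst y₀ * m) := by
    intro a
    have e : ∀ d : ℤ, dvdBound m w z c (a, d) = (‖z + a / c‖ ^ 2)⁻¹ *
        (if c ∣ a * d - m then (‖w + d / c‖ ^ 2)⁻¹ else 0) := by
      intro d
      simp only [dvdBound, pairBound, mul_ite, mul_zero]
    simp only [e]
    rw [tsum_mul_left]
    exact mul_le_mul_of_nonneg_left (tsum_dvd_le hy₀ hy₁ hw hm hc a) (by positivity)
  refine (hs.prod.tsum_le_tsum hb (h3.mul_right _)).trans ?_
  rw [tsum_mul_right]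
  calc _ ≤ (latticeConst y₀ * |(c : ℝ)|) * (latticeConst y₀ * m) := by gcongr
    _ = _ := by ring

/-- The majorant of the terms with `c ≠ 0`, with exponent `s` of `|c|`. -/
def tripleBound (m : ℕ) (w z : ℂ) (s : ℝ) (t : ℤ × ℤ × ℤ) : ℝ :=
  if t.1 ≠ 0 then |(t.1 : ℝ)| ^ s * dvdBound m w z t.1 t.2 else 0

lemma tripleBound_nonneg (m : ℕ) (w z : ℂ) (s : ℝ) (t : ℤ × ℤ × ℤ) :
    0 ≤ tripleBound m w z s t := by
  rw [tripleBound]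
  split_ifs
  · exact mul_nonneg (by positivity) (dvdBound_nonneg _ _ _ _ _)
  · exact le_rfl

lemma summable_abs_rpow {s : ℝ} (hs : s < -1) :
    Summable fun c : ℤ => if c ≠ 0 then |(c : ℝ)| ^ s else 0 := by
  have h : Summable fun q : ℕ+ => ((q : ℕ) : ℝ) ^ s :=
    (Real.summable_nat_rpow.2 hs).comp_injective PNat.coe_injective
  refine summable_int_of_pnat ?_ ?_
  · simpa using h
  · simpa using h

/-- The inner sum contributes one factor `|c|`, whence the condition `s < -2`. It is used with `s =
-2 - 2 Re ε` for absolute convergence and with `s = -4` for estimates uniform in `ε`. -/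
lemma summable_and_tsum_tripleBound_le (hy₀ : 0 < y₀) (hy₁ : y₀ ≤ 1) {w z : ℂ} (hw : y₀ ≤ w.im)
    (hz : y₀ ≤ z.im) {m : ℕ} (hm : 0 < m) {s : ℝ} (hs : s < -2) :
    Summable (tripleBound m w z s) ∧ ∑' t, tripleBound m w z s t ≤
      latticeConst y₀ ^ 2 * m * ∑' c : ℤ, if c ≠ 0 then |(c : ℝ)| ^ (s + 1) else 0 := by
  have hb : ∀ c : ℤ, ∑' x, tripleBound m w z s (c, x) ≤
      latticeConst y₀ ^ 2 * m * (if c ≠ 0 then |(c : ℝ)| ^ (s + 1) else 0) := by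
    intro c
    simp only [tripleBound]
    split_ifs with hc
    · have hc0 : 0 < |(c : ℝ)| := abs_pos.2 (by exact_mod_cast hc)
      rw [tsum_mul_left, Real.rpow_add hc0, Real.rpow_one]
      calc _ ≤ |(c : ℝ)| ^ s * (latticeConst y₀ ^ 2 * m * |(c : ℝ)|) := by
            gcongr
            exact tsum_dvdBound_le hy₀ hy₁ hw hz hm hc
        _ = _ := by ring
    · simp
  have hs1 := (summable_abs_rpow (s := s + 1) (by linarith)).mul_left (latticeConst y₀ ^ 2 * m)
  have hsum : Summable (tripleBound m w z s) := by
    rw [summable_prod_of_nonneg (tripleBound_nonneg m w z s)]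
    refine ⟨fun c => ?_, hs1.of_nonneg_of_le (fun c => tsum_nonneg fun _ =>
      tripleBound_nonneg _ _ _ _ _) hb⟩
    simp only [tripleBound]
    split_ifs with hc
    · exact (summable_dvdBound hy₀ hy₁ hw hz m hc).mul_left _
    · exact summable_zero
  refine ⟨hsum, ?_⟩
  rw [hsum.tsum_prod, ← tsum_mul_left]
  exact hsum.prod.tsum_le_tsum hb hs1

end TripleSums

/-! ### Perturbation of a factor by the determinant. -/

section FactorEstimates

variable {y₀ : ℝ} {ε : ℂ}

/-- The perturbation of the factor `B` caused by the determinant. -/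
def perturbation (m : ℕ) (c : ℤ) (A : ℂ) : ℂ := -(m / ((c : ℂ) ^ 2 * A))

/-- The map `A ↦ -1/A` preserves the upper half plane. The sign is the one that pushes `B` further
away from `0`. -/
lemma perturbation_im_nonneg (m : ℕ) (c : ℤ) {A : ℂ} (hA : 0 ≤ A.im) :
    0 ≤ (perturbation m c A).im := by
  have e : perturbation m c A = ((m / (c : ℝ) ^ 2 : ℝ) : ℂ) * -A⁻¹ := by
    rw [perturbation]
    push_cast
    rw [div_mul_eq_div_div, div_eq_mul_inv _ A]
    ring
  rw [e, Complex.im_ofReal_mul, Complex.neg_im, Complex.inv_im, neg_div, neg_neg]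
  have := Complex.normSq_nonneg A
  positivity

lemma norm_perturbation_le (hy₀ : 0 < y₀) (m : ℕ) (c : ℤ) {A : ℂ} (hA : y₀ ≤ ‖A‖) :
    ‖perturbation m c A‖ ≤ m / y₀ * ((c : ℝ) ^ 2)⁻¹ := by
  rw [perturbation, norm_neg, norm_div, norm_mul, norm_pow, Complex.norm_natCast,
    Complex.norm_intCast, sq_abs, div_mul_eq_div_div, div_eq_mul_inv _ ((c : ℝ) ^ 2), mul_div_right_comm]
  gcongr

/-- The constant comparing `B` with its perturbations. -/
def perturbConst (m : ℕ) (y₀ : ℝ) : ℝ := 1 + m / y₀ / y₀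

/-- The imaginary part can only grow along the segment, which gives the lower bound. The
perturbation has norm at most `m / y₀`, which is absorbed because `‖B + t v‖ ≥ y₀`. -/
lemma le_norm_add_perturbation (hy₀ : 0 < y₀) (m : ℕ) {c : ℤ} (hc : c ≠ 0) {A B : ℂ}
    (hA : y₀ ≤ A.im) (hB : y₀ ≤ B.im) {t : ℝ} (ht : t ∈ Set.Icc (0 : ℝ) 1) :
    y₀ ≤ ‖B + t * perturbation m c A‖ ∧
      ‖B‖ ≤ perturbConst m y₀ * ‖B + t * perturbation m c A‖ := by
  have him := perturbation_im_nonneg m c (hy₀.le.trans hA)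
  have h1 : y₀ ≤ ‖B + t * perturbation m c A‖ := by
    refine le_trans ?_ (Complex.im_le_norm _)
    rw [Complex.add_im, Complex.im_ofReal_mul]
    nlinarith [mul_nonneg ht.1 him]
  refine ⟨h1, ?_⟩
  have hc1 : (1 : ℝ) ≤ (c : ℝ) ^ 2 := by
    have h : (0 : ℤ) < c ^ 2 := by positivity
    exact_mod_cast h
  have h2 : ‖t * perturbation m c A‖ ≤ m / y₀ := by
    rw [norm_mul, Complex.norm_real, Real.norm_of_nonneg ht.1]
    have h3 := norm_perturbation_le hy₀ m c (hA.trans (Complex.im_le_norm A))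
    have h4 : m / y₀ * ((c : ℝ) ^ 2)⁻¹ ≤ m / y₀ * 1 := by
      gcongr
      exact inv_le_one_of_one_le₀ hc1
    calc _ ≤ 1 * (m / y₀) := mul_le_mul ht.2 (by linarith) (norm_nonneg _) zero_le_one
      _ = _ := one_mul _
  have h5 : ‖B‖ ≤ ‖B + t * perturbation m c A‖ + m / y₀ := by
    calc ‖B‖ = ‖(B + t * perturbation m c A) - t * perturbation m c A‖ := by rw [add_sub_cancel_right]
      _ ≤ _ := (norm_sub_le _ _).trans (by gcongr)
  have h6 : m / y₀ ≤ m / y₀ / y₀ * ‖B + t * perturbation m c A‖ := by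
    rw [div_mul_eq_mul_div, le_div_iff₀ hy₀]
    gcongr
  rw [perturbConst]
  linarith

/-- Mean value inequality along `B + t v`, `0 ≤ t ≤ 1`; this segment stays away from zero, and `v =
O(c⁻²)` provides the gain. -/
lemma norm_regInv_perturb_sub_le (hε : IsSmall ε) (hy₀ : 0 < y₀) (hy₁ : y₀ ≤ 1) (m : ℕ) {c : ℤ}
    (hc : c ≠ 0) {A B : ℂ} (hA : y₀ ≤ A.im) (hB : y₀ ≤ B.im) :
    ‖regInv ε (B + perturbation m c A) - regInv ε B‖ ≤
      5 / 2 * y₀⁻¹ * (m / y₀ * ((c : ℝ) ^ 2)⁻¹) * (perturbConst m y₀ ^ 3 * (‖B‖ ^ 3)⁻¹) := by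
  set v := perturbation m c A with hv
  have hB0 : 0 < ‖B‖ := hy₀.trans_le (hB.trans (Complex.im_le_norm B))
  have key := norm_image_sub_le_of_norm_deriv_le_segment_01'
    (f := fun t : ℝ => regInv ε (B + t * v))
    (f' := fun t : ℝ => regInv ε (B + t * v) * regInvLogDeriv ε (v / (B + t * v)))
    (C := 5 / 2 * y₀⁻¹ * (m / y₀ * ((c : ℝ) ^ 2)⁻¹) * (perturbConst m y₀ ^ 3 * (‖B‖ ^ 3)⁻¹))
    (fun t ht => (hasDerivAt_regInv ε (norm_pos_iff.1 (hy₀.trans_le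
      (le_norm_add_perturbation hy₀ m hc hA hB ht).1))).hasDerivWithinAt) ?_
  · simpa using key
  · intro t ht
    obtain ⟨h1, h2⟩ := le_norm_add_perturbation hy₀ m hc hA hB (Set.Ico_subset_Icc_self ht)
    refine (norm_regInv_deriv_le hε.1 hε.2 hy₀ hy₁ h1 v).trans ?_
    gcongr
    · exact norm_perturbation_le hy₀ m c (hA.trans (Complex.im_le_norm A))
    · have h0 : 0 < ‖B + t * v‖ := hy₀.trans_le h1
      rw [← div_eq_mul_inv, le_div_iff₀ (by positivity), inv_mul_le_iff₀ (by positivity), ← mul_pow,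
        mul_comm]
      gcongr

end FactorEstimates

/-! ### Parametrization of the matrices of determinant `m`. -/

section MatrixSums

variable {y₀ : ℝ} {ε : ℂ}

/-- The matrix of determinant `m` with given entries `c ≠ 0`, `a`, `d`. -/
def ofTriple (m : ℕ) (t : ℤ × ℤ × ℤ) : Matrix (Fin 2) (Fin 2) ℤ :=
  !![t.2.1, (t.2.1 * t.2.2 - m) / t.1; t.1, t.2.2]

lemma ofTriple_injective (m : ℕ) : Function.Injective (ofTriple m) := by
  intro s t h
  have h1 := congrFun (congrFun h 0) 0
  have h2 := congrFun (congrFun h 1) 0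
  have h3 := congrFun (congrFun h 1) 1
  simp only [ofTriple, Matrix.of_apply, Matrix.cons_val', Matrix.cons_val_zero,
    Matrix.cons_val_one, Matrix.cons_val_fin_one] at h1 h2 h3
  exact Prod.ext h2 (Prod.ext h1 h3)

lemma mem_range_ofTriple {m : ℕ} {γ : Matrix (Fin 2) (Fin 2) ℤ} (h : γ.det = (m : ℤ)) (hc : γ 1 0 ≠ 0) :
    γ ∈ Set.range (ofTriple m) := by
  rw [Matrix.det_fin_two] at h
  refine ⟨(γ 1 0, γ 0 0, γ 1 1), ?_⟩
  have e : (γ 0 0 * γ 1 1 - m) / γ 1 0 = γ 0 1 :=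
    Int.ediv_eq_of_eq_mul_left hc (by linear_combination h)
  ext i j
  fin_cases i <;> fin_cases j <;> simp [ofTriple, e]

/-- The upper right entry is an integer quotient, and the determinant is `m` only when the division
is exact. Sums over matrices with `c ≠ 0` thus become sums over all triples, cut off by the
divisibility condition. -/
lemma det_ofTriple_iff (m : ℕ) (t : ℤ × ℤ × ℤ) :
    (ofTriple m t).det = (m : ℤ) ↔ t.1 ∣ t.2.1 * t.2.2 - m := by
  have e : (ofTriple m t).det = t.2.1 * t.2.2 - (t.2.1 * t.2.2 - m) / t.1 * t.1 := by
    simp [ofTriple, Matrix.det_fin_two]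
  rw [e]
  constructor
  · intro h
    exact ⟨(t.2.1 * t.2.2 - m) / t.1, by linear_combination h⟩
  · intro h
    rw [Int.ediv_mul_cancel h]
    ring

/-- Restriction of a function of matrices to the matrices of determinant `m` with `c ≠ 0` whose
first column satisfies a condition. -/
def largePart {E : Type*} [Zero E] (m : ℕ) (P : ℤ → ℤ → Prop)
    (F : Matrix (Fin 2) (Fin 2) ℤ → E) : Matrix (Fin 2) (Fin 2) ℤ → E :=
  {γ | γ.det = (m : ℤ) ∧ γ 1 0 ≠ 0 ∧ P (γ 0 0) (γ 1 0)}.indicator F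

lemma largePart_ofTriple {E : Type*} [Zero E] (m : ℕ) (P : ℤ → ℤ → Prop)
    (F : Matrix (Fin 2) (Fin 2) ℤ → E) (t : ℤ × ℤ × ℤ)
    [Decidable (t.1 ≠ 0 ∧ t.1 ∣ t.2.1 * t.2.2 - m ∧ P t.2.1 t.1)] :
    largePart m P F (ofTriple m t) =
      if t.1 ≠ 0 ∧ t.1 ∣ t.2.1 * t.2.2 - m ∧ P t.2.1 t.1 then F (ofTriple m t) else 0 := by
  classical
  rw [largePart, Set.indicator_apply]
  refine if_congr ?_ rfl rfl
  have e1 : (ofTriple m t) 1 0 = t.1 := rfl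
  have e2 : (ofTriple m t) 0 0 = t.2.1 := rfl
  rw [Set.mem_ofPred_eq, e1, e2]
  constructor
  · rintro ⟨h1, h2, h3⟩
    exact ⟨h2, (det_ofTriple_iff m t).1 h1, h3⟩
  · rintro ⟨h1, h2, h3⟩
    exact ⟨(det_ofTriple_iff m t).2 h2, h1, h3⟩

lemma support_largePart_subset {E : Type*} [Zero E] (m : ℕ) (P : ℤ → ℤ → Prop)
    (F : Matrix (Fin 2) (Fin 2) ℤ → E) :
    Function.support (largePart m P F) ⊆ Set.range (ofTriple m) := by
  intro γ hγ
  have h : γ ∈ {γ : Matrix (Fin 2) (Fin 2) ℤ | γ.det = (m : ℤ) ∧ γ 1 0 ≠ 0 ∧ P (γ 0 0) (γ 1 0)} :=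
    Set.support_indicator_subset hγ
  exact mem_range_ofTriple h.1 h.2.1

lemma summable_largePart_iff {E : Type*} [NormedAddCommGroup E] (m : ℕ) (P : ℤ → ℤ → Prop)
    (F : Matrix (Fin 2) (Fin 2) ℤ → E) :
    Summable (largePart m P F ∘ ofTriple m) ↔ Summable (largePart m P F) :=
  (ofTriple_injective m).summable_iff fun γ hγ => by
    by_contra h
    exact hγ (support_largePart_subset m P F h)

lemma tsum_largePart {E : Type*} [NormedAddCommGroup E] (m : ℕ) (P : ℤ → ℤ → Prop)
    (F : Matrix (Fin 2) (Fin 2) ℤ → E) :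
    ∑' t, largePart m P F (ofTriple m t) = ∑' γ, largePart m P F γ :=
  (ofTriple_injective m).tsum_eq (support_largePart_subset m P F)

/-- The first factor `z₁ + d / c`. -/
def factorA (w : ℂ) (t : ℤ × ℤ × ℤ) : ℂ := w + t.2.2 / t.1

/-- The second factor `z' + a / c`. -/
def factorB (z : ℂ) (t : ℤ × ℤ × ℤ) : ℂ := z + t.2.1 / t.1

lemma im_add_intCast_div (w : ℂ) (a c : ℤ) : (w + a / c).im = w.im := by
  have e : (w + a / c) = w + ((a / c : ℝ) : ℂ) := by push_cast; ring
  rw [e]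
  simp

/-- Using `b = (a d - m) / c`, one gets `μ = c (A B - m / c²)`, and factoring out `A` leaves the
perturbed `B`. -/
lemma mu_ofTriple {m : ℕ} {t : ℤ × ℤ × ℤ} (hc : t.1 ≠ 0) (hd : t.1 ∣ t.2.1 * t.2.2 - m) {w z : ℂ}
    (hw : 0 < w.im) :
    mu (ofTriple m t) w z =
      t.1 * (factorA w t * (factorB z t + perturbation m t.1 (factorA w t))) := by
  have hcC : (t.1 : ℂ) ≠ 0 := by exact_mod_cast hc
  have hA : factorA w t ≠ 0 := fun h => by
    have : (factorA w t).im = w.im := im_add_intCast_div w _ _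
    rw [h] at this
    simp only [Complex.zero_im] at this
    exact hw.ne this
  have hb : (((t.2.1 * t.2.2 - m) / t.1 : ℤ) : ℂ) = (t.2.1 * t.2.2 - m) / t.1 := by
    rw [Int.cast_div hd hcC]
    push_cast
    ring
  have e : factorA w t * perturbation m t.1 (factorA w t) = -(m / (t.1 : ℂ) ^ 2) := by
    rw [perturbation]
    field_simp
  rw [mul_add, e]
  simp only [mu, ofTriple, Matrix.of_apply, Matrix.cons_val', Matrix.cons_val_zero,
    Matrix.cons_val_one, Matrix.cons_val_fin_one, hb, factorA, factorB]
  field_simp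
  ring

lemma pairBound_eq (w z : ℂ) (t : ℤ × ℤ × ℤ) :
    pairBound w z t.1 t.2 = (‖factorB z t‖ ^ 2)⁻¹ * (‖factorA w t‖ ^ 2)⁻¹ := rfl

section LargeEstimates

variable {m : ℕ} {w z : ℂ} {t : ℤ × ℤ × ℤ}

lemma le_factor_im (hw : y₀ ≤ w.im) (hz : y₀ ≤ z.im) (t : ℤ × ℤ × ℤ) :
    y₀ ≤ (factorA w t).im ∧ y₀ ≤ (factorB z t).im := by
  rw [factorA, factorB, im_add_intCast_div, im_add_intCast_div]
  exact ⟨hw, hz⟩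

/-- The prefactor `c⁻²` and the perturbation `O(c⁻²)` combine to `|c|⁻⁴`. Together with the sum
`O(|c|)` over `a, d` this converges absolutely, uniformly in `ε`. -/
lemma norm_regInv_mu_sub_le (hε : IsSmall ε) (hy₀ : 0 < y₀) (hy₁ : y₀ ≤ 1) (hw : y₀ ≤ w.im)
    (hz : y₀ ≤ z.im) (hc : t.1 ≠ 0) (hd : t.1 ∣ t.2.1 * t.2.2 - m) :
    ‖regInv ε (mu (ofTriple m t) w z) - regInv ε t.1 * (regInv ε (factorB z t) *
      regInv ε (factorA w t))‖ ≤
      5 / 2 * y₀⁻¹ ^ 4 * m * perturbConst m y₀ ^ 3 *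
        (|(t.1 : ℝ)| ^ (-4 : ℝ) * pairBound w z t.1 t.2) := by
  obtain ⟨hA, hB⟩ := le_factor_im hw hz t
  have hcC : (t.1 : ℂ) ≠ 0 := by exact_mod_cast hc
  have hc0 : 0 < |(t.1 : ℝ)| := abs_pos.2 (by exact_mod_cast hc)
  have hA' := hA.trans (Complex.im_le_norm _)
  have hB' := hB.trans (Complex.im_le_norm _)
  have hA0 : factorA w t ≠ 0 := norm_pos_iff.1 (hy₀.trans_le hA')
  have hB1 := (le_norm_add_perturbation hy₀ m hc hA hB (Set.right_mem_Icc.2 zero_le_one)).1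
  rw [Complex.ofReal_one, one_mul] at hB1
  have hB0 : factorB z t + perturbation m t.1 (factorA w t) ≠ 0 :=
    norm_pos_iff.1 (hy₀.trans_le hB1)
  have e : regInv ε (mu (ofTriple m t) w z) - regInv ε t.1 * (regInv ε (factorB z t) *
      regInv ε (factorA w t)) = regInv ε t.1 * (regInv ε (factorA w t) *
        (regInv ε (factorB z t + perturbation m t.1 (factorA w t)) - regInv ε (factorB z t))) := by
    rw [mu_ofTriple hc hd (hy₀.trans_le hw), regInv_mul hcC (mul_ne_zero hA0 hB0),
      regInv_mul hA0 hB0]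
    ring
  have hK : 0 < perturbConst m y₀ := by
    rw [perturbConst]
    positivity
  have hbpos : 0 < ‖factorB z t‖ := hy₀.trans_le hB'
  have h3 : (‖factorB z t‖ ^ 3)⁻¹ ≤ y₀⁻¹ * (‖factorB z t‖ ^ 2)⁻¹ := by
    rw [← mul_inv]
    refine inv_anti₀ (by positivity) ?_
    rw [pow_succ' _ 2]
    exact mul_le_mul_of_nonneg_right hB' (by positivity)
  rw [e, norm_mul, norm_mul]
  calc _ ≤ (|(t.1 : ℝ)| ^ 2)⁻¹ * ((y₀⁻¹ * (‖factorA w t‖ ^ 2)⁻¹) *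
        (5 / 2 * y₀⁻¹ * (m / y₀ * ((t.1 : ℝ) ^ 2)⁻¹) *
          (perturbConst m y₀ ^ 3 * (y₀⁻¹ * (‖factorB z t‖ ^ 2)⁻¹)))) := by
        refine mul_le_mul (norm_regInv_intCast_le hε.1 hc) (mul_le_mul
          (norm_regInv_le hε.1 hε.2 hy₀ hy₁ hA') ((norm_regInv_perturb_sub_le hε hy₀ hy₁ m hc
            hA hB).trans ?_) (norm_nonneg _) (by positivity)) (by positivity) (by positivity)
        gcongr
    _ = _ := by
        have : |(t.1 : ℝ)| ^ (-4 : ℝ) = (|(t.1 : ℝ)| ^ 2)⁻¹ * (|(t.1 : ℝ)| ^ 2)⁻¹ := by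
          rw [← mul_inv, ← pow_add, Real.rpow_neg hc0.le]
          norm_cast
        rw [pairBound_eq, this, sq_abs]
        ring

lemma norm_regInv_mu_le (hε : IsSmall ε) (hy₀ : 0 < y₀) (hy₁ : y₀ ≤ 1) (hw : y₀ ≤ w.im)
    (hz : y₀ ≤ z.im) (hc : t.1 ≠ 0) (hd : t.1 ∣ t.2.1 * t.2.2 - m) :
    ‖regInv ε (mu (ofTriple m t) w z)‖ ≤
      y₀⁻¹ ^ 2 * perturbConst m y₀ ^ 3 *
        (|(t.1 : ℝ)| ^ (-2 - 2 * ε.re) * pairBound w z t.1 t.2) := by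
  obtain ⟨hA, hB⟩ := le_factor_im hw hz t
  have hcC : (t.1 : ℂ) ≠ 0 := by exact_mod_cast hc
  have hA' := hA.trans (Complex.im_le_norm _)
  have hB' := hB.trans (Complex.im_le_norm _)
  have hA0 : factorA w t ≠ 0 := norm_pos_iff.1 (hy₀.trans_le hA')
  obtain ⟨hB1, hB2⟩ := le_norm_add_perturbation hy₀ m hc hA hB (Set.right_mem_Icc.2 zero_le_one)
  rw [Complex.ofReal_one, one_mul] at hB1 hB2
  have hB0 : factorB z t + perturbation m t.1 (factorA w t) ≠ 0 :=
    norm_pos_iff.1 (hy₀.trans_le hB1)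
  have hbpos : 0 < ‖factorB z t‖ := hy₀.trans_le hB'
  have hK1 : 1 ≤ perturbConst m y₀ := by
    rw [perturbConst]
    have : 0 ≤ (m : ℝ) / y₀ / y₀ := by positivity
    linarith
  have h4 : (‖factorB z t + perturbation m t.1 (factorA w t)‖ ^ 2)⁻¹ ≤
      perturbConst m y₀ ^ 3 * (‖factorB z t‖ ^ 2)⁻¹ := by
    have h0 := norm_pos_iff.2 hB0
    calc _ ≤ perturbConst m y₀ ^ 2 * (‖factorB z t‖ ^ 2)⁻¹ := by
          rw [← div_eq_mul_inv, le_div_iff₀ (by positivity), inv_mul_le_iff₀ (by positivity),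
            ← mul_pow, mul_comm]
          gcongr
      _ ≤ _ := by
          gcongr
          norm_num
  rw [mu_ofTriple hc hd (hy₀.trans_le hw), regInv_mul hcC (mul_ne_zero hA0 hB0),
      regInv_mul hA0 hB0, norm_mul, norm_mul, norm_regInv_eq_rpow ε hcC, Complex.norm_intCast]
  calc _ ≤ |(t.1 : ℝ)| ^ (-2 - 2 * ε.re) * ((y₀⁻¹ * (‖factorA w t‖ ^ 2)⁻¹) *
        (y₀⁻¹ * (perturbConst m y₀ ^ 3 * (‖factorB z t‖ ^ 2)⁻¹))) := by
        gcongr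
        · exact norm_regInv_le hε.1 hε.2 hy₀ hy₁ hA'
        · refine (norm_regInv_le hε.1 hε.2 hy₀ hy₁ hB1).trans ?_
          gcongr
    _ = _ := by
        rw [pairBound_eq]
        ring

end LargeEstimates

/-! ### The matrices with `c = 0`. -/

section LowerTriangular

/-- The upper triangular matrices. -/
def ofDiagonal (m : ℕ) (x : (m : ℤ).divisorsAntidiag × ℤ) : Matrix (Fin 2) (Fin 2) ℤ :=
  !![x.1.1.1, x.2; 0, x.1.1.2]

lemma ofDiagonal_injective (m : ℕ) : Function.Injective (ofDiagonal m) := by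
  intro s t h
  have h1 := congrFun (congrFun h 0) 0
  have h2 := congrFun (congrFun h 0) 1
  have h3 := congrFun (congrFun h 1) 1
  simp only [ofDiagonal, Matrix.of_apply, Matrix.cons_val', Matrix.cons_val_zero,
    Matrix.cons_val_one, Matrix.cons_val_fin_one] at h1 h2 h3
  exact Prod.ext (Subtype.ext (Prod.ext h1 h3)) h2

lemma mem_range_ofDiagonal {m : ℕ} (hm : 0 < m) {γ : Matrix (Fin 2) (Fin 2) ℤ} (h : γ.det = (m : ℤ))
    (hc : γ 1 0 = 0) : γ ∈ Set.range (ofDiagonal m) := by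
  rw [Matrix.det_fin_two, hc, mul_zero, sub_zero] at h
  refine ⟨(⟨(γ 0 0, γ 1 1), Int.mem_divisorsAntidiag.2 ⟨h, by exact_mod_cast hm.ne'⟩⟩, γ 0 1), ?_⟩
  ext i j
  fin_cases i <;> fin_cases j <;> simp [ofDiagonal, hc]

variable {m : ℕ} {w z : ℂ}

/-- As `a d = m > 0`, the entries `a` and `d` have the same sign and the two imaginary parts cannot
cancel. -/
lemma le_abs_im_mu (hy₀ : 0 < y₀) (hw : y₀ ≤ w.im) (hz : y₀ ≤ z.im)
    (x : (m : ℤ).divisorsAntidiag) :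
    y₀ ≤ (x.1.2 * z + x.1.1 * w : ℂ).im ∨ y₀ ≤ (-(x.1.2 * z + x.1.1 * w) : ℂ).im := by
  obtain ⟨⟨a, d⟩, h⟩ := x
  rw [Int.mem_divisorsAntidiag] at h
  have hpos : 0 < a * d := by
    have h1 := h.1
    have h2 := h.2
    dsimp only at h1
    have : (0 : ℤ) ≤ m := by positivity
    omega
  have e : (d * z + a * w : ℂ).im = d * z.im + a * w.im := by simp
  have hw' := hy₀.trans_le hw
  have hz' := hy₀.trans_le hz
  rw [Complex.neg_im]
  dsimp only
  rw [e]
  rcases pos_and_pos_or_neg_and_neg_of_mul_pos hpos with ⟨ha, hd⟩ | ⟨ha, hd⟩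
  · left
    have h1 : (1 : ℝ) ≤ a := by exact_mod_cast ha
    have h2 : (0 : ℝ) ≤ d := by exact_mod_cast hd.le
    nlinarith [mul_nonneg h2 hz'.le]
  · right
    have h1 : (a : ℝ) ≤ -1 := by exact_mod_cast Int.le_sub_one_of_lt ha
    have h2 : (d : ℝ) ≤ 0 := by exact_mod_cast hd.le
    nlinarith [mul_nonneg (neg_nonneg.2 h2) hz'.le]

lemma mu_ofDiagonal (x : (m : ℤ).divisorsAntidiag) (b : ℤ) :
    mu (ofDiagonal m (x, b)) w z = (x.1.2 * z + x.1.1 * w) + b := by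
  simp [mu, ofDiagonal]

lemma le_norm_mu_ofDiagonal (hy₀ : 0 < y₀) (hw : y₀ ≤ w.im) (hz : y₀ ≤ z.im)
    (x : (m : ℤ).divisorsAntidiag) (b : ℤ) : y₀ ≤ ‖mu (ofDiagonal m (x, b)) w z‖ := by
  rw [mu_ofDiagonal]
  rcases le_abs_im_mu hy₀ hw hz x with h | h
  · refine le_trans ?_ (Complex.im_le_norm _)
    simpa using h
  · rw [← norm_neg]
    refine le_trans ?_ (Complex.im_le_norm _)
    simpa using h

lemma diagonalSum (hy₀ : 0 < y₀) (hy₁ : y₀ ≤ 1) (hw : y₀ ≤ w.im) (hz : y₀ ≤ z.im)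
    (x : (m : ℤ).divisorsAntidiag) :
    Summable (fun b : ℤ => (‖mu (ofDiagonal m (x, b)) w z‖ ^ 2)⁻¹) ∧
      ∑' b : ℤ, (‖mu (ofDiagonal m (x, b)) w z‖ ^ 2)⁻¹ ≤ latticeConst y₀ := by
  simp only [mu_ofDiagonal]
  rcases le_abs_im_mu hy₀ hw hz x with h | h
  · exact latticeSum_one hy₀ hy₁ h
  · obtain ⟨h1, h2⟩ := latticeSum_one hy₀ hy₁ h
    have e : ∀ b : ℤ, ‖-(x.1.2 * z + x.1.1 * w) + ((-b : ℤ) : ℂ)‖ =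
        ‖(x.1.2 * z + x.1.1 * w) + (b : ℂ)‖ := by
      intro b
      rw [← norm_neg]
      push_cast
      congr 1
      ring
    have h3 := (Equiv.neg ℤ).summable_iff.2 h1
    have h4 := (Equiv.neg ℤ).tsum_eq fun n : ℤ => (‖-(x.1.2 * z + x.1.1 * w) + (n : ℂ)‖ ^ 2)⁻¹
    simp only [Equiv.neg_apply, e] at h4
    rw [h4]
    refine ⟨h3.congr fun b => ?_, h2⟩
    simp only [Function.comp, Equiv.neg_apply, e]

/-- The majorant of the terms with `c = 0`. -/
def diagonalBound (m : ℕ) (w z : ℂ) : Matrix (Fin 2) (Fin 2) ℤ → ℝ :=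
  {γ | γ.det = (m : ℤ) ∧ γ 1 0 = 0}.indicator fun γ => (‖mu γ w z‖ ^ 2)⁻¹

lemma diagonalBound_nonneg (m : ℕ) (w z : ℂ) (γ : Matrix (Fin 2) (Fin 2) ℤ) :
    0 ≤ diagonalBound m w z γ := Set.indicator_nonneg (fun _ _ => by positivity) _

/-- There are finitely many pairs `(a, d)`, and for each the sum over `b` is a lattice sum. -/
lemma summable_and_tsum_diagonalBound_le (hm : 0 < m) (hy₀ : 0 < y₀) (hy₁ : y₀ ≤ 1)
    (hw : y₀ ≤ w.im) (hz : y₀ ≤ z.im) :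
    Summable (diagonalBound m w z) ∧ ∑' γ, diagonalBound m w z γ ≤
      (m : ℤ).divisorsAntidiag.card * latticeConst y₀ := by
  have hsupp : Function.support (diagonalBound m w z) ⊆ Set.range (ofDiagonal m) := by
    intro γ hγ
    have h : γ ∈ {γ : Matrix (Fin 2) (Fin 2) ℤ | γ.det = (m : ℤ) ∧ γ 1 0 = 0} :=
      Set.support_indicator_subset hγ
    exact mem_range_ofDiagonal hm h.1 h.2
  have hval : ∀ x, diagonalBound m w z (ofDiagonal m x) =
      (‖mu (ofDiagonal m x) w z‖ ^ 2)⁻¹ := by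
    rintro ⟨⟨⟨a, d⟩, h⟩, b⟩
    rw [diagonalBound, Set.indicator_of_mem]
    have := (Int.mem_divisorsAntidiag.1 h).1
    simpa [ofDiagonal, Matrix.det_fin_two] using this
  have hs : Summable fun x => (‖mu (ofDiagonal m x) w z‖ ^ 2)⁻¹ := by
    rw [summable_prod_of_nonneg fun x => by positivity]
    exact ⟨fun x => (diagonalSum hy₀ hy₁ hw hz x).1, Summable.of_finite⟩
  constructor
  · rw [← (ofDiagonal_injective m).summable_iff fun γ hγ => by
      by_contra h
      exact hγ (hsupp h)]
    exact hs.congr fun x => (hval x).symm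
  · rw [← (ofDiagonal_injective m).tsum_eq hsupp, tsum_congr hval, hs.tsum_prod, tsum_fintype]
    refine (Finset.sum_le_card_nsmul _ _ _ fun x _ => (diagonalSum hy₀ hy₁ hw hz x).2).trans_eq ?_
    rw [nsmul_eq_mul, Finset.card_univ, Fintype.card_coe]

end LowerTriangular

end MatrixSums

/-! ### The regularized kernel in terms of `|μ₋|` alone. -/

section KernelSums

set_option linter.unusedSectionVars false

variable {y₀ : ℝ} {ε : ℂ} {m : ℕ} {w z : ℂ}

/-- The matrices of determinant `m` whose first column satisfies a condition. -/
def detSet (m : ℕ) (P : ℤ → ℤ → Prop) : Set (Matrix (Fin 2) (Fin 2) ℤ) :=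
  {γ | γ.det = (m : ℤ) ∧ P (γ 0 0) (γ 1 0)}

/-- Restriction to the matrices with `c = 0`. -/
def diagonalPart {E : Type*} [Zero E] (m : ℕ) (P : ℤ → ℤ → Prop)
    (F : Matrix (Fin 2) (Fin 2) ℤ → E) : Matrix (Fin 2) (Fin 2) ℤ → E :=
  {γ | γ.det = (m : ℤ) ∧ γ 1 0 = 0 ∧ P (γ 0 0) (γ 1 0)}.indicator F

lemma indicator_detSet {E : Type*} [AddZeroClass E] (m : ℕ) (P : ℤ → ℤ → Prop)
    (F : Matrix (Fin 2) (Fin 2) ℤ → E) (γ : Matrix (Fin 2) (Fin 2) ℤ) :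
    (detSet m P).indicator F γ = diagonalPart m P F γ + largePart m P F γ := by
  classical
  simp only [detSet, diagonalPart, largePart, Set.indicator_apply, Set.mem_ofPred_eq]
  by_cases h1 : γ.det = (m : ℤ) <;> by_cases h2 : γ 1 0 = 0 <;>
    by_cases h3 : P (γ 0 0) (γ 1 0) <;> simp [h1, h2, h3]

lemma le_norm_mu_of_eq_zero (hm : 0 < m) (hy₀ : 0 < y₀) (hw : y₀ ≤ w.im) (hz : y₀ ≤ z.im)
    {γ : Matrix (Fin 2) (Fin 2) ℤ} (h : γ.det = (m : ℤ)) (hc : γ 1 0 = 0) :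
    y₀ ≤ ‖mu γ w z‖ := by
  obtain ⟨⟨x, b⟩, rfl⟩ := mem_range_ofDiagonal hm h hc
  exact le_norm_mu_ofDiagonal hy₀ hw hz x b

lemma norm_diagonalPart_le (hm : 0 < m) (P : ℤ → ℤ → Prop) (hε : IsSmall ε) (hy₀ : 0 < y₀)
    (hy₁ : y₀ ≤ 1) (hw : y₀ ≤ w.im) (hz : y₀ ≤ z.im) (γ : Matrix (Fin 2) (Fin 2) ℤ) :
    ‖diagonalPart m P (fun γ => regInv ε (mu γ w z)) γ‖ ≤ y₀⁻¹ * diagonalBound m w z γ := by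
  classical
  rw [diagonalPart, diagonalBound, Set.indicator_apply]
  split_ifs with h
  · have h' : γ ∈ {γ : Matrix (Fin 2) (Fin 2) ℤ | γ.det = (m : ℤ) ∧ γ 1 0 = 0} := ⟨h.1, h.2.1⟩
    rw [Set.indicator_of_mem h']
    exact norm_regInv_le hε.1 hε.2 hy₀ hy₁ (le_norm_mu_of_eq_zero hm hy₀ hw hz h.1 h.2.1)
  · rw [norm_zero]
    exact mul_nonneg (by positivity) (diagonalBound_nonneg m w z γ)

/-- A constant in the estimates of the terms with `c ≠ 0`. -/
def largeConst (m : ℕ) (y₀ : ℝ) : ℝ :=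
  y₀⁻¹ ^ 2 * perturbConst m y₀ ^ 3 + 5 / 2 * y₀⁻¹ ^ 4 * m * perturbConst m y₀ ^ 3

lemma one_le_perturbConst (hy₀ : 0 < y₀) (m : ℕ) : 1 ≤ perturbConst m y₀ := by
  rw [perturbConst]
  have : 0 ≤ (m : ℝ) / y₀ / y₀ := by positivity
  linarith

lemma largeConst_nonneg (hy₀ : 0 < y₀) (m : ℕ) : 0 ≤ largeConst m y₀ := by
  have := one_le_perturbConst hy₀ m
  rw [largeConst]
  positivity

lemma tripleBound_eq (s : ℝ) {t : ℤ × ℤ × ℤ} (hc : t.1 ≠ 0) (hd : t.1 ∣ t.2.1 * t.2.2 - m) :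
    tripleBound m w z s t = |(t.1 : ℝ)| ^ s * pairBound w z t.1 t.2 := by
  rw [tripleBound, if_pos hc, dvdBound, if_pos hd]

open scoped Classical in
lemma norm_largePart_le (P : ℤ → ℤ → Prop) (hε : IsSmall ε) (hy₀ : 0 < y₀)
    (hy₁ : y₀ ≤ 1) (hw : y₀ ≤ w.im) (hz : y₀ ≤ z.im) (t : ℤ × ℤ × ℤ) :
    ‖largePart m P (fun γ => regInv ε (mu γ w z)) (ofTriple m t)‖ ≤
      largeConst m y₀ * tripleBound m w z (-2 - 2 * ε.re) t := by
  have hL := largeConst_nonneg hy₀ m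
  rw [largePart_ofTriple]
  split_ifs with h
  · refine (norm_regInv_mu_le hε hy₀ hy₁ hw hz h.1 h.2.1).trans ?_
    rw [tripleBound_eq _ h.1 h.2.1, largeConst]
    have := one_le_perturbConst hy₀ m
    gcongr
    · exact mul_nonneg (by positivity) (pairBound_nonneg _ _ _ _)
    · exact le_add_of_nonneg_right (by positivity)
  · rw [norm_zero]
    exact mul_nonneg hL (tripleBound_nonneg _ _ _ _ _)

lemma summable_largePart_comp (hm : 0 < m) (P : ℤ → ℤ → Prop) (hε : IsSmall ε) (hpos : 0 < ε.re)
    (hy₀ : 0 < y₀) (hy₁ : y₀ ≤ 1) (hw : y₀ ≤ w.im) (hz : y₀ ≤ z.im) :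
    Summable fun t => largePart m P (fun γ => regInv ε (mu γ w z)) (ofTriple m t) :=
  .of_norm_bounded ((summable_and_tsum_tripleBound_le hy₀ hy₁ hw hz hm (by linarith)).1.mul_left _)
    (norm_largePart_le P hε hy₀ hy₁ hw hz)

lemma summable_largePart (hm : 0 < m) (P : ℤ → ℤ → Prop) (hε : IsSmall ε) (hpos : 0 < ε.re)
    (hy₀ : 0 < y₀) (hy₁ : y₀ ≤ 1) (hw : y₀ ≤ w.im) (hz : y₀ ≤ z.im) :
    Summable (largePart m P fun γ => regInv ε (mu γ w z)) :=
  (summable_largePart_iff m P _).1 (summable_largePart_comp hm P hε hpos hy₀ hy₁ hw hz)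

lemma summable_diagonalPart (hm : 0 < m) (P : ℤ → ℤ → Prop) (hε : IsSmall ε) (hy₀ : 0 < y₀)
    (hy₁ : y₀ ≤ 1) (hw : y₀ ≤ w.im) (hz : y₀ ≤ z.im) :
    Summable (diagonalPart m P fun γ => regInv ε (mu γ w z)) :=
  .of_norm_bounded ((summable_and_tsum_diagonalBound_le hm hy₀ hy₁ hw hz).1.mul_left _)
    (norm_diagonalPart_le hm P hε hy₀ hy₁ hw hz)

/-- The product approximation to a term of the kernel with `c ≠ 0`. -/
def productTerm (w z ε : ℂ) (t : ℤ × ℤ × ℤ) : ℂ :=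
  regInv ε t.1 * (regInv ε (factorB z t) * regInv ε (factorA w t))

lemma norm_productTerm_le (hε : IsSmall ε) (hy₀ : 0 < y₀) (hy₁ : y₀ ≤ 1) (hw : y₀ ≤ w.im)
    (hz : y₀ ≤ z.im) {t : ℤ × ℤ × ℤ} (hc : t.1 ≠ 0) :
    ‖productTerm w z ε t‖ ≤ y₀⁻¹ ^ 2 *
      (|(t.1 : ℝ)| ^ (-2 - 2 * ε.re) * pairBound w z t.1 t.2) := by
  have hcC : (t.1 : ℂ) ≠ 0 := by exact_mod_cast hc
  obtain ⟨hA, hB⟩ := le_factor_im hw hz t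
  rw [productTerm, norm_mul, norm_mul, norm_regInv_eq_rpow ε hcC, Complex.norm_intCast,
    pairBound_eq]
  calc _ ≤ |(t.1 : ℝ)| ^ (-2 - 2 * ε.re) * ((y₀⁻¹ * (‖factorB z t‖ ^ 2)⁻¹) *
        (y₀⁻¹ * (‖factorA w t‖ ^ 2)⁻¹)) := by
        gcongr
        · exact norm_regInv_le hε.1 hε.2 hy₀ hy₁ (hB.trans (Complex.im_le_norm _))
        · exact norm_regInv_le hε.1 hε.2 hy₀ hy₁ (hA.trans (Complex.im_le_norm _))
    _ = _ := by ring

open scoped Classical in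
/-- `productTerm` on the admissible triples. -/
def restrictedProduct (m : ℕ) (P : ℤ → ℤ → Prop) (w z ε : ℂ) (t : ℤ × ℤ × ℤ) : ℂ :=
  if t.1 ≠ 0 ∧ t.1 ∣ t.2.1 * t.2.2 - m ∧ P t.2.1 t.1 then productTerm w z ε t else 0

lemma summable_restrictedProduct (hm : 0 < m) (P : ℤ → ℤ → Prop) (hε : IsSmall ε)
    (hpos : 0 < ε.re) (hy₀ : 0 < y₀) (hy₁ : y₀ ≤ 1) (hw : y₀ ≤ w.im) (hz : y₀ ≤ z.im) :
    Summable (restrictedProduct m P w z ε) := by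
  refine .of_norm_bounded ((summable_and_tsum_tripleBound_le hy₀ hy₁ hw hz hm
    (s := -2 - 2 * ε.re) (by linarith)).1.mul_left (y₀⁻¹ ^ 2)) fun t => ?_
  rw [restrictedProduct]
  split_ifs with h
  · rw [tripleBound_eq _ h.1 h.2.1]
    exact norm_productTerm_le hε hy₀ hy₁ hw hz h.1
  · rw [norm_zero]
    exact mul_nonneg (by positivity) (tripleBound_nonneg _ _ _ _ _)

/-- The difference between the terms of the kernel and their product approximation. -/
def largeCorrection (m : ℕ) (P : ℤ → ℤ → Prop) (w z ε : ℂ) (t : ℤ × ℤ × ℤ) : ℂ :=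
  largePart m P (fun γ => regInv ε (mu γ w z)) (ofTriple m t) - restrictedProduct m P w z ε t

lemma norm_largeCorrection_le (P : ℤ → ℤ → Prop) (hε : IsSmall ε) (hy₀ : 0 < y₀)
    (hy₁ : y₀ ≤ 1) (hw : y₀ ≤ w.im) (hz : y₀ ≤ z.im) (t : ℤ × ℤ × ℤ) :
    ‖largeCorrection m P w z ε t‖ ≤ largeConst m y₀ * tripleBound m w z (-4) t := by
  classical
  have hL := largeConst_nonneg hy₀ m
  rw [largeCorrection, largePart_ofTriple, restrictedProduct]
  split_ifs with h
  · refine (norm_regInv_mu_sub_le hε hy₀ hy₁ hw hz h.1 h.2.1).trans ?_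
    rw [tripleBound_eq _ h.1 h.2.1, largeConst]
    have := one_le_perturbConst hy₀ m
    gcongr
    · exact mul_nonneg (by positivity) (pairBound_nonneg _ _ _ _)
    · exact le_add_of_nonneg_left (by positivity)
  · rw [sub_zero, norm_zero]
    exact mul_nonneg hL (tripleBound_nonneg _ _ _ _ _)

lemma tsum_largePart_eq (hm : 0 < m) (P : ℤ → ℤ → Prop) (hε : IsSmall ε) (hpos : 0 < ε.re)
    (hy₀ : 0 < y₀) (hy₁ : y₀ ≤ 1) (hw : y₀ ≤ w.im) (hz : y₀ ≤ z.im) :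
    ∑' γ, largePart m P (fun γ => regInv ε (mu γ w z)) γ =
      ∑' t, largeCorrection m P w z ε t + ∑' t, restrictedProduct m P w z ε t := by
  rw [← tsum_largePart, ← Summable.tsum_add]
  · exact tsum_congr fun t => by rw [largeCorrection, sub_add_cancel]
  · exact (summable_largePart_comp hm P hε hpos hy₀ hy₁ hw hz).sub
      (summable_restrictedProduct hm P hε hpos hy₀ hy₁ hw hz)
  · exact summable_restrictedProduct hm P hε hpos hy₀ hy₁ hw hz

section Classes

variable {N : ℕ} [NeZero N]

/-- The condition that the first column lies in a class modulo `N`. -/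
def InClass (r ρ : ZMod N) (a c : ℤ) : Prop := (a : ZMod N) = r ∧ (c : ZMod N) = ρ

lemma tsum_restrictedProduct_eq (hm : 0 < m) (r ρ : ZMod N) (hε : IsSmall ε) (hpos : 0 < ε.re)
    (hy₀ : 0 < y₀) (hy₁ : y₀ ≤ 1) (hw : y₀ ≤ w.im) (hz : y₀ ≤ z.im) :
    ∑' t, restrictedProduct m (InClass r ρ) w z ε t = ∑' c, classTerm m r ρ w z ε c := by
  classical
  rw [(summable_restrictedProduct hm _ hε hpos hy₀ hy₁ hw hz).tsum_prod]
  refine tsum_congr fun c => ?_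
  rw [classTerm]
  split_ifs with h
  · rw [mainTerm, ← tsum_mul_left]
    refine tsum_congr fun x => ?_
    rw [mul_ite, mul_zero, restrictedProduct]
    refine if_congr ?_ rfl rfl
    simp only [InClass, h, ne_eq, not_false_eq_true, and_true, true_and]
  · have : ∀ x, restrictedProduct m (InClass r ρ) w z ε (c, x) = 0 := fun x => by
      rw [restrictedProduct, if_neg]
      rintro ⟨h1, -, h2⟩
      exact h ⟨h1, h2.2⟩
    simp [this]

/-- The regularized sum over a set of matrices, with `|μ₋|` in place of `|μ₊|`. -/
def kernelSum (m : ℕ) (P : ℤ → ℤ → Prop) (w z ε : ℂ) : ℂ :=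
  ∑' γ, (detSet m P).indicator (fun γ => regInv ε (mu γ w z)) γ

lemma summable_indicator_regInv (hm : 0 < m) (P : ℤ → ℤ → Prop) (hε : IsSmall ε) (hpos : 0 < ε.re)
    (hy₀ : 0 < y₀) (hy₁ : y₀ ≤ 1) (hw : y₀ ≤ w.im) (hz : y₀ ≤ z.im) :
    Summable ((detSet m P).indicator fun γ => regInv ε (mu γ w z)) := by
  rw [funext (indicator_detSet m P _)]
  exact (summable_diagonalPart hm P hε hy₀ hy₁ hw hz).add
    (summable_largePart hm P hε hpos hy₀ hy₁ hw hz)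

/-- The first two pieces have summable majorants independent of `ε`; the third is the product
approximation, treated by equidistribution. Both the uniform bound and the existence of the limit
are read off from this splitting. -/
lemma kernelSum_eq (hm : 0 < m) (r ρ : ZMod N) (hε : IsSmall ε) (hpos : 0 < ε.re)
    (hy₀ : 0 < y₀) (hy₁ : y₀ ≤ 1) (hw : y₀ ≤ w.im) (hz : y₀ ≤ z.im) :
    kernelSum m (InClass r ρ) w z ε =
      ∑' γ, diagonalPart m (InClass r ρ) (fun γ => regInv ε (mu γ w z)) γ +
        (∑' t, largeCorrection m (InClass r ρ) w z ε t + ∑' c, classTerm m r ρ w z ε c) := by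
  rw [← tsum_restrictedProduct_eq hm r ρ hε hpos hy₀ hy₁ hw hz,
    ← tsum_largePart_eq hm _ hε hpos hy₀ hy₁ hw hz, ← Summable.tsum_add
    (summable_diagonalPart hm _ hε hy₀ hy₁ hw hz) (summable_largePart hm _ hε hpos hy₀ hy₁ hw hz)]
  exact tsum_congr (indicator_detSet m _ _)

lemma exists_norm_kernelSum_class_le (hm : 0 < m) (r ρ : ZMod N) (hy₀ : 0 < y₀) (hy₁ : y₀ ≤ 1) :
    ∃ C : ℝ, ∀ ε : ℂ, IsSmall ε → 0 < ε.re → ∀ w z : ℂ, y₀ ≤ w.im → y₀ ≤ z.im →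
      ‖kernelSum m (InClass r ρ) w z ε‖ ≤ C := by
  obtain ⟨C, hC⟩ := exists_norm_classSum_main_le hm r ρ hy₀ hy₁
  refine ⟨y₀⁻¹ * ((m : ℤ).divisorsAntidiag.card * latticeConst y₀) +
    (largeConst m y₀ * (latticeConst y₀ ^ 2 * m *
      ∑' c : ℤ, if c ≠ 0 then |(c : ℝ)| ^ ((-4 : ℝ) + 1) else 0) + C),
    fun ε hε hpos w z hw hz => ?_⟩
  rw [kernelSum_eq hm r ρ hε hpos hy₀ hy₁ hw hz]
  obtain ⟨h1, h2⟩ := summable_and_tsum_diagonalBound_le hm hy₀ hy₁ hw hz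
  obtain ⟨h3, h4⟩ := summable_and_tsum_tripleBound_le hy₀ hy₁ hw hz hm (s := -4) (by norm_num)
  refine (norm_add_le _ _).trans (add_le_add ?_ ((norm_add_le _ _).trans (add_le_add ?_
    (hC ε hε hpos w z hw hz))))
  · refine (tsum_of_norm_bounded (h1.mul_left y₀⁻¹).hasSum
      (norm_diagonalPart_le hm _ hε hy₀ hy₁ hw hz)).trans ?_
    rw [tsum_mul_left]
    gcongr
  · refine (tsum_of_norm_bounded (h3.mul_left (largeConst m y₀)).hasSum
      (norm_largeCorrection_le _ hε hy₀ hy₁ hw hz)).trans ?_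
    rw [tsum_mul_left]
    have := largeConst_nonneg hy₀ m
    gcongr

lemma exists_tendsto_kernelSum_class (hm : 0 < m) (r ρ : ZMod N) (hy₀ : 0 < y₀) (hy₁ : y₀ ≤ 1)
    (hw : y₀ ≤ w.im) (hz : y₀ ≤ z.im) :
    ∃ L : ℂ, Tendsto (kernelSum m (InClass r ρ) w z) regFilter (𝓝 L) := by
  classical
  obtain ⟨L, hL⟩ := exists_tendsto_classSum hm r ρ hy₀ hy₁ hw hz
  obtain ⟨h1, h2⟩ := summable_and_tsum_diagonalBound_le hm hy₀ hy₁ hw hz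
  obtain ⟨h3, h4⟩ := summable_and_tsum_tripleBound_le hy₀ hy₁ hw hz hm (s := -4) (by norm_num)
  have t1 : Tendsto (fun ε => ∑' γ, diagonalPart m (InClass r ρ) (fun γ => regInv ε (mu γ w z)) γ)
      regFilter (𝓝 (∑' γ, diagonalPart m (InClass r ρ) (fun γ => regInv 0 (mu γ w z)) γ)) := by
    refine tendsto_tsum_of_dominated_convergence (h1.mul_left y₀⁻¹) (fun γ => ?_) ?_
    · simp only [diagonalPart, Set.indicator_apply]
      split_ifs
      · exact tendsto_regInv_left _
      · exact tendsto_const_nhds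
    · filter_upwards [eventually_isSmall] with ε hε
      exact norm_diagonalPart_le hm _ hε.1 hy₀ hy₁ hw hz
  have t2 : Tendsto (fun ε => ∑' t, largeCorrection m (InClass r ρ) w z ε t)
      regFilter (𝓝 (∑' t, largeCorrection m (InClass r ρ) w z 0 t)) := by
    refine tendsto_tsum_of_dominated_convergence (h3.mul_left (largeConst m y₀)) (fun t => ?_) ?_
    · simp only [largeCorrection, largePart_ofTriple, restrictedProduct]
      split_ifs
      · exact (tendsto_regInv_left _).sub ((tendsto_regInv_left _).mul
          ((tendsto_regInv_left _).mul (tendsto_regInv_left _)))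
      · exact tendsto_const_nhds
    · filter_upwards [eventually_isSmall] with ε hε
      exact norm_largeCorrection_le _ hε.1 hy₀ hy₁ hw hz
  refine ⟨_, (t1.add (t2.add hL)).congr' ?_⟩
  filter_upwards [eventually_isSmall] with ε hε
  exact (kernelSum_eq hm r ρ hε.1 hε.2 hy₀ hy₁ hw hz).symm

/-- A condition on the first column modulo `N`. -/
def ModCond (Q : ZMod N × ZMod N → Prop) (a c : ℤ) : Prop := Q ((a : ZMod N), (c : ZMod N))

open scoped Classical in
lemma kernelSum_modCond_eq (hm : 0 < m) (Q : ZMod N × ZMod N → Prop) (hε : IsSmall ε)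
    (hpos : 0 < ε.re) (hy₀ : 0 < y₀) (hy₁ : y₀ ≤ 1) (hw : y₀ ≤ w.im) (hz : y₀ ≤ z.im) :
    kernelSum m (ModCond Q) w z ε = ∑ x with Q x, kernelSum m (InClass x.1 x.2) w z ε := by
  simp only [kernelSum]
  rw [← Summable.tsum_finsetSum fun x _ => summable_indicator_regInv hm _ hε hpos hy₀ hy₁ hw hz]
  refine tsum_congr fun γ => ?_
  simp only [Set.indicator_apply, detSet, Set.mem_ofPred_eq, InClass, ModCond]
  by_cases hd : γ.det = (m : ℤ)
  · simp only [hd, true_and]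
    rw [Finset.sum_filter]
    rw [Finset.sum_eq_single (((γ 0 0 : ℤ) : ZMod N), ((γ 1 0 : ℤ) : ZMod N))]
    · simp
    · rintro ⟨r, ρ⟩ _ h
      rw [if_neg (c := _ ∧ _), ite_self]
      rintro ⟨h1, h2⟩
      exact h (Prod.ext h1.symm h2.symm)
    · simp
  · simp [hd]

lemma exists_norm_kernelSum_le (hm : 0 < m) (Q : ZMod N × ZMod N → Prop) (hy₀ : 0 < y₀)
    (hy₁ : y₀ ≤ 1) :
    ∃ C : ℝ, ∀ ε : ℂ, IsSmall ε → 0 < ε.re → ∀ w z : ℂ, y₀ ≤ w.im → y₀ ≤ z.im →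
      ‖kernelSum m (ModCond Q) w z ε‖ ≤ C := by
  classical
  choose C hC using fun x : ZMod N × ZMod N =>
    exists_norm_kernelSum_class_le hm x.1 x.2 hy₀ hy₁
  refine ⟨∑ x with Q x, C x, fun ε hε hpos w z hw hz => ?_⟩
  rw [kernelSum_modCond_eq hm Q hε hpos hy₀ hy₁ hw hz]
  exact norm_sum_le_of_le _ fun x _ => hC x ε hε hpos w z hw hz

lemma exists_tendsto_kernelSum (hm : 0 < m) (Q : ZMod N × ZMod N → Prop) (hy₀ : 0 < y₀)
    (hy₁ : y₀ ≤ 1) (hw : y₀ ≤ w.im) (hz : y₀ ≤ z.im) :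
    ∃ L : ℂ, Tendsto (kernelSum m (ModCond Q) w z) regFilter (𝓝 L) := by
  classical
  choose L hL using fun x : ZMod N × ZMod N =>
    exists_tendsto_kernelSum_class hm x.1 x.2 hy₀ hy₁ hw hz
  refine ⟨∑ x with Q x, L x, (tendsto_finsetSum _ fun x _ => hL x).congr' ?_⟩
  filter_upwards [eventually_isSmall] with ε hε
  exact (kernelSum_modCond_eq hm Q hε.1 hε.2 hy₀ hy₁ hw hz).symm

end Classes

end KernelSums

/-! ### Comparison of Hecke's terms with `regInv ε μ₋`. -/

section RegularizedTerms

variable {m : ℕ} {z₁ z₂ : ℍ} {γ : Matrix (Fin 2) (Fin 2) ℤ}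

/-- `μ_γ(z₁, -z̄₂)`. -/
def muMinus (z₁ z₂ : ℍ) (γ : Matrix (Fin 2) (Fin 2) ℤ) : ℂ := mu γ z₁ (-conj (z₂ : ℂ))

/-- `μ_γ(z₁, -z₂)`. -/
def muPlus (z₁ z₂ : ℍ) (γ : Matrix (Fin 2) (Fin 2) ℤ) : ℂ := mu γ z₁ (-(z₂ : ℂ))

/-- This identity bounds `|μ₋|` away from zero and shows that `|μ₋| / |μ₊|` tends to `1` as `|μ₋|`
grows. -/
lemma sq_norm_muMinus_sub (h : γ.det = (m : ℤ)) (z₁ z₂ : ℍ) :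
    ‖muMinus z₁ z₂ γ‖ ^ 2 - ‖muPlus z₁ z₂ γ‖ ^ 2 = 4 * m * z₁.im * z₂.im := by
  rw [Matrix.det_fin_two] at h
  have h' : (γ 0 0 : ℝ) * γ 1 1 - γ 0 1 * γ 1 0 = m := by exact_mod_cast h
  rw [Complex.sq_norm, Complex.sq_norm, Complex.normSq_apply, Complex.normSq_apply]
  simp only [muMinus, muPlus, mu, Complex.add_re, Complex.add_im, Complex.mul_re, Complex.mul_im,
    Complex.neg_re, Complex.neg_im, Complex.conj_re, Complex.conj_im, Complex.intCast_re,
    Complex.intCast_im, UpperHalfPlane.coe_re, UpperHalfPlane.coe_im]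
  linear_combination 4 * z₁.im * z₂.im * h'

lemma sq_norm_muMinus_ge (h : γ.det = (m : ℤ)) (z₁ z₂ : ℍ) :
    4 * m * z₁.im * z₂.im ≤ ‖muMinus z₁ z₂ γ‖ ^ 2 := by
  rw [← sq_norm_muMinus_sub h]
  linarith [sq_nonneg ‖muPlus z₁ z₂ γ‖]

lemma muMinus_ne_zero (hm : 0 < m) (h : γ.det = (m : ℤ)) (z₁ z₂ : ℍ) : muMinus z₁ z₂ γ ≠ 0 := by
  intro h0
  have := sq_norm_muMinus_ge h z₁ z₂
  rw [h0, norm_zero] at this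
  have hm' : (0 : ℝ) < m := by exact_mod_cast hm
  have : 0 < 4 * m * z₁.im * z₂.im := by
    have := z₁.im_pos
    have := z₂.im_pos
    positivity
  linarith

lemma le_norm_muMinus (hm : 0 < m) (h : γ.det = (m : ℤ)) {y₀ : ℝ} (hy₀ : 0 < y₀)
    (h₁ : y₀ ≤ z₁.im) (h₂ : y₀ ≤ z₂.im) : y₀ ≤ ‖muMinus z₁ z₂ γ‖ := by
  refine le_of_sq_le_sq ?_ (norm_nonneg _)
  refine le_trans ?_ (sq_norm_muMinus_ge h z₁ z₂)
  have hm' : (1 : ℝ) ≤ m := by exact_mod_cast hm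
  have h3 : y₀ * y₀ ≤ z₁.im * z₂.im := by gcongr
  nlinarith

lemma conj_mu_conj (z₁ z₂ : ℍ) (γ : Matrix (Fin 2) (Fin 2) ℤ) :
    mu γ (conj (z₁ : ℂ)) (-(z₂ : ℂ)) = conj (muMinus z₁ z₂ γ) := by
  simp [mu, muMinus]

/-- The numerator is `conj(μ₋)² = |μ₋|⁴ / μ₋²`, so the term is `μ₋⁻² |μ₋|^(-2ε)` times `(|μ₋| /
|μ₊|)^ε`. -/
lemma regTerm_eq {s ε : ℂ} (hs : ε = 2 * s - 2) (h₁ : muMinus z₁ z₂ γ ≠ 0)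
    (h₂ : muPlus z₁ z₂ γ ≠ 0) :
    regTerm z₁ z₂ s γ = regInv ε (muMinus z₁ z₂ γ) *
      cexp (ε * (Real.log ‖muMinus z₁ z₂ γ‖ - Real.log ‖muPlus z₁ z₂ γ‖ : ℝ)) := by
  have n₁ : (‖muMinus z₁ z₂ γ‖ : ℂ) ≠ 0 := by exact_mod_cast norm_ne_zero_iff.2 h₁
  have n₂ : (‖muPlus z₁ z₂ γ‖ : ℂ) ≠ 0 := by exact_mod_cast norm_ne_zero_iff.2 h₂
  have hc : conj (muMinus z₁ z₂ γ) = (‖muMinus z₁ z₂ γ‖ : ℂ) ^ 2 / muMinus z₁ z₂ γ := by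
    rw [eq_div_iff h₁, mul_comm, Complex.mul_conj, Complex.normSq_eq_norm_sq]
    push_cast
    rfl
  rw [regTerm, conj_mu_conj, ← muPlus, ← muMinus, hc, ← hs,
    show 2 * s + 2 = ε + (4 : ℕ) by rw [hs]; push_cast; ring, Complex.cpow_add _ _ n₁,
    Complex.cpow_natCast, Complex.cpow_def_of_ne_zero n₁, Complex.cpow_def_of_ne_zero n₂, regInv,
    ← Complex.ofReal_log (norm_nonneg _), ← Complex.ofReal_log (norm_nonneg _)]
  rw [div_pow, div_div, div_eq_iff (by
    refine mul_ne_zero (pow_ne_zero _ h₁) (mul_ne_zero (Complex.exp_ne_zero _)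
      (mul_ne_zero (Complex.exp_ne_zero _) (pow_ne_zero _ n₁))))]
  have e : cexp (-2 * ε * (Real.log ‖muMinus z₁ z₂ γ‖ : ℝ)) *
      cexp (ε * (Real.log ‖muMinus z₁ z₂ γ‖ - Real.log ‖muPlus z₁ z₂ γ‖ : ℝ)) *
      cexp ((Real.log ‖muPlus z₁ z₂ γ‖ : ℝ) * ε) * cexp ((Real.log ‖muMinus z₁ z₂ γ‖ : ℝ) * ε) =
      1 := by
    rw [← Complex.exp_add, ← Complex.exp_add, ← Complex.exp_add, ← Complex.exp_zero]
    congr 1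
    push_cast
    ring
  have e2 : ((muMinus z₁ z₂ γ) ^ 2)⁻¹ * (muMinus z₁ z₂ γ) ^ 2 = 1 :=
    inv_mul_cancel₀ (pow_ne_zero _ h₁)
  linear_combination (-(‖muMinus z₁ z₂ γ‖ : ℂ) ^ 4) *
    (((muMinus z₁ z₂ γ) ^ 2)⁻¹ * (muMinus z₁ z₂ γ) ^ 2 * e + e2)

lemma norm_regTerm_eq {s : ℂ} (h₁ : muMinus z₁ z₂ γ ≠ 0) (h₂ : muPlus z₁ z₂ γ ≠ 0) :
    ‖regTerm z₁ z₂ s γ‖ = ‖muMinus z₁ z₂ γ‖ ^ (-2 - (2 * s - 2).re) *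
      ‖muPlus z₁ z₂ γ‖ ^ (-(2 * s - 2).re) := by
  have n₁ := norm_pos_iff.2 h₁
  have n₂ := norm_pos_iff.2 h₂
  rw [regTerm_eq rfl h₁ h₂, norm_mul, norm_regInv_eq_rpow _ h₁, Complex.norm_exp,
    Complex.re_mul_ofReal, Real.rpow_def_of_pos n₁, Real.rpow_def_of_pos n₁,
    Real.rpow_def_of_pos n₂, ← Real.exp_add, ← Real.exp_add]
  congr 1
  ring

/-- The error made in replacing `|μ₊|` by `|μ₋|`, up to a constant. -/
def crossTerm (z₁ z₂ : ℍ) (γ : Matrix (Fin 2) (Fin 2) ℤ) : ℝ :=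
  ‖muMinus z₁ z₂ γ‖ ^ (-(7 / 2) : ℝ) * ‖muPlus z₁ z₂ γ‖ ^ (-(1 / 2) : ℝ)

lemma crossTerm_nonneg (z₁ z₂ : ℍ) (γ : Matrix (Fin 2) (Fin 2) ℤ) : 0 ≤ crossTerm z₁ z₂ γ := by
  rw [crossTerm]
  positivity

/-- For `l = log(|μ₋| / |μ₊|)` the factor `1 - e^(-2l)` equals `4 m y₁ y₂ / |μ₋|²`, which provides
convergence, and `e^(l/2)` produces only the integrable singularity `|μ₊|^(-1/2)`. The proof
compares `l` with `4 (e^(l/4) - 1)`. -/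
lemma norm_exp_mul_sub_one_le {ε : ℂ} (hε : ‖ε‖ ≤ 1 / 4) {l : ℝ} (hl : 0 ≤ l) :
    ‖cexp (ε * l) - 1‖ ≤ 4 * ‖ε‖ * (Real.exp (l / 2) * (1 - Real.exp (-2 * l))) := by
  have h1 := Complex.norm_exp_sub_sum_le_norm_mul_exp (ε * l) 1
  simp only [Finset.range_one, Finset.sum_singleton, pow_zero, Nat.factorial_zero, Nat.cast_one,
    div_one, pow_one, norm_mul, Complex.norm_real, Real.norm_of_nonneg hl] at h1
  have h2 : Real.exp (‖ε‖ * l) ≤ Real.exp (l / 4) := by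
    gcongr
    nlinarith
  have h3 : l / 4 ≤ Real.exp (l / 4) - 1 := by linarith [Real.add_one_le_exp (l / 4)]
  have h4 : Real.exp (-2 * l) ≤ Real.exp (-(l / 4)) := by
    gcongr
    linarith
  have e1 : Real.exp (l / 4) * Real.exp (-(l / 4)) = 1 := by
    rw [← Real.exp_add]
    simp
  have e2 : Real.exp (l / 2) = Real.exp (l / 4) * Real.exp (l / 4) := by
    rw [← Real.exp_add]
    ring_nf
  have h5 : 0 < Real.exp (l / 4) := Real.exp_pos _
  calc _ ≤ ‖ε‖ * l * Real.exp (‖ε‖ * l) := h1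
    _ ≤ ‖ε‖ * (4 * (Real.exp (l / 4) - 1)) * Real.exp (l / 4) := by
        refine mul_le_mul (by gcongr; linarith) h2 (Real.exp_pos _).le
          (mul_nonneg (norm_nonneg _) (by linarith))
    _ = 4 * ‖ε‖ * (Real.exp (l / 2) * (1 - Real.exp (-(l / 4)))) := by
        rw [e2]
        linear_combination (4 * ‖ε‖ * Real.exp (l / 4)) * e1
    _ ≤ _ := by gcongr

lemma norm_regTerm_sub_le (hm : 0 < m) (h : γ.det = (m : ℤ)) {y₀ : ℝ} (hy₀ : 0 < y₀)
    (hy₁ : y₀ ≤ 1) (h₁ : y₀ ≤ z₁.im) (h₂ : y₀ ≤ z₂.im) {s ε : ℂ} (hs : ε = 2 * s - 2)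
    (hε : IsSmall ε) (hp : muPlus z₁ z₂ γ ≠ 0) :
    ‖regTerm z₁ z₂ s γ - regInv ε (muMinus z₁ z₂ γ)‖ ≤
      16 * y₀⁻¹ * m * z₁.im * z₂.im * ‖ε‖ * crossTerm z₁ z₂ γ := by
  have hmu := muMinus_ne_zero hm h z₁ z₂
  set X := ‖muMinus z₁ z₂ γ‖ with hX
  set Y := ‖muPlus z₁ z₂ γ‖ with hY
  have hX0 : 0 < X := norm_pos_iff.2 hmu
  have hY0 : 0 < Y := norm_pos_iff.2 hp
  have hy1 := z₁.im_pos
  have hy2 := z₂.im_pos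
  have hXY : X ^ 2 - Y ^ 2 = 4 * m * z₁.im * z₂.im := sq_norm_muMinus_sub h z₁ z₂
  have hYX : Y ≤ X := by
    refine le_of_sq_le_sq ?_ hX0.le
    have : 0 ≤ 4 * m * z₁.im * z₂.im := by positivity
    linarith
  have hl : 0 ≤ Real.log X - Real.log Y := sub_nonneg.2 (Real.log_le_log hY0 hYX)
  have e1 : Real.exp (-2 * (Real.log X - Real.log Y)) = Y ^ 2 / X ^ 2 := by
    rw [show -2 * (Real.log X - Real.log Y) = 2 * Real.log Y - 2 * Real.log X by ring,
      Real.exp_sub, two_mul, two_mul, Real.exp_add, Real.exp_add, Real.exp_log hY0,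
      Real.exp_log hX0]
    ring
  have e2 : Real.exp ((Real.log X - Real.log Y) / 2) = X ^ (1 / 2 : ℝ) * Y ^ (-(1 / 2) : ℝ) := by
    rw [Real.rpow_def_of_pos hX0, Real.rpow_def_of_pos hY0, ← Real.exp_add]
    congr 1
    ring
  rw [regTerm_eq hs hmu hp, ← mul_sub_one, norm_mul]
  calc _ ≤ (y₀⁻¹ * (X ^ 2)⁻¹) * (4 * ‖ε‖ * ((X ^ (1 / 2 : ℝ) * Y ^ (-(1 / 2) : ℝ)) *
        (1 - Y ^ 2 / X ^ 2))) := by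
        rw [← e1, ← e2]
        exact mul_le_mul (norm_regInv_le hε.1 hε.2 hy₀ hy₁ (le_norm_muMinus hm h hy₀ h₁ h₂))
          (norm_exp_mul_sub_one_le hε.2 hl) (norm_nonneg _) (by positivity)
    _ = y₀⁻¹ * 4 * ‖ε‖ * (X ^ 2 - Y ^ 2) *
        (X ^ (1 / 2 : ℝ) * ((X ^ 2)⁻¹ * (X ^ 2)⁻¹) * Y ^ (-(1 / 2) : ℝ)) := by
        field_simp
    _ = _ := by
        have e3 : X ^ (1 / 2 : ℝ) * ((X ^ 2)⁻¹ * (X ^ 2)⁻¹) = X ^ (-(7 / 2) : ℝ) := by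
          rw [← mul_inv, ← pow_add, ← Real.rpow_natCast, ← Real.rpow_neg hX0.le,
            ← Real.rpow_add hX0]
          norm_num
        rw [e3, hXY, crossTerm]
        ring

end RegularizedTerms

/-! ### Convergence, uniform bounds and the limit of the regularized series. -/

section RegularizedSums

variable {m : ℕ} {z₁ z₂ : ℍ}

lemma exists_pos_le_im (z₁ z₂ : ℍ) : ∃ y₀ : ℝ, 0 < y₀ ∧ y₀ ≤ 1 ∧ y₀ ≤ z₁.im ∧ y₀ ≤ z₂.im :=
  ⟨min 1 (min z₁.im z₂.im), lt_min one_pos (lt_min z₁.im_pos z₂.im_pos), min_le_left _ _,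
    (min_le_right _ _).trans (min_le_left _ _), (min_le_right _ _).trans (min_le_right _ _)⟩

lemma neg_conj_im (z : ℍ) : (-conj (z : ℂ)).im = z.im := by simp

lemma isSmall_ofReal {δ : ℝ} (h0 : 0 ≤ δ) (h1 : δ ≤ 1 / 4) : IsSmall (δ : ℂ) :=
  ⟨by simpa using h0, by simpa [abs_of_nonneg h0] using h1⟩

/-- The absolute convergence already known at a small real parameter `δ` covers the exponent `-2 -
2δ ≥ s`; the remaining power is bounded because `|μ₋| ≥ y₀`. -/
lemma summable_norm_muMinus_rpow (hm : 0 < m) (P : ℤ → ℤ → Prop) (z₁ z₂ : ℍ) {s : ℝ}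
    (hs : s < -2) :
    Summable ((detSet m P).indicator fun γ => ‖muMinus z₁ z₂ γ‖ ^ s) := by
  classical
  obtain ⟨y₀, hy₀, hy₁, h₁, h₂⟩ := exists_pos_le_im z₁ z₂
  set δ : ℝ := min (1 / 4) ((-2 - s) / 2) with hδ
  have hδ0 : 0 < δ := lt_min (by norm_num) (by linarith)
  have hδs : s ≤ -2 - 2 * δ := by linarith [min_le_right (1 / 4 : ℝ) ((-2 - s) / 2)]
  have hsmall := isSmall_ofReal hδ0.le (min_le_left _ _)
  have key := (summable_indicator_regInv hm P hsmall (by simpa using hδ0) hy₀ hy₁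
    (w := z₁) (z := -conj (z₂ : ℂ)) h₁ (by rw [neg_conj_im]; exact h₂)).norm
  refine (key.mul_left (y₀ ^ (s + 2 + 2 * δ))).of_nonneg_of_le
    (fun γ => Set.indicator_nonneg (fun _ _ => by positivity) _) fun γ => ?_
  simp only [Set.indicator_apply]
  split_ifs with h
  · have hmu := muMinus_ne_zero hm h.1 z₁ z₂
    have h0 : 0 < ‖muMinus z₁ z₂ γ‖ := norm_pos_iff.2 hmu
    rw [← muMinus, norm_regInv_eq_rpow _ hmu, Complex.ofReal_re,
      show s = (s + 2 + 2 * δ) + (-2 - 2 * δ) by ring, Real.rpow_add h0]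
    rw [show s + 2 + 2 * δ + (-2 - 2 * δ) + 2 + 2 * δ = s + 2 + 2 * δ by ring]
    gcongr ?_ * _
    exact Real.rpow_le_rpow_of_nonpos hy₀ (le_norm_muMinus hm h.1 hy₀ h₁ h₂) (by linarith)
  · simp

/-- Summability of `|μ₋|⁻⁴` leaves only finitely many `γ` with `|μ₋|² ≤ 8 m y₁ y₂`. For the others
`|μ₊|² = |μ₋|² - 4 m y₁ y₂` is at least half of `|μ₋|²`. -/
lemma eventually_norm_muMinus_le (hm : 0 < m) (P : ℤ → ℤ → Prop) (z₁ z₂ : ℍ) :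
    ∀ᶠ γ in cofinite, γ ∈ detSet m P → ‖muMinus z₁ z₂ γ‖ ≤ 2 * ‖muPlus z₁ z₂ γ‖ := by
  classical
  have h := (summable_norm_muMinus_rpow hm P z₁ z₂ (s := -4) (by norm_num)).tendsto_cofinite_zero
  have hy1 := z₁.im_pos
  have hy2 := z₂.im_pos
  have hm' : (0 : ℝ) < m := by exact_mod_cast hm
  set K := 8 * m * z₁.im * z₂.im with hK
  have hK0 : 0 < K := by positivity
  filter_upwards [h.eventually (gt_mem_nhds (show (0 : ℝ) < (K ^ 2)⁻¹ by positivity))] with γ hγ hmem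
  rw [Set.indicator_of_mem hmem] at hγ
  have hX0 : 0 < ‖muMinus z₁ z₂ γ‖ := norm_pos_iff.2 (muMinus_ne_zero hm hmem.1 z₁ z₂)
  have e : ‖muMinus z₁ z₂ γ‖ ^ (-4 : ℝ) = ((‖muMinus z₁ z₂ γ‖ ^ 2) ^ 2)⁻¹ := by
    rw [← pow_mul, ← Real.rpow_natCast, ← Real.rpow_neg hX0.le]
    norm_num
  rw [e, inv_lt_inv₀ (by positivity) (by positivity)] at hγ
  have h1 : K < ‖muMinus z₁ z₂ γ‖ ^ 2 := lt_of_pow_lt_pow_left₀ 2 (by positivity) hγ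
  have h2 := sq_norm_muMinus_sub hmem.1 z₁ z₂
  refine le_of_sq_le_sq ?_ (by positivity)
  nlinarith [sq_nonneg ‖muPlus z₁ z₂ γ‖]

lemma norm_muPlus_rpow_le {γ : Matrix (Fin 2) (Fin 2) ℤ} (h0 : muMinus z₁ z₂ γ ≠ 0)
    (h : ‖muMinus z₁ z₂ γ‖ ≤ 2 * ‖muPlus z₁ z₂ γ‖) {δ : ℝ} (hδ : 0 ≤ δ) :
    ‖muPlus z₁ z₂ γ‖ ^ (-δ) ≤ 2 ^ δ * ‖muMinus z₁ z₂ γ‖ ^ (-δ) := by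
  have h1 := norm_pos_iff.2 h0
  have h2 := Real.rpow_le_rpow_of_nonpos h1 h (neg_nonpos.2 hδ)
  rw [Real.mul_rpow zero_le_two (norm_nonneg _), Real.rpow_neg zero_le_two] at h2
  have h3 : (0 : ℝ) < 2 ^ δ := by positivity
  calc ‖muPlus z₁ z₂ γ‖ ^ (-δ) = 2 ^ δ * ((2 ^ δ)⁻¹ * ‖muPlus z₁ z₂ γ‖ ^ (-δ)) := by
        field_simp
    _ ≤ _ := by gcongr

lemma summable_crossTerm (hm : 0 < m) (P : ℤ → ℤ → Prop) (z₁ z₂ : ℍ) :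
    Summable ((detSet m P).indicator (crossTerm z₁ z₂)) := by
  classical
  refine Summable.of_norm_bounded_eventually (((summable_norm_muMinus_rpow hm P z₁ z₂ (s := -4)
    (by norm_num)).mul_left (2 ^ (1 / 2 : ℝ)))) ?_
  filter_upwards [eventually_norm_muMinus_le hm P z₁ z₂] with γ hγ
  rw [Set.indicator_apply, Set.indicator_apply]
  split_ifs with h
  · have hmu := muMinus_ne_zero hm h.1 z₁ z₂
    rw [Real.norm_of_nonneg (crossTerm_nonneg _ _ _), crossTerm]
    calc _ ≤ ‖muMinus z₁ z₂ γ‖ ^ (-(7 / 2) : ℝ) *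
          (2 ^ (1 / 2 : ℝ) * ‖muMinus z₁ z₂ γ‖ ^ (-(1 / 2) : ℝ)) := by
          gcongr
          exact norm_muPlus_rpow_le hmu (hγ h) (by norm_num)
      _ = 2 ^ (1 / 2 : ℝ) * (‖muMinus z₁ z₂ γ‖ ^ (-(7 / 2) : ℝ) *
          ‖muMinus z₁ z₂ γ‖ ^ (-(1 / 2) : ℝ)) := by ring
      _ = _ := by
          rw [← Real.rpow_add (norm_pos_iff.2 hmu)]
          norm_num
  · simp

/-- For all but finitely many `γ` the term is dominated by a constant times `|μ₋|^(-2 - 2δ)` with `δ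
= 2 Re s - 2`. Summability therefore holds even when some `μ₊` vanishes. -/
lemma summable_regTerm (hm : 0 < m) (P : ℤ → ℤ → Prop) (z₁ z₂ : ℍ) {s : ℂ} (hs : 1 < s.re) :
    Summable ((detSet m P).indicator (regTerm z₁ z₂ s)) := by
  classical
  set δ : ℝ := (2 * s - 2).re with hδ
  have hδ0 : 0 < δ := by
    simp [hδ]
    linarith
  refine Summable.of_norm_bounded_eventually (((summable_norm_muMinus_rpow hm P z₁ z₂
    (s := -2 - 2 * δ) (by linarith)).mul_left (2 ^ δ))) ?_
  filter_upwards [eventually_norm_muMinus_le hm P z₁ z₂] with γ hγ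
  rw [Set.indicator_apply, Set.indicator_apply]
  split_ifs with h
  · have hmu := muMinus_ne_zero hm h.1 z₁ z₂
    have hX0 := norm_pos_iff.2 hmu
    have hp : muPlus z₁ z₂ γ ≠ 0 := norm_pos_iff.1 (by linarith [hγ h])
    rw [norm_regTerm_eq hmu hp, ← hδ]
    calc _ ≤ ‖muMinus z₁ z₂ γ‖ ^ (-2 - δ) * (2 ^ δ * ‖muMinus z₁ z₂ γ‖ ^ (-δ)) := by
          gcongr
          exact norm_muPlus_rpow_le hmu (hγ h) hδ0.le
      _ = 2 ^ δ * (‖muMinus z₁ z₂ γ‖ ^ (-2 - δ) * ‖muMinus z₁ z₂ γ‖ ^ (-δ)) := by ring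
      _ = _ := by
          rw [← Real.rpow_add hX0]
          ring_nf
  · simp

/-- The regularized series over the matrices of determinant `m` satisfying `P`. -/
def regSum (m : ℕ) (P : ℤ → ℤ → Prop) (z₁ z₂ : ℍ) (s : ℂ) : ℂ :=
  ∑' γ, (detSet m P).indicator (regTerm z₁ z₂ s) γ

lemma norm_regSum_sub_kernelSum_le (hm : 0 < m) (P : ℤ → ℤ → Prop) {y₀ : ℝ} (hy₀ : 0 < y₀)
    (hy₁ : y₀ ≤ 1) (h₁ : y₀ ≤ z₁.im) (h₂ : y₀ ≤ z₂.im) {s ε : ℂ} (hs : ε = 2 * s - 2)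
    (hε : IsSmall ε) (hpos : 0 < ε.re) (hp : ∀ γ ∈ detSet m P, muPlus z₁ z₂ γ ≠ 0) :
    ‖regSum m P z₁ z₂ s - kernelSum m P z₁ (-conj (z₂ : ℂ)) ε‖ ≤
      16 * y₀⁻¹ * m * z₁.im * z₂.im * ‖ε‖ * ∑' γ, (detSet m P).indicator (crossTerm z₁ z₂) γ := by
  classical
  have hs1 : 1 < s.re := by
    have : ε.re = 2 * s.re - 2 := by rw [hs]; simp
    linarith
  rw [regSum, kernelSum, ← (summable_regTerm hm P z₁ z₂ hs1).tsum_sub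
    (summable_indicator_regInv hm P hε hpos hy₀ hy₁ (w := z₁) (z := -conj (z₂ : ℂ)) h₁
      (by rw [neg_conj_im]; exact h₂)), ← tsum_mul_left]
  refine tsum_of_norm_bounded ((summable_crossTerm hm P z₁ z₂).mul_left _).hasSum fun γ => ?_
  simp only [Set.indicator_apply]
  split_ifs with h
  · exact norm_regTerm_sub_le hm h.1 hy₀ hy₁ h₁ h₂ hs hε (hp γ h)
  · simp

variable {N : ℕ} [NeZero N]

/-- The constant is independent of `s` and of `z₂` with `Im z₂ ≥ y₀`. All singular behaviour in `z₂`
sits in the cross terms, and growth towards the cusp is at most the explicit factor `Im z₂`; this is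
the input for the domination argument. -/
lemma exists_norm_regSum_le (hm : 0 < m) (Q : ZMod N × ZMod N → Prop) (z₁ : ℍ) {y₀ : ℝ}
    (hy₀ : 0 < y₀) (hy₁ : y₀ ≤ 1) (h₁ : y₀ ≤ z₁.im) :
    ∃ C : ℝ, 0 ≤ C ∧ ∀ s ε : ℂ, ε = 2 * s - 2 → IsSmall ε → 0 < ε.re → ∀ z₂ : ℍ, y₀ ≤ z₂.im →
      (∀ γ ∈ detSet m (ModCond Q), muPlus z₁ z₂ γ ≠ 0) →
      ‖regSum m (ModCond Q) z₁ z₂ s‖ ≤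
        C + C * z₂.im * ∑' γ, (detSet m (ModCond Q)).indicator (crossTerm z₁ z₂) γ := by
  obtain ⟨C, hC⟩ := exists_norm_kernelSum_le hm Q hy₀ hy₁
  refine ⟨max C (16 * y₀⁻¹ * m * z₁.im), le_max_of_le_right (by have := z₁.im_pos; positivity),
    fun s ε hs hε hpos z₂ h₂ hp => ?_⟩
  have hy2 := z₂.im_pos
  have hy1 := z₁.im_pos
  have hS : 0 ≤ ∑' γ, (detSet m (ModCond Q)).indicator (crossTerm z₁ z₂) γ :=
    tsum_nonneg fun γ => Set.indicator_nonneg (fun _ _ => crossTerm_nonneg _ _ _) _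
  have k1 := norm_regSum_sub_kernelSum_le hm (ModCond Q) hy₀ hy₁ h₁ h₂ hs hε hpos hp
  have k2 := hC ε hε hpos z₁ (-conj (z₂ : ℂ)) h₁ (by rw [neg_conj_im]; exact h₂)
  have k3 := norm_sub_norm_le (regSum m (ModCond Q) z₁ z₂ s)
    (kernelSum m (ModCond Q) z₁ (-conj (z₂ : ℂ)) ε)
  have k4 : 16 * y₀⁻¹ * m * z₁.im * z₂.im * ‖ε‖ *
      ∑' γ, (detSet m (ModCond Q)).indicator (crossTerm z₁ z₂) γ ≤
      max C (16 * y₀⁻¹ * m * z₁.im) * z₂.im *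
        ∑' γ, (detSet m (ModCond Q)).indicator (crossTerm z₁ z₂) γ := by
    gcongr ?_ * _
    have : 16 * y₀⁻¹ * m * z₁.im * z₂.im * ‖ε‖ ≤ 16 * y₀⁻¹ * m * z₁.im * z₂.im * 1 := by
      gcongr
      exact hε.2.trans (by norm_num)
    refine this.trans ?_
    rw [mul_one]
    gcongr
    exact le_max_right _ _
  have k5 := le_max_left C (16 * y₀⁻¹ * m * z₁.im)
  linarith

lemma tendsto_two_mul_sub_two :
    Tendsto (fun s : ℂ => 2 * s - 2) (𝓝[{s : ℂ | 1 < s.re}] 1) regFilter := by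
  refine tendsto_nhdsWithin_iff.2 ⟨?_, ?_⟩
  · have : Tendsto (fun s : ℂ => 2 * s - 2) (𝓝 1) (𝓝 (2 * 1 - 2)) :=
      (by fun_prop : Continuous fun s : ℂ => 2 * s - 2).tendsto 1
    rw [mul_one, sub_self] at this
    exact this.mono_left nhdsWithin_le_nhds
  · filter_upwards [self_mem_nhdsWithin] with s hs
    have : (1 : ℝ) < s.re := hs
    simp
    linarith

/-- The difference from `kernelSum` is `O(|ε|)` for fixed `z₁, z₂`, so both have the same limit. -/
lemma exists_tendsto_regSum (hm : 0 < m) (Q : ZMod N × ZMod N → Prop) (z₁ z₂ : ℍ)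
    (hp : ∀ γ ∈ detSet m (ModCond Q), muPlus z₁ z₂ γ ≠ 0) :
    ∃ L : ℂ, Tendsto (regSum m (ModCond Q) z₁ z₂) (𝓝[{s : ℂ | 1 < s.re}] 1) (𝓝 L) := by
  obtain ⟨y₀, hy₀, hy₁, h₁, h₂⟩ := exists_pos_le_im z₁ z₂
  obtain ⟨L, hL⟩ := exists_tendsto_kernelSum hm Q hy₀ hy₁ (w := z₁) (z := -conj (z₂ : ℂ)) h₁
    (by rw [neg_conj_im]; exact h₂)
  refine ⟨L, ?_⟩
  have t1 := hL.comp tendsto_two_mul_sub_two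
  have t2 : Tendsto (fun s : ℂ => regSum m (ModCond Q) z₁ z₂ s -
      kernelSum m (ModCond Q) z₁ (-conj (z₂ : ℂ)) (2 * s - 2)) (𝓝[{s : ℂ | 1 < s.re}] 1) (𝓝 0) := by
    have t3 : Tendsto (fun s : ℂ => 16 * y₀⁻¹ * m * z₁.im * z₂.im * ‖2 * s - 2‖ *
        ∑' γ, (detSet m (ModCond Q)).indicator (crossTerm z₁ z₂) γ) (𝓝[{s : ℂ | 1 < s.re}] 1)
        (𝓝 0) := by
      have := ((tendsto_regFilter_id.comp tendsto_two_mul_sub_two).norm.const_mul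
        (16 * y₀⁻¹ * m * z₁.im * z₂.im)).mul_const
        (∑' γ, (detSet m (ModCond Q)).indicator (crossTerm z₁ z₂) γ)
      simpa using this
    refine squeeze_zero_norm' ?_ t3
    filter_upwards [tendsto_two_mul_sub_two.eventually eventually_isSmall] with s hs
    exact norm_regSum_sub_kernelSum_le hm _ hy₀ hy₁ h₁ h₂ rfl hs.1 hs.2 hp
  have := t2.add t1
  simpa using this

end RegularizedSums

/-! ### The kernel is well defined. -/

section Kernel

variable {N m : ℕ} [NeZero N]

/-- The condition on the first column in the definition of `M(m, N)`. -/
def UnitCond (N : ℕ) (x : ZMod N × ZMod N) : Prop := IsUnit x.1 ∧ x.2 = 0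

lemma matSet_eq_detSet (m N : ℕ) : matSet m N = detSet m (ModCond (UnitCond N)) := by
  ext γ
  simp only [matSet, detSet, ModCond, UnitCond, Set.mem_ofPred_eq, ZMod.intCast_zmod_eq_zero_iff_dvd,
    ZMod.coe_int_isUnit_iff_isCoprime, isCoprime_comm]

lemma Omega_eq_regSum (m N : ℕ) (z₁ z₂ : ℍ) (s : ℂ) :
    Omega m N z₁ z₂ s = 1 / 2 * regSum m (ModCond (UnitCond N)) z₁ z₂ s := by
  rw [Omega, tsum_subtype (matSet m N) (regTerm z₁ z₂ s), matSet_eq_detSet, regSum]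

/-- Nontriviality of the filter makes the limit unique, so that `limUnder` returns it. -/
lemma neBot_re_gt_one : (𝓝[{s : ℂ | 1 < s.re}] (1 : ℂ)).NeBot := by
  rw [← mem_closure_iff_nhdsWithin_neBot]
  have : (1 : ℂ) ∈ closure {s : ℂ | 1 < s.re} := by
    rw [Complex.closure_setOfPred_lt_re]
    simp
  exact this

lemma summable_and_tendsto_Omega (hm : 0 < m) {z₁ z₂ : ℍ}
    (hp : ∀ γ ∈ matSet m N, mu γ z₁ (-(z₂ : ℂ)) ≠ 0) :
    (∀ s : ℂ, 1 < s.re → Summable fun γ : matSet m N => regTerm z₁ z₂ s γ) ∧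
      Tendsto (Omega m N z₁ z₂) (𝓝[{s : ℂ | 1 < s.re}] 1) (𝓝 (omega m N z₁ z₂)) := by
  constructor
  · intro s hs
    have := summable_regTerm hm (ModCond (UnitCond N)) z₁ z₂ hs
    rw [← matSet_eq_detSet] at this
    exact (summable_subtype_iff_indicator (s := matSet m N)).2 this
  · rw [matSet_eq_detSet] at hp
    obtain ⟨L, hL⟩ := exists_tendsto_regSum hm (UnitCond N) z₁ z₂ hp
    have h : Tendsto (Omega m N z₁ z₂) (𝓝[{s : ℂ | 1 < s.re}] 1) (𝓝 (1 / 2 * L)) := by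
      rw [funext (Omega_eq_regSum m N z₁ z₂)]
      exact hL.const_mul _
    have := neBot_re_gt_one
    rw [omega, h.limUnder_eq]
    exact h

end Kernel

/-! ### Behaviour under unimodular substitutions of `z₂`. -/

section Transformation

open UpperHalfPlane

/-- The factor of automorphy. -/
def autFactor (σ : SL(2, ℤ)) (z : ℍ) : ℂ := (σ 1 0 : ℂ) * z + σ 1 1

lemma denom_eq_autFactor (σ : SL(2, ℤ)) (z : ℍ) : denom σ z = autFactor σ z := by
  rw [ModularGroup.denom_apply, autFactor]

lemma autFactor_ne_zero (σ : SL(2, ℤ)) (z : ℍ) : autFactor σ z ≠ 0 := by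
  rw [← denom_eq_autFactor]
  exact denom_ne_zero _ _

lemma im_smul_eq (σ : SL(2, ℤ)) (z : ℍ) : (σ • z).im = z.im / ‖autFactor σ z‖ ^ 2 := by
  rw [ModularGroup.im_smul_eq_div_normSq, denom_eq_autFactor, Complex.normSq_eq_norm_sq]

lemma coe_smul_mul_autFactor (σ : SL(2, ℤ)) (z : ℍ) :
    ((σ • z : ℍ) : ℂ) * autFactor σ z = (σ 0 0 : ℂ) * z + σ 0 1 := by
  rw [UpperHalfPlane.coe_specialLinearGroup_apply]
  have h := autFactor_ne_zero σ z
  rw [autFactor] at h ⊢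
  simp only [eq_intCast, Complex.ofReal_intCast]
  exact div_mul_cancel₀ _ h

/-- Left multiplication of `γ` by `σ` matches the action of `σ` on the second variable, up to the
factor of automorphy. -/
lemma mu_mul_smul (σ : SL(2, ℤ)) (γ : Matrix (Fin 2) (Fin 2) ℤ) (x : ℂ) (z : ℍ) :
    mu ((σ : Matrix (Fin 2) (Fin 2) ℤ) * γ) x (-((σ • z : ℍ) : ℂ)) * autFactor σ z =
      mu γ x (-(z : ℂ)) := by
  have h1 := coe_smul_mul_autFactor σ z
  have hdet : (σ 0 0 : ℂ) * σ 1 1 - σ 0 1 * σ 1 0 = 1 := by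
    have := σ.det_coe
    rw [Matrix.det_fin_two] at this
    exact_mod_cast this
  simp only [mu, Matrix.mul_apply, Fin.sum_univ_two]
  push_cast
  rw [autFactor] at h1 ⊢
  linear_combination (-((σ 1 0 : ℂ) * γ 0 0 + σ 1 1 * γ 1 0) * x -
    (σ 1 0 * γ 0 1 + σ 1 1 * γ 1 1)) * h1 +
    (γ 0 0 * x + γ 0 1 - z * (γ 1 0 * x + γ 1 1)) * hdet

lemma norm_muPlus_mul_smul (σ : SL(2, ℤ)) (γ : Matrix (Fin 2) (Fin 2) ℤ) (z₁ z : ℍ) :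
    ‖muPlus z₁ (σ • z) ((σ : Matrix (Fin 2) (Fin 2) ℤ) * γ)‖ =
      ‖muPlus z₁ z γ‖ / ‖autFactor σ z‖ := by
  rw [eq_div_iff (norm_ne_zero_iff.2 (autFactor_ne_zero σ z)), ← norm_mul, muPlus, mu_mul_smul]
  rfl

lemma conj_muMinus_mul_smul (σ : SL(2, ℤ)) (γ : Matrix (Fin 2) (Fin 2) ℤ) (z₁ z : ℍ) :
    conj (muMinus z₁ (σ • z) ((σ : Matrix (Fin 2) (Fin 2) ℤ) * γ)) =
      conj (muMinus z₁ z γ) / autFactor σ z := by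
  rw [eq_div_iff (autFactor_ne_zero σ z), ← conj_mu_conj, mu_mul_smul, conj_mu_conj]

lemma norm_muMinus_mul_smul (σ : SL(2, ℤ)) (γ : Matrix (Fin 2) (Fin 2) ℤ) (z₁ z : ℍ) :
    ‖muMinus z₁ (σ • z) ((σ : Matrix (Fin 2) (Fin 2) ℤ) * γ)‖ =
      ‖muMinus z₁ z γ‖ / ‖autFactor σ z‖ := by
  have := congrArg norm (conj_muMinus_mul_smul σ γ z₁ z)
  rwa [norm_div, Complex.norm_conj, Complex.norm_conj] at this

/-- The weight-correct version of the regularized term, for real `ε = 2 s - 2`. -/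
def kernelTerm (ε : ℝ) (z₁ z : ℍ) (γ : Matrix (Fin 2) (Fin 2) ℤ) : ℂ :=
  ((z.im ^ (2 + ε) : ℝ) : ℂ) * regTerm z₁ z (1 + ε / 2) γ

lemma kernelTerm_eq (ε : ℝ) (z₁ z : ℍ) (γ : Matrix (Fin 2) (Fin 2) ℤ) :
    kernelTerm ε z₁ z γ = conj (muMinus z₁ z γ) ^ 2 *
      ((z.im ^ (2 + ε) / (‖muPlus z₁ z γ‖ ^ ε * ‖muMinus z₁ z γ‖ ^ (4 + ε)) : ℝ) : ℂ) := by
  rw [kernelTerm, regTerm, conj_mu_conj, ← muPlus, ← muMinus,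
    show 2 * (1 + (ε : ℂ) / 2) - 2 = (ε : ℂ) by ring,
    show 2 * (1 + (ε : ℂ) / 2) + 2 = ((4 + ε : ℝ) : ℂ) by push_cast; ring,
    ← Complex.ofReal_cpow (norm_nonneg _), ← Complex.ofReal_cpow (norm_nonneg _)]
  push_cast
  ring

/-- The factor `y^(2+ε)` contributes `|j|^(-4-2ε)`, which cancels the total power `ε + (4 + ε)` of
`|j|` from the denominator. Only `j⁻²` from the squared conjugate survives, the inverse of the
weight of `f`. -/
lemma kernelTerm_mul_smul (ε : ℝ) (σ : SL(2, ℤ)) (γ : Matrix (Fin 2) (Fin 2) ℤ) (z₁ z : ℍ) :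
    kernelTerm ε z₁ (σ • z) ((σ : Matrix (Fin 2) (Fin 2) ℤ) * γ) =
      (autFactor σ z ^ 2)⁻¹ * kernelTerm ε z₁ z γ := by
  have hj : 0 < ‖autFactor σ z‖ := norm_pos_iff.2 (autFactor_ne_zero σ z)
  rw [kernelTerm_eq, kernelTerm_eq, conj_muMinus_mul_smul, norm_muPlus_mul_smul,
    norm_muMinus_mul_smul, im_smul_eq]
  have e : (z.im / ‖autFactor σ z‖ ^ 2) ^ (2 + ε) / ((‖muPlus z₁ z γ‖ / ‖autFactor σ z‖) ^ ε *
      (‖muMinus z₁ z γ‖ / ‖autFactor σ z‖) ^ (4 + ε)) =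
      z.im ^ (2 + ε) / (‖muPlus z₁ z γ‖ ^ ε * ‖muMinus z₁ z γ‖ ^ (4 + ε)) := by
    rw [Real.div_rpow z.im_pos.le (by positivity), Real.div_rpow (norm_nonneg _) hj.le,
      Real.div_rpow (norm_nonneg _) hj.le]
    have e1 : (‖autFactor σ z‖ ^ 2) ^ (2 + ε) =
        ‖autFactor σ z‖ ^ ε * ‖autFactor σ z‖ ^ (4 + ε) := by
      rw [← Real.rpow_natCast, ← Real.rpow_mul hj.le, ← Real.rpow_add hj]
      congr 1
      push_cast
      ring
    rw [e1]
    have h1 : ‖autFactor σ z‖ ^ ε ≠ 0 := (Real.rpow_pos_of_pos hj _).ne'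
    have h2 : ‖autFactor σ z‖ ^ (4 + ε) ≠ 0 := (Real.rpow_pos_of_pos hj _).ne'
    rw [div_mul_div_comm, div_div_div_cancel_right₀ (mul_ne_zero h1 h2)]
  rw [e, div_pow]
  ring

/-- The weight-correct version of the regularized series, for real `ε = 2 s - 2`. -/
def kernelSeries (m : ℕ) (P : ℤ → ℤ → Prop) (ε : ℝ) (z₁ z : ℍ) : ℂ :=
  ((z.im ^ (2 + ε) : ℝ) : ℂ) * regSum m P z₁ z (1 + ε / 2)

lemma kernelSeries_eq_tsum (m : ℕ) (P : ℤ → ℤ → Prop) (ε : ℝ) (z₁ z : ℍ) :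
    kernelSeries m P ε z₁ z = ∑' γ, (detSet m P).indicator (kernelTerm ε z₁ z) γ := by
  classical
  rw [kernelSeries, regSum, ← tsum_mul_left]
  refine tsum_congr fun γ => ?_
  simp only [Set.indicator_apply, mul_ite, mul_zero, kernelTerm]

/-- The action of a unimodular matrix on a condition on the first column. -/
def smulCond (σ : SL(2, ℤ)) (P : ℤ → ℤ → Prop) (a c : ℤ) : Prop :=
  P (σ 0 0 * a + σ 0 1 * c) (σ 1 0 * a + σ 1 1 * c)

lemma mul_mem_detSet_iff (m : ℕ) (P : ℤ → ℤ → Prop) (σ : SL(2, ℤ))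
    (γ : Matrix (Fin 2) (Fin 2) ℤ) :
    (σ : Matrix (Fin 2) (Fin 2) ℤ) * γ ∈ detSet m P ↔ γ ∈ detSet m (smulCond σ P) := by
  simp only [detSet, smulCond, Set.mem_ofPred_eq, Matrix.det_mul, σ.det_coe, one_mul,
    Matrix.mul_apply, Fin.sum_univ_two]

/-- Left multiplication by a unimodular matrix. -/
def leftMulEquiv (σ : SL(2, ℤ)) : Matrix (Fin 2) (Fin 2) ℤ ≃ Matrix (Fin 2) (Fin 2) ℤ where
  toFun γ := (σ : Matrix (Fin 2) (Fin 2) ℤ) * γ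
  invFun γ := ((σ⁻¹ : SL(2, ℤ)) : Matrix (Fin 2) (Fin 2) ℤ) * γ
  left_inv γ := by
    change ((σ⁻¹ : SL(2, ℤ)) : Matrix (Fin 2) (Fin 2) ℤ) *
      ((σ : Matrix (Fin 2) (Fin 2) ℤ) * γ) = γ
    rw [← Matrix.mul_assoc, ← Matrix.SpecialLinearGroup.coe_mul, inv_mul_cancel,
      Matrix.SpecialLinearGroup.coe_one, Matrix.one_mul]
  right_inv γ := by
    change (σ : Matrix (Fin 2) (Fin 2) ℤ) *
      (((σ⁻¹ : SL(2, ℤ)) : Matrix (Fin 2) (Fin 2) ℤ) * γ) = γ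
    rw [← Matrix.mul_assoc, ← Matrix.SpecialLinearGroup.coe_mul, mul_inv_cancel,
      Matrix.SpecialLinearGroup.coe_one, Matrix.one_mul]

lemma kernelSeries_smul (m : ℕ) (P : ℤ → ℤ → Prop) (ε : ℝ) (σ : SL(2, ℤ)) (z₁ z : ℍ) :
    kernelSeries m P ε z₁ (σ • z) =
      (autFactor σ z ^ 2)⁻¹ * kernelSeries m (smulCond σ P) ε z₁ z := by
  classical
  rw [kernelSeries_eq_tsum, kernelSeries_eq_tsum, ← tsum_mul_left, ← (leftMulEquiv σ).tsum_eq]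
  refine tsum_congr fun γ => ?_
  change (detSet m P).indicator _ ((σ : Matrix (Fin 2) (Fin 2) ℤ) * γ) = _
  rw [Set.indicator_apply, Set.indicator_apply, mul_ite, mul_zero]
  exact if_congr (mul_mem_detSet_iff m P σ γ) (kernelTerm_mul_smul ε σ γ z₁ z) rfl

/-- A condition modulo `N` transforms into a condition modulo `N`. -/
lemma smulCond_modCond {N : ℕ} (σ : SL(2, ℤ)) (Q : ZMod N × ZMod N → Prop) :
    smulCond σ (ModCond Q) = ModCond fun x =>
      Q ((σ 0 0 : ZMod N) * x.1 + (σ 0 1 : ZMod N) * x.2,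
        (σ 1 0 : ZMod N) * x.1 + (σ 1 1 : ZMod N) * x.2) := by
  funext a c
  simp [smulCond, ModCond]

/-- Modulo `N` an element of `Γ₀(N)` is upper triangular with unit diagonal, so it preserves the
columns whose first entry is a unit and whose second entry is zero. -/
lemma smulCond_unitCond {N : ℕ} [NeZero N] {τ : SL(2, ℤ)} (hτ : τ ∈ CongruenceSubgroup.Gamma0 N) :
    smulCond τ (ModCond (UnitCond N)) = ModCond (UnitCond N) := by
  rw [smulCond_modCond]
  have h0 : ((τ 1 0 : ℤ) : ZMod N) = 0 := CongruenceSubgroup.Gamma0_mem.1 hτ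
  have hdet : (τ 0 0 : ZMod N) * τ 1 1 = 1 := by
    have := τ.det_coe
    rw [Matrix.det_fin_two] at this
    have h2 := congrArg (Int.cast : ℤ → ZMod N) this
    push_cast at h2
    rw [h0, mul_zero, sub_zero] at h2
    exact h2
  have u0 : IsUnit (τ 0 0 : ZMod N) := IsUnit.of_mul_eq_one _ hdet
  have u1 : IsUnit (τ 1 1 : ZMod N) := IsUnit.of_mul_eq_one _ (by rw [mul_comm]; exact hdet)
  congr 1
  funext x
  simp only [UnitCond, h0, zero_mul, zero_add, eq_iff_iff]
  constructor
  · rintro ⟨h1, h2⟩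
    have h3 : x.2 = 0 := (u1.mul_right_eq_zero).1 h2
    rw [h3, mul_zero, add_zero] at h1
    exact ⟨(IsUnit.mul_iff.1 h1).2, h3⟩
  · rintro ⟨h1, h2⟩
    rw [h2, mul_zero, mul_zero, add_zero]
    exact ⟨u0.mul h1, rfl⟩

end Transformation

/-! ### Coset representatives of `Γ₀(N) \ M(m, N)`. -/

section Representatives

variable {m N : ℕ}

/-- The index set of the representatives of `Γ₀(N) \ M(m, N)`. -/
def repIndex (m N : ℕ) : Finset (Σ _ : ℕ × ℕ, ℕ) :=
  (m.divisorsAntidiagonal.filter fun p => p.1.Coprime N).sigma fun p => Finset.range p.2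

/-- The representatives of `Γ₀(N) \ M(m, N)`. -/
def repMatrix (x : Σ _ : ℕ × ℕ, ℕ) : Matrix (Fin 2) (Fin 2) ℤ := !![(x.1.1 : ℤ), x.2; 0, x.1.2]

lemma mem_repIndex {x : Σ _ : ℕ × ℕ, ℕ} : x ∈ repIndex m N ↔
    (x.1.1 * x.1.2 = m ∧ m ≠ 0) ∧ x.1.1.Coprime N ∧ x.2 < x.1.2 := by
  simp [repIndex, Nat.mem_divisorsAntidiagonal, and_assoc]

lemma repMatrix_mem {x : Σ _ : ℕ × ℕ, ℕ} (hx : x ∈ repIndex m N) : repMatrix x ∈ matSet m N := by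
  rw [mem_repIndex] at hx
  refine ⟨?_, ?_, ?_⟩
  · simp only [repMatrix, Matrix.det_fin_two_of, mul_zero, sub_zero]
    exact_mod_cast hx.1.1
  · exact Nat.isCoprime_iff_coprime.2 hx.2.1
  · exact dvd_zero _

lemma mul_mem_matSet [NeZero N] {τ : SL(2, ℤ)} (hτ : τ ∈ CongruenceSubgroup.Gamma0 N)
    {γ : Matrix (Fin 2) (Fin 2) ℤ} (hγ : γ ∈ matSet m N) :
    (τ : Matrix (Fin 2) (Fin 2) ℤ) * γ ∈ matSet m N := by
  rw [matSet_eq_detSet] at hγ ⊢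
  rw [mul_mem_detSet_iff, smulCond_unitCond hτ]
  exact hγ

/-- The decomposition `M(m, N) = ⨆ Γ₀(N) δ`. -/
def cosetMap [NeZero N] (x : CongruenceSubgroup.Gamma0 N × repIndex m N) : matSet m N :=
  ⟨((x.1 : SL(2, ℤ)) : Matrix (Fin 2) (Fin 2) ℤ) * repMatrix x.2,
    mul_mem_matSet x.1.2 (repMatrix_mem x.2.2)⟩

/-- Comparing first columns makes `u` upper triangular with positive diagonal, hence unipotent; both
`b` and `b'` lie in `[0, d)`, so no translation is left. -/
lemma eq_one_of_mul_repMatrix_eq {u : SL(2, ℤ)} {x y : Σ _ : ℕ × ℕ, ℕ} (hx : x ∈ repIndex m N)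
    (hy : y ∈ repIndex m N)
    (h : (u : Matrix (Fin 2) (Fin 2) ℤ) * repMatrix x = repMatrix y) : u = 1 ∧ x = y := by
  rw [mem_repIndex] at hx hy
  obtain ⟨⟨a, d⟩, b⟩ := x
  obtain ⟨⟨a', d'⟩, b'⟩ := y
  dsimp only at hx hy
  have ha : 0 < a := Nat.pos_of_ne_zero fun h0 => hx.1.2 (by rw [← hx.1.1, h0, zero_mul])
  have ha' : 0 < a' := Nat.pos_of_ne_zero fun h0 => hy.1.2 (by rw [← hy.1.1, h0, zero_mul])
  have h00 := congrFun (congrFun h 0) 0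
  have h01 := congrFun (congrFun h 0) 1
  have h10 := congrFun (congrFun h 1) 0
  simp only [repMatrix, Matrix.mul_apply, Fin.sum_univ_two, Matrix.of_apply, Matrix.cons_val',
    Matrix.cons_val_zero, Matrix.cons_val_one, Matrix.cons_val_fin_one, mul_zero, add_zero]
    at h00 h01 h10
  have hu := u.det_coe
  rw [Matrix.det_fin_two] at hu
  have haZ : (a : ℤ) ≠ 0 := by exact_mod_cast ha.ne'
  have u10 : u 1 0 = 0 := (mul_eq_zero.1 h10).resolve_right haZ
  rw [u10, mul_zero, sub_zero] at hu
  have u00pos : 0 < u 0 0 := by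
    have h1 : (0 : ℤ) < a' := by exact_mod_cast ha'
    have h2 : (0 : ℤ) < a := by exact_mod_cast ha
    rw [← h00] at h1
    exact pos_of_mul_pos_left h1 h2.le
  have u00 : u 0 0 = 1 := Int.eq_one_of_mul_eq_one_right u00pos.le hu
  have u11 : u 1 1 = 1 := by rw [u00, one_mul] at hu; exact hu
  rw [u00, one_mul] at h00 h01
  have haa : a = a' := by exact_mod_cast h00
  subst haa
  have hdd : d = d' := Nat.eq_of_mul_eq_mul_left ha (hx.1.1.trans hy.1.1.symm)
  subst hdd
  have u01 : u 0 1 = 0 := by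
    have hb : (b : ℤ) < d := by exact_mod_cast hx.2.2
    have hb' : (b' : ℤ) < d := by exact_mod_cast hy.2.2
    have hb0 : (0 : ℤ) ≤ b := by positivity
    have hb0' : (0 : ℤ) ≤ b' := by positivity
    by_contra h0
    rcases lt_or_gt_of_ne h0 with h1 | h1
    · have : u 0 1 * d ≤ -1 * d := by
        apply mul_le_mul_of_nonneg_right _ (by positivity)
        omega
      linarith
    · have : 1 * (d : ℤ) ≤ u 0 1 * d := by
        apply mul_le_mul_of_nonneg_right _ (by positivity)
        omega
      linarith
  rw [u01, zero_mul, add_zero] at h01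
  have hbb : b = b' := by exact_mod_cast h01
  subst hbb
  refine ⟨?_, rfl⟩
  ext i j
  fin_cases i <;> fin_cases j <;> simp [u00, u01, u10, u11]

lemma cosetMap_injective [NeZero N] : Function.Injective (cosetMap (m := m) (N := N)) := by
  rintro ⟨τ, x⟩ ⟨τ', y⟩ h
  have h1 : ((τ : SL(2, ℤ)) : Matrix (Fin 2) (Fin 2) ℤ) * repMatrix x =
    ((τ' : SL(2, ℤ)) : Matrix (Fin 2) (Fin 2) ℤ) * repMatrix y := congrArg Subtype.val h
  have h2 : (((τ' : SL(2, ℤ))⁻¹ * (τ : SL(2, ℤ)) : SL(2, ℤ)) : Matrix (Fin 2) (Fin 2) ℤ) *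
      repMatrix x = repMatrix y := by
    rw [Matrix.SpecialLinearGroup.coe_mul, Matrix.mul_assoc, h1, ← Matrix.mul_assoc,
      ← Matrix.SpecialLinearGroup.coe_mul, inv_mul_cancel, Matrix.SpecialLinearGroup.coe_one,
      Matrix.one_mul]
  obtain ⟨h3, h4⟩ := eq_one_of_mul_repMatrix_eq x.2 y.2 h2
  exact Prod.ext (Subtype.ext (inv_mul_eq_one.1 h3).symm) (Subtype.ext h4)

/-- Hermite normal form. Dividing the first column by its gcd `g` gives a primitive column, which
Bézout completes to a unimodular matrix. Since `g` is prime to `N`, the condition `N ∣ c` passes to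
the lower entry, so this matrix lies in `Γ₀(N)`. -/
lemma cosetMap_surjective [NeZero N] (hm : 0 < m) :
    Function.Surjective (cosetMap (m := m) (N := N)) := by
  rintro ⟨γ, hdet, hcop, hdvd⟩
  rw [Matrix.det_fin_two] at hdet
  set A := γ 0 0
  set B := γ 0 1
  set C := γ 1 0
  set D := γ 1 1
  set g : ℕ := Int.gcd A C with hg
  have hmZ : (0 : ℤ) < m := by exact_mod_cast hm
  have hg0 : g ≠ 0 := by
    intro h
    obtain ⟨h1, h2⟩ := Int.gcd_eq_zero_iff.1 h
    rw [h1, h2] at hdet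
    simp at hdet
    omega
  have hgZ : (g : ℤ) ≠ 0 := by exact_mod_cast hg0
  obtain ⟨p, hp⟩ : (g : ℤ) ∣ A := Int.gcd_dvd_left _ _
  obtain ⟨r, hr⟩ : (g : ℤ) ∣ C := Int.gcd_dvd_right _ _
  have hbez : (g : ℤ) = A * Int.gcdA A C + C * Int.gcdB A C := Int.gcd_eq_gcd_ab A C
  set u := Int.gcdA A C
  set v := Int.gcdB A C
  have huv : p * u + r * v = 1 := by
    apply mul_left_cancel₀ hgZ
    linear_combination (-u) * hp - v * hr - hbez
  have hgm : (g : ℤ) * (p * D - r * B) = m := by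
    linear_combination hdet - D * hp + B * hr
  set d : ℤ := p * D - r * B with hd
  have hd0 : 0 < d := pos_of_mul_pos_right (by rw [hgm]; exact hmZ) (by positivity)
  set b : ℤ := u * B + v * D with hb
  have hgN : IsCoprime (g : ℤ) (N : ℤ) := hcop.of_isCoprime_of_dvd_left ⟨p, hp⟩
  have hNr : (N : ℤ) ∣ r := by
    rw [hr] at hdvd
    exact hgN.symm.dvd_of_dvd_mul_left hdvd
  -- Shifting the second column of the unimodular matrix by `k` times the first reduces `b` modulo
  -- `d`.
  set k : ℤ := b / d with hk
  have hbk : b = d * k + b % d := (Int.mul_ediv_add_emod b d).symm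
  have hdet' : (!![p, -v + p * k; r, u + r * k] : Matrix (Fin 2) (Fin 2) ℤ).det = 1 := by
    rw [Matrix.det_fin_two_of]
    linear_combination huv
  set τ : SL(2, ℤ) := ⟨!![p, -v + p * k; r, u + r * k], hdet'⟩ with hτ
  have hτmem : τ ∈ CongruenceSubgroup.Gamma0 N := by
    rw [CongruenceSubgroup.Gamma0_mem]
    exact (ZMod.intCast_zmod_eq_zero_iff_dvd r N).2 hNr
  have hbmod : 0 ≤ b % d := Int.emod_nonneg _ hd0.ne'
  have hx : (⟨(g, d.toNat), (b % d).toNat⟩ : Σ _ : ℕ × ℕ, ℕ) ∈ repIndex m N := by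
    rw [mem_repIndex]
    refine ⟨⟨?_, hm.ne'⟩, Nat.isCoprime_iff_coprime.1 hgN, ?_⟩
    · zify
      rw [Int.toNat_of_nonneg hd0.le]
      exact hgm
    · zify
      rw [Int.toNat_of_nonneg hd0.le, Int.toNat_of_nonneg hbmod]
      exact Int.emod_lt_of_pos _ hd0
  refine ⟨(⟨τ, hτmem⟩, ⟨_, hx⟩), Subtype.ext ?_⟩
  change (!![p, -v + p * k; r, u + r * k] : Matrix (Fin 2) (Fin 2) ℤ) *
    !![(g : ℤ), ((b % d).toNat : ℤ); 0, (d.toNat : ℤ)] = γ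
  rw [Int.toNat_of_nonneg hd0.le, Int.toNat_of_nonneg hbmod]
  ext i j
  fin_cases i <;> fin_cases j <;>
    simp only [Matrix.mul_apply, Fin.sum_univ_two, Matrix.of_apply, Matrix.cons_val',
      Matrix.cons_val_zero, Matrix.cons_val_one, Matrix.cons_val_fin_one, mul_zero, add_zero,
      Fin.zero_eta, Fin.mk_one, Fin.isValue]
  · change p * g = A
    linear_combination -hp
  · change p * (b % d) + (-v + p * k) * d = B
    linear_combination (-p) * hbk + p * hb - v * hd + B * huv
  · change r * g = C
    linear_combination -hr
  · change r * (b % d) + (u + r * k) * d = D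
    linear_combination (-r) * hbk + r * hb + u * hd + D * huv

/-- The decomposition of `M(m, N)` into cosets of `Γ₀(N)`. -/
def cosetEquiv [NeZero N] (hm : 0 < m) :
    CongruenceSubgroup.Gamma0 N × repIndex m N ≃ matSet m N :=
  Equiv.ofBijective cosetMap ⟨cosetMap_injective, cosetMap_surjective hm⟩

end Representatives

/-! ### Mean value property with a radial weight. -/

section Radial

open Metric

/-- In polar coordinates `r dr` cancels `‖ζ‖⁻¹`, leaving `(1 - r)^(ε - 1)`, integrable because `ε >
0`. -/
lemma integrableOn_ball_one_sub_rpow {ε : ℝ} (hε : 0 < ε) :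
    IntegrableOn (fun ζ : ℂ => (1 - ‖ζ‖) ^ (ε - 1) * ‖ζ‖⁻¹) (ball 0 1) := by
  rw [integrableOn_fun_norm_addHaar volume (f := fun r : ℝ => (1 - r) ^ (ε - 1) * r⁻¹)]
  have h1 : IntervalIntegrable (fun x : ℝ => x ^ (ε - 1)) volume 0 1 :=
    intervalIntegral.intervalIntegrable_rpow' (by linarith)
  have h2 := (h1.comp_sub_left 1).symm
  rw [sub_zero, sub_self, intervalIntegrable_iff_integrableOn_Ioo_of_le zero_le_one] at h2
  refine h2.congr_fun (fun r hr => ?_) measurableSet_Ioo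
  simp only [Complex.finrank_real_complex, smul_eq_mul]
  have : r ≠ 0 := hr.1.ne'
  field_simp
  ring

lemma integral_rotation_ball (θ : ℝ) (g : ℂ → ℂ) :
    ∫ ζ in ball (0 : ℂ) 1, g (circleMap 0 1 θ * ζ) = ∫ ζ in ball (0 : ℂ) 1, g ζ := by
  have hmp := (rotation (Circle.exp θ)).measurePreserving
  have hpre : (rotation (Circle.exp θ)) ⁻¹' ball (0 : ℂ) 1 = ball (0 : ℂ) 1 := by
    ext ζ
    rw [Set.mem_preimage, mem_ball_zero_iff, mem_ball_zero_iff, LinearIsometryEquiv.norm_map]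
  have h := hmp.setIntegral_preimage_emb
    (rotation (Circle.exp θ)).toHomeomorph.measurableEmbedding g (ball (0 : ℂ) 1)
  rw [hpre] at h
  rw [← h]
  simp [rotation_apply, circleMap, Circle.coe_exp]

/-- Mean value property against a radial weight on the unit disc. -/
lemma integral_mul_radial {F : ℂ → ℂ} (hF : DifferentiableOn ℂ F (ball 0 1)) {ρ D : ℝ → ℝ}
    (hρ : Measurable ρ) (hD : IntegrableOn (fun ζ : ℂ => D ‖ζ‖) (ball 0 1))
    (hle : ∀ ζ ∈ ball (0 : ℂ) 1, ‖F ζ * (ρ ‖ζ‖ : ℂ)‖ ≤ D ‖ζ‖) :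
    IntegrableOn (fun ζ : ℂ => F ζ * (ρ ‖ζ‖ : ℂ)) (ball 0 1) ∧
      ∫ ζ in ball (0 : ℂ) 1, F ζ * (ρ ‖ζ‖ : ℂ) =
        F 0 * ((∫ ζ in ball (0 : ℂ) 1, ρ ‖ζ‖ : ℝ) : ℂ) := by
  have hρm : Measurable fun ζ : ℂ => (ρ ‖ζ‖ : ℂ) := by fun_prop
  have hint : IntegrableOn (fun ζ : ℂ => F ζ * (ρ ‖ζ‖ : ℂ)) (ball 0 1) := by
    refine Integrable.mono' hD ?_ ((ae_restrict_iff' measurableSet_ball).2 (Eventually.of_forall hle))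
    exact (hF.continuousOn.aestronglyMeasurable measurableSet_ball).mul
      hρm.aestronglyMeasurable
  refine ⟨hint, ?_⟩
  have hmem : ∀ θ : ℝ, ∀ ζ ∈ ball (0 : ℂ) 1, circleMap 0 1 θ * ζ ∈ ball (0 : ℂ) 1 := by
    intro θ ζ hζ
    simpa using hζ
  set T : Set ℝ := Set.Ioc 0 (2 * Real.pi) with hT
  have hprod : Integrable (fun p : ℂ × ℝ => F (circleMap 0 1 p.2 * p.1) * (ρ ‖p.1‖ : ℂ))
      ((volume.restrict (ball (0 : ℂ) 1)).prod (volume.restrict T)) := by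
    have hdom : Integrable (fun p : ℂ × ℝ => D ‖p.1‖)
        ((volume.restrict (ball (0 : ℂ) 1)).prod (volume.restrict T)) := hD.comp_fst _
    refine hdom.mono' ?_ ?_
    · refine AEStronglyMeasurable.mul ?_ (hρm.comp measurable_fst).aestronglyMeasurable
      rw [Measure.prod_restrict]
      refine ContinuousOn.aestronglyMeasurable ?_ (measurableSet_ball.prod measurableSet_Ioc)
      refine hF.continuousOn.comp (by fun_prop) fun p hp => hmem _ _ hp.1
    · rw [Measure.prod_restrict]
      refine (ae_restrict_iff' (measurableSet_ball.prod measurableSet_Ioc)).2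
        (Eventually.of_forall fun p hp => ?_)
      have := hle _ (hmem p.2 p.1 hp.1)
      simpa using this
  -- The integral over the disc is unchanged by rotations. Averaging over all of them and exchanging
  -- the integrals replaces `F` by its circle averages, which all equal `F 0`.
  have hswap := integral_integral_swap
    (f := fun (ζ : ℂ) (θ : ℝ) => F (circleMap 0 1 θ * ζ) * (ρ ‖ζ‖ : ℂ)) hprod
  have hmean : ∀ ζ ∈ ball (0 : ℂ) 1, ∫ θ in T, F (circleMap 0 1 θ * ζ) * (ρ ‖ζ‖ : ℂ) =
      2 * Real.pi * F 0 * (ρ ‖ζ‖ : ℂ) := by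
    intro ζ hζ
    rw [integral_mul_const]
    congr 1
    have hd : DiffContOnCl ℂ (fun u => F (u * ζ)) (ball 0 |1|) := by
      rw [abs_one]
      have hsub : Set.MapsTo (fun u : ℂ => u * ζ) (closedBall 0 1) (ball 0 1) := by
        intro u hu
        rw [mem_closedBall_zero_iff] at hu
        rw [mem_ball_zero_iff] at hζ ⊢
        rw [norm_mul]
        calc _ ≤ 1 * ‖ζ‖ := by gcongr
          _ < 1 := by rwa [one_mul]
      refine DifferentiableOn.diffContOnCl ?_
      rw [closure_ball _ one_ne_zero]
      exact hF.comp (by fun_prop) hsub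
    have h2 := hd.circleAverage
    rw [zero_mul, Real.circleAverage, intervalIntegral.integral_of_le Real.two_pi_pos.le] at h2
    rw [← h2, Complex.real_smul, ← mul_assoc, ← Complex.ofReal_ofNat, ← Complex.ofReal_mul,
      ← Complex.ofReal_mul, mul_inv_cancel₀ Real.two_pi_pos.ne', Complex.ofReal_one, one_mul]
  have hleft : ∫ ζ in ball (0 : ℂ) 1, ∫ θ in T, F (circleMap 0 1 θ * ζ) * (ρ ‖ζ‖ : ℂ) =
      2 * Real.pi * (F 0 * ((∫ ζ in ball (0 : ℂ) 1, ρ ‖ζ‖ : ℝ) : ℂ)) := by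
    rw [setIntegral_congr_fun measurableSet_ball hmean, integral_const_mul, ← integral_complex_ofReal]
    ring
  have hright : ∫ θ in T, ∫ ζ in ball (0 : ℂ) 1, F (circleMap 0 1 θ * ζ) * (ρ ‖ζ‖ : ℂ) =
      2 * Real.pi * ∫ ζ in ball (0 : ℂ) 1, F ζ * (ρ ‖ζ‖ : ℂ) := by
    have : ∀ θ : ℝ, ∫ ζ in ball (0 : ℂ) 1, F (circleMap 0 1 θ * ζ) * (ρ ‖ζ‖ : ℂ) =
        ∫ ζ in ball (0 : ℂ) 1, F ζ * (ρ ‖ζ‖ : ℂ) := by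
      intro θ
      rw [← integral_rotation_ball θ fun ζ => F ζ * (ρ ‖ζ‖ : ℂ)]
      simp
    simp only [this, integral_const]
    rw [Complex.real_smul]
    simp [hT, Measure.real, Real.volume_Ioc, Real.pi_pos.le]
  rw [hleft, hright] at hswap
  exact (mul_left_cancel₀ (by simp [Real.pi_ne_zero]) hswap).symm

end Radial

/-! ### The disc model with a given centre. -/

section Disc

open Metric

/-- The Cayley map from the unit disc to the upper half plane with `0 ↦ w`. -/
def discMap (w : ℍ) (ζ : ℂ) : ℂ := (w - conj (w : ℂ) * ζ) / (1 - ζ)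

lemma one_sub_ne_zero_of_mem_ball {ζ : ℂ} (hζ : ζ ∈ ball (0 : ℂ) 1) : 1 - ζ ≠ 0 := by
  intro h
  rw [mem_ball_zero_iff, ← sub_eq_zero.1 h, norm_one] at hζ
  exact lt_irrefl _ hζ

lemma coe_sub_conj (w : ℍ) : (w : ℂ) - conj (w : ℂ) = 2 * I * (w.im : ℂ) := by
  rw [Complex.sub_conj]
  push_cast
  rw [UpperHalfPlane.coe_im]
  ring

lemma discMap_sub (w : ℍ) {ζ : ℂ} (hζ : ζ ∈ ball (0 : ℂ) 1) :
    discMap w ζ - w = 2 * I * w.im * ζ / (1 - ζ) := by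
  have h := one_sub_ne_zero_of_mem_ball hζ
  rw [discMap, ← coe_sub_conj]
  field_simp
  ring

lemma discMap_sub_conj (w : ℍ) {ζ : ℂ} (hζ : ζ ∈ ball (0 : ℂ) 1) :
    discMap w ζ - conj (w : ℂ) = 2 * I * w.im / (1 - ζ) := by
  have h := one_sub_ne_zero_of_mem_ball hζ
  rw [discMap, ← coe_sub_conj]
  field_simp
  ring

lemma discMap_im (w : ℍ) {ζ : ℂ} (hζ : ζ ∈ ball (0 : ℂ) 1) :
    (discMap w ζ).im = w.im * (1 - ‖ζ‖ ^ 2) / ‖1 - ζ‖ ^ 2 := by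
  have h := one_sub_ne_zero_of_mem_ball hζ
  have hn : ‖1 - ζ‖ ≠ 0 := norm_ne_zero_iff.2 h
  rw [discMap, Complex.div_im, Complex.normSq_eq_norm_sq, ← sub_div]
  congr 1
  rw [← Complex.normSq_eq_norm_sq ζ, Complex.normSq_apply]
  simp
  ring

lemma discMap_im_pos (w : ℍ) {ζ : ℂ} (hζ : ζ ∈ ball (0 : ℂ) 1) : 0 < (discMap w ζ).im := by
  rw [discMap_im w hζ]
  have h := norm_pos_iff.2 (one_sub_ne_zero_of_mem_ball hζ)
  rw [mem_ball_zero_iff] at hζ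
  have : 0 < 1 - ‖ζ‖ ^ 2 := by nlinarith [norm_nonneg ζ]
  have := w.im_pos
  positivity

lemma hasDerivAt_discMap (w : ℍ) {ζ : ℂ} (hζ : ζ ∈ ball (0 : ℂ) 1) :
    HasDerivAt (discMap w) (2 * I * w.im / (1 - ζ) ^ 2) ζ := by
  have h := one_sub_ne_zero_of_mem_ball hζ
  have h1 : HasDerivAt (fun ζ : ℂ => (w : ℂ) - conj (w : ℂ) * ζ) (-(conj (w : ℂ) * 1)) ζ :=
    ((hasDerivAt_id ζ).const_mul _).const_sub _
  have h2 : HasDerivAt (fun ζ : ℂ => 1 - ζ) (-1) ζ := (hasDerivAt_id ζ).const_sub _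
  refine (h1.div h2 h).congr_deriv ?_
  rw [← coe_sub_conj]
  congr 1
  ring

lemma discMap_injOn (w : ℍ) : Set.InjOn (discMap w) (ball 0 1) := by
  intro a ha b hb h
  have h1 := one_sub_ne_zero_of_mem_ball ha
  have h2 := one_sub_ne_zero_of_mem_ball hb
  have hv : (2 * I * (w.im : ℂ)) ≠ 0 := by simp [w.im_ne_zero]
  have h3 : discMap w a - conj (w : ℂ) = discMap w b - conj (w : ℂ) := by rw [h]
  rw [discMap_sub_conj w ha, discMap_sub_conj w hb, div_eq_div_iff h1 h2] at h3
  have := mul_left_cancel₀ hv h3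
  linear_combination this

lemma discMap_image (w : ℍ) : discMap w '' ball 0 1 = Set.range UpperHalfPlane.coe := by
  rw [UpperHalfPlane.range_coe]
  ext z
  constructor
  · rintro ⟨ζ, hζ, rfl⟩
    exact discMap_im_pos w hζ
  · intro hz
    have hz' : 0 < z.im := hz
    have hw := w.im_pos
    have hne : z - conj (w : ℂ) ≠ 0 := by
      intro h
      have := congrArg Complex.im h
      simp at this
      linarith
    have hv := coe_sub_conj w
    have hv0 : (w : ℂ) - conj (w : ℂ) ≠ 0 := by rw [hv]; simp [w.im_ne_zero]
    -- The inverse Cayley map.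
    refine ⟨(z - w) / (z - conj (w : ℂ)), ?_, ?_⟩
    · rw [mem_ball_zero_iff, norm_div, div_lt_one (norm_pos_iff.2 hne)]
      apply lt_of_pow_lt_pow_left₀ 2 (norm_nonneg _)
      rw [← Complex.normSq_eq_norm_sq, ← Complex.normSq_eq_norm_sq, Complex.normSq_apply,
        Complex.normSq_apply]
      simp
      nlinarith
    · have h4 : 1 - (z - w) / (z - conj (w : ℂ)) = (w - conj (w : ℂ)) / (z - conj (w : ℂ)) := by
        field_simp
        ring
      rw [discMap, h4]
      field_simp
      ring

lemma measurePreserving_coe_area :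
    MeasurePreserving UpperHalfPlane.coe area (volume.restrict (Set.range UpperHalfPlane.coe)) :=
  ⟨UpperHalfPlane.measurable_coe, by
    rw [area, UpperHalfPlane.measurableEmbedding_coe.map_comap]⟩

lemma measurable_inv_im_sq : Measurable fun z : ℍ => (1 / NNReal.mk z.im z.im_pos.le) ^ 2 := by
  refine Measurable.pow_const (Measurable.const_div ?_ 1) 2
  exact (UpperHalfPlane.continuous_im.measurable).subtype_mk

lemma integrableOn_volume_iff_area (s : Set ℍ) (h : ℍ → ℂ) :
    IntegrableOn h s volume ↔ IntegrableOn (fun z => ((z.im ^ 2)⁻¹ : ℝ) • h z) s area := by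
  rw [IntegrableOn, UpperHalfPlane.volume_def, restrict_withDensity' s,
    integrable_withDensity_iff_integrable_smul measurable_inv_im_sq]
  refine integrable_congr (Eventually.of_forall fun z => ?_)
  simp [NNReal.smul_def]

lemma integral_volume_eq_area (s : Set ℍ) (h : ℍ → ℂ) :
    ∫ z in s, h z = ∫ z in s, ((z.im ^ 2)⁻¹ : ℝ) • h z ∂area := by
  rw [UpperHalfPlane.volume_def, restrict_withDensity' s,
    integral_withDensity_eq_integral_smul measurable_inv_im_sq]
  refine integral_congr_ae (Eventually.of_forall fun z => ?_)
  simp [NNReal.smul_def]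

/-- The density of the hyperbolic area in the disc model, with the base point `w`. -/
lemma disc_change_of_variables (w : ℍ) (h : ℍ → ℂ) (H : ℂ → ℂ)
    (hH : ∀ ζ ∈ ball (0 : ℂ) 1, ((4 / (1 - ‖ζ‖ ^ 2) ^ 2 : ℝ) : ℂ) *
      h (UpperHalfPlane.ofComplex (discMap w ζ)) = H ζ) (hint : IntegrableOn H (ball 0 1)) :
    Integrable h volume ∧ ∫ z, h z = ∫ ζ in ball (0 : ℂ) 1, H ζ := by
  set g : ℂ → ℂ := fun z => ((z.im ^ 2)⁻¹ : ℝ) • h (UpperHalfPlane.ofComplex z) with hg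
  have hgc : ∀ z : ℍ, ((z.im ^ 2)⁻¹ : ℝ) • h z = g z := by
    intro z
    simp [hg]
  have hder : ∀ ζ ∈ ball (0 : ℂ) 1, HasFDerivWithinAt (discMap w)
      ((ContinuousLinearMap.toSpanSingleton ℂ
        (2 * I * w.im / (1 - ζ) ^ 2)).restrictScalars ℝ) (ball 0 1) ζ :=
    fun ζ hζ => ((hasDerivAt_discMap w hζ).hasFDerivAt.restrictScalars ℝ).hasFDerivWithinAt
  have hH' : ∀ ζ ∈ ball (0 : ℂ) 1, |((ContinuousLinearMap.toSpanSingleton ℂ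
        (2 * I * w.im / (1 - ζ) ^ 2)).restrictScalars ℝ).det| • g (discMap w ζ) = H ζ := by
    intro ζ hζ
    -- The real Jacobian of a holomorphic map is the squared modulus of its derivative.
    have hdet : ((ContinuousLinearMap.toSpanSingleton ℂ
        (2 * I * w.im / (1 - ζ) ^ 2)).restrictScalars ℝ).det =
        4 * w.im ^ 2 / ‖1 - ζ‖ ^ 4 := by
      simp [ContinuousLinearMap.det, LinearMap.det_restrictScalars, Algebra.norm_complex_eq,
        Complex.normSq_eq_norm_sq, mul_pow]
      ring
    rw [hdet, ← hH ζ hζ, hg]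
    simp only [discMap_im w hζ]
    have hn := norm_ne_zero_iff.2 (one_sub_ne_zero_of_mem_ball hζ)
    have hw := w.im_ne_zero
    have h1 : 1 - ‖ζ‖ ^ 2 ≠ 0 := by
      rw [mem_ball_zero_iff] at hζ
      nlinarith [norm_nonneg ζ]
    rw [abs_of_nonneg (by positivity), ← Complex.real_smul, smul_smul]
    congr 1
    field_simp
  have hintg : IntegrableOn g (Set.range UpperHalfPlane.coe) := by
    rw [← discMap_image w,
      integrableOn_image_iff_integrableOn_abs_det_fderiv_smul volume measurableSet_ball hder
        (discMap_injOn w)]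
    exact hint.congr_fun (fun ζ hζ => (hH' ζ hζ).symm) measurableSet_ball
  have e1 := integrableOn_volume_iff_area Set.univ h
  have e2 := integral_volume_eq_area Set.univ h
  simp only [hgc, integrableOn_univ, Measure.restrict_univ] at e1 e2
  constructor
  · rw [e1]
    exact (measurePreserving_coe_area.integrable_comp_emb
      UpperHalfPlane.measurableEmbedding_coe).2 hintg
  · rw [e2, measurePreserving_coe_area.integral_comp UpperHalfPlane.measurableEmbedding_coe,
      ← discMap_image w, integral_image_eq_integral_abs_det_fderiv_smul volume measurableSet_ball
        hder (discMap_injOn w)]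
    exact setIntegral_congr_fun measurableSet_ball hH'

end Disc

/-! ### The reproducing property of the regularized kernel. -/

section UnfoldedIntegral

open Metric

/-- The regularized reproducing kernel of the upper half plane. -/
def diagKernel (ε : ℝ) (w z : ℍ) : ℂ :=
  ((z : ℂ) - conj (w : ℂ)) ^ 2 *
    ((z.im ^ (2 + ε) / (‖(z : ℂ) - w‖ ^ ε * ‖(z : ℂ) - conj (w : ℂ)‖ ^ (4 + ε)) : ℝ) : ℂ)

/-- The radial weight of the regularized kernel in the disc model. -/
def radialWeight (ε v r : ℝ) : ℝ := ((1 - r ^ 2) / (4 * v * r)) ^ ε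

lemma radialWeight_eq {ε v r n : ℝ} (hv : 0 < v) (hr : 0 ≤ r) (hr1 : r < 1) (hn : 0 < n) :
    4 / (1 - r ^ 2) ^ 2 * (4 * v ^ 2 * ((v * (1 - r ^ 2) / n ^ 2) ^ (2 + ε) /
      ((2 * v * r / n) ^ ε * (2 * v / n) ^ (4 + ε)))) = radialWeight ε v r := by
  have h1 : 0 < 1 - r ^ 2 := by nlinarith
  rw [radialWeight, Real.rpow_add (by positivity), Real.rpow_add (by positivity)]
  have e : (1 - r ^ 2) / (4 * v * r) =
      v * (1 - r ^ 2) / n ^ 2 / (2 * v * r / n * (2 * v / n)) := by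
    rw [div_mul_div_comm, ← pow_two n, div_div_div_cancel_right₀ (by positivity),
      show 2 * v * r * (2 * v) = v * (4 * v * r) by ring, mul_div_mul_left _ _ hv.ne']
  rw [e, Real.div_rpow (x := v * (1 - r ^ 2) / n ^ 2) (by positivity) (by positivity),
    Real.mul_rpow (x := 2 * v * r / n) (by positivity) (by positivity)]
  have h2 : (2 * v / n) ^ (4 : ℝ) = (2 * v / n) ^ (4 : ℕ) := by exact_mod_cast Real.rpow_natCast _ 4
  rw [h2, Real.rpow_two]
  field_simp
  ring

lemma radialWeight_nonneg {ε v r : ℝ} (hv : 0 < v) (hr : 0 ≤ r) (hr1 : r < 1) :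
    0 ≤ radialWeight ε v r := by
  have h1 : 0 ≤ 1 - r ^ 2 := by nlinarith
  exact Real.rpow_nonneg (by positivity) _

lemma measurable_radialWeight (ε v : ℝ) : Measurable (radialWeight ε v) := by
  unfold radialWeight
  fun_prop

lemma ofComplex_discMap_coe (w : ℍ) {ζ : ℂ} (hζ : ζ ∈ ball (0 : ℂ) 1) :
    ((UpperHalfPlane.ofComplex (discMap w ζ) : ℍ) : ℂ) = discMap w ζ := by
  rw [UpperHalfPlane.ofComplex_apply_of_im_pos (discMap_im_pos w hζ)]

/-- Including the density of hyperbolic area, all powers of `|1 - ζ|` cancel and the kernel splits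
into the holomorphic factor `-(1 - ζ)⁻²` and a radial weight. This makes the mean value property
applicable. -/
lemma diagKernel_discMap (ε : ℝ) (w : ℍ) {ζ : ℂ} (hζ : ζ ∈ ball (0 : ℂ) 1) :
    ((4 / (1 - ‖ζ‖ ^ 2) ^ 2 : ℝ) : ℂ) *
      diagKernel ε w (UpperHalfPlane.ofComplex (discMap w ζ)) =
      -((1 - ζ) ^ 2)⁻¹ * (radialWeight ε w.im ‖ζ‖ : ℂ) := by
  have hn := norm_pos_iff.2 (one_sub_ne_zero_of_mem_ball hζ)
  have hw := w.im_pos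
  have hr := mem_ball_zero_iff.1 hζ
  rw [diagKernel, ← UpperHalfPlane.coe_im, ofComplex_discMap_coe w hζ, discMap_im w hζ,
    discMap_sub w hζ, discMap_sub_conj w hζ, ← radialWeight_eq hw (norm_nonneg ζ) hr hn]
  have e1 : ‖2 * I * (w.im : ℂ) * ζ / (1 - ζ)‖ = 2 * w.im * ‖ζ‖ / ‖1 - ζ‖ := by
    simp [abs_of_pos hw]
  have e2 : ‖2 * I * (w.im : ℂ) / (1 - ζ)‖ = 2 * w.im / ‖1 - ζ‖ := by
    simp [abs_of_pos hw]
  rw [e1, e2, div_pow, mul_pow, mul_pow, Complex.I_sq]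
  push_cast
  ring

/-- The constant in the unfolded integral. -/
def radialIntegral (ε v : ℝ) : ℝ := ∫ ζ in ball (0 : ℂ) 1, radialWeight ε v ‖ζ‖

/-- The factor `(1 - r²)⁻¹` comes from the bound `C / Im z` for `f`. By itself it is not integrable
up to the boundary circle; the regularization with `ε > 0` is what restores integrability. -/
lemma radialWeight_le {ε v r : ℝ} (hε : 0 < ε) (hε1 : ε ≤ 1) (hv : 0 < v) (hr : 0 ≤ r)
    (hr1 : r < 1) :
    (1 - r ^ 2)⁻¹ * radialWeight ε v r ≤ (4 * v) ^ (-ε) * ((1 - r) ^ (ε - 1) * r⁻¹) := by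
  rcases hr.eq_or_lt with rfl | hr0
  -- At `r = 0` division by zero makes the weight zero; this concerns a single point of the disc.
  · simp [radialWeight, Real.zero_rpow hε.ne']
  have h1 : 0 < 1 - r := by linarith
  have h2 : 1 - r ≤ 1 - r ^ 2 := by nlinarith
  have h3 : 0 < 1 - r ^ 2 := by linarith
  rw [radialWeight, Real.div_rpow h3.le (by positivity), Real.mul_rpow (by positivity) hr,
    Real.rpow_neg (by positivity)]
  have e : (1 - r ^ 2)⁻¹ * ((1 - r ^ 2) ^ ε / ((4 * v) ^ ε * r ^ ε)) =
      ((4 * v) ^ ε)⁻¹ * ((1 - r ^ 2) ^ (ε - 1) * (r ^ ε)⁻¹) := by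
    rw [Real.rpow_sub_one h3.ne']
    field_simp
  rw [e]
  gcongr ?_ * (?_ * ?_)
  · exact Real.rpow_le_rpow_of_nonpos h1 h2 (by linarith)
  · exact inv_anti₀ hr0 (by simpa using Real.rpow_le_rpow_of_exponent_ge hr0 hr1.le hε1)

/-- The unfolded integral, by the mean value property in the disc model. -/
lemma integral_diagKernel {f : ℍ → ℂ} 
    (hf : DifferentiableOn ℂ (fun z => f (UpperHalfPlane.ofComplex z)) {z : ℂ | 0 < z.im}) {C : ℝ}
    (hC : ∀ z, ‖f z‖ ≤ C / z.im) {ε : ℝ} (hε : 0 < ε) (hε1 : ε ≤ 1) (w : ℍ) :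
    Integrable (fun z => f z * diagKernel ε w z) volume ∧
      ∫ z, f z * diagKernel ε w z = -f w * (radialIntegral ε w.im : ℂ) := by
  have hw := w.im_pos
  set F : ℂ → ℂ := fun ζ => f (UpperHalfPlane.ofComplex (discMap w ζ)) * -((1 - ζ) ^ 2)⁻¹ with hF
  have hFd : DifferentiableOn ℂ F (ball 0 1) := by
    refine DifferentiableOn.mul ?_ ?_
    · exact hf.comp (g := fun z => f (UpperHalfPlane.ofComplex z)) (f := discMap w)
        (fun ζ hζ => (hasDerivAt_discMap w hζ).differentiableAt.differentiableWithinAt)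
        fun ζ hζ => discMap_im_pos w hζ
    · refine (DifferentiableOn.inv (by fun_prop) fun ζ hζ => ?_).neg
      exact pow_ne_zero 2 (one_sub_ne_zero_of_mem_ball hζ)
  have hC0 : 0 ≤ C := by
    have := (norm_nonneg _).trans (hC w)
    by_contra h
    exact absurd this (not_le.2 (div_neg_of_neg_of_pos (not_le.1 h) hw))
  have hbound : ∀ ζ ∈ ball (0 : ℂ) 1, ‖F ζ * (radialWeight ε w.im ‖ζ‖ : ℂ)‖ ≤
      C / w.im * (4 * w.im) ^ (-ε) * ((1 - ‖ζ‖) ^ (ε - 1) * ‖ζ‖⁻¹) := by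
    intro ζ hζ
    have hr := mem_ball_zero_iff.1 hζ
    have hn := norm_pos_iff.2 (one_sub_ne_zero_of_mem_ball hζ)
    have h3 : 0 < 1 - ‖ζ‖ ^ 2 := by nlinarith [norm_nonneg ζ]
    have hρ := radialWeight_nonneg (ε := ε) hw (norm_nonneg ζ) hr
    have h1 := hC (UpperHalfPlane.ofComplex (discMap w ζ))
    rw [← UpperHalfPlane.coe_im, ofComplex_discMap_coe w hζ, discMap_im w hζ] at h1
    rw [norm_mul, hF, norm_mul, norm_neg, norm_inv, norm_pow, Complex.norm_real,
      Real.norm_of_nonneg hρ]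
    calc _ ≤ C / (w.im * (1 - ‖ζ‖ ^ 2) / ‖1 - ζ‖ ^ 2) * (‖1 - ζ‖ ^ 2)⁻¹ *
          radialWeight ε w.im ‖ζ‖ := by gcongr
      _ = C / w.im * ((1 - ‖ζ‖ ^ 2)⁻¹ * radialWeight ε w.im ‖ζ‖) := by field_simp
      _ ≤ C / w.im * ((4 * w.im) ^ (-ε) * ((1 - ‖ζ‖) ^ (ε - 1) * ‖ζ‖⁻¹)) := by
        gcongr ?_ * ?_
        exact radialWeight_le hε hε1 hw (norm_nonneg ζ) hr
      _ = _ := by ring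
  obtain ⟨h1, h2⟩ := integral_mul_radial hFd (measurable_radialWeight ε w.im)
    (D := fun r => C / w.im * (4 * w.im) ^ (-ε) * ((1 - r) ^ (ε - 1) * r⁻¹))
    (by exact Integrable.const_mul (integrableOn_ball_one_sub_rpow hε) _) hbound
  obtain ⟨h3, h4⟩ := disc_change_of_variables w (fun z => f z * diagKernel ε w z)
    (fun ζ => F ζ * (radialWeight ε w.im ‖ζ‖ : ℂ)) (fun ζ hζ => by
      rw [mul_left_comm, diagKernel_discMap ε w hζ, hF]
      ring) h1
  refine ⟨h3, ?_⟩
  rw [h4, h2, hF, radialIntegral]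
  have : discMap w 0 = w := by simp [discMap]
  simp [this]

lemma rpow_le_one_add {x ε : ℝ} (hx : 0 ≤ x) (hε : 0 ≤ ε) (hε1 : ε ≤ 1) : x ^ ε ≤ 1 + x := by
  rcases le_total x 1 with h | h
  · linarith [Real.rpow_le_one hx h hε]
  · have := Real.rpow_le_rpow_of_exponent_le h hε1
    rw [Real.rpow_one] at this
    linarith

/-- The weight tends to `1` away from the centre and is dominated by `1 + 1/(4 v r)`, so its
integral tends to the area of the unit disc. -/
lemma tendsto_radialIntegral {v : ℝ} (hv : 0 < v) :
    Tendsto (fun ε => radialIntegral ε v) (𝓝[>] 0) (𝓝 Real.pi) := by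
  have hlim : ∫ ζ in ball (0 : ℂ) 1, (1 : ℝ) = Real.pi := by
    rw [setIntegral_const, smul_eq_mul, mul_one, Measure.real, Complex.volume_ball]
    simp
  rw [← hlim]
  have hb : IntegrableOn (fun ζ : ℂ => 1 + (4 * v)⁻¹ * ‖ζ‖⁻¹) (ball 0 1) := by
    refine Integrable.add ?_ (Integrable.const_mul ?_ _)
    · exact integrableOn_const (by simp) (by simp)
    · have := integrableOn_ball_one_sub_rpow one_pos
      simpa [IntegrableOn] using this
  refine tendsto_integral_filter_of_dominated_convergence _
    (Eventually.of_forall fun ε => ?_) ?_ hb ?_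
  · exact ((measurable_radialWeight ε v).comp measurable_norm).aestronglyMeasurable
  · filter_upwards [Ioc_mem_nhdsGT (zero_lt_one (α := ℝ))] with ε hε
    refine (ae_restrict_iff' measurableSet_ball).2 (Eventually.of_forall fun ζ hζ => ?_)
    have hr := mem_ball_zero_iff.1 hζ
    have h0 := norm_nonneg ζ
    rw [Real.norm_of_nonneg (radialWeight_nonneg hv h0 hr)]
    have h1 : 0 ≤ 1 - ‖ζ‖ ^ 2 := by nlinarith
    refine (rpow_le_one_add (by positivity) hε.1.le hε.2).trans ?_
    gcongr
    rw [← mul_inv, ← one_div]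
    gcongr
    nlinarith
  · have hne : ∀ᵐ ζ : ℂ ∂(volume.restrict (ball 0 1)), ζ ≠ 0 :=
      ae_restrict_of_ae (by simp [ae_iff])
    filter_upwards [hne, ae_restrict_mem measurableSet_ball] with ζ h0 hζ
    have hr := mem_ball_zero_iff.1 hζ
    have h0' := norm_pos_iff.2 h0
    have hx : (1 - ‖ζ‖ ^ 2) / (4 * v * ‖ζ‖) ≠ 0 := by
      have h1 : 0 < 1 - ‖ζ‖ ^ 2 := by nlinarith
      positivity
    have := (Real.continuousAt_const_rpow (b := 0) hx).tendsto
    rw [Real.rpow_zero] at this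
    exact this.mono_left nhdsWithin_le_nhds

end UnfoldedIntegral

/-! ### The passage from `Γ₀(N)` to its group of transformations. -/

section GroupAction

variable {N : ℕ}

lemma exists_smul_eq (g : transformationGroup N) :
    ∃ τ ∈ CongruenceSubgroup.Gamma0 N, ∀ z : ℍ, g • z = τ • z := by
  obtain ⟨g, hg⟩ := g
  obtain ⟨τ, hτ, rfl⟩ := Subgroup.mem_map.1 hg
  exact ⟨τ, hτ, fun z => rfl⟩

instance : MeasurableConstSMul (transformationGroup N) ℍ where
  measurable_const_smul g := by
    obtain ⟨τ, -, h⟩ := exists_smul_eq g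
    have e : (fun z : ℍ => g • z) = fun z => τ • z := funext h
    change Measurable fun z : ℍ => g • z
    rw [e]
    exact (continuous_const_smul (Matrix.SpecialLinearGroup.mapGL ℝ τ)).measurable

instance : SMulInvariantMeasure (transformationGroup N) ℍ volume where
  measure_preimage_smul g s hs := by
    obtain ⟨τ, -, h⟩ := exists_smul_eq g
    have e : (fun z : ℍ => g • z) = fun z => τ • z := funext h
    rw [e]
    exact measure_preimage_smul volume (Matrix.SpecialLinearGroup.mapGL ℝ τ) s

/-- The projection of `Γ₀(N)` onto the group of transformations. -/
def toTransformation (τ : CongruenceSubgroup.Gamma0 N) : transformationGroup N :=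
  ⟨MulAction.toPermHom SL(2, ℤ) ℍ τ, Subgroup.mem_map_of_mem _ τ.2⟩

lemma toTransformation_smul (τ : CongruenceSubgroup.Gamma0 N) (z : ℍ) :
    toTransformation τ • z = (τ : SL(2, ℤ)) • z := rfl

lemma toTransformation_inv_smul (τ : CongruenceSubgroup.Gamma0 N) (z : ℍ) :
    (toTransformation τ)⁻¹ • z = (τ : SL(2, ℤ))⁻¹ • z := by
  rw [inv_smul_eq_iff, toTransformation_smul, smul_inv_smul]

lemma toTransformation_surjective : Function.Surjective (toTransformation (N := N)) := by
  rintro ⟨g, hg⟩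
  obtain ⟨τ, hτ, rfl⟩ := Subgroup.mem_map.1 hg
  exact ⟨⟨τ, hτ⟩, rfl⟩

instance : Countable (Matrix (Fin 2) (Fin 2) ℤ) :=
  inferInstanceAs (Countable (Fin 2 → Fin 2 → ℤ))

instance : Countable SL(2, ℤ) := Subtype.countable

instance : Countable (transformationGroup N) := toTransformation_surjective.countable

/-- Fixing the two points `i` and `2i` already forces the matrix to be scalar. -/
lemma eq_one_or_neg_one_of_smul_eq {σ : SL(2, ℤ)} (h : ∀ z : ℍ, σ • z = z) :
    σ = 1 ∨ σ = -1 := by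
  have key : ∀ z : ℍ, (z : ℂ) * (σ 1 0 * z + σ 1 1) = σ 0 0 * z + σ 0 1 := by
    intro z
    have := coe_smul_mul_autFactor σ z
    rwa [h z, autFactor] at this
  have h1 := key ⟨I, by simp⟩
  have h2 := key ⟨2 * I, by simp⟩
  have r1 := congrArg Complex.re h1
  have i1 := congrArg Complex.im h1
  have r2 := congrArg Complex.re h2
  simp at r1 i1 r2
  have e1 : -σ 1 0 = σ 0 1 := by exact_mod_cast r1
  have e2 : σ 1 1 = σ 0 0 := by exact_mod_cast i1
  have e3 : -(4 * σ 1 0) = σ 0 1 := by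
    rify
    linarith
  have c0 : σ 1 0 = 0 := by omega
  have b0 : σ 0 1 = 0 := by omega
  have hdet := σ.det_coe
  rw [Matrix.det_fin_two, c0, b0, e2, mul_zero, sub_zero] at hdet
  rcases Int.mul_eq_one_iff_eq_one_or_neg_one.1 hdet with ⟨h3, -⟩ | ⟨h3, -⟩
  · left
    ext i j
    fin_cases i <;> fin_cases j <;> simp [c0, b0, e2, h3]
  · right
    ext i j
    fin_cases i <;> fin_cases j <;> simp [c0, b0, e2, h3]

lemma neg_mem_gamma0 {τ : SL(2, ℤ)} (h : τ ∈ CongruenceSubgroup.Gamma0 N) :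
    -τ ∈ CongruenceSubgroup.Gamma0 N := by
  rw [CongruenceSubgroup.Gamma0_mem] at h ⊢
  simp [h]

/-- The fibre is `{τ, -τ}`. Its order accounts for the factor `1/2` in the definition of the kernel.
-/
lemma card_toTransformation_fiber (g : transformationGroup N) :
    Nat.card (toTransformation (N := N) ⁻¹' {g}) = 2 := by
  obtain ⟨τ, rfl⟩ := toTransformation_surjective g
  set τ' : CongruenceSubgroup.Gamma0 N := ⟨-(τ : SL(2, ℤ)), neg_mem_gamma0 τ.2⟩ with hτ'
  have hne : τ ≠ τ' := by
    intro h
    have h1 := congrArg (fun σ : CongruenceSubgroup.Gamma0 N => (σ : SL(2, ℤ))) h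
    simp only [hτ'] at h1
    have h00 : (τ : SL(2, ℤ)) 0 0 = -(τ : SL(2, ℤ)) 0 0 := by
      conv_lhs => rw [h1]
      simp
    have h10 : (τ : SL(2, ℤ)) 1 0 = -(τ : SL(2, ℤ)) 1 0 := by
      conv_lhs => rw [h1]
      simp
    have hdet := (τ : SL(2, ℤ)).det_coe
    rw [Matrix.det_fin_two, show (τ : SL(2, ℤ)) 0 0 = 0 by omega,
      show (τ : SL(2, ℤ)) 1 0 = 0 by omega] at hdet
    simp at hdet
  have hset : toTransformation (N := N) ⁻¹' {toTransformation τ} = {τ, τ'} := by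
    ext σ
    simp only [Set.mem_preimage, Set.mem_singleton_iff, Set.mem_insert_iff]
    constructor
    · intro h
      have h1 : ∀ z : ℍ, ((τ : SL(2, ℤ))⁻¹ * (σ : SL(2, ℤ))) • z = z := by
        intro z
        rw [mul_smul, ← toTransformation_smul σ, h, toTransformation_smul, inv_smul_smul]
      rcases eq_one_or_neg_one_of_smul_eq h1 with h2 | h2
      · left
        exact Subtype.ext (inv_mul_eq_one.1 h2).symm
      · right
        refine Subtype.ext ?_
        rw [inv_mul_eq_iff_eq_mul] at h2
        rw [h2, hτ']
        simp
    · rintro (rfl | rfl)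
      · rfl
      · refine Subtype.ext (Equiv.ext fun z => ?_)
        change (-(τ : SL(2, ℤ))) • z = (τ : SL(2, ℤ)) • z
        exact ModularGroup.SL_neg_smul _ _
  rw [hset, Nat.card_coe_set_eq, Set.ncard_pair hne]

/-- A sum over `Γ₀(N)` is twice the sum over the group of transformations. -/
lemma tsum_gamma0 (h : ℍ → ℂ) (z : ℍ)
    (hs : Summable fun τ : CongruenceSubgroup.Gamma0 N => h ((τ : SL(2, ℤ))⁻¹ • z)) :
    ∑' τ : CongruenceSubgroup.Gamma0 N, h ((τ : SL(2, ℤ))⁻¹ • z) =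
      2 * ∑' g : transformationGroup N, h (g⁻¹ • z) := by
  rw [← (hs.hasSum.tsum_fiberwise toTransformation).tsum_eq, ← tsum_mul_left]
  refine tsum_congr fun g => ?_
  have : ∀ τ : toTransformation (N := N) ⁻¹' {g},
      h (((τ : CongruenceSubgroup.Gamma0 N) : SL(2, ℤ))⁻¹ • z) = h (g⁻¹ • z) := by
    rintro ⟨τ, hτ⟩
    rw [← toTransformation_inv_smul, (hτ : toTransformation τ = g)]
  simp only [this, tsum_const, card_toTransformation_fiber]
  simp

end GroupAction

/-! ### Kernel terms at the coset representatives. -/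

section Representatives

/-- The image of `z` under a representative of `Γ₀(N) \ M(m, N)`. -/
def repPoint (x : Σ _ : ℕ × ℕ, ℕ) (z : ℍ) : ℍ :=
  UpperHalfPlane.ofComplex (((x.1.1 : ℂ) * z + x.2) / x.1.2)

lemma coe_repPoint {m N : ℕ} {x : Σ _ : ℕ × ℕ, ℕ} (hx : x ∈ repIndex m N) (z : ℍ) :
    (repPoint x z : ℂ) = ((x.1.1 : ℂ) * z + x.2) / x.1.2 := by
  rw [mem_repIndex] at hx
  have ha : 0 < x.1.1 := Nat.pos_of_ne_zero fun h => hx.1.2 (by rw [← hx.1.1, h, zero_mul])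
  have hd : 0 < x.1.2 := Nat.pos_of_ne_zero fun h => hx.1.2 (by rw [← hx.1.1, h, mul_zero])
  rw [repPoint, UpperHalfPlane.ofComplex_apply_of_im_pos]
  rw [← Complex.ofReal_natCast x.1.2, Complex.div_ofReal_im]
  simp
  have := z.im_pos
  positivity

/-- For an upper triangular matrix, `μ₊ = -d (z - w)` with `w = (a z₁ + b) / d`, and similarly for
the conjugate. Collecting the powers of `d` leaves `d^(-2-2ε)`, the source of the `d⁻²` in the Hecke
operator. -/
lemma kernelTerm_repMatrix {m N : ℕ} {x : Σ _ : ℕ × ℕ, ℕ} (hx : x ∈ repIndex m N) (ε : ℝ)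
    (z₁ z : ℍ) : kernelTerm ε z₁ z (repMatrix x) =
      (((x.1.2 : ℝ) ^ (-(2 + 2 * ε)) : ℝ) : ℂ) * diagKernel ε (repPoint x z₁) z := by
  have hw := coe_repPoint hx z₁
  rw [mem_repIndex] at hx
  have hd : 0 < x.1.2 := Nat.pos_of_ne_zero fun h => hx.1.2 (by rw [← hx.1.1, h, mul_zero])
  have hdR : (0 : ℝ) < x.1.2 := by exact_mod_cast hd
  have hdC : (x.1.2 : ℂ) ≠ 0 := by exact_mod_cast hd.ne'
  rw [eq_div_iff hdC] at hw
  have e1 : muPlus z₁ z (repMatrix x) = -(x.1.2 * ((z : ℂ) - repPoint x z₁)) := by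
    simp only [muPlus, mu, repMatrix, Matrix.of_apply, Matrix.cons_val', Matrix.cons_val_zero,
      Matrix.cons_val_one, Matrix.cons_val_fin_one]
    push_cast
    linear_combination -hw
  have e2 : conj (muMinus z₁ z (repMatrix x)) =
      -(x.1.2 * ((z : ℂ) - conj (repPoint x z₁ : ℂ))) := by
    have h2 := congrArg conj hw
    simp only [map_mul, map_add, Complex.conj_natCast] at h2
    simp only [muMinus, mu, repMatrix, Matrix.of_apply, Matrix.cons_val', Matrix.cons_val_zero,
      Matrix.cons_val_one, Matrix.cons_val_fin_one]
    simp
    linear_combination -h2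
  have e3 : ‖muMinus z₁ z (repMatrix x)‖ = x.1.2 * ‖(z : ℂ) - conj (repPoint x z₁ : ℂ)‖ := by
    rw [← Complex.norm_conj, e2, norm_neg, norm_mul, Complex.norm_natCast]
  rw [kernelTerm_eq, e1, e2, e3, norm_neg, norm_mul, Complex.norm_natCast, diagKernel,
    Real.mul_rpow hdR.le (norm_nonneg _), Real.mul_rpow hdR.le (norm_nonneg _), Real.rpow_neg hdR.le]
  have e4 : ((x.1.2 : ℝ) ^ 2 : ℝ) * (x.1.2 : ℝ) ^ (2 + 2 * ε) =
      (x.1.2 : ℝ) ^ ε * (x.1.2 : ℝ) ^ (4 + ε) := by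
    rw [← Real.rpow_natCast, ← Real.rpow_add hdR, ← Real.rpow_add hdR]
    congr 1
    push_cast
    ring
  have h1 : (x.1.2 : ℝ) ^ ε ≠ 0 := (Real.rpow_pos_of_pos hdR _).ne'
  have h2 : (x.1.2 : ℝ) ^ (4 + ε) ≠ 0 := (Real.rpow_pos_of_pos hdR _).ne'
  have h3 : (x.1.2 : ℝ) ^ (2 + 2 * ε) ≠ 0 := (Real.rpow_pos_of_pos hdR _).ne'
  have e5 : ((x.1.2 : ℝ) ^ (2 + 2 * ε))⁻¹ =
      (x.1.2 : ℝ) ^ 2 / ((x.1.2 : ℝ) ^ ε * (x.1.2 : ℝ) ^ (4 + ε)) := by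
    rw [← e4]
    field_simp
  rw [e5]
  push_cast
  ring

end Representatives

/-! ### Unfolding the integral over the fundamental domain. -/

section Unfolding

variable {m N : ℕ} [NeZero N]

set_option linter.unusedSectionVars false

lemma summable_kernelTerm (hm : 0 < m) (P : ℤ → ℤ → Prop) {ε : ℝ} (hε : 0 < ε) (z₁ z : ℍ) :
    Summable ((detSet m P).indicator (kernelTerm ε z₁ z)) := by
  classical
  have h := (summable_regTerm hm P z₁ z (s := 1 + ε / 2) (by
    rw [← Complex.ofReal_ofNat, ← Complex.ofReal_div]
    simpa using hε)).mul_left ((z.im ^ (2 + ε) : ℝ) : ℂ)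
  refine h.congr fun γ => ?_
  simp only [Set.indicator_apply, mul_ite, mul_zero, kernelTerm]

/-- The weights of `f` and of the kernel term cancel, so the coset of a representative produces one
function evaluated along the `Γ₀(N)`-orbit of `z`. -/
lemma mul_kernelTerm_eq {f : ℍ → ℂ} (hf : ∀ τ ∈ CongruenceSubgroup.Gamma0 N, ∀ z : ℍ,
    f (τ • z) = autFactor τ z ^ 2 * f z) {τ : SL(2, ℤ)} (hτ : τ ∈ CongruenceSubgroup.Gamma0 N)
    (ε : ℝ) (z₁ z : ℍ) (γ : Matrix (Fin 2) (Fin 2) ℤ) :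
    f z * kernelTerm ε z₁ z ((τ : Matrix (Fin 2) (Fin 2) ℤ) * γ) =
      f (τ⁻¹ • z) * kernelTerm ε z₁ (τ⁻¹ • z) γ := by
  obtain ⟨y, rfl⟩ : ∃ y : ℍ, τ • y = z := ⟨τ⁻¹ • z, smul_inv_smul _ _⟩
  rw [inv_smul_smul, kernelTerm_mul_smul, hf τ hτ]
  have := autFactor_ne_zero τ y
  field_simp

/-- The function `f` times the regularized series is a sum of incomplete Poincaré series. -/
lemma mul_kernelSeries_eq {f : ℍ → ℂ} (hf : ∀ τ ∈ CongruenceSubgroup.Gamma0 N, ∀ z : ℍ,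
    f (τ • z) = autFactor τ z ^ 2 * f z) (hm : 0 < m) {ε : ℝ} (hε : 0 < ε) (z₁ z : ℍ) :
    f z * (1 / 2 * kernelSeries m (ModCond (UnitCond N)) ε z₁ z) =
      ∑ x : repIndex m N, ∑' g : transformationGroup N,
        f (g⁻¹ • z) * kernelTerm ε z₁ (g⁻¹ • z) (repMatrix x) := by
  have hs := summable_kernelTerm hm (ModCond (UnitCond N)) hε z₁ z
  rw [← matSet_eq_detSet, ← summable_subtype_iff_indicator, ← (cosetEquiv hm).summable_iff] at hs
  have hs' : Summable fun p : CongruenceSubgroup.Gamma0 N × repIndex m N =>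
      f ((p.1 : SL(2, ℤ))⁻¹ • z) *
        kernelTerm ε z₁ ((p.1 : SL(2, ℤ))⁻¹ • z) (repMatrix p.2) := by
    refine (hs.mul_left (f z)).congr fun p => ?_
    rw [← mul_kernelTerm_eq hf p.1.2]
    rfl
  have hs'' : Summable fun p : repIndex m N × CongruenceSubgroup.Gamma0 N =>
      f ((p.2 : SL(2, ℤ))⁻¹ • z) * kernelTerm ε z₁ ((p.2 : SL(2, ℤ))⁻¹ • z) (repMatrix p.1) :=
    (Equiv.prodComm _ _).summable_iff.2 hs'
  have h1 : f z * kernelSeries m (ModCond (UnitCond N)) ε z₁ z =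
      ∑' p : repIndex m N × CongruenceSubgroup.Gamma0 N, f ((p.2 : SL(2, ℤ))⁻¹ • z) *
        kernelTerm ε z₁ ((p.2 : SL(2, ℤ))⁻¹ • z) (repMatrix p.1) := by
    rw [kernelSeries_eq_tsum, ← matSet_eq_detSet, ← tsum_subtype, ← (cosetEquiv hm).tsum_eq,
      ← tsum_mul_left, ← (Equiv.prodComm (repIndex m N) (CongruenceSubgroup.Gamma0 N)).tsum_eq]
    refine tsum_congr fun p => ?_
    rw [← mul_kernelTerm_eq hf p.2.2]
    rfl
  rw [mul_left_comm, h1, Summable.tsum_prod hs'', tsum_fintype, Finset.mul_sum]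
  refine Finset.sum_congr rfl fun x _ => ?_
  have h3 : Summable fun τ : CongruenceSubgroup.Gamma0 N =>
      f ((τ : SL(2, ℤ))⁻¹ • z) * kernelTerm ε z₁ ((τ : SL(2, ℤ))⁻¹ • z) (repMatrix x) :=
    hs''.prod_factor x
  -- The double counting of `τ` and `-τ` cancels the factor `1/2`.
  rw [tsum_gamma0 (fun y => f y * kernelTerm ε z₁ y (repMatrix x)) z h3, ← mul_assoc,
    one_div_mul_cancel two_ne_zero, one_mul]

/-- Unfolding of a Poincaré series. -/
lemma setIntegral_tsum_eq {Φ : Set ℍ} (hΦ : IsFundamentalDomainGamma0 N Φ) {h : ℍ → ℂ}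
    (hh : Integrable h volume) :
    IntegrableOn (fun z => ∑' g : transformationGroup N, h (g⁻¹ • z)) Φ volume ∧
      ∫ z in Φ, ∑' g : transformationGroup N, h (g⁻¹ • z) = ∫ z, h z := by
  have hΦ' : IsFundamentalDomain (transformationGroup N) Φ (volume : Measure ℍ) := hΦ
  have hmeas : ∀ g : transformationGroup N,
      AEStronglyMeasurable (fun z => h (g⁻¹ • z)) (volume.restrict Φ) := fun g =>
    ((measurePreserving_smul (g⁻¹)
      (volume : Measure ℍ)).integrable_comp_of_integrable hh).aestronglyMeasurable.restrict
  -- The translates of the fundamental domain tile `ℍ`, so this sum is the integral of `‖h‖` over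
  -- `ℍ`.
  have hfin : ∑' g : transformationGroup N, ∫⁻ z in Φ, ‖h (g⁻¹ • z)‖ₑ ≠ ⊤ := by
    rw [← hΦ'.lintegral_eq_tsum' fun z => ‖h z‖ₑ]
    exact hh.2.ne
  refine ⟨⟨(AEMeasurable.tsum fun g => (hmeas g).aemeasurable).aestronglyMeasurable, ?_⟩, ?_⟩
  · refine lt_of_le_of_lt (lintegral_mono fun z => enorm_tsum_le_tsum_enorm) ?_
    rw [lintegral_tsum fun g => (hmeas g).enorm]
    exact hfin.lt_top
  · rw [hΦ'.integral_eq_tsum' h hh]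
    exact integral_tsum hmeas hfin

/-- The integral of `f` against the regularized kernel. -/
theorem setIntegral_mul_kernelSeries {Φ : Set ℍ} (hΦ : IsFundamentalDomainGamma0 N Φ) {f : ℍ → ℂ}
    (hf : ∀ τ ∈ CongruenceSubgroup.Gamma0 N, ∀ z : ℍ, f (τ • z) = autFactor τ z ^ 2 * f z)
    (hfd : DifferentiableOn ℂ (fun z => f (UpperHalfPlane.ofComplex z)) {z : ℂ | 0 < z.im})
    {C : ℝ} (hC : ∀ z, ‖f z‖ ≤ C / z.im) (hm : 0 < m) {ε : ℝ} (hε : 0 < ε) (hε1 : ε ≤ 1)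
    (z₁ : ℍ) :
    ∫ z in Φ, f z * (1 / 2 * kernelSeries m (ModCond (UnitCond N)) ε z₁ z) =
      ∑ x ∈ repIndex m N, (((x.1.2 : ℝ) ^ (-(2 + 2 * ε)) : ℝ) : ℂ) *
        (-f (repPoint x z₁) * (radialIntegral ε (repPoint x z₁).im : ℂ)) := by
  have hint : ∀ x : repIndex m N,
      Integrable (fun z => f z * kernelTerm ε z₁ z (repMatrix x)) volume ∧
      ∫ z, f z * kernelTerm ε z₁ z (repMatrix x) =
        ((((x : Σ _ : ℕ × ℕ, ℕ).1.2 : ℝ) ^ (-(2 + 2 * ε)) : ℝ) : ℂ) *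
        (-f (repPoint x z₁) * (radialIntegral ε (repPoint x z₁).im : ℂ)) := by
    intro x
    obtain ⟨h1, h2⟩ := integral_diagKernel hfd hC hε hε1 (repPoint x z₁)
    simp only [kernelTerm_repMatrix x.2, mul_left_comm (f _)]
    refine ⟨h1.const_mul _, ?_⟩
    rw [integral_const_mul, h2]
  simp only [mul_kernelSeries_eq hf hm hε]
  rw [integral_finsetSum _ fun x _ => (setIntegral_tsum_eq hΦ (hint x).1).1,
    ← Finset.sum_coe_sort (repIndex m N)]
  refine Finset.sum_congr rfl fun x _ => ?_
  rw [← (hint x).2, ← (setIntegral_tsum_eq hΦ (hint x).1).2]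

end Unfolding

/-! ### Integrability of the cross terms on a neighbourhood of the cusp. -/

section CuspRegion

open scoped ENNReal

variable {m : ℕ}

/-- A region containing the standard fundamental domain of the modular group. -/
def cuspRegion : Set ℍ := {z | |z.re| ≤ 1 / 2 ∧ 1 / 2 ≤ z.im}

lemma measurableSet_cuspRegion : MeasurableSet cuspRegion :=
  (measurableSet_le (UpperHalfPlane.continuous_re.measurable.abs) measurable_const).inter
    (measurableSet_le measurable_const UpperHalfPlane.continuous_im.measurable)

/-- The singular weight `|x - t|^(-1/2)`. -/
def singWeight (t x : ℝ) : ℝ≥0∞ := ENNReal.ofReal |x - t| ^ (-(1 / 2) : ℝ)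

lemma measurable_singWeight (t : ℝ) : Measurable (singWeight t) := by
  unfold singWeight
  fun_prop

/-- The weight is at most `1` at distance at least `1` from `t`, and near `t` it is a translate of a
fixed integrable function; translation invariance makes the bound independent of `t`. -/
lemma exists_lintegral_singWeight_le :
    ∃ C : ℝ≥0∞, C ≠ ∞ ∧ ∀ t, ∫⁻ x in Set.Icc (-(1 / 2)) (1 / 2), singWeight t x ≤ C := by
  set g : ℝ → ℝ≥0∞ := (Metric.ball (0 : ℝ) 1).indicator (singWeight 0) with hg
  have hgm : Measurable g := (measurable_singWeight 0).indicator measurableSet_ball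
  have hfin : ∫⁻ x, g x ≠ ∞ := by
    rw [hg, lintegral_indicator measurableSet_ball]
    have h1 : IntegrableOn (fun x : ℝ => ‖x‖ ^ (-(1 / 2) : ℝ)) (Metric.ball 0 1) := by
      rw [integrableOn_fun_norm_addHaar volume (f := fun r : ℝ => r ^ (-(1 / 2) : ℝ))]
      have h2 : IntervalIntegrable (fun x : ℝ => x ^ (-(1 / 2) : ℝ)) volume 0 1 :=
        intervalIntegral.intervalIntegrable_rpow' (by norm_num)
      rw [intervalIntegrable_iff_integrableOn_Ioo_of_le zero_le_one] at h2
      simpa using h2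
    refine ne_of_lt (lt_of_le_of_lt (le_of_eq ?_) (Integrable.lintegral_lt_top h1))
    refine lintegral_congr_ae ?_
    have hne : ∀ᵐ x : ℝ ∂(volume.restrict (Metric.ball 0 1)), x ≠ 0 :=
      ae_restrict_of_ae (by simp [ae_iff])
    filter_upwards [hne] with x hx
    rw [singWeight, sub_zero, ENNReal.ofReal_rpow_of_pos (abs_pos.2 hx), Real.norm_eq_abs]
  refine ⟨1 + ∫⁻ x, g x, by simp [hfin], fun t => ?_⟩
  have hle : ∀ x, singWeight t x ≤ 1 + g (x - t) := by
    intro x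
    by_cases h : x - t ∈ Metric.ball (0 : ℝ) 1
    · rw [hg, Set.indicator_of_mem h, singWeight, singWeight, sub_zero]
      exact le_add_self
    · rw [hg, Set.indicator_of_notMem h, add_zero, singWeight]
      rw [mem_ball_zero_iff, Real.norm_eq_abs, not_lt] at h
      rw [ENNReal.rpow_neg]
      refine ENNReal.inv_le_one.2 ?_
      exact ENNReal.one_le_rpow (by simpa using ENNReal.ofReal_le_ofReal h) (by norm_num)
  calc ∫⁻ x in Set.Icc (-(1 / 2)) (1 / 2), singWeight t x
      ≤ ∫⁻ x in Set.Icc (-(1 / 2)) (1 / 2), (1 + g (x - t)) := lintegral_mono hle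
    _ = (∫⁻ x in Set.Icc (-(1 / 2) : ℝ) (1 / 2), 1) +
          ∫⁻ x in Set.Icc (-(1 / 2)) (1 / 2), g (x - t) := lintegral_add_left measurable_const _
    _ ≤ 1 + ∫⁻ x, g (x - t) := by
      gcongr
      · rw [setLIntegral_one, Real.volume_Icc]
        norm_num
      · exact Measure.restrict_le_self
    _ = 1 + ∫⁻ x, g x := by rw [lintegral_sub_right_eq_self g t]

/-- The factor `y²` cancels the density of hyperbolic area, after which Tonelli separates the
variables. -/
lemma lintegral_cuspRegion {E H : ℝ → ℝ≥0∞} (hE : Measurable E) (hH : Measurable H) :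
    ∫⁻ z in cuspRegion, ENNReal.ofReal (z.im ^ 2) * (E z.im * H z.re) ≤
      (∫⁻ x in Set.Icc (-(1 / 2)) (1 / 2), H x) * ∫⁻ y in Set.Ici (1 / 2), E y := by
  set H' : ℝ → ℝ≥0∞ := (Set.Icc (-(1 / 2)) (1 / 2)).indicator H with hH'
  set E' : ℝ → ℝ≥0∞ := (Set.Ici (1 / 2)).indicator E with hE'
  have hH'm : Measurable H' := hH.indicator measurableSet_Icc
  have hE'm : Measurable E' := hE.indicator measurableSet_Ici
  have hre : Measurable fun z : ℍ => z.re := UpperHalfPlane.continuous_re.measurable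
  have him : Measurable fun z : ℍ => z.im := UpperHalfPlane.continuous_im.measurable
  calc ∫⁻ z in cuspRegion, ENNReal.ofReal (z.im ^ 2) * (E z.im * H z.re)
      = ∫⁻ z : ℍ, ENNReal.ofReal (z.im ^ 2) * (H' z.re * E' z.im) := by
        rw [← lintegral_indicator measurableSet_cuspRegion]
        refine lintegral_congr fun z => ?_
        by_cases h : z ∈ cuspRegion
        · rw [Set.indicator_of_mem h, hH', hE', Set.indicator_of_mem (show z.re ∈ Set.Icc (-(1 / 2)) (1 / 2) from abs_le.1 h.1),
            Set.indicator_of_mem (show z.im ∈ Set.Ici (1 / 2) from h.2), mul_comm (E _)]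
        · rw [Set.indicator_of_notMem h]
          by_cases h1 : |z.re| ≤ 1 / 2
          · have h2 : z.im ∉ Set.Ici (1 / 2 : ℝ) := fun h2 => h ⟨h1, h2⟩
            rw [hE', Set.indicator_of_notMem h2, mul_zero, mul_zero]
          · have h2 : z.re ∉ Set.Icc (-(1 / 2) : ℝ) (1 / 2) := fun h2 => h1 (abs_le.2 h2)
            rw [hH', Set.indicator_of_notMem h2, zero_mul, mul_zero]
    _ = ∫⁻ z : ℍ, H' (z : ℂ).re * E' (z : ℂ).im ∂area := by
        rw [UpperHalfPlane.volume_def, lintegral_withDensity_eq_lintegral_mul _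
          (measurable_inv_im_sq.coe_nnreal_ennreal) (by fun_prop)]
        refine lintegral_congr fun z => ?_
        rw [Pi.mul_apply, ← mul_assoc]
        have hz := z.im_pos
        have : (((1 / NNReal.mk z.im z.im_pos.le) ^ 2 : NNReal) : ℝ≥0∞) =
            ENNReal.ofReal ((z.im ^ 2)⁻¹) := by
          rw [ENNReal.ofReal, ENNReal.coe_inj, ← NNReal.coe_inj, Real.coe_toNNReal _ (by positivity)]
          simp
        rw [this, ← ENNReal.ofReal_mul (by positivity), inv_mul_cancel₀ (by positivity),
          ENNReal.ofReal_one, one_mul]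
        rfl
    _ = ∫⁻ z in Set.range UpperHalfPlane.coe, H' z.re * E' z.im :=
        measurePreserving_coe_area.lintegral_comp_emb UpperHalfPlane.measurableEmbedding_coe
          fun z : ℂ => H' z.re * E' z.im
    _ ≤ ∫⁻ z : ℂ, H' z.re * E' z.im := setLIntegral_le_lintegral _ _
    _ = ∫⁻ p : ℝ × ℝ, H' p.1 * E' p.2 :=
        Complex.volume_preserving_equiv_real_prod.lintegral_comp_emb
          Complex.measurableEquivRealProd.measurableEmbedding fun p => H' p.1 * E' p.2
    _ = (∫⁻ x, H' x) * ∫⁻ y, E' y :=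
        lintegral_prod_mul hH'm.aemeasurable hE'm.aemeasurable
    _ = _ := by rw [hH', hE', lintegral_indicator measurableSet_Icc,
        lintegral_indicator measurableSet_Ici]

lemma lintegral_exp_neg_ne_top {c : ℝ} (hc : 0 < c) :
    ∫⁻ y in Set.Ici (1 / 2), ENNReal.ofReal (Real.exp (-c * y)) ≠ ∞ := by
  have h : IntegrableOn (fun y => Real.exp (-c * y)) (Set.Ici (1 / 2)) :=
    (integrableOn_Ici_iff_integrableOn_Ioi (by simp)).2 (exp_neg_integrableOn_Ioi _ hc)
  exact h.lintegral_lt_top.ne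

/-- The real part of `γ z`. -/
def rePoint (z : ℍ) (γ : Matrix (Fin 2) (Fin 2) ℤ) : ℝ :=
  (((γ 0 0 : ℂ) * z + γ 0 1) / ((γ 1 0 : ℂ) * z + γ 1 1)).re

lemma exists_le_norm_bottomRow (z : ℍ) : ∃ κ : ℝ, 0 < κ ∧
    ∀ c d : ℤ, (c ≠ 0 ∨ d ≠ 0) → κ ≤ ‖(c : ℂ) * z + d‖ := by
  refine ⟨min 1 z.im, lt_min one_pos z.im_pos, fun c d h => ?_⟩
  by_cases hc : c = 0
  · have hd : d ≠ 0 := by simpa [hc] using h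
    refine (min_le_left _ _).trans ?_
    rw [hc]
    simp only [Int.cast_zero, zero_mul, zero_add, Complex.norm_intCast]
    exact_mod_cast Int.one_le_abs hd
  · refine (min_le_right _ _).trans ?_
    have h1 := Complex.abs_im_le_norm ((c : ℂ) * z + d)
    have h2 : ((c : ℂ) * z + d).im = c * z.im := by simp
    rw [h2, abs_mul, abs_of_pos z.im_pos] at h1
    refine le_trans ?_ h1
    have : (1 : ℝ) ≤ |(c : ℝ)| := by exact_mod_cast Int.one_le_abs hc
    nlinarith [z.im_pos]

/-- On the cusp region the cross terms are bounded by singular weights in the real part. -/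
lemma exists_crossTerm_le (hm : 0 < m) (z₁ : ℍ) : ∃ K : ℝ, 0 < K ∧
    ∀ γ : Matrix (Fin 2) (Fin 2) ℤ, γ.det = (m : ℤ) → ∀ z ∈ cuspRegion,
      ENNReal.ofReal (crossTerm z₁ z γ) ≤
        ENNReal.ofReal (K * ‖muMinus z₁ UpperHalfPlane.I γ‖ ^ (-(7 / 2) : ℝ)) *
          singWeight (rePoint z₁ γ) z.re := by
  obtain ⟨κ, hκ, hκ'⟩ := exists_le_norm_bottomRow z₁
  refine ⟨(4⁻¹ : ℝ) ^ (-(7 / 2) : ℝ) * κ ^ (-(1 / 2) : ℝ), by positivity, fun γ hγ z hz => ?_⟩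
  have hmZ : (0 : ℤ) < m := by exact_mod_cast hm
  have hmR : (0 : ℝ) < m := by exact_mod_cast hm
  set j : ℂ := (γ 1 0 : ℂ) * z₁ + γ 1 1 with hj
  set p : ℂ := ((γ 0 0 : ℂ) * z₁ + γ 0 1) / j with hp
  have hκj : κ ≤ ‖j‖ := hκ' _ _ (by
    by_contra! h
    rw [Matrix.det_fin_two, h.1, h.2] at hγ
    omega)
  have hjn : 0 < ‖j‖ := hκ.trans_le hκj
  have hj0 : j ≠ 0 := norm_pos_iff.1 hjn
  have hpj : p * j = (γ 0 0 : ℂ) * z₁ + γ 0 1 := div_mul_cancel₀ _ hj0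
  have e1 : ∀ w : ℍ, muMinus z₁ w γ = j * (p - conj (w : ℂ)) := by
    intro w
    rw [muMinus, mu, hj]
    rw [hj] at hpj
    linear_combination -hpj
  have e2 : muPlus z₁ z γ = j * (p - z) := by
    rw [muPlus, mu, hj]
    rw [hj] at hpj
    linear_combination -hpj
  -- Here `p = γ z₁`. The identity for `|μ₋|² - |μ₊|²` at `z₂ = i` reads `4 |j|² Im p = 4 m y₁`.
  have hpim : 0 ≤ p.im := by
    have h1 := sq_norm_muMinus_sub hγ z₁ UpperHalfPlane.I
    have h2 : muPlus z₁ UpperHalfPlane.I γ = j * (p - (UpperHalfPlane.I : ℂ)) := by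
      rw [muPlus, mu, hj]
      rw [hj] at hpj
      linear_combination -hpj
    rw [e1, h2, norm_mul, norm_mul, mul_pow, mul_pow, ← mul_sub,
      ← Complex.normSq_eq_norm_sq (p - conj (UpperHalfPlane.I : ℂ)),
      ← Complex.normSq_eq_norm_sq (p - (UpperHalfPlane.I : ℂ)), Complex.normSq_apply,
      Complex.normSq_apply] at h1
    simp only [UpperHalfPlane.coe_I, Complex.conj_I, Complex.sub_re, Complex.sub_im,
      Complex.neg_re, Complex.neg_im, Complex.I_re, Complex.I_im, UpperHalfPlane.I_im] at h1
    have h3 := z₁.im_pos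
    have h4 : 0 < ‖j‖ ^ 2 * (4 * p.im) := by
      have : 0 < 4 * (m : ℝ) * z₁.im * 1 := by positivity
      rw [← h1] at this
      convert this using 1
      ring
    have h5 : 0 < 4 * p.im := pos_of_mul_pos_right h4 (by positivity)
    linarith
  -- On the region `|Re z| ≤ 1/2 ≤ Im z` and `Im p ≥ 0`, so `|p + i| ≤ 4 |p - z̄|`. The dependence
  -- of `μ₋` on `z` can therefore be frozen at `z = i`.
  have hM : 4⁻¹ * ‖muMinus z₁ UpperHalfPlane.I γ‖ ≤ ‖muMinus z₁ z γ‖ := by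
    rw [e1, e1, norm_mul, norm_mul]
    have h1 : ‖p - conj (UpperHalfPlane.I : ℂ)‖ ≤ 4 * ‖p - conj (z : ℂ)‖ := by
      refine le_of_sq_le_sq ?_ (by positivity)
      rw [mul_pow, ← Complex.normSq_eq_norm_sq, ← Complex.normSq_eq_norm_sq, Complex.normSq_apply,
        Complex.normSq_apply]
      simp only [UpperHalfPlane.coe_I, Complex.conj_I, Complex.sub_re, Complex.sub_im,
        Complex.neg_re, Complex.neg_im, Complex.I_re, Complex.I_im, Complex.conj_re,
        Complex.conj_im, UpperHalfPlane.coe_re, UpperHalfPlane.coe_im]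
      obtain ⟨hz1, hz2⟩ := hz
      obtain ⟨hz3, hz4⟩ := abs_le.1 hz1
      have q1 : z.re ^ 2 ≤ (p.im + z.im) ^ 2 := by nlinarith
      have q2 : (p.im + 1) ^ 2 ≤ 4 * (p.im + z.im) ^ 2 := by nlinarith
      nlinarith [sq_nonneg (p.re - 2 * z.re)]
    nlinarith [norm_nonneg j]
  have hM0 : 0 < ‖muMinus z₁ UpperHalfPlane.I γ‖ := norm_pos_iff.2 (muMinus_ne_zero hm hγ _ _)
  have hA : 0 < (4⁻¹ : ℝ) ^ (-(7 / 2) : ℝ) * κ ^ (-(1 / 2) : ℝ) *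
      ‖muMinus z₁ UpperHalfPlane.I γ‖ ^ (-(7 / 2) : ℝ) := by positivity
  rw [singWeight]
  -- On the vertical line through `γ z₁` the singular weight is infinite and nothing is claimed.
  rcases eq_or_ne z.re (rePoint z₁ γ) with h0 | h0
  · rw [h0, sub_self, abs_zero, ENNReal.ofReal_zero, ENNReal.zero_rpow_of_neg (by norm_num),
      ENNReal.mul_top (by simpa using hA)]
    exact le_top
  · have hx : 0 < |z.re - rePoint z₁ γ| := abs_pos.2 (sub_ne_zero.2 h0)
    rw [ENNReal.ofReal_rpow_of_pos hx, ← ENNReal.ofReal_mul hA.le]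
    refine ENNReal.ofReal_le_ofReal ?_
    have hP : κ * |z.re - rePoint z₁ γ| ≤ ‖muPlus z₁ z γ‖ := by
      rw [e2, norm_mul]
      have h1 := Complex.abs_re_le_norm (p - z)
      rw [Complex.sub_re, abs_sub_comm, UpperHalfPlane.coe_re] at h1
      have h2 : |z.re - rePoint z₁ γ| ≤ ‖p - z‖ := h1
      gcongr
    rw [crossTerm]
    calc _ ≤ (4⁻¹ * ‖muMinus z₁ UpperHalfPlane.I γ‖) ^ (-(7 / 2) : ℝ) *
          (κ * |z.re - rePoint z₁ γ|) ^ (-(1 / 2) : ℝ) := by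
          gcongr ?_ * ?_
          · exact Real.rpow_le_rpow_of_nonpos (by positivity) hM (by norm_num)
          · exact Real.rpow_le_rpow_of_nonpos (by positivity) hP (by norm_num)
      _ = _ := by
          rw [Real.mul_rpow (by norm_num) hM0.le, Real.mul_rpow hκ.le hx.le]
          ring

/-- The dominating function on the cusp region. -/
def cuspBound (m : ℕ) (P : ℤ → ℤ → Prop) (A c : ℝ) (z₁ z : ℍ) : ℝ≥0∞ :=
  ENNReal.ofReal (z.im ^ 2) * (ENNReal.ofReal (A * Real.exp (-c * z.im)) *
    (1 + ∑' γ, ENNReal.ofReal ((detSet m P).indicator (crossTerm z₁ z) γ)))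

lemma measurable_muMinus (z₁ : ℍ) (γ : Matrix (Fin 2) (Fin 2) ℤ) :
    Measurable fun z : ℍ => muMinus z₁ z γ := by
  unfold muMinus mu
  fun_prop

lemma measurable_muPlus (z₁ : ℍ) (γ : Matrix (Fin 2) (Fin 2) ℤ) :
    Measurable fun z : ℍ => muPlus z₁ z γ := by
  unfold muPlus mu
  fun_prop

lemma measurable_im : Measurable fun z : ℍ => z.im := UpperHalfPlane.continuous_im.measurable

lemma measurable_cuspBound (m : ℕ) (P : ℤ → ℤ → Prop) (A c : ℝ) (z₁ : ℍ) :
    Measurable (cuspBound m P A c z₁) := by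
  classical
  have h1 := measurable_im
  have h2 : ∀ γ, Measurable fun z : ℍ =>
      ENNReal.ofReal ((detSet m P).indicator (crossTerm z₁ z) γ) := by
    intro γ
    by_cases hγ : γ ∈ detSet m P
    · simp only [Set.indicator_of_mem hγ, crossTerm]
      have := measurable_muMinus z₁ γ
      have := measurable_muPlus z₁ γ
      fun_prop
    · simp only [Set.indicator_of_notMem hγ]
      exact measurable_const
  unfold cuspBound
  have h3 : Measurable fun z : ℍ =>
      ∑' γ, ENNReal.ofReal ((detSet m P).indicator (crossTerm z₁ z) γ) := Measurable.tsum h2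
  fun_prop

/-- The coefficients `|μ₋(z₁, i)|^(-7/2)` are summable over `γ`, each singular weight has uniformly
bounded integral in `x`, and the exponential decay takes care of the integral in `y`. -/
lemma setLIntegral_cuspBound_ne_top (hm : 0 < m) (P : ℤ → ℤ → Prop) (A : ℝ) {c : ℝ} (hc : 0 < c)
    (z₁ : ℍ) : ∫⁻ z in cuspRegion, cuspBound m P A c z₁ z ≠ ∞ := by
  classical
  obtain ⟨K, hK, hle⟩ := exists_crossTerm_le hm z₁
  obtain ⟨C, hC, hint⟩ := exists_lintegral_singWeight_le
  set a : Matrix (Fin 2) (Fin 2) ℤ → ℝ := (detSet m P).indicator fun γ =>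
    K * ‖muMinus z₁ UpperHalfPlane.I γ‖ ^ (-(7 / 2) : ℝ) with ha
  have ha0 : ∀ γ, 0 ≤ a γ := fun γ => Set.indicator_nonneg (fun γ _ => by positivity) γ
  have hasum : Summable a := by
    have h1 := (summable_norm_muMinus_rpow hm P z₁ UpperHalfPlane.I
      (s := -(7 / 2)) (by norm_num)).mul_left K
    refine h1.congr fun γ => ?_
    rw [ha]
    simp only [Set.indicator_apply, mul_ite, mul_zero]
  set H : ℝ → ℝ≥0∞ := fun x =>
    1 + ∑' γ, ENNReal.ofReal (a γ) * singWeight (rePoint z₁ γ) x with hH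
  have hterm : ∀ γ, Measurable fun x : ℝ => ENNReal.ofReal (a γ) * singWeight (rePoint z₁ γ) x :=
    fun γ => (measurable_singWeight _).const_mul _
  have hHm : Measurable H := (Measurable.tsum hterm).const_add 1
  have hHfin : ∫⁻ x in Set.Icc (-(1 / 2)) (1 / 2), H x ≠ ∞ := by
    rw [hH, lintegral_add_left measurable_const, lintegral_tsum fun γ => (hterm γ).aemeasurable]
    refine ENNReal.add_ne_top.2 ⟨by simp, ?_⟩
    refine ne_top_of_le_ne_top (b := (∑' γ, ENNReal.ofReal (a γ)) * C) ?_ ?_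
    · exact ENNReal.mul_ne_top hasum.tsum_ofReal_ne_top hC
    · rw [← ENNReal.tsum_mul_right]
      refine ENNReal.tsum_le_tsum fun γ => ?_
      rw [lintegral_const_mul _ (measurable_singWeight _)]
      gcongr
      exact hint _
  set E : ℝ → ℝ≥0∞ := fun y => ENNReal.ofReal (A * Real.exp (-c * y)) with hE
  have hEm : Measurable E := by
    rw [hE]
    fun_prop
  have hEfin : ∫⁻ y in Set.Ici (1 / 2), E y ≠ ∞ := by
    refine ne_top_of_le_ne_top (ENNReal.mul_ne_top (ENNReal.ofReal_ne_top (r := |A|))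
      (lintegral_exp_neg_ne_top hc)) ?_
    rw [← lintegral_const_mul _ (by fun_prop)]
    refine lintegral_mono fun y => ?_
    rw [← ENNReal.ofReal_mul (abs_nonneg A)]
    exact ENNReal.ofReal_le_ofReal (by gcongr; exact le_abs_self A)
  refine ne_top_of_le_ne_top (ENNReal.mul_ne_top hHfin hEfin)
    (le_trans ?_ (lintegral_cuspRegion hEm hHm))
  refine setLIntegral_mono' measurableSet_cuspRegion fun z hz => ?_
  rw [cuspBound]
  refine mul_le_mul_right (mul_le_mul_right ?_ _) _
  refine add_le_add_right (ENNReal.tsum_le_tsum fun γ => ?_) 1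
  by_cases hγ : γ ∈ detSet m P
  · rw [ha, Set.indicator_of_mem hγ, Set.indicator_of_mem hγ]
    exact hle γ hγ.1 z hz
  · rw [Set.indicator_of_notMem hγ, ENNReal.ofReal_zero]
    exact zero_le

end CuspRegion

/-! ### Decay of a cusp form at every cusp. -/

section CuspFormBounds

open scoped ModularForm

variable {N : ℕ} [NeZero N]

set_option linter.unusedSectionVars false

lemma cuspForm_smul
    (f : CuspForm ((CongruenceSubgroup.Gamma0 N : Subgroup SL(2, ℤ)) : Subgroup (GL (Fin 2) ℝ)) 2)
    (τ : SL(2, ℤ)) (hτ : τ ∈ CongruenceSubgroup.Gamma0 N) (z : ℍ) :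
    f (τ • z) = autFactor τ z ^ 2 * f z := by
  have h := SlashInvariantForm.slash_action_eqn_SL'' f hτ z
  rw [denom_eq_autFactor] at h
  exact_mod_cast h

-- The translate `f ∣ σ` is a cusp form for a conjugate arithmetic group, hence decays exponentially
-- at infinity. In the remaining strip of bounded height the bound `C / Im z` is absorbed into the
-- constant.
open ConjAct Pointwise Matrix.SpecialLinearGroup in
lemma exists_norm_cuspForm_smul_le
    (f : CuspForm ((CongruenceSubgroup.Gamma0 N : Subgroup SL(2, ℤ)) : Subgroup (GL (Fin 2) ℝ)) 2)
    (σ : SL(2, ℤ)) : ∃ C c : ℝ, 0 ≤ C ∧ 0 < c ∧ ∀ z : ℍ, 1 / 2 ≤ z.im →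
      ‖(autFactor σ z ^ 2)⁻¹ * f (σ • z)‖ ≤ C * Real.exp (-c * z.im) := by
  have : ((toConjAct (σ : GL (Fin 2) ℝ)⁻¹) • ((CongruenceSubgroup.Gamma0 N : Subgroup SL(2, ℤ)) :
      Subgroup (GL (Fin 2) ℝ))).IsArithmetic := by
    simpa [(show Rat.castHom ℝ = algebraMap ℚ ℝ by rfl), map_inv, map_mapGL]
      using! Subgroup.IsArithmetic.conj ((CongruenceSubgroup.Gamma0 N : Subgroup SL(2, ℤ)) :
        Subgroup (GL (Fin 2) ℝ)) (mapGL ℚ σ)⁻¹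
  have hg : ∀ z, CuspForm.translate f (σ : GL (Fin 2) ℝ) z =
      (autFactor σ z ^ 2)⁻¹ * f (σ • z) := by
    intro z
    change ((f : ℍ → ℂ) ∣[(2 : ℤ)] σ) z = _
    rw [ModularForm.SL_slash_apply, denom_eq_autFactor, mul_comm, zpow_neg]
    norm_cast
  obtain ⟨C, hC⟩ := CuspFormClass.exists_bound (CuspForm.translate f (σ : GL (Fin 2) ℝ))
  obtain ⟨c, hc, hO⟩ := CuspFormClass.exp_decay_atImInfty'
    (CuspForm.translate f (σ : GL (Fin 2) ℝ))
  obtain ⟨D, hD⟩ := hO.bound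
  rw [UpperHalfPlane.atImInfty, eventually_comap, eventually_atTop] at hD
  obtain ⟨B, hB⟩ := hD
  refine ⟨max |D| (2 * |C| * Real.exp (c * B)), c, le_max_of_le_left (abs_nonneg D), hc,
    fun z hz => ?_⟩
  rw [← hg]
  rcases le_total B z.im with h | h
  · have h1 := hB z.im h z rfl
    rw [Real.norm_of_nonneg (Real.exp_pos _).le] at h1
    refine h1.trans ?_
    gcongr
    exact (le_abs_self D).trans (le_max_left _ _)
  · have h1 := hC z
    have e : z.im ^ (((2 : ℤ) : ℝ) / 2) = z.im := by norm_num
    rw [e] at h1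
    have hz0 := z.im_pos
    calc _ ≤ |C| / z.im := h1.trans (by gcongr; exact le_abs_self C)
      _ ≤ |C| / (1 / 2) := by gcongr
      _ = 2 * |C| * 1 := by ring
      _ ≤ 2 * |C| * Real.exp (c * B + -c * z.im) := by
        gcongr
        rw [Real.one_le_exp_iff]
        nlinarith
      _ = 2 * |C| * Real.exp (c * B) * Real.exp (-c * z.im) := by rw [Real.exp_add]; ring
      _ ≤ _ := by
        gcongr
        exact le_max_right _ _

end CuspFormBounds

/-! ### The Hecke orbit of `z₁`, where the kernel may be singular. -/

section BadSet

variable {m : ℕ}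

/-- The orbit of `z₁` under the integer matrices of determinant `m`. -/
def heckeOrbit (m : ℕ) (z₁ : ℍ) : Set ℍ :=
  {z | ∃ γ : Matrix (Fin 2) (Fin 2) ℤ, γ.det = (m : ℤ) ∧ muPlus z₁ z γ = 0}

lemma smul_mem_heckeOrbit {z₁ z : ℍ} (σ : SL(2, ℤ)) (h : z ∈ heckeOrbit m z₁) :
    σ • z ∈ heckeOrbit m z₁ := by
  obtain ⟨γ, hγ, h0⟩ := h
  refine ⟨(σ : Matrix (Fin 2) (Fin 2) ℤ) * γ, by rw [Matrix.det_mul, σ.det_coe, one_mul, hγ], ?_⟩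
  rw [← norm_eq_zero, norm_muPlus_mul_smul, h0, norm_zero, zero_div]

lemma volume_subsingleton {s : Set ℍ} (hs : s.Subsingleton) : volume s = 0 := by
  rw [UpperHalfPlane.volume_eq_lintegral]
  exact setLIntegral_measure_zero _ _ ((hs.image _).measure_zero _)

/-- There are countably many matrices, and for each the equation `μ₊ = 0` is linear in `z` with
leading coefficient `c z₁ + d ≠ 0`, so it has at most one solution. -/
lemma volume_heckeOrbit (hm : 0 < m) (z₁ : ℍ) : volume (heckeOrbit m z₁) = 0 := by
  obtain ⟨κ, hκ, hκ'⟩ := exists_le_norm_bottomRow z₁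
  have e : heckeOrbit m z₁ = ⋃ γ ∈ {γ : Matrix (Fin 2) (Fin 2) ℤ | γ.det = (m : ℤ)},
      {z : ℍ | muPlus z₁ z γ = 0} := by
    ext z
    simp [heckeOrbit]
  rw [e, measure_biUnion_null_iff (Set.to_countable _)]
  intro γ hγ
  refine volume_subsingleton fun z hz w hw => ?_
  have hj : κ ≤ ‖(γ 1 0 : ℂ) * z₁ + γ 1 1‖ := hκ' _ _ (by
    by_contra! h
    have hγ' : γ.det = (m : ℤ) := hγ
    rw [Matrix.det_fin_two, h.1, h.2] at hγ'
    omega)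
  have hj0 : (γ 1 0 : ℂ) * z₁ + γ 1 1 ≠ 0 := norm_pos_iff.1 (hκ.trans_le hj)
  have h1 : muPlus z₁ z γ = 0 := hz
  have h2 : muPlus z₁ w γ = 0 := hw
  rw [muPlus, mu] at h1 h2
  refine UpperHalfPlane.ext (mul_left_cancel₀ hj0 ?_)
  linear_combination h2 - h1

end BadSet

/-! ### A majorant of the regularized integrands, independent of `ε`. -/

section Domination

open scoped ENNReal

variable {m N : ℕ} [NeZero N]

set_option linter.unusedSectionVars false

lemma one_add_sq_mul_exp_le {c : ℝ} (hc : 0 < c) {y : ℝ} (hy : 0 ≤ y) :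
    (1 + y) ^ 2 * Real.exp (-c * y) ≤ (1 + 4 / c) ^ 2 * Real.exp (-(c / 2) * y) := by
  have h1 : 1 + y ≤ (1 + 4 / c) * Real.exp (c / 4 * y) := by
    have h2 := Real.add_one_le_exp (c / 4 * y)
    have h3 : y = 4 / c * (c / 4 * y) := by field_simp
    have h4 : 0 < 4 / c := by positivity
    have h5 : 0 ≤ c / 4 * y := by positivity
    calc 1 + y = 1 + 4 / c * (c / 4 * y) := by rw [← h3]
      _ ≤ (1 + 4 / c) * (c / 4 * y + 1) := by nlinarith
      _ ≤ _ := by gcongr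
  calc _ ≤ ((1 + 4 / c) * Real.exp (c / 4 * y)) ^ 2 * Real.exp (-c * y) := by gcongr
    _ = (1 + 4 / c) ^ 2 * Real.exp (-(c / 2) * y) := by
      rw [mul_pow, ← Real.exp_nat_mul, mul_assoc, ← Real.exp_add]
      congr 2
      push_cast
      ring

/-- Polynomial growth in `Im z`, uniform in `ε`, for an arbitrary condition modulo `N`. This
generality is needed because translation by `SL(2, ℤ)` changes the condition. -/
lemma exists_norm_kernelSeries_le (hm : 0 < m) (Q : ZMod N × ZMod N → Prop) (z₁ : ℍ) :
    ∃ C : ℝ, 0 ≤ C ∧ ∀ ε : ℝ, 0 < ε → ε ≤ 1 / 4 → ∀ z : ℍ, 1 / 2 ≤ z.im → z ∉ heckeOrbit m z₁ →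
      ‖kernelSeries m (ModCond Q) ε z₁ z‖ ≤ C * z.im ^ 2 * (1 + z.im) ^ 2 *
        (1 + ∑' γ, (detSet m (ModCond Q)).indicator (crossTerm z₁ z) γ) := by
  obtain ⟨C, hC0, hC⟩ := exists_norm_regSum_le hm Q z₁ (y₀ := min (1 / 2) z₁.im)
    (lt_min (by norm_num) z₁.im_pos) ((min_le_left _ _).trans (by norm_num)) (min_le_right _ _)
  refine ⟨C, hC0, fun ε hε hε4 z hz hbad => ?_⟩
  have h1 := hC (1 + ε / 2) ε (by ring) (isSmall_ofReal hε.le hε4) (by simpa using hε) z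
    ((min_le_left _ _).trans hz) fun γ hγ h0 => hbad ⟨γ, hγ.1, h0⟩
  have hy := z.im_pos
  have hS : 0 ≤ ∑' γ, (detSet m (ModCond Q)).indicator (crossTerm z₁ z) γ :=
    tsum_nonneg fun γ => Set.indicator_nonneg (fun γ _ => crossTerm_nonneg z₁ z γ) γ
  set S := ∑' γ, (detSet m (ModCond Q)).indicator (crossTerm z₁ z) γ with hSdef
  have h2 : z.im ^ (2 + ε) ≤ z.im ^ 2 * (1 + z.im) := by
    rw [Real.rpow_add hy, Real.rpow_two]
    gcongr
    exact rpow_le_one_add hy.le hε.le (by linarith)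
  rw [kernelSeries, norm_mul, Complex.norm_real, Real.norm_of_nonneg (by positivity)]
  calc _ ≤ z.im ^ 2 * (1 + z.im) * (C + C * z.im * S) := by gcongr
    _ ≤ z.im ^ 2 * (1 + z.im) * (C * (1 + z.im) * (1 + S)) := by
      gcongr
      nlinarith [mul_nonneg hC0 hS, mul_nonneg hC0 hy.le]
    _ = _ := by ring

/-- The regularized integrand. -/
def regIntegrand (m N : ℕ) (f : ℍ → ℂ) (ε : ℝ) (z₁ z : ℍ) : ℂ :=
  f z * (1 / 2 * kernelSeries m (ModCond (UnitCond N)) ε z₁ z)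

lemma regIntegrand_smul {f : ℍ → ℂ} (hf : ∀ τ ∈ CongruenceSubgroup.Gamma0 N, ∀ z : ℍ,
    f (τ • z) = autFactor τ z ^ 2 * f z) {τ : SL(2, ℤ)} (hτ : τ ∈ CongruenceSubgroup.Gamma0 N)
    (ε : ℝ) (z₁ z : ℍ) : regIntegrand m N f ε z₁ (τ • z) = regIntegrand m N f ε z₁ z := by
  rw [regIntegrand, regIntegrand, kernelSeries_smul, smulCond_unitCond hτ, hf τ hτ]
  have := autFactor_ne_zero τ z
  field_simp

/-- Near the cusp given by `σ`, the weights of `f` and of the kernel cancel. Half of the exponential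
decay of the translated form absorbs the polynomial growth of the kernel. -/
lemma exists_enorm_regIntegrand_le (hm : 0 < m) {f : ℍ → ℂ} (σ : SL(2, ℤ))
    (hf : ∃ C c : ℝ, 0 ≤ C ∧ 0 < c ∧ ∀ z : ℍ, 1 / 2 ≤ z.im →
      ‖(autFactor σ z ^ 2)⁻¹ * f (σ • z)‖ ≤ C * Real.exp (-c * z.im)) (z₁ : ℍ) :
    ∃ A c : ℝ, 0 < c ∧ ∀ ε : ℝ, 0 < ε → ε ≤ 1 / 4 → ∀ z : ℍ, 1 / 2 ≤ z.im → z ∉ heckeOrbit m z₁ →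
      ‖regIntegrand m N f ε z₁ (σ • z)‖ₑ ≤
        cuspBound m (smulCond σ (ModCond (UnitCond N))) A c z₁ z := by
  obtain ⟨C, c, hC0, hc, hC⟩ := hf
  rw [smulCond_modCond]
  obtain ⟨D, hD0, hD⟩ := exists_norm_kernelSeries_le hm (fun x : ZMod N × ZMod N =>
    UnitCond N ((σ 0 0 : ZMod N) * x.1 + (σ 0 1 : ZMod N) * x.2,
        (σ 1 0 : ZMod N) * x.1 + (σ 1 1 : ZMod N) * x.2)) z₁
  refine ⟨C * D * (1 + 4 / c) ^ 2, c / 2, by positivity, fun ε hε hε4 z hz hbad => ?_⟩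
  have h1 := hD ε hε hε4 z hz hbad
  have h2 := hC z hz
  rw [regIntegrand, kernelSeries_smul, smulCond_modCond, cuspBound]
  set P := ModCond fun x : ZMod N × ZMod N =>
    UnitCond N ((σ 0 0 : ZMod N) * x.1 + (σ 0 1 : ZMod N) * x.2,
        (σ 1 0 : ZMod N) * x.1 + (σ 1 1 : ZMod N) * x.2)
  have hnn : ∀ γ, 0 ≤ (detSet m P).indicator (crossTerm z₁ z) γ := fun γ =>
    Set.indicator_nonneg (fun γ _ => crossTerm_nonneg z₁ z γ) γ
  rw [← ENNReal.ofReal_tsum_of_nonneg hnn (summable_crossTerm hm P z₁ z), ← ENNReal.ofReal_one,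
    ← ENNReal.ofReal_add zero_le_one (tsum_nonneg hnn), ← ENNReal.ofReal_mul (by positivity),
    ← ENNReal.ofReal_mul (by positivity), ← ofReal_norm]
  refine ENNReal.ofReal_le_ofReal ?_
  have hS : 0 ≤ ∑' γ, (detSet m P).indicator (crossTerm z₁ z) γ := tsum_nonneg hnn
  set S := ∑' γ, (detSet m P).indicator (crossTerm z₁ z) γ
  have e : f (σ • z) * (1 / 2 * ((autFactor σ z ^ 2)⁻¹ * kernelSeries m P ε z₁ z)) =
      (autFactor σ z ^ 2)⁻¹ * f (σ • z) * (1 / 2 * kernelSeries m P ε z₁ z) := by ring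
  have hy := z.im_pos
  rw [e, norm_mul, norm_mul (1 / 2 : ℂ)]
  calc _ ≤ C * Real.exp (-c * z.im) *
        (1 * (D * z.im ^ 2 * (1 + z.im) ^ 2 * (1 + S))) := by
        gcongr
        norm_num
    _ = C * D * z.im ^ 2 * (1 + S) * ((1 + z.im) ^ 2 * Real.exp (-c * z.im)) := by ring
    _ ≤ C * D * z.im ^ 2 * (1 + S) * ((1 + 4 / c) ^ 2 * Real.exp (-(c / 2) * z.im)) :=
        mul_le_mul_of_nonneg_left (one_add_sq_mul_exp_le hc hy.le) (by positivity)
    _ = _ := by ring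

/-- Move `z` to the standard fundamental domain of the modular group by some `ρ`, and write `ρ` as
the chosen representative of its coset times an element of `Γ₀(N)`. -/
lemma exists_coset_mem_cuspRegion (z : ℍ) :
    ∃ (q : SL(2, ℤ) ⧸ CongruenceSubgroup.Gamma0 N) (τ : CongruenceSubgroup.Gamma0 N),
      q.out • ((τ : SL(2, ℤ))⁻¹ • z) ∈ cuspRegion := by
  obtain ⟨ρ, hρ⟩ := ModularGroup.exists_smul_mem_fd z
  obtain ⟨τ, hτ⟩ := QuotientGroup.mk_out_eq_mul (CongruenceSubgroup.Gamma0 N) ρ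
  refine ⟨QuotientGroup.mk ρ, τ, ?_⟩
  rw [hτ, mul_smul, smul_inv_smul]
  have h1 := ModularGroup.three_le_four_mul_im_sq_of_mem_fd hρ
  have h2 := (ρ • z).im_pos
  exact ⟨hρ.2, by nlinarith⟩

lemma lintegral_smul_eq (σ : SL(2, ℤ)) (h : ℍ → ℝ≥0∞) :
    ∫⁻ z : ℍ, h (σ • z) = ∫⁻ z, h z :=
  (measurePreserving_smul (Matrix.SpecialLinearGroup.mapGL ℝ σ)
    (volume : Measure ℍ)).lintegral_comp_emb (measurableEmbedding_const_smul _) h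

/-- An integrable function dominating the regularized integrands. -/
lemma exists_dominating (hm : 0 < m) {f : ℍ → ℂ}
    (hf : ∀ τ ∈ CongruenceSubgroup.Gamma0 N, ∀ z : ℍ, f (τ • z) = autFactor τ z ^ 2 * f z)
    (hdec : ∀ σ : SL(2, ℤ), ∃ C c : ℝ, 0 ≤ C ∧ 0 < c ∧ ∀ z : ℍ, 1 / 2 ≤ z.im →
      ‖(autFactor σ z ^ 2)⁻¹ * f (σ • z)‖ ≤ C * Real.exp (-c * z.im)) (z₁ : ℍ)
    {Φ : Set ℍ} (hΦ : IsFundamentalDomainGamma0 N Φ) :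
    ∃ M : ℍ → ℝ≥0∞, Measurable M ∧ ∫⁻ z in Φ, M z ≠ ∞ ∧
      ∀ ε : ℝ, 0 < ε → ε ≤ 1 / 4 → ∀ z ∉ heckeOrbit m z₁,
        ‖regIntegrand m N f ε z₁ z‖ₑ ≤ M z := by
  have hΦ' : IsFundamentalDomain (transformationGroup N) Φ (volume : Measure ℍ) := hΦ
  have : Fintype (SL(2, ℤ) ⧸ CongruenceSubgroup.Gamma0 N) := Subgroup.fintypeQuotientOfFiniteIndex
  choose A c hc hle using fun q : SL(2, ℤ) ⧸ CongruenceSubgroup.Gamma0 N =>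
    -- The cosets are left cosets `q Γ₀(N)`, so the inverses of their representatives carry the cusp
    -- region to the pieces of a domain for `Γ₀(N)`.
    exists_enorm_regIntegrand_le (N := N) hm q.out⁻¹ (hdec _) z₁
  set b : SL(2, ℤ) ⧸ CongruenceSubgroup.Gamma0 N → ℍ → ℝ≥0∞ := fun q =>
    cuspRegion.indicator
      (cuspBound m (smulCond q.out⁻¹ (ModCond (UnitCond N))) (A q) (c q) z₁) with hb
  have hbm : ∀ q, Measurable (b q) := fun q =>
    (measurable_cuspBound _ _ _ _ _).indicator measurableSet_cuspRegion
  have hsm : ∀ σ : SL(2, ℤ), Measurable fun z : ℍ => σ • z := fun σ =>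
    (continuous_const_smul (Matrix.SpecialLinearGroup.mapGL ℝ σ)).measurable
  set h : ℍ → ℝ≥0∞ := fun z => ∑ q, b q (q.out • z) with hh
  have hhm : Measurable h := Finset.measurable_sum _ fun q _ => (hbm q).comp (hsm _)
  have hgm : ∀ g : transformationGroup N, Measurable fun z : ℍ => h (g⁻¹ • z) := fun g =>
    hhm.comp (measurable_const_smul g⁻¹)
  refine ⟨fun z => ∑' g : transformationGroup N, h (g⁻¹ • z), Measurable.tsum hgm, ?_, ?_⟩
  -- The majorant is a sum over the group, so its integral over `Φ` unfolds to the integral of `h`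
  -- over `ℍ`, a finite sum of integrals over the cusp region.
  · rw [lintegral_tsum fun g => (hgm g).aemeasurable, ← hΦ'.lintegral_eq_tsum' h]
    change ∫⁻ z, ∑ q, b q (q.out • z) ≠ ∞
    rw [lintegral_finsetSum (f := fun q z => b q (q.out • z)) _ fun q _ => (hbm q).comp (hsm _)]
    refine ENNReal.sum_ne_top.2 fun q _ => ?_
    rw [lintegral_smul_eq q.out (b q), hb, lintegral_indicator measurableSet_cuspRegion]
    exact setLIntegral_cuspBound_ne_top hm _ _ (hc q) z₁
  · intro ε hε hε4 z hz
    obtain ⟨q, τ, hqτ⟩ := exists_coset_mem_cuspRegion (N := N) z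
    set w : ℍ := q.out • ((τ : SL(2, ℤ))⁻¹ • z) with hw
    have hwbad : w ∉ heckeOrbit m z₁ := by
      intro h1
      have h2 := smul_mem_heckeOrbit (τ : SL(2, ℤ)) (smul_mem_heckeOrbit q.out⁻¹ h1)
      rw [hw, inv_smul_smul, smul_inv_smul] at h2
      exact hz h2
    have h1 := hle q ε hε hε4 w hqτ.2 hwbad
    rw [hw, inv_smul_smul, regIntegrand_smul hf (inv_mem τ.2)] at h1
    calc _ ≤ b q w := by
          rw [hb]
          simp only [Set.indicator_of_mem hqτ]
          exact h1
      _ ≤ h ((toTransformation τ)⁻¹ • z) := by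
          rw [hh, hw, toTransformation_inv_smul]
          exact Finset.single_le_sum (f := fun q => b q (q.out • ((τ : SL(2, ℤ))⁻¹ • z)))
            (fun _ _ => zero_le) (Finset.mem_univ q)
      _ ≤ _ := ENNReal.le_tsum (f := fun g : transformationGroup N => h (g⁻¹ • z)) _

end Domination

/-! ### Passage to the limit `ε → 0` under the integral sign. -/

section Limit

open scoped ENNReal

variable {m N : ℕ} [NeZero N]

lemma measurable_kernelTerm (ε : ℝ) (z₁ : ℍ) (γ : Matrix (Fin 2) (Fin 2) ℤ) :
    Measurable fun z : ℍ => kernelTerm ε z₁ z γ := by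
  simp only [kernelTerm_eq]
  have h1 := measurable_im
  have h2 := measurable_muMinus z₁ γ
  have h3 := measurable_muPlus z₁ γ
  have h4 : Measurable fun z : ℍ => conj (muMinus z₁ z γ) :=
    Complex.continuous_conj.measurable.comp h2
  fun_prop

lemma measurable_kernelSeries (m : ℕ) (P : ℤ → ℤ → Prop) (ε : ℝ) (z₁ : ℍ) :
    Measurable fun z : ℍ => kernelSeries m P ε z₁ z := by
  classical
  simp only [kernelSeries_eq_tsum]
  have h : ∀ γ, Measurable fun z : ℍ => (detSet m P).indicator (kernelTerm ε z₁ z) γ := by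
    intro γ
    by_cases hγ : γ ∈ detSet m P
    · simp only [Set.indicator_of_mem hγ]
      exact measurable_kernelTerm ε z₁ γ
    · simp only [Set.indicator_of_notMem hγ]
      exact measurable_const
  exact Measurable.tsum h

/-- Real `ε → 0+` corresponds to `s = 1 + ε/2`, a path inside the half-plane in which the kernel was
defined. -/
lemma tendsto_regIntegrand (hm : 0 < m) (f : ℍ → ℂ) {z₁ z : ℍ} (hz : z ∉ heckeOrbit m z₁) :
    Tendsto (fun ε => regIntegrand m N f ε z₁ z) (𝓝[>] 0)
      (𝓝 (((z.im ^ 2 : ℝ) : ℂ) * (f z * omega m N z₁ z))) := by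
  have h1 := (summable_and_tendsto_Omega hm (N := N) (z₁ := z₁) (z₂ := z)
    fun γ hγ h0 => hz ⟨γ, hγ.1, h0⟩).2
  have h2 : Tendsto (fun ε : ℝ => (1 + ε / 2 : ℂ)) (𝓝[>] 0) (𝓝[{s : ℂ | 1 < s.re}] 1) := by
    refine tendsto_nhdsWithin_iff.2 ⟨?_, ?_⟩
    · have : Continuous fun ε : ℝ => (1 + ε / 2 : ℂ) := by fun_prop
      have h3 := this.tendsto 0
      simp only [Complex.ofReal_zero, zero_div, add_zero] at h3
      exact h3.mono_left nhdsWithin_le_nhds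
    · filter_upwards [self_mem_nhdsWithin] with ε hε
      have hε' : 0 < ε := hε
      change 1 < (1 + (ε : ℂ) / 2).re
      rw [← Complex.ofReal_ofNat, ← Complex.ofReal_div]
      simpa using hε'
  have h3 := h1.comp h2
  have h4 : Tendsto (fun ε : ℝ => ((z.im ^ (2 + ε) : ℝ) : ℂ)) (𝓝[>] 0) (𝓝 ((z.im ^ 2 : ℝ) : ℂ)) := by
    have hc : Continuous fun ε : ℝ => ((z.im ^ (2 + ε) : ℝ) : ℂ) :=
      Complex.continuous_ofReal.comp
        ((Real.continuous_const_rpow z.im_ne_zero).comp (by fun_prop))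
    have h5 := hc.tendsto 0
    rw [add_zero, Real.rpow_two] at h5
    exact h5.mono_left nhdsWithin_le_nhds
  refine (h4.mul (h3.const_mul (f z))).congr fun ε => ?_
  rw [Function.comp_apply, Omega_eq_regSum, regIntegrand, kernelSeries]
  ring

/-- The integral of `f` against the kernel, with respect to the hyperbolic area. -/
theorem setIntegral_mul_omega (hm : 0 < m) {f : ℍ → ℂ} (hfm : Measurable f)
    (hf : ∀ τ ∈ CongruenceSubgroup.Gamma0 N, ∀ z : ℍ, f (τ • z) = autFactor τ z ^ 2 * f z)
    (hfd : DifferentiableOn ℂ (fun z => f (UpperHalfPlane.ofComplex z)) {z : ℂ | 0 < z.im})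
    {C : ℝ} (hC : ∀ z, ‖f z‖ ≤ C / z.im)
    (hdec : ∀ σ : SL(2, ℤ), ∃ C c : ℝ, 0 ≤ C ∧ 0 < c ∧ ∀ z : ℍ, 1 / 2 ≤ z.im →
      ‖(autFactor σ z ^ 2)⁻¹ * f (σ • z)‖ ≤ C * Real.exp (-c * z.im)) (z₁ : ℍ)
    {Φ : Set ℍ} (hΦ : IsFundamentalDomainGamma0 N Φ) :
    IntegrableOn (fun z => ((z.im ^ 2 : ℝ) : ℂ) * (f z * omega m N z₁ z)) Φ volume ∧
      ∫ z in Φ, ((z.im ^ 2 : ℝ) : ℂ) * (f z * omega m N z₁ z) =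
        -Real.pi * ∑ x ∈ repIndex m N, ((x.1.2 : ℂ) ^ 2)⁻¹ * f (repPoint x z₁) := by
  obtain ⟨M, hMm, hMfin, hM⟩ := exists_dominating hm hf hdec z₁ hΦ
  have hbad : ∀ᵐ z ∂(volume.restrict Φ), z ∉ heckeOrbit m z₁ :=
    ae_restrict_of_ae (measure_eq_zero_iff_ae_notMem.1 (volume_heckeOrbit hm z₁))
  have hMtop : ∀ᵐ z ∂(volume.restrict Φ), M z < ∞ := ae_lt_top hMm hMfin
  have hbound : Integrable (fun z => (M z).toReal) (volume.restrict Φ) :=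
    integrable_toReal_of_lintegral_ne_top hMm.aemeasurable hMfin
  have hsmall : ∀ᶠ ε : ℝ in 𝓝[>] 0, 0 < ε ∧ ε ≤ 1 / 4 := Ioc_mem_nhdsGT (by norm_num)
  have hmeas : ∀ ε, Measurable fun z => regIntegrand m N f ε z₁ z := fun ε =>
    hfm.mul ((measurable_kernelSeries m _ ε z₁).const_mul _)
  have hle : ∀ᶠ ε : ℝ in 𝓝[>] 0, ∀ᵐ z ∂(volume.restrict Φ),
      ‖regIntegrand m N f ε z₁ z‖ ≤ (M z).toReal := by
    filter_upwards [hsmall] with ε hε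
    filter_upwards [hbad, hMtop] with z hz hzM
    rw [← toReal_enorm]
    exact ENNReal.toReal_mono hzM.ne (hM ε hε.1 hε.2 z hz)
  have hlim : ∀ᵐ z ∂(volume.restrict Φ), Tendsto (fun ε => regIntegrand m N f ε z₁ z) (𝓝[>] 0)
      (𝓝 (((z.im ^ 2 : ℝ) : ℂ) * (f z * omega m N z₁ z))) := by
    filter_upwards [hbad] with z hz
    exact tendsto_regIntegrand hm f hz
  refine ⟨hbound.mono' (aestronglyMeasurable_of_tendsto_ae (𝓝[>] (0 : ℝ))
    (fun ε => (hmeas ε).aestronglyMeasurable) hlim) ?_, ?_⟩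
  · filter_upwards [hbad, hMtop, hlim] with z hz hzM hzl
    refine le_of_tendsto hzl.norm ?_
    filter_upwards [hsmall] with ε hε
    rw [← toReal_enorm]
    exact ENNReal.toReal_mono hzM.ne (hM ε hε.1 hε.2 z hz)
  -- The same integrals have two limits: the desired one by dominated convergence, and the explicit
  -- one obtained from the unfolded formula.
  · have h1 := tendsto_integral_filter_of_dominated_convergence _
      (Eventually.of_forall fun ε => (hmeas ε).aestronglyMeasurable) hle hbound hlim
    have h2 : Tendsto (fun ε : ℝ => ∑ x ∈ repIndex m N,
        (((x.1.2 : ℝ) ^ (-(2 + 2 * ε)) : ℝ) : ℂ) *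
          (-f (repPoint x z₁) * (radialIntegral ε (repPoint x z₁).im : ℂ))) (𝓝[>] 0)
        (𝓝 (∑ x ∈ repIndex m N, (((x.1.2 : ℝ) ^ (-(2 : ℝ)) : ℝ) : ℂ) *
          (-f (repPoint x z₁) * (Real.pi : ℂ)))) := by
      refine tendsto_finsetSum _ fun x hx => Tendsto.mul ?_ (Tendsto.const_mul _ ?_)
      · rw [mem_repIndex] at hx
        have hd : x.1.2 ≠ 0 := fun h => hx.1.2 (by rw [← hx.1.1, h, mul_zero])
        have hc : Continuous fun ε : ℝ => (((x.1.2 : ℝ) ^ (-(2 + 2 * ε)) : ℝ) : ℂ) :=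
          Complex.continuous_ofReal.comp
            ((Real.continuous_const_rpow (by exact_mod_cast hd)).comp (by fun_prop))
        have h5 := hc.tendsto 0
        rw [mul_zero, add_zero] at h5
        exact h5.mono_left nhdsWithin_le_nhds
      · exact (Complex.continuous_ofReal.tendsto _).comp
          (tendsto_radialIntegral (repPoint x z₁).im_pos)
    have h3 := h2.congr' (f₂ := fun ε => ∫ z in Φ, regIntegrand m N f ε z₁ z) (by
      filter_upwards [hsmall] with ε hε
      exact (setIntegral_mul_kernelSeries hΦ hf hfd hC hm hε.1 (by linarith [hε.2]) z₁).symm)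
    rw [tendsto_nhds_unique h1 h3, Finset.mul_sum]
    refine Finset.sum_congr rfl fun x _ => ?_
    rw [Real.rpow_neg (Nat.cast_nonneg _), Real.rpow_two]
    push_cast
    ring

end Limit

/-! ### From hyperbolic area to `dx dy`, and the Hecke operator as a sum over representatives. -/

section Conclusion

variable {m N : ℕ}

lemma heckeT2_eq (f : ℍ → ℂ) (z : ℍ) : heckeT2 m N f z =
    m * ∑ x ∈ repIndex m N, ((x.1.2 : ℂ) ^ 2)⁻¹ * f (repPoint x z) := by
  rw [heckeT2, repIndex, Finset.sum_sigma]
  rfl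

lemma inv_smul_mul_eq (f : ℍ → ℂ) (z₁ z : ℍ) :
    ((z.im ^ 2)⁻¹ : ℝ) • (((z.im ^ 2 : ℝ) : ℂ) * (f z * omega m N z₁ z)) =
      f z * omega m N z₁ z := by
  have h : ((z.im ^ 2 : ℝ) : ℂ) ≠ 0 := by
    exact_mod_cast pow_ne_zero 2 z.im_ne_zero
  rw [Complex.real_smul, ← mul_assoc, Complex.ofReal_inv, inv_mul_cancel₀ h, one_mul]

end Conclusion

end ZagierKernel

end

theorem theorem2 (N m : ℕ) (hN : 0 < N) (hm : 0 < m)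
    (Φ : Set UpperHalfPlane) (hΦ : ZagierKernel.IsFundamentalDomainGamma0 N Φ)
    (f : CuspForm ((CongruenceSubgroup.Gamma0 N : Subgroup SL(2, ℤ)) : Subgroup (GL (Fin 2) ℝ)) 2)
    (z₁ : UpperHalfPlane) :
    -- the kernel is well defined for all `z₂` outside the orbit `M(m, N) z₁`
    (∀ z₂ : UpperHalfPlane,
      (∀ γ ∈ ZagierKernel.matSet m N, ZagierKernel.mu γ z₁ (-(z₂ : ℂ)) ≠ 0) →
        (∀ s : ℂ, 1 < s.re →
          Summable fun γ : ZagierKernel.matSet m N => ZagierKernel.regTerm z₁ z₂ s γ) ∧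
        Tendsto (ZagierKernel.Omega m N z₁ z₂) (𝓝[{s : ℂ | 1 < s.re}] 1)
          (𝓝 (ZagierKernel.omega m N z₁ z₂))) ∧
    -- the integral converges absolutely
    IntegrableOn (fun z₂ => f z₂ * ZagierKernel.omega m N z₁ z₂) Φ ZagierKernel.area ∧
    -- the integral formula
    ZagierKernel.formIntegral Φ (fun z₂ => f z₂ * ZagierKernel.omega m N z₁ z₂) =
      ZagierKernel.peterssonProd Φ f (fun z₂ => conj (ZagierKernel.omega m N z₁ z₂)) ∧
    ZagierKernel.peterssonProd Φ f (fun z₂ => conj (ZagierKernel.omega m N z₁ z₂)) =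
      2 * (Real.pi : ℂ) * Complex.I * (m : ℂ)⁻¹ * ZagierKernel.heckeT2 m N f z₁ := by
  have : NeZero N := ⟨hN.ne'⟩
  obtain ⟨C, hC⟩ := CuspFormClass.exists_bound f
  have hC' : ∀ z : UpperHalfPlane, ‖f z‖ ≤ C / z.im := by
    intro z
    simpa using hC z
  have hfd : DifferentiableOn ℂ (fun z => f (UpperHalfPlane.ofComplex z)) {z : ℂ | 0 < z.im} :=
    UpperHalfPlane.mdifferentiable_iff.1 (CuspFormClass.holo f)
  have hfm : Measurable f := (CuspFormClass.holo f).continuous.measurable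
  obtain ⟨hint, hval⟩ := ZagierKernel.setIntegral_mul_omega hm hfm
    (ZagierKernel.cuspForm_smul f) hfd hC' (ZagierKernel.exists_norm_cuspForm_smul_le f) z₁ hΦ
  -- The factor `y²` accompanying the integrand cancels the density `y⁻²` of hyperbolic area,
  -- leaving `dx dy`.
  rw [ZagierKernel.integrableOn_volume_iff_area] at hint
  rw [ZagierKernel.integral_volume_eq_area] at hval
  simp only [ZagierKernel.inv_smul_mul_eq] at hint hval
  have hpet : ZagierKernel.peterssonProd Φ f (fun z₂ => conj (ZagierKernel.omega m N z₁ z₂)) =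
      ZagierKernel.formIntegral Φ (fun z₂ => f z₂ * ZagierKernel.omega m N z₁ z₂) := by
    simp only [ZagierKernel.peterssonProd, Complex.conj_conj]
  refine ⟨fun z₂ hz₂ => ZagierKernel.summable_and_tendsto_Omega hm hz₂, hint, hpet.symm, ?_⟩
  -- The factor `-2i` from `dz dz̄` times `-π` is `2πi`, and `m⁻¹` cancels the factor `m` in the
  -- Hecke operator.
  rw [hpet, ZagierKernel.formIntegral, hval, ZagierKernel.heckeT2_eq]
  have hm' : (m : ℂ) ≠ 0 := by exact_mod_cast hm.ne'
  field_simp
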